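/- Let $q\in\mathbb C$ with $0<|q|<1$. Write $(x;q)_n=\prod_{i=0}^{n-1}(1-xq^i)$, $(x;q)_\infty=\prod_{i\ge0}(1-xq^i)$, $(x_1,\ldots,x_k;q)_n=\prod_j(x_j;q)_n$ (also for $n=\infty$), $\vartheta(x;q)=(x,q/x;q)_\infty$, $\vartheta(x_1,\ldots,x_k;q)=\prod_j\vartheta(x_j;q)$, $\pm x$ for the pair $x,-x$ in a list, $${}_{r+1}\phi_r\!\left({a_1,\ldots,a_{r+1}\atop b_1,\ldots,b_r};q,z\right)=\sum_{k\ge0}\frac{(a_1,\ldots,a_{r+1};q)_k}{(q,b_1,\ldots,b_r;q)_k}z^k,$$ $\Omega_q=\{q^{-k}:k=0,1,2,\ldots\}$ and $\Upsilon_q=\{q^k:k\in\mathbb Z\}$. Let $\sqrt q$ be either square root of $q$, and $q^{3/2}=(\sqrt q)^3$. Let $a,b,h$ be nonzero complex numbers; in (1) and (2) let $0<|z|<1$. (1) Let $\sigma>0$, let $s$ be either square root of $qa/z$ and $t$ either square root of $az$, and suppose that $\sigma|b/s|,\ \sigma|s/b|,\ |bsz/q|/\sigma,\ |t|/\sigma,\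 |sz/b|/\sigma,\ |sz|/\sigma$ are all less than $1$. Then, with $w=e^{i\psi}$, the following integrand is integrable on $[-\pi,\pi]$ and $$\int_{-\pi}^{\pi}\frac{\left(\frac{hs}{b}\frac{\sigma}{w},\frac{qb}{hs}\frac{\sigma}{w},\frac{hs}{b}\frac{w}{\sigma},\frac{qb}{hs}\frac{w}{\sigma},sz\frac{w}{\sigma},\frac{bsz^2}{q}\frac{w}{\sigma},\frac{asz}{b}\frac{w}{\sigma};q\right)_\infty}{\left(\frac{b}{s}\frac{\sigma}{w},\frac{s}{b}\frac{\sigma}{w},\frac{bsz}{q}\frac{w}{\sigma},\pm t\frac{w}{\sigma},\frac{sz}{b}\frac{w}{\sigma},-sz\frac{w}{\sigma};q\right)_\infty}\,d\psi=\frac{2\pi\,\vartheta(h,\frac{hqa}{b^2z};q)\,(z,\frac{qa}{b},\frac{qa}{b};q)_\infty}{(q,a,\frac{qa}{b^2},\frac{b^2z}{q};q)_\infty}\left({}_2\phi_1\!\left({a,b\atop qa/b};q,z\right)\right)^2.$$ (2) Suppose that no denominator factor vanishes, i.e. $h,\frac{hqa}{b^2z},b^2\notin\Upsilon_q$ and $\pm\frac{qa}{b},-bz\notin\Omega_q$.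 Then $$\begin{aligned}\left({}_2\phi_1\!\left({a,b\atop qa/b};q,z\right)\right)^2=\frac{1}{\vartheta(h,\frac{hqa}{b^2z};q)}\Biggl(&\frac{\vartheta(ha,\frac{hq}{b^2z};q)(\frac qb,\frac qb,\frac{qa}{b^2},\frac{qa}{b^2};q)_\infty}{(\frac{qa}b,\frac{qa}b,\frac q{b^2},\frac q{b^2};q)_\infty}\,{}_5\phi_4\!\left({a,b,\frac{b^2}a,\frac{b^2z}q,\frac qz\atop b^2,\pm b\sqrt q,-b};q,q\right)\\ &+\frac{\vartheta(\frac{hqa}{b^2},\frac hz;q)(a,a,b,b,\frac{b^2z}q,\frac{b^2z}q;q)_\infty}{(z,z,\frac{b^2}q,\frac{b^2}q,\frac{qa}b,\frac{qa}b;q)_\infty}\,{}_5\phi_4\!\left({\frac qa,\frac qb,\frac{qa}{b^2},z,\frac{q^2}{b^2z}\atop \frac{q^2}{b^2},\pm\frac{q^{3/2}}b,-\frac qb};q,q\right)\\ &+\sum_{p\in\{\sqrt q,-\sqrt q\}}\frac{\vartheta(\frac{hap}b,\frac{hp}{bz};q)(p,a,\frac{qa}{b^2},\frac{b^2z}q;q)_\infty}{(-1,-p,z,\frac{qa}b,\frac{qa}b,\frac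 bp,\frac pb;q)_\infty}\,{}_5\phi_4\!\left({p,\frac{ap}b,\frac{bp}a,\frac{bz}p,\frac{p^3}{bz}\atop -q,-p,bp,\frac{p^3}b};q,q\right)\\ &+\frac{\vartheta(-\frac{hqa}b,-\frac h{bz};q)(-1,a,-\frac ab,\frac{qa}{b^2},-\frac{bz}q,\frac{b^2z}q;q)_\infty}{(z,-bz,\pm\frac1{\sqrt q},\frac{qa}b,\frac{qa}b,-\frac{qa}b,-\frac1b,-\frac bq;q)_\infty}\,{}_5\phi_4\!\left({-q,-bz,-\frac{qa}b,-\frac{qb}a,-\frac{q^2}{bz}\atop -qb,\pm q^{3/2},-\frac{q^2}b};q,q\right)\Biggr).\end{aligned}$$ (3) Put $$S=\frac{(-q,-q;q)_\infty\,(qa,qa,\frac{q^2a}{b^2},\frac{q^2a}{b^2};q^2)_\infty}{(-\frac qb,-\frac qb,\frac{qa}b,\frac{qa}b;q)_\infty}.$$ If $-\frac qb,\frac{qa}b,\frac{qa^2}{b^2}\notin\Omega_q$ and $-\frac ab\notin\Upsilon_q$, then $$S=\frac{(-b,-\frac{qa}b;q)_\infty}{(-\frac qb,-\frac ba;q)_\infty}\,{}_4\phi_3\!\left({\pm\frac{a\sqrt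 q}b,\frac{qa}{b^2},a\atop\pm\frac{qa}b,\frac{qa^2}{b^2}};q,q\right)+\frac{(-q,-q,a,-\frac{qa}b,\frac{qa}{b^2};q)_\infty}{(\frac{qa}b,\frac{qa}b,-\frac qb,-\frac qb,-\frac ab;q)_\infty}\,{}_4\phi_3\!\left({\pm\sqrt q,-b,-\frac qb\atop -q,-\frac{qa}b,-\frac{qb}a};q,q\right).$$ (4) With the same $S$, if $h,-\frac{ha}b,b^2\notin\Upsilon_q$ and $\frac{qa}b\notin\Omega_q$, then $$\begin{aligned}S=\frac1{\vartheta(h,-\frac{ha}b;q)}\Biggl(&\frac{\vartheta(ha,-\frac hb;q)(\frac qb,\frac qb,\frac{qa}{b^2},\frac{qa}{b^2};q)_\infty}{(\frac{qa}b,\frac{qa}b,\frac q{b^2},\frac q{b^2};q)_\infty}\,{}_4\phi_3\!\left({a,\pm b,\frac{b^2}a\atop b^2,\pm b\sqrt q};q,q\right)\\ &+\frac{\vartheta(\frac{hqa}{b^2},-\frac{hb}q;q)(a,a,\pm b,\pm b;q)_\infty}{(-\frac qb,-\frac qb,\frac{b^2}q,\frac{b^2}q,\frac{qa}b,\frac{qa}b;q)_\infty}\,{}_4\phi_3\!\left({\frac{qa}{b^2},\pm\frac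 qb,\frac qa\atop\frac{q^2}{b^2},\pm\frac{q^{3/2}}b};q,q\right)\\ &+\sum_{p\in\{\sqrt q,-\sqrt q\}}\frac{\vartheta(\frac{hap}b,-\frac hp;q)(p,a,-b,\frac{qa}{b^2};q)_\infty}{(-1,-p,-\frac qb,\frac{qa}b,\frac{qa}b,\frac bp,\frac pb;q)_\infty}\,{}_4\phi_3\!\left({\frac{ap}b,\frac{bp}a,\pm\sqrt q\atop -q,bp,\frac{p^3}b};q,q\right)\Biggr).\end{aligned}$$ -/

import Mathlib

noncomputable section

/-- The set `Ω_q = {q^{-k} : k = 0, 1, 2, …}`. -/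
def OmegaSet (q : ℂ) : Set ℂ := Set.range fun k : ℕ => (q ^ k)⁻¹

/-- The set `Υ_q = {q^k : k ∈ ℤ}`. -/
def UpsilonSet (q : ℂ) : Set ℂ := Set.range fun k : ℤ => q ^ k

/-- The finite `q`-shifted factorial `(a;q)_n`. -/
def qPoch (a q : ℂ) (n : ℕ) : ℂ := ∏ i ∈ Finset.range n, (1 - a * q ^ i)

/-- The infinite `q`-shifted factorial `(a;q)_∞` (used for `|q| < 1`, where the product converges). -/
def qPochInf (a q : ℂ) : ℂ := ∏' i : ℕ, (1 - a * q ^ i)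

/-- `(a₁,…,a_k;q)_n`. -/
def qPochL (as : List ℂ) (q : ℂ) (n : ℕ) : ℂ := (as.map fun a => qPoch a q n).prod

/-- `(a₁,…,a_k;q)_∞`. -/
def qPochInfL (as : List ℂ) (q : ℂ) : ℂ := (as.map fun a => qPochInf a q).prod

/-- The modified theta function `ϑ(x;q) = (x, q/x; q)_∞`, for `x ≠ 0`. -/
def qTheta (x q : ℂ) : ℂ := qPochInf x q * qPochInf (q / x) q

/-- `ϑ(x₁,…,x_k;q)`. -/
def qThetaL (xs : List ℂ) (q : ℂ) : ℂ := (xs.map fun x => qTheta x q).prod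

/-- The basic hypergeometric series `_rφ_s(as; bs; q, z)`, with `r = as.length`, `s = bs.length`. -/
def qHyp (as bs : List ℂ) (q z : ℂ) : ℂ :=
  ∑' k : ℕ, qPochL as q k / qPochL (q :: bs) q k *
    ((-1) ^ k * q ^ k.choose 2) ^ ((bs.length : ℤ) + 1 - (as.length : ℤ)) * z ^ k

/-- The integrand of the `q`-Mellin–Barnes integral, `w = e^{iψ}`.
The square roots of the source are written through `s = √(qa/z)` and `t = √(az)`:
`√(z/(qa)) = 1/s`, `√(qaz) = s z`, `√(az/q) = s z / q`, `√(az³/q) = s z² / q`,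
`√(q a³ z) = a s z`. -/
def mbIntegrand (a b h q z s t : ℂ) (σ ψ : ℝ) : ℂ :=
  let w : ℂ := Complex.exp (Complex.I * (ψ : ℂ))
  let u : ℂ := (σ : ℂ) / w
  let v : ℂ := w / (σ : ℂ)
  qPochInfL [h * s / b * u, q * b / (h * s) * u,
      h * s / b * v, q * b / (h * s) * v, s * z * v, b * (s * z ^ 2 / q) * v, a * s * z / b * v] q /
    qPochInfL [b / s * u, s / b * u,
      b * (s * z / q) * v, t * v, -t * v, s * z / b * v, -(s * z) * v] q

end

open Filter Topology

/-! ### Shifted factorials, theta functions and the exceptional sets. -/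

section QPochhammer

variable {q : ℂ}

/-! Put p = √q, β = b/p, U = bz/p, V = pa/b, so that βV = a, βp = b, U/β = z and pV = qa/b. The
normalized series f(U,V) = (z, qa/b; q)_∞ ₂φ₁(a,b;qa/b;q,z) satisfies a second-order recurrence
under U → Uq (the q-difference equation in z) and, with the roles of U and V exchanged, one under V
→ Vq (a contiguous relation). The middle coefficient has a factor 1+V/p that the shift of U does not
change. Because of it the cross terms cancel and f² satisfies a third-order recurrence
(`sq_recurrence`), as in Clausen's theorem.

The heart of the proof is `clausenSeries_sq`: for generic parameters f² is an explicit constant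
times the Jackson integral from V to U of a product kernel. The integral satisfies the recurrence of
f², since the recurrence applied to the kernel is an explicit q-difference
(`telescoping_certificate`, `jackson_chain`, `clausenRec_integral`). Along U, Uq, Uq², … both sides
tend to (pV;q)_∞². The limiting recurrence has characteristic roots 1, e, e² with e = V/p; if |e| <
1, the difference of the two sides is a null sequence that must vanish (`eq_zero_of_recurrence`).
The recurrence in V then removes the restriction on e.

For (1), the Mellin–Barnes integrand in the variable X = tw/σ is a theta quotient, multiplied by q
under X → qX, times the Jackson kernel. Its residues at Uq^k and Vq^k are therefore constants times
Jackson summands, and their sum is f² up to theta functions. For (2), the remaining poles form five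
chains running to infinity. Each chain sums to a ₅φ₄, and inner and outer residues balance
(`ChainData.sum_eq_sum`).

For (3) and (4) one takes z = -q/b, that is U = -p. The recurrence in V then has no middle term and
can be iterated in base q²; this is the Bailey–Daum sum (`clausenSeries_neg`), whose square is S.
Formula (3) is the Jackson formula with both sums read as ₄φ₃. In (4), one of the five terms
vanishes and the other four lose a parameter. Convergence asks for |q/b| < 1; the involution (a,b) →
(qa/b², q/b) covers the other case.

Identities obtained for generic parameters are extended by continuity, along a real curve in
parameter space that meets the degenerate set only countably often (`eq_of_eq_off_countable`). -/

theorem mem_OmegaSet_iff (hq0 : q ≠ 0) {a : ℂ} : a ∈ OmegaSet q ↔ ∃ k : ℕ, a * q ^ k = 1 := by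
  unfold OmegaSet
  simp only [Set.mem_range]
  refine exists_congr fun k => ?_
  have hk : q ^ k ≠ 0 := pow_ne_zero k hq0
  constructor
  · rintro rfl
    exact inv_mul_cancel₀ hk
  · intro h
    exact (eq_inv_of_mul_eq_one_left h).symm

theorem mul_pow_ne_one (hq0 : q ≠ 0) {a : ℂ} (h : a ∉ OmegaSet q) (k : ℕ) : a * q ^ k ≠ 1 :=
  fun hk => h ((mem_OmegaSet_iff hq0).2 ⟨k, hk⟩)

theorem one_sub_mul_pow_ne_zero (hq0 : q ≠ 0) {a : ℂ} (h : a ∉ OmegaSet q) (k : ℕ) :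
    1 - a * q ^ k ≠ 0 :=
  fun hk => mul_pow_ne_one hq0 h k (sub_eq_zero.1 hk).symm

theorem one_sub_ne_zero_of_notMem (hq0 : q ≠ 0) {a : ℂ} (h : a ∉ OmegaSet q) : 1 - a ≠ 0 := by
  simpa using one_sub_mul_pow_ne_zero hq0 h 0

theorem mul_pow_notMem_OmegaSet (hq0 : q ≠ 0) {a : ℂ} (h : a ∉ OmegaSet q) (n : ℕ) :
    a * q ^ n ∉ OmegaSet q := by
  rw [mem_OmegaSet_iff hq0]
  rintro ⟨k, hk⟩
  refine mul_pow_ne_one hq0 h (n + k) ?_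
  rw [← hk]; ring

theorem notMem_OmegaSet_of_norm_lt_one (hq0 : q ≠ 0) (hq1 : ‖q‖ < 1) {a : ℂ} (h : ‖a‖ < 1) :
    a ∉ OmegaSet q := by
  rw [mem_OmegaSet_iff hq0]
  rintro ⟨k, hk⟩
  have h1 : ‖a * q ^ k‖ < 1 := by
    rw [norm_mul, norm_pow]
    calc ‖a‖ * ‖q‖ ^ k ≤ ‖a‖ * 1 := by
          gcongr; exact pow_le_one₀ (norm_nonneg _) hq1.le
      _ < 1 := by simpa using h
  rw [hk] at h1
  simp at h1

theorem mem_UpsilonSet_of_mem_OmegaSet {a : ℂ} (h : a ∈ OmegaSet q) : a ∈ UpsilonSet q := by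
  obtain ⟨k, rfl⟩ := h
  exact ⟨-(k : ℤ), by simp⟩

theorem inv_mem_UpsilonSet {a : ℂ} (h : a ∈ UpsilonSet q) : a⁻¹ ∈ UpsilonSet q := by
  obtain ⟨k, rfl⟩ := h
  exact ⟨-k, by simp⟩

theorem inv_mem_UpsilonSet_iff {a : ℂ} : a⁻¹ ∈ UpsilonSet q ↔ a ∈ UpsilonSet q :=
  ⟨fun h => by simpa using inv_mem_UpsilonSet h, inv_mem_UpsilonSet⟩

theorem zpow_mul_mem_UpsilonSet (hq0 : q ≠ 0) {a : ℂ} (k : ℤ) (h : q ^ k * a ∈ UpsilonSet q) :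
    a ∈ UpsilonSet q := by
  obtain ⟨l, hl⟩ := h
  refine ⟨l - k, ?_⟩
  have hk : q ^ k ≠ 0 := zpow_ne_zero k hq0
  simp only at hl ⊢
  rw [zpow_sub₀ hq0, hl]
  field_simp

theorem mul_q_mem_UpsilonSet (hq0 : q ≠ 0) {a : ℂ} (h : q * a ∈ UpsilonSet q) :
    a ∈ UpsilonSet q := by
  refine zpow_mul_mem_UpsilonSet hq0 1 ?_
  simpa using h

theorem sq_mem_UpsilonSet {a : ℂ} (h : a ∈ UpsilonSet q) : a ^ 2 ∈ UpsilonSet q := by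
  obtain ⟨k, rfl⟩ := h
  exact ⟨k * 2, by simp [zpow_mul]⟩

theorem summable_norm_mul_pow (hq1 : ‖q‖ < 1) (a : ℂ) : Summable fun i : ℕ => ‖-(a * q ^ i)‖ := by
  simpa [norm_mul, norm_pow] using
    (summable_geometric_of_lt_one (norm_nonneg q) hq1).mul_left ‖a‖

theorem multipliable_qPochInf (hq1 : ‖q‖ < 1) (a : ℂ) :
    Multipliable fun i : ℕ => 1 - a * q ^ i := by
  simpa [sub_eq_add_neg] using multipliable_one_add_of_summable (summable_norm_mul_pow hq1 a)

theorem qPoch_succ (a : ℂ) (n : ℕ) : qPoch a q (n + 1) = qPoch a q n * (1 - a * q ^ n) := by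
  simp [qPoch, Finset.prod_range_succ]

@[simp] theorem qPoch_zero (a : ℂ) : qPoch a q 0 = 1 := by simp [qPoch]

theorem qPoch_succ' (a : ℂ) (n : ℕ) : qPoch a q (n + 1) = (1 - a) * qPoch (a * q) q n := by
  simp only [qPoch, Finset.prod_range_succ', pow_succ', mul_assoc, pow_zero, mul_one]
  rw [mul_comm]

theorem tendsto_qPoch (hq1 : ‖q‖ < 1) (a : ℂ) :
    Tendsto (fun n => qPoch a q n) atTop (𝓝 (qPochInf a q)) :=
  (multipliable_qPochInf hq1 a).hasProd.tendsto_prod_nat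

theorem qPochInf_step (hq1 : ‖q‖ < 1) (a : ℂ) :
    qPochInf a q = (1 - a) * qPochInf (a * q) q := by
  refine tendsto_nhds_unique ((tendsto_qPoch hq1 a).comp (tendsto_add_atTop_nat 1)) ?_
  refine ((tendsto_qPoch hq1 (a * q)).const_mul (1 - a)).congr fun n => ?_
  simp [qPoch_succ']

theorem qPochInf_eq_qPoch_mul (hq1 : ‖q‖ < 1) (a : ℂ) (n : ℕ) :
    qPochInf a q = qPoch a q n * qPochInf (a * q ^ n) q := by
  induction n with
  | zero => simp
  | succ n ih =>
    rw [ih, qPoch_succ, qPochInf_step hq1 (a * q ^ n)]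
    ring_nf

@[simp] theorem qPochInf_zero : qPochInf 0 q = 1 := by simp [qPochInf]

theorem qPochInf_ne_zero (hq0 : q ≠ 0) (hq1 : ‖q‖ < 1) {a : ℂ} (h : a ∉ OmegaSet q) :
    qPochInf a q ≠ 0 := by
  have := tprod_one_add_ne_zero_of_summable (f := fun i : ℕ => -(a * q ^ i))
    (fun i => by simpa [sub_eq_add_neg] using one_sub_mul_pow_ne_zero hq0 h i)
    (summable_norm_mul_pow hq1 a)
  simpa [qPochInf, sub_eq_add_neg] using this

theorem qPochInf_ne_zero_of_norm_lt_one (hq0 : q ≠ 0) (hq1 : ‖q‖ < 1) {a : ℂ} (h : ‖a‖ < 1) :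
    qPochInf a q ≠ 0 :=
  qPochInf_ne_zero hq0 hq1 (notMem_OmegaSet_of_norm_lt_one hq0 hq1 h)

theorem qPoch_ne_zero (hq0 : q ≠ 0) {a : ℂ} (h : a ∉ OmegaSet q) (n : ℕ) : qPoch a q n ≠ 0 :=
  Finset.prod_ne_zero_iff.2 fun i _ => one_sub_mul_pow_ne_zero hq0 h i

theorem qPochInf_eq_zero (hq0 : q ≠ 0) (hq1 : ‖q‖ < 1) {a : ℂ} (h : a ∈ OmegaSet q) :
    qPochInf a q = 0 := by
  obtain ⟨k, hk⟩ := (mem_OmegaSet_iff hq0).1 h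
  rw [qPochInf_eq_qPoch_mul hq1 a (k + 1), qPoch_succ, hk]
  simp

theorem qPochInf_one (hq0 : q ≠ 0) (hq1 : ‖q‖ < 1) : qPochInf 1 q = 0 :=
  qPochInf_eq_zero hq0 hq1 ((mem_OmegaSet_iff hq0).2 ⟨0, by simp⟩)

/-- On a compact set contained in ‖a‖ ≤ M the factors differ from 1 by at most M‖q‖^i, so the
product converges locally uniformly and the limit of the entire partial products is entire. -/
theorem differentiable_qPochInf (hq1 : ‖q‖ < 1) : Differentiable ℂ fun a => qPochInf a q := by
  have key : HasProdLocallyUniformlyOn (fun (i : ℕ) (a : ℂ) => 1 + -(a * q ^ i))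
      (fun a => ∏' i : ℕ, (1 + -(a * q ^ i))) Set.univ := by
    apply hasProdLocallyUniformlyOn_of_forall_compact isOpen_univ
    intro K _ hK
    obtain ⟨M, hM⟩ := hK.isBounded.exists_norm_le
    refine ((summable_geometric_of_lt_one (norm_nonneg q) hq1).mul_left M).hasProdUniformlyOn_nat_one_add
      hK (.of_forall fun n x hx => ?_) (fun _ => by fun_prop)
    rw [norm_neg, norm_mul, norm_pow]
    gcongr
    exact hM x hx
  have := key.differentiableOn
    (.of_forall fun _ => by simpa [Finset.prod_fn] using
      DifferentiableOn.finsetProd (fun _ _ => by fun_prop)) isOpen_univ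
  simpa [qPochInf, sub_eq_add_neg, differentiableOn_univ] using this

theorem continuous_qPochInf (hq1 : ‖q‖ < 1) : Continuous fun a => qPochInf a q :=
  (differentiable_qPochInf hq1).continuous

theorem norm_qPoch_le (hq1 : ‖q‖ < 1) {a : ℂ} {M : ℝ} (ha : ‖a‖ ≤ M) (n : ℕ) :
    ‖qPoch a q n‖ ≤ Real.exp (M * (1 - ‖q‖)⁻¹) := by
  have hM : 0 ≤ M := (norm_nonneg a).trans ha
  unfold qPoch
  rw [norm_prod]
  calc ∏ i ∈ Finset.range n, ‖1 - a * q ^ i‖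
      ≤ ∏ i ∈ Finset.range n, Real.exp (M * ‖q‖ ^ i) := by
        refine Finset.prod_le_prod (fun _ _ => norm_nonneg _) fun i _ => ?_
        calc ‖1 - a * q ^ i‖ ≤ ‖(1 : ℂ)‖ + ‖a * q ^ i‖ := norm_sub_le _ _
          _ ≤ M * ‖q‖ ^ i + 1 := by
            rw [norm_one, norm_mul, norm_pow, add_comm]; gcongr
          _ ≤ _ := Real.add_one_le_exp _
    _ = Real.exp (M * ∑ i ∈ Finset.range n, ‖q‖ ^ i) := by
        rw [← Real.exp_sum, Finset.mul_sum]
    _ ≤ _ := by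
        gcongr
        rw [← tsum_geometric_of_lt_one (norm_nonneg q) hq1]
        exact (summable_geometric_of_lt_one (norm_nonneg q) hq1).sum_le_tsum _
          (fun _ _ => by positivity)

theorem norm_qPochInf_le (hq1 : ‖q‖ < 1) {a : ℂ} {M : ℝ} (ha : ‖a‖ ≤ M) :
    ‖qPochInf a q‖ ≤ Real.exp (M * (1 - ‖q‖)⁻¹) :=
  le_of_tendsto (tendsto_qPoch hq1 a).norm (.of_forall fun n => norm_qPoch_le hq1 ha n)

/-- Since 1/(a;q)_n = (aqⁿ;q)_∞/(a;q)_∞, the upper bound for infinite products also bounds the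
inverses, uniformly in n. -/
theorem norm_inv_qPoch_le (hq0 : q ≠ 0) (hq1 : ‖q‖ < 1) {a : ℂ} {M : ℝ} (ha : ‖a‖ ≤ M)
    (h : a ∉ OmegaSet q) (n : ℕ) :
    ‖(qPoch a q n)⁻¹‖ ≤ Real.exp (M * (1 - ‖q‖)⁻¹) * ‖qPochInf a q‖⁻¹ := by
  have h1 := qPochInf_ne_zero hq0 hq1 h
  have h2 := qPoch_ne_zero hq0 h n
  have h3 : (qPoch a q n)⁻¹ = qPochInf (a * q ^ n) q * (qPochInf a q)⁻¹ := by
    rw [qPochInf_eq_qPoch_mul hq1 a n] at h1 ⊢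
    have := right_ne_zero_of_mul h1
    field_simp
  rw [h3, norm_mul, norm_inv]
  gcongr
  refine norm_qPochInf_le hq1 ?_
  rw [norm_mul, norm_pow]
  calc ‖a‖ * ‖q‖ ^ n ≤ M * 1 := by
        have hM : 0 ≤ M := (norm_nonneg a).trans ha
        gcongr; exact pow_le_one₀ (norm_nonneg _) hq1.le
    _ = M := mul_one M

theorem norm_sq_lt_one (hq1 : ‖q‖ < 1) : ‖q ^ 2‖ < 1 := by
  rw [norm_pow]; exact pow_lt_one₀ (norm_nonneg _) hq1 two_ne_zero

/-- `(x²;q²)_∞ = (x,-x;q)_∞`. -/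
theorem qPochInf_sq_sq (hq1 : ‖q‖ < 1) (x : ℂ) :
    qPochInf (x ^ 2) (q ^ 2) = qPochInf x q * qPochInf (-x) q := by
  unfold qPochInf
  rw [← (multipliable_qPochInf hq1 x).tprod_mul (multipliable_qPochInf hq1 (-x))]
  refine tprod_congr fun i => ?_
  ring

/-- `(x;q)_∞ = (x,xq;q²)_∞`. -/
theorem qPochInf_eq_even_mul_odd (hq1 : ‖q‖ < 1) (x : ℂ) :
    qPochInf x q = qPochInf x (q ^ 2) * qPochInf (x * q) (q ^ 2) := by
  have h2 : Tendsto (fun n : ℕ => 2 * n) atTop atTop :=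
    tendsto_id.const_mul_atTop' (by norm_num)
  refine tendsto_nhds_unique ((tendsto_qPoch hq1 x).comp h2) ?_
  refine ((tendsto_qPoch (norm_sq_lt_one hq1) x).mul
    (tendsto_qPoch (norm_sq_lt_one hq1) (x * q))).congr fun n => ?_
  induction n with
  | zero => simp
  | succ n ih =>
    simp only [Function.comp_apply] at ih
    rw [Function.comp_apply, show 2 * (n + 1) = 2 * n + 1 + 1 by ring, qPoch_succ, qPoch_succ,
      qPoch_succ, qPoch_succ, ← ih]
    ring

/-- `(x²;p²)_∞ = (x,-x,px,-px;p²)_∞`. -/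
theorem qPochInf_sq {p : ℂ} (hp : p ^ 2 = q) (hq1 : ‖q‖ < 1) (x : ℂ) :
    qPochInf (x ^ 2) q =
      qPochInf x q * qPochInf (-x) q * qPochInf (p * x) q * qPochInf (-(p * x)) q := by
  rw [qPochInf_eq_even_mul_odd hq1, qPochInf_sq_sq hq1,
    show x ^ 2 * q = (p * x) ^ 2 by rw [← hp]; ring, qPochInf_sq_sq hq1]
  ring

theorem qTheta_mul_q (hq0 : q ≠ 0) (hq1 : ‖q‖ < 1) {x : ℂ} (hx : x ≠ 0) :
    qTheta (x * q) q = -x⁻¹ * qTheta x q := by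
  unfold qTheta
  have h1 : q / (x * q) = x⁻¹ := by field_simp
  rw [h1, qPochInf_step hq1 x, qPochInf_step hq1 x⁻¹, show q / x = x⁻¹ * q by ring]
  field_simp
  ring

theorem qTheta_ne_zero (hq0 : q ≠ 0) (hq1 : ‖q‖ < 1) {x : ℂ} (h : x ∉ UpsilonSet q) :
    qTheta x q ≠ 0 := by
  refine mul_ne_zero (qPochInf_ne_zero hq0 hq1 fun h' => h (mem_UpsilonSet_of_mem_OmegaSet h'))
    (qPochInf_ne_zero hq0 hq1 fun h' => h ?_)
  have := mem_UpsilonSet_of_mem_OmegaSet h'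
  rw [div_eq_mul_inv] at this
  exact inv_mem_UpsilonSet_iff.1 (mul_q_mem_UpsilonSet hq0 this)

end QPochhammer

/-! ### Convergence of basic hypergeometric series and continuity in their parameters. -/

section HypergeometricSeries

variable {q : ℂ}

theorem qHyp_eq_tsum {as bs : List ℂ} (h : as.length = bs.length + 1) (z : ℂ) :
    qHyp as bs q z = ∑' k : ℕ, qPochL as q k / qPochL (q :: bs) q k * z ^ k := by
  unfold qHyp
  refine tsum_congr fun k => ?_
  have : (bs.length : ℤ) + 1 - (as.length : ℤ) = 0 := by rw [h]; push_cast; ring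
  rw [this]
  simp

theorem qPochL_cons (a : ℂ) (as : List ℂ) (k : ℕ) :
    qPochL (a :: as) q k = qPoch a q k * qPochL as q k := by
  simp [qPochL]

@[simp] theorem qPochL_nil (k : ℕ) : qPochL [] q k = 1 := by simp [qPochL]

theorem qPochL_ne_zero (hq0 : q ≠ 0) {bs : List ℂ} (h : ∀ b ∈ bs, b ∉ OmegaSet q) (k : ℕ) :
    qPochL bs q k ≠ 0 := by
  induction bs with
  | nil => simp
  | cons b bs ih =>
    rw [qPochL_cons]
    exact mul_ne_zero (qPoch_ne_zero hq0 (h b (by simp)) k) (ih fun c hc => h c (by simp [hc]))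

theorem qHyp_zero {as bs : List ℂ} (h : as.length = bs.length + 1) : qHyp as bs q 0 = 1 := by
  rw [qHyp_eq_tsum h, tsum_eq_single 0 (fun k hk => by simp [hk])]
  have hz : ∀ l : List ℂ, qPochL l q 0 = 1 := fun l => by
    induction l with
    | nil => simp
    | cons a l ih => rw [qPochL_cons, ih]; simp
  simp [hz]

theorem continuous_qPoch (n : ℕ) : Continuous fun a => qPoch a q n := by
  unfold qPoch; fun_prop

variable {X : Type*} [TopologicalSpace X] {x₀ : X}

/-- The bound is uniform both in k and in a neighbourhood of the parameter value, which is what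
dominated convergence of the series requires. -/
theorem eventually_norm_qPoch_le (hq1 : ‖q‖ < 1) {a : X → ℂ} (ha : ContinuousAt a x₀) :
    ∃ C : ℝ, 0 ≤ C ∧ ∀ᶠ x in 𝓝 x₀, ∀ k, ‖qPoch (a x) q k‖ ≤ C := by
  refine ⟨Real.exp ((‖a x₀‖ + 1) * (1 - ‖q‖)⁻¹), (Real.exp_pos _).le, ?_⟩
  filter_upwards [ha.norm.eventually_lt_const (lt_add_one ‖a x₀‖)] with x hx k
  exact norm_qPoch_le hq1 hx.le k

/-- The complement of Ω_q is the nonvanishing locus of the continuous function (·;q)_∞, hence open.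
-/
theorem eventually_notMem_OmegaSet (hq0 : q ≠ 0) (hq1 : ‖q‖ < 1) {b : X → ℂ}
    (hb : ContinuousAt b x₀) (h : b x₀ ∉ OmegaSet q) : ∀ᶠ x in 𝓝 x₀, b x ∉ OmegaSet q := by
  have h1 : ContinuousAt (fun x => qPochInf (b x) q) x₀ :=
    (continuous_qPochInf hq1).continuousAt.comp hb
  filter_upwards [h1.eventually_ne (qPochInf_ne_zero hq0 hq1 h)] with x hx hx'
  exact hx (qPochInf_eq_zero hq0 hq1 hx')

theorem eventually_norm_inv_qPoch_le (hq0 : q ≠ 0) (hq1 : ‖q‖ < 1) {b : X → ℂ}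
    (hb : ContinuousAt b x₀) (h : b x₀ ∉ OmegaSet q) :
    ∃ C : ℝ, 0 ≤ C ∧ ∀ᶠ x in 𝓝 x₀, ∀ k, ‖(qPoch (b x) q k)⁻¹‖ ≤ C := by
  have h1 : ContinuousAt (fun x => ‖qPochInf (b x) q‖⁻¹) x₀ :=
    (((continuous_qPochInf hq1).continuousAt.comp hb).norm).inv₀
      (norm_ne_zero_iff.2 (qPochInf_ne_zero hq0 hq1 h))
  refine ⟨Real.exp ((‖b x₀‖ + 1) * (1 - ‖q‖)⁻¹) * (‖qPochInf (b x₀) q‖⁻¹ + 1), by positivity, ?_⟩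
  filter_upwards [hb.norm.eventually_lt_const (lt_add_one ‖b x₀‖),
    h1.eventually_lt_const (lt_add_one _), eventually_notMem_OmegaSet hq0 hq1 hb h] with x hx hx' hΩ k
  refine (norm_inv_qPoch_le hq0 hq1 hx.le hΩ k).trans ?_
  gcongr

theorem eventually_norm_qPochL_le (hq1 : ‖q‖ < 1) (as : List (X → ℂ))
    (has : ∀ a ∈ as, ContinuousAt a x₀) :
    ∃ C : ℝ, 0 ≤ C ∧ ∀ᶠ x in 𝓝 x₀, ∀ k, ‖qPochL (as.map (· x)) q k‖ ≤ C := by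
  induction as with
  | nil => exact ⟨1, zero_le_one, by simp⟩
  | cons a as ih =>
    obtain ⟨C, hC, h⟩ := ih fun b hb => has b (by simp [hb])
    obtain ⟨D, hD, h'⟩ := eventually_norm_qPoch_le hq1 (has a (by simp))
    refine ⟨D * C, by positivity, ?_⟩
    filter_upwards [h, h'] with x hx hx' k
    rw [List.map_cons, qPochL_cons, norm_mul]
    exact mul_le_mul (hx' k) (hx k) (norm_nonneg _) hD

theorem eventually_norm_inv_qPochL_le (hq0 : q ≠ 0) (hq1 : ‖q‖ < 1) (bs : List (X → ℂ))
    (hbs : ∀ b ∈ bs, ContinuousAt b x₀) (hb : ∀ b ∈ bs, b x₀ ∉ OmegaSet q) :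
    ∃ C : ℝ, 0 ≤ C ∧ ∀ᶠ x in 𝓝 x₀, ∀ k, ‖(qPochL (bs.map (· x)) q k)⁻¹‖ ≤ C := by
  induction bs with
  | nil => exact ⟨1, zero_le_one, by simp⟩
  | cons a as ih =>
    obtain ⟨C, hC, h⟩ := ih (fun b hb => hbs b (by simp [hb])) fun b hb' => hb b (by simp [hb'])
    obtain ⟨D, hD, h'⟩ := eventually_norm_inv_qPoch_le hq0 hq1 (hbs a (by simp)) (hb a (by simp))
    refine ⟨D * C, by positivity, ?_⟩
    filter_upwards [h, h'] with x hx hx' k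
    rw [List.map_cons, qPochL_cons, mul_inv, norm_mul]
    exact mul_le_mul (hx' k) (hx k) (norm_nonneg _) hD

theorem continuousAt_qPochL (as : List (X → ℂ)) (has : ∀ a ∈ as, ContinuousAt a x₀) (k : ℕ) :
    ContinuousAt (fun x => qPochL (as.map (· x)) q k) x₀ := by
  induction as with
  | nil => simp only [List.map_nil, qPochL_nil]; exact continuousAt_const
  | cons a as ih =>
    simp only [List.map_cons, qPochL_cons]
    exact ((continuous_qPoch k).continuousAt.comp (has a (by simp))).mul
      (ih fun b hb => has b (by simp [hb]))

/-- Dominated convergence: near x₀ the numerators are bounded by C, the inverse denominators by D,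
and the powers of the argument by r^k for some r strictly between ‖z x₀‖ and 1. -/
theorem continuousAt_qHyp (hq0 : q ≠ 0) (hq1 : ‖q‖ < 1) (as bs : List (X → ℂ)) (z : X → ℂ)
    (hlen : as.length = bs.length + 1) (has : ∀ a ∈ as, ContinuousAt a x₀)
    (hbs : ∀ b ∈ bs, ContinuousAt b x₀) (hb : ∀ b ∈ bs, b x₀ ∉ OmegaSet q)
    (hz : ContinuousAt z x₀) (hz1 : ‖z x₀‖ < 1) :
    ContinuousAt (fun x => qHyp (as.map (· x)) (bs.map (· x)) q (z x)) x₀ := by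
  have hbs' : ∀ b ∈ (fun _ => q) :: bs, ContinuousAt b x₀ := by
    intro b hb'
    rcases List.mem_cons.1 hb' with rfl | h
    · exact continuousAt_const
    · exact hbs b h
  have hb' : ∀ b ∈ (fun _ => q) :: bs, b x₀ ∉ OmegaSet q := by
    intro b hb'
    rcases List.mem_cons.1 hb' with rfl | h
    · exact notMem_OmegaSet_of_norm_lt_one hq0 hq1 hq1
    · exact hb b h
  have e : ∀ x, qHyp (as.map (· x)) (bs.map (· x)) q (z x) = _ := fun x =>
    qHyp_eq_tsum (by simpa using hlen) (z x)
  simp_rw [e]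
  obtain ⟨C, hC, h1⟩ := eventually_norm_qPochL_le hq1 as has
  obtain ⟨D, hD, h2⟩ := eventually_norm_inv_qPochL_le hq0 hq1 _ hbs' hb'
  obtain ⟨r, hr, hr1⟩ := exists_between hz1
  have hr0 : 0 ≤ r := (norm_nonneg _).trans hr.le
  refine tendsto_tsum_of_dominated_convergence (bound := fun k => C * D * r ^ k)
    ((summable_geometric_of_lt_one hr0 hr1).mul_left _) (fun k => ?_) ?_
  · exact ((continuousAt_qPochL as has k).div (continuousAt_qPochL _ hbs' k)
      (qPochL_ne_zero hq0 (by
        intro b hb1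
        obtain ⟨f, hf, rfl⟩ := List.mem_map.1 hb1
        exact hb' f hf) k)).mul (hz.pow k)
  · filter_upwards [h1, h2, hz.norm.eventually_lt_const hr] with x hx1 hx2 hx3 k
    rw [norm_mul, div_eq_mul_inv, norm_mul, norm_pow]
    have := hx2 k
    simp only [List.map_cons] at this
    gcongr
    exact hx1 k

theorem summable_qHyp (hq0 : q ≠ 0) (hq1 : ‖q‖ < 1) (as bs : List ℂ) {z : ℂ}
    (hb : ∀ b ∈ bs, b ∉ OmegaSet q) (hz1 : ‖z‖ < 1) :
    Summable fun k : ℕ => qPochL as q k / qPochL (q :: bs) q k * z ^ k := by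
  obtain ⟨C, hC, h1⟩ := eventually_norm_qPochL_le (x₀ := ()) hq1 (as.map fun a _ => a)
    (by simp [continuousAt_const])
  obtain ⟨D, hD, h2⟩ := eventually_norm_inv_qPochL_le (x₀ := ()) hq0 hq1
    ((q :: bs).map fun a _ => a) (by simp [continuousAt_const]) (by
      simpa using ⟨notMem_OmegaSet_of_norm_lt_one hq0 hq1 hq1, hb⟩)
  have h1 := h1.self_of_nhds
  have h2 := h2.self_of_nhds
  rw [List.map_map] at h1 h2
  refine Summable.of_norm_bounded (g := fun k => C * D * ‖z‖ ^ k)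
    ((summable_geometric_of_lt_one (norm_nonneg _) hz1).mul_left _) fun k => ?_
  rw [norm_mul, div_eq_mul_inv, norm_mul, norm_pow]
  have h1 := h1 k
  have h2 := h2 k
  simp only [Function.comp_def, List.map_id'] at h1 h2
  gcongr

end HypergeometricSeries

/-! ### Passage from generic to arbitrary parameters. -/

/-- Two functions continuous at a point that agree off a countable set of reals
agree at the point. -/
theorem eq_of_eq_off_countable {F G : ℝ → ℂ} {x₀ : ℝ} (hF : ContinuousAt F x₀)
    (hG : ContinuousAt G x₀) {s : Set ℝ} (hs : s.Countable)
    (h : ∀ᶠ x in 𝓝 x₀, x ∉ s → F x = G x) : F x₀ = G x₀ := by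
  have hd : Dense sᶜ := hs.dense_compl ℝ
  have hne : (𝓝[sᶜ] x₀).NeBot := mem_closure_iff_nhdsWithin_neBot.1 (hd x₀)
  refine tendsto_nhds_unique (f := F) (l := 𝓝[sᶜ] x₀) (hF.tendsto.mono_left nhdsWithin_le_nhds) ?_
  refine (hG.tendsto.mono_left nhdsWithin_le_nhds).congr' ?_
  filter_upwards [h.filter_mono nhdsWithin_le_nhds, self_mem_nhdsWithin] with x hx hxs
  exact (hx hxs).symm

/-- Compare norms: for each k the equation ‖C‖e^{mx} = ‖q^k‖ has at most one real solution x,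
because m ≠ 0. -/
theorem countable_setOf_exp_mem_UpsilonSet {q : ℂ} (C : ℂ) (m : ℝ) (hC : C ≠ 0) (hm : m ≠ 0) :
    {x : ℝ | C * Complex.exp ((m * x : ℝ) : ℂ) ∈ UpsilonSet q}.Countable := by
  have : {x : ℝ | C * Complex.exp ((m * x : ℝ) : ℂ) ∈ UpsilonSet q} ⊆
      ⋃ k : ℤ, {x : ℝ | ‖C‖ * Real.exp (m * x) = ‖q ^ k‖} := by
    rintro x ⟨k, hk⟩
    refine Set.mem_iUnion.2 ⟨k, ?_⟩
    simp only at hk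
    simp only [Set.mem_ofPred_eq, hk, norm_mul, Complex.norm_exp, Complex.ofReal_re]
  refine (Set.countable_iUnion fun k => Set.Subsingleton.countable ?_).mono this
  intro x hx y hy
  simp only [Set.mem_ofPred_eq] at hx hy
  have h1 := mul_left_cancel₀ (norm_ne_zero_iff.2 hC) (hx.trans hy.symm)
  exact mul_left_cancel₀ hm (Real.exp_injective h1)

/-! ### Second-order relations of the ₂φ₁: the argument shift and the first-parameter shift. -/

section SecondOrder

variable {q : ℂ}

theorem HasSum.eq_sub_of_telescope {v : ℕ → ℂ} {S l : ℂ}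
    (h : HasSum (fun k => v k - v (k + 1)) S) (hl : Tendsto v atTop (𝓝 l)) : S = v 0 - l := by
  refine tendsto_nhds_unique h.tendsto_sum_nat ?_
  simp_rw [Finset.sum_range_sub']
  exact hl.const_sub _

/-- The coefficients of `₂φ₁(a,b;c;q,z)`. -/
noncomputable def phiCoeff (a b c q : ℂ) (k : ℕ) : ℂ :=
  qPoch a q k * qPoch b q k / (qPoch q q k * qPoch c q k)

theorem hasSum_phi (hq0 : q ≠ 0) (hq1 : ‖q‖ < 1) (a b : ℂ) {c z : ℂ} (hc : c ∉ OmegaSet q)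
    (hz : ‖z‖ < 1) :
    HasSum (fun k => phiCoeff a b c q k * z ^ k) (qHyp [a, b] [c] q z) := by
  rw [qHyp_eq_tsum rfl]
  have := (summable_qHyp hq0 hq1 [a, b] [c] (z := z) (by simpa using hc) hz).hasSum
  refine this.congr_fun fun k => ?_
  simp [phiCoeff, qPochL]

theorem phiCoeff_succ (hq0 : q ≠ 0) (hq1 : ‖q‖ < 1) (a b : ℂ) {c : ℂ} (hc : c ∉ OmegaSet q)
    (k : ℕ) :
    phiCoeff a b c q (k + 1) * ((1 - q * q ^ k) * (1 - c * q ^ k)) =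
      phiCoeff a b c q k * ((1 - a * q ^ k) * (1 - b * q ^ k)) := by
  have hq := notMem_OmegaSet_of_norm_lt_one hq0 hq1 hq1
  have h1 := one_sub_mul_pow_ne_zero hq0 hq k
  have h2 := one_sub_mul_pow_ne_zero hq0 hc k
  have h3 := qPoch_ne_zero hq0 hq k
  have h4 := qPoch_ne_zero hq0 hc k
  simp only [phiCoeff, qPoch_succ]
  generalize q ^ k = Q at *
  rw [mul_comm] at h1 h2
  field_simp

theorem norm_mul_pow_lt_one (hq1 : ‖q‖ < 1) {z : ℂ} (hz : ‖z‖ < 1) (n : ℕ) : ‖z * q ^ n‖ < 1 := by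
  rw [norm_mul, norm_pow]
  calc ‖z‖ * ‖q‖ ^ n ≤ ‖z‖ * 1 := by
        gcongr; exact pow_le_one₀ (norm_nonneg _) hq1.le
    _ < 1 := by simpa using hz

/-- The `q`-difference equation of `₂φ₁` in its argument. -/
theorem phi_qDifference (hq0 : q ≠ 0) (hq1 : ‖q‖ < 1) (a b : ℂ) {c z : ℂ} (hc : c ∉ OmegaSet q)
    (hz : ‖z‖ < 1) :
    (1 - z) * qHyp [a, b] [c] q z - (1 + c / q - (a + b) * z) * qHyp [a, b] [c] q (z * q) +
      (c / q - a * b * z) * qHyp [a, b] [c] q (z * q ^ 2) = 0 := by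
  have h0 := hasSum_phi hq0 hq1 a b hc hz
  have h1 := hasSum_phi hq0 hq1 a b hc (by simpa using norm_mul_pow_lt_one hq1 hz 1 : ‖z * q‖ < 1)
  have h2 := hasSum_phi hq0 hq1 a b hc (norm_mul_pow_lt_one hq1 hz 2)
  set u := phiCoeff a b c q with hu
  have hs := ((h0.mul_left (1 - z)).sub (h1.mul_left (1 + c / q - (a + b) * z))).add
    (h2.mul_left (c / q - a * b * z))
  -- The combination of the three series telescopes through v_k = u_k z^k (1-q^k)(1-cq^{k-1}). The
  -- factor 1-q^k makes v_0 vanish.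
  have hv : Tendsto (fun k => u k * z ^ k * ((1 - q ^ k) * (1 - c * q ^ k / q))) atTop (𝓝 0) := by
    have hqk : Tendsto (fun k => q ^ k) atTop (𝓝 0) := tendsto_pow_atTop_nhds_zero_of_norm_lt_one hq1
    have := h0.summable.tendsto_atTop_zero.mul ((hqk.const_sub 1).mul
      (((hqk.const_mul c).div_const q).const_sub 1))
    simpa using this
  refine (HasSum.eq_sub_of_telescope (hs.congr_fun fun k => ?_) hv).trans (by simp)
  have key := phiCoeff_succ hq0 hq1 a b hc k
  rw [← hu] at key
  simp only [pow_succ, mul_pow, ← pow_mul]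
  field_simp
  simp only [pow_mul]
  generalize q ^ k = Q at *
  linear_combination -(z * z ^ k * q) * key

/-- The coefficients of a well-poised `₂φ₁` under a shift of the first parameter. -/
theorem phiCoeff_shift (hq0 : q ≠ 0) (hq1 : ‖q‖ < 1) {a b : ℂ} (hb : b ≠ 0)
    (hc : q * a / b ∉ OmegaSet q) (k : ℕ) :
    (1 - q * a / b) * (1 - q * a / b * q) *
        (phiCoeff a b (q * a / b) q (k + 1) - phiCoeff (a * q) b (q * a / b * q) q (k + 1)) =
      (b / q - a) * (1 - q * a / b * q) * phiCoeff (a * q) b (q * a / b * q) q k -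
        b / q * ((1 - q * a) * (1 - q * (q * a / b) / b)) *
          phiCoeff (a * q ^ 2) b (q * a / b * q ^ 2) q k := by
  have hq := notMem_OmegaSet_of_norm_lt_one hq0 hq1 hq1
  have hc' : q * a / b * q ∉ OmegaSet q := by simpa using mul_pow_notMem_OmegaSet hq0 hc 1
  have hc'' := mul_pow_notMem_OmegaSet hq0 hc 2
  have e1 : (1 - a * q) * qPoch (a * q ^ 2) q k = qPoch (a * q) q k * (1 - a * q * q ^ k) := by
    rw [← qPoch_succ, qPoch_succ']; ring_nf
  have e2 : (1 - q * a / b * q) * qPoch (q * a / b * q ^ 2) q k =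
      qPoch (q * a / b * q) q k * (1 - q * a / b * q * q ^ k) := by
    rw [← qPoch_succ, qPoch_succ']; ring_nf
  simp only [phiCoeff]
  rw [qPoch_succ' a, qPoch_succ' (q * a / b), qPoch_succ (a * q), qPoch_succ (q * a / b * q),
    qPoch_succ b, qPoch_succ q]
  have n1 := one_sub_mul_pow_ne_zero hq0 hq k
  have n2 := qPoch_ne_zero hq0 hq k
  have n3 := one_sub_ne_zero_of_notMem hq0 hc
  have n4 := one_sub_ne_zero_of_notMem hq0 hc'
  have n5 := one_sub_mul_pow_ne_zero hq0 hc' k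
  have n6 := qPoch_ne_zero hq0 hc' k
  have n7 := qPoch_ne_zero hq0 hc'' k
  have e1' : (1 - q * a) * qPoch (a * q ^ 2) q k = qPoch (a * q) q k * (1 - a * q * q ^ k) := by
    rw [← e1]; ring
  have e2' : qPoch (q * a / b * q ^ 2) q k =
      qPoch (q * a / b * q) q k * (1 - q * a / b * q * q ^ k) / (1 - q * a / b * q) := by
    rw [eq_div_iff n4, ← e2]; ring
  have e3 : b / q * ((1 - q * a) * (1 - q * (q * a / b) / b)) *
      (qPoch (a * q ^ 2) q k * qPoch b q k / (qPoch q q k * qPoch (q * a / b * q ^ 2) q k)) =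
      b / q * (1 - q * (q * a / b) / b) * (qPoch (a * q) q k * (1 - a * q * q ^ k)) * qPoch b q k /
        (qPoch q q k * (qPoch (q * a / b * q) q k * (1 - q * a / b * q * q ^ k) /
          (1 - q * a / b * q))) := by
    rw [← e1', ← e2']; ring
  rw [e3]
  generalize qPoch (a * q) q k = A at *
  generalize qPoch (q * a / b * q) q k = C at *
  generalize qPoch b q k = B at *
  generalize qPoch q q k = D at *
  generalize q ^ k = Q at *
  -- Taking c = qa/b as the free variable and eliminating a = cb/q removes the nested fractions.
  obtain ⟨c, hcdef⟩ : ∃ c, c = q * a / b := ⟨_, rfl⟩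
  have ha : a = c * b / q := by rw [hcdef]; field_simp
  rw [← hcdef] at n3 n4 n5 ⊢
  clear e1 e1' e2 e2' e3 hc hc' hc'' n7 hcdef
  subst ha
  field_simp
  ring

/-- Contiguous relation of the well-poised `₂φ₁` in its first parameter. -/
theorem phi_contiguous (hq0 : q ≠ 0) (hq1 : ‖q‖ < 1) {a b z : ℂ} (hb : b ≠ 0)
    (hc : q * a / b ∉ OmegaSet q) (hz : ‖z‖ < 1) :
    (1 - q * a / b) * (1 - q * a / b * q) * qHyp [a, b] [q * a / b] q z -
      (1 + b * z / q - a * z - q * a / b) * (1 - q * a / b * q) *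
        qHyp [a * q, b] [q * a / b * q] q z +
      b * z / q * ((1 - q * a) * (1 - q * (q * a / b) / b)) *
        qHyp [a * q ^ 2, b] [q * a / b * q ^ 2] q z = 0 := by
  have hc' : q * a / b * q ∉ OmegaSet q := by simpa using mul_pow_notMem_OmegaSet hq0 hc 1
  have hc'' := mul_pow_notMem_OmegaSet hq0 hc 2
  have h0 := hasSum_phi hq0 hq1 a b hc hz
  have h1 := hasSum_phi hq0 hq1 (a * q) b hc' hz
  have h2 := hasSum_phi hq0 hq1 (a * q ^ 2) b hc'' hz
  have hs := ((h0.mul_left ((1 - q * a / b) * (1 - q * a / b * q))).sub (h1.mul_left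
    ((1 + b * z / q - a * z - q * a / b) * (1 - q * a / b * q)))).add
    (h2.mul_left (b * z / q * ((1 - q * a) * (1 - q * (q * a / b) / b))))
  -- The telescoping sequence is a constant times the difference of the k-th terms of the first two
  -- series. It vanishes at k = 0 because both series begin with 1.
  have hv := (h0.summable.tendsto_atTop_zero.sub h1.summable.tendsto_atTop_zero).const_mul
    ((1 - q * a / b) * (1 - q * a / b * q))
  refine (HasSum.eq_sub_of_telescope (hs.congr_fun fun k => ?_) hv).trans (by simp [phiCoeff])
  have key := phiCoeff_shift hq0 hq1 hb hc k
  have e : ∀ x y : ℂ, x * z ^ (k + 1) - y * z ^ (k + 1) = (x - y) * z ^ (k + 1) := fun x y => by ring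
  rw [e, ← mul_assoc, key]
  ring

end SecondOrder

/-! ### The Jackson kernel and its telescoping certificate. -/

section TwoTerm

set_option maxHeartbeats 1000000 in
-- Creative telescoping, with the kernel W(X) divided out. On the left, r₀, r₁, r₂ are the
-- successive ratios of the kernel under U → Uq, and n₀, n₁, n₂ those of the normalizing constant.
-- On the right, the two fractions are Y(X)/W(X) and Y(qX)/W(X) for the certificate Y of
-- `jackson_chain`. After the denominators are cleared the claim is a polynomial identity.
theorem telescoping_certificate {q p β U V X : ℂ} (hpq : p ^ 2 = q) (hp : p ≠ 0) (hβ : β ≠ 0) (hU : U ≠ 0) (hV : V ≠ 0)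
    (a0 : 1 - β * U ≠ 0) (a1 : 1 - β * (U * q) ≠ 0) (a2 : 1 - β * (U * q * q) ≠ 0)
    (b0 : β - U ≠ 0) (b1 : β - U * q ≠ 0) (b2 : β - (U * q * q) ≠ 0)
    (d0 : 1 - U * X ≠ 0) (d1 : 1 - U * q * X ≠ 0) (d2 : 1 - U * q * q * X ≠ 0) (m0 m1 e0 e1 Γ n0 n1 n2 r0 r1 r2 τ : ℂ)
    (hm0 : m0 = 1 - p * U) (hm1 : m1 = 1 - p * (U * q))
    (he0 : e0 = V / p * ((1 - β * (U * q)) * (1 - U * q / β)))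
    (he1 : e1 = V / p * ((1 - β * (U * q * q)) * (1 - U * q * q / β)))
    (hΓ : Γ = (1 + V / p) ^ 2 * (m0 * m1) - e0)
    (hn0 : n0 = -(U / V) / ((1 - β * U) * (1 - U / β)))
    (hn1 : n1 = -(U * q / V) / ((1 - β * (U * q)) * (1 - U * q / β)))
    (hn2 : n2 = -(U * q * q / V) / ((1 - β * (U * q * q)) * (1 - U * q * q / β)))
    (hr0 : r0 = (1 - X / U) / (1 - U * X))
    (hr1 : r1 = (1 - X / (U * q)) / (1 - U * q * X))
    (hr2 : r2 = (1 - X / (U * q * q)) / (1 - U * q * q * X))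
    (hτ : τ = -(U * m1 * (1 - p * U) * (1 - (U * q)^2)) / ((1 - β * U) * (1 - U / β))) :
   X * (m1 - m0 * Γ * (n0 * r0) + e0 * m1 * Γ * (n0 * n1 * (r0 * r1)) -
     e0 * e1 ^ 2 * m0 * (n0 * n1 * n2 * (r0 * r1 * r2))) =
   τ * ((1 - X / U) * (1 - X / V) * (1 - V * X / q) * (1 - X / p)) / ((1 - U * X) * (1 - U * q * X)) -
   τ * ((1 - β * X) * (1 - X / β) * (1 - X ^ 2) * (1 + p * X)) / ((1 - U * X) * (1 - U * q * X) * (1 - U * q * q * X)) := by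
  subst hpq
  have c1 : 1 - U * p ^ 2 / β ≠ 0 := by rw [one_sub_div hβ]; exact div_ne_zero b1 hβ
  have c2 : 1 - U * p ^ 2 * p ^ 2 / β ≠ 0 := by rw [one_sub_div hβ]; exact div_ne_zero b2 hβ
  -- In e₀n₁ and e₁n₂ the quadratic factors in β cancel, leaving monomials. Only the denominator of
  -- n₀, which τ shares, survives.
  have k0 : e0 * n1 = - (U * p) := by
    rw [he0, hn1, mul_div_assoc', div_eq_iff (mul_ne_zero a1 c1)]; field_simp
  have k1 : e1 * n2 = - (U * p ^ 3) := by
    rw [he1, hn2, mul_div_assoc', div_eq_iff (mul_ne_zero a2 c2)]; field_simp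
  have l : m1 - m0 * Γ * (n0 * r0) + e0 * m1 * Γ * (n0 * n1 * (r0 * r1)) -
     e0 * e1 ^ 2 * m0 * (n0 * n1 * n2 * (r0 * r1 * r2)) = m1 - n0 * r0 * (m0 * Γ + U * p * m1 * Γ * r1 + U * p * (U * p ^3) * e1 * m0 * r1 * r2) := by
    linear_combination (m1 * Γ * n0 * r0 * r1 - e1 * m0 * n0 * r0 * r1 * r2 * e1 * n2) * k0 - (e1 * m0 * n0 * r0 * r1 * r2 * (-(U*p))) * k1
  have s0 : (1 - β * U) * (1 - U / β) ≠ 0 := by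
    refine mul_ne_zero a0 ?_
    rw [one_sub_div hβ]; exact div_ne_zero b0 hβ
  rw [l, hn0, hτ]
  have h1 : ∀ a b : ℂ, a / ((1 - β * U) * (1 - U / β)) * b = a * b / ((1 - β * U) * (1 - U / β)) := fun a b => by ring
  have h2 : ∀ a b c : ℂ, a / ((1 - β * U) * (1 - U / β)) / b - c / ((1 - β * U) * (1 - U / β)) / (b * (1 - U * p ^ 2 * p ^ 2 * X)) = (a / b - c / (b * (1 - U * p ^ 2 * p ^ 2 * X))) / ((1 - β * U) * (1 - U / β)) := fun a b c => by 
     rw [sub_div, div_div, div_div, div_div, div_div]; ring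
  rw [h1, h1, h1, h1, h2, eq_div_iff s0, mul_sub, sub_mul, mul_assoc X (_ / _), div_mul_cancel₀ _ s0, hr0, hr1, hr2]
  rw [hΓ, he0, he1, hm0, hm1]
  clear * - hp hβ hU hV d0 d1 d2
  -- The three denominators stay atomic while fractions are cleared and are expanded only for the
  -- final polynomial identity.
  obtain ⟨D0, h0⟩ : ∃ D, D = 1 - U * X := ⟨_, rfl⟩
  obtain ⟨D1, h1⟩ : ∃ D, D = 1 - U * p ^ 2 * X := ⟨_, rfl⟩
  obtain ⟨D2, h2⟩ : ∃ D, D = 1 - U * p ^ 2 * p ^ 2 * X := ⟨_, rfl⟩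
  rw [← h0] at d0 ⊢
  rw [← h1] at d1 ⊢
  rw [← h2] at d2 ⊢
  field_simp
  rw [h0, h1, h2]
  ring

/-- The weight of the two-term formula. -/
noncomputable def clausenKernel (q p β U V X : ℂ) : ℂ :=
  qPochInf (q * X / U) q * qPochInf (q * X / V) q * qPochInf (U * X) q * qPochInf (V * X) q *
      qPochInf (p * X) q ^ 2 /
    (qPochInf (β * X) q * qPochInf (X / β) q * qPochInf (X ^ 2) q)

/-- The Jackson integral `∑ x q^k F(x q^k)`. -/
noncomputable def jacksonSum (q : ℂ) (F : ℂ → ℂ) (x : ℂ) : ℂ :=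
  ∑' k : ℕ, x * q ^ k * F (x * q ^ k)

variable {q p β U V : ℂ}

theorem continuousAt_clausenKernel (hq1 : ‖q‖ < 1) {X : ℂ}
    (h : qPochInf (β * X) q * qPochInf (X / β) q * qPochInf (X ^ 2) q ≠ 0) :
    ContinuousAt (clausenKernel q p β U V) X := by
  have := continuous_qPochInf hq1
  unfold clausenKernel
  refine ContinuousAt.div ?_ ?_ h <;> refine Continuous.continuousAt ?_ <;> fun_prop

theorem clausenKernel_zero : clausenKernel q p β U V 0 = 1 := by simp [clausenKernel]

theorem tendsto_mul_pow_zero (hq1 : ‖q‖ < 1) (x : ℂ) :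
    Tendsto (fun k : ℕ => x * q ^ k) atTop (𝓝 0) := by
  simpa using (tendsto_pow_atTop_nhds_zero_of_norm_lt_one hq1).const_mul x

theorem tendsto_clausenKernel (hq1 : ‖q‖ < 1) (x : ℂ) :
    Tendsto (fun k : ℕ => clausenKernel q p β U V (x * q ^ k)) atTop (𝓝 1) := by
  have h : ContinuousAt (clausenKernel q p β U V) 0 :=
    continuousAt_clausenKernel hq1 (by simp)
  have := h.tendsto.comp (tendsto_mul_pow_zero hq1 x)
  rwa [clausenKernel_zero] at this

/-- A convergent F is bounded along the chain, so the terms are O(‖q‖^k). -/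
theorem summable_jackson (hq1 : ‖q‖ < 1) {F : ℂ → ℂ} {x l : ℂ}
    (h : Tendsto (fun k : ℕ => F (x * q ^ k)) atTop (𝓝 l)) :
    Summable fun k : ℕ => x * q ^ k * F (x * q ^ k) := by
  have h1 : (fun k : ℕ => x * q ^ k * F (x * q ^ k)) =O[atTop] fun k => ‖q‖ ^ k := by
    have h2 : (fun k : ℕ => x * q ^ k) =O[atTop] fun k => ‖q‖ ^ k := by
      refine Asymptotics.IsBigO.of_bound ‖x‖ (.of_forall fun k => ?_)
      simp
    simpa using h2.mul (h.isBigO_one ℝ)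
  exact summable_of_isBigO_nat (summable_geometric_of_lt_one (norm_nonneg q) hq1) h1

theorem jacksonSum_step (hq1 : ‖q‖ < 1) {F : ℂ → ℂ} {x l : ℂ}
    (h : Tendsto (fun k : ℕ => F (x * q ^ k)) atTop (𝓝 l)) :
    jacksonSum q F x = x * F x + jacksonSum q F (x * q) := by
  unfold jacksonSum
  rw [(summable_jackson hq1 h).tsum_eq_zero_add]
  simp [pow_succ', mul_assoc]

/-- Only the factors (qX/U;q)_∞ and (UX;q)_∞ involve U. The first gains the factor 1-X/U and the
second loses 1-UX. -/
theorem clausenKernel_shift (hq0 : q ≠ 0) (hq1 : ‖q‖ < 1) {X : ℂ} (hD : 1 - U * X ≠ 0) :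
    clausenKernel q p β (U * q) V X =
      clausenKernel q p β U V X * ((1 - X / U) / (1 - U * X)) := by
  unfold clausenKernel
  have h1 : q * X / (U * q) = X / U := by field_simp
  rw [h1, qPochInf_step hq1 (X / U), qPochInf_step hq1 (U * X),
    show X / U * q = q * X / U by ring, show U * X * q = U * q * X by ring]
  generalize 1 - U * X = D at *
  field_simp

/-- The q-Pearson equation of the kernel: each product sheds its first factor, except (X²;q)_∞,
which sheds two because X² becomes q²X². -/
theorem clausenKernel_mul_q (hq1 : ‖q‖ < 1) {X : ℂ}
    (h : (1 - β * X) * (1 - X / β) * ((1 - X ^ 2) * (1 - q * X ^ 2)) ≠ 0) :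
    clausenKernel q p β U V X * ((1 - β * X) * (1 - X / β) * ((1 - X ^ 2) * (1 - q * X ^ 2))) =
      clausenKernel q p β U V (X * q) * ((1 - q * X / U) * (1 - q * X / V) * (1 - U * X) *
        (1 - V * X) * (1 - p * X) ^ 2) := by
  unfold clausenKernel
  rw [qPochInf_step hq1 (q * X / U), qPochInf_step hq1 (q * X / V), qPochInf_step hq1 (U * X),
    qPochInf_step hq1 (V * X), qPochInf_step hq1 (p * X), qPochInf_step hq1 (β * X),
    qPochInf_step hq1 (X / β), qPochInf_step hq1 (X ^ 2), qPochInf_step hq1 (X ^ 2 * q),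
    show q * X / U * q = q * (X * q) / U by ring, show q * X / V * q = q * (X * q) / V by ring,
    show U * X * q = U * (X * q) by ring, show V * X * q = V * (X * q) by ring,
    show p * X * q = p * (X * q) by ring, show β * X * q = β * (X * q) by ring,
    show X / β * q = X * q / β by ring, show X ^ 2 * q * q = (X * q) ^ 2 by ring,
    mul_comm (X ^ 2) q]
  set B := (1 - β * X) * (1 - X / β) * ((1 - X ^ 2) * (1 - q * X ^ 2)) with hB
  have e : (1 - β * X) * qPochInf (β * (X * q)) q * ((1 - X / β) * qPochInf (X * q / β) q) *
      ((1 - X ^ 2) * ((1 - q * X ^ 2) * qPochInf ((X * q) ^ 2) q)) =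
      B * (qPochInf (β * (X * q)) q * qPochInf (X * q / β) q * qPochInf ((X * q) ^ 2) q) := by
    rw [hB]; ring
  rw [e, ← div_div, div_mul_eq_mul_div, div_mul_cancel₀ _ h]
  ring

end TwoTerm

/-! ### Generic parameters and the recurrence for a single Jackson sum. -/

section TwoTerm

variable {q p β U V : ℂ}

/-- Parameters for which all the factors of the two-term formula are regular. -/
structure ClausenGeneric (q β U V : ℂ) : Prop where
  hβ : β ≠ 0
  hU : U ≠ 0
  hV : V ≠ 0
  βU : β * U ∉ OmegaSet q
  Uβ : U / β ∉ OmegaSet q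
  βV : β * V ∉ OmegaSet q
  Vβ : V / β ∉ OmegaSet q
  UU : U ^ 2 ∉ OmegaSet q
  VV : V ^ 2 ∉ OmegaSet q
  UV : U * V ∉ OmegaSet q
  hUV : U / V ∉ UpsilonSet q

theorem ClausenGeneric.symm (h : ClausenGeneric q β U V) : ClausenGeneric q β V U :=
  ⟨h.hβ, h.hV, h.hU, h.βV, h.Vβ, h.βU, h.Uβ, h.VV, h.UU, by rw [mul_comm]; exact h.UV,
    fun h' => h.hUV (by simpa using inv_mem_UpsilonSet h')⟩

theorem ClausenGeneric.mul_q (hq0 : q ≠ 0) (h : ClausenGeneric q β U V) :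
    ClausenGeneric q β (U * q) V := by
  refine ⟨h.hβ, mul_ne_zero h.hU hq0, h.hV, ?_, ?_, h.βV, h.Vβ, ?_, h.VV, ?_, fun h' => h.hUV ?_⟩
  · simpa [mul_assoc] using mul_pow_notMem_OmegaSet hq0 h.βU 1
  · simpa [div_mul_eq_mul_div] using mul_pow_notMem_OmegaSet hq0 h.Uβ 1
  · simpa [mul_pow] using mul_pow_notMem_OmegaSet hq0 h.UU 2
  · simpa [mul_right_comm] using mul_pow_notMem_OmegaSet hq0 h.UV 1
  · refine mul_q_mem_UpsilonSet hq0 ?_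
    convert! h' using 1
    ring

theorem ClausenGeneric.mul_pow (hq0 : q ≠ 0) (h : ClausenGeneric q β U V) (n : ℕ) :
    ClausenGeneric q β (U * q ^ n) V := by
  induction n with
  | zero => simpa using h
  | succ n ih => simpa [pow_succ, mul_assoc] using ih.mul_q hq0

/-- The recurrence coefficients. -/
noncomputable def cM (p U : ℂ) : ℂ := 1 - p * U
noncomputable def cE (q p β U V : ℂ) : ℂ := V / p * ((1 - β * (U * q)) * (1 - U * q / β))
-- This combination arises when a second-order recurrence is squared; see `sq_recurrence`.
noncomputable def cΓ (q p β U V : ℂ) : ℂ :=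
  (1 + V / p) ^ 2 * (cM p U * cM p (U * q)) - cE q p β U V
-- The ratio by which the constant in front of the Jackson integral changes under U → Uq; see
-- `clausenConst_shift`.
noncomputable def cN (β U V : ℂ) : ℂ := -(U / V) / ((1 - β * U) * (1 - U / β))

/-- The recurrence applied to the summand is Y(X) - Y(qX), so only the boundary terms remain. Y
vanishes at x = U and at x = V, and tends to τ along the chain. The resulting inhomogeneity -τ is
the same for both starting points and cancels in their difference. -/
theorem jackson_chain (hpq : p ^ 2 = q) (hp : p ≠ 0) (hq1 : ‖q‖ < 1) (h : ClausenGeneric q β U V)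
    {x : ℂ} (hβx : β * x ∉ OmegaSet q) (hxβ : x / β ∉ OmegaSet q) (hxx : x ^ 2 ∉ OmegaSet q)
    (hUx : U * x ∉ OmegaSet q) (hx : x = U ∨ x = V) :
    cM p (U * q) * jacksonSum q (clausenKernel q p β U V) x -
      cM p U * cΓ q p β U V * (cN β U V * jacksonSum q (clausenKernel q p β (U * q) V) x) +
      cE q p β U V * cM p (U * q) * cΓ q p β U V *
        (cN β U V * cN β (U * q) V * jacksonSum q (clausenKernel q p β (U * q * q) V) x) -
      cE q p β U V * cE q p β (U * q) V ^ 2 * cM p U *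
        (cN β U V * cN β (U * q) V * cN β (U * q * q) V *
          jacksonSum q (clausenKernel q p β (U * q * q * q) V) x) =
      U * cM p (U * q) * (1 - p * U) * (1 - (U * q) ^ 2) / ((1 - β * U) * (1 - U / β)) := by
  have hq0 : q ≠ 0 := by rw [← hpq]; exact pow_ne_zero 2 hp
  have hs : ∀ u : ℂ, HasSum (fun k : ℕ => x * q ^ k * clausenKernel q p β u V (x * q ^ k))
      (jacksonSum q (clausenKernel q p β u V) x) := fun u =>
    (summable_jackson hq1 (tendsto_clausenKernel hq1 x)).hasSum
  set τ : ℂ := -(U * cM p (U * q) * (1 - p * U) * (1 - (U * q) ^ 2)) /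
    ((1 - β * U) * (1 - U / β)) with hτ
  let Y : ℂ → ℂ := fun X => τ * clausenKernel q p β U V X *
    ((1 - X / U) * (1 - X / V) * (1 - V * X / q) * (1 - X / p)) /
      ((1 - U * X) * (1 - U * q * X))
  -- The factors 1-X/U and 1-X/V in Y are there for these two starting points.
  have hY0 : Y x = 0 := by
    simp only [Y]
    rcases hx with rfl | rfl
    · rw [div_self h.hU]; simp
    · rw [div_self h.hV]; simp
  have hY : Tendsto (fun k : ℕ => Y (x * q ^ k)) atTop (𝓝 τ) := by
    have hc : ContinuousAt (fun X : ℂ => τ * ((1 - X / U) * (1 - X / V) * (1 - V * X / q) *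
        (1 - X / p)) / ((1 - U * X) * (1 - U * q * X))) 0 := by
      refine ContinuousAt.div ?_ ?_ (by simp) <;> refine Continuous.continuousAt ?_ <;> fun_prop
    have h1 := (hc.tendsto.comp (tendsto_mul_pow_zero hq1 x)).mul
      (tendsto_clausenKernel (q := q) (p := p) (β := β) (U := U) (V := V) hq1 x)
    simp only [Function.comp_def] at h1
    convert! h1 using 2
    · simp only [Y]; ring
    · simp
  have hsum := ((((hs U).mul_left (cM p (U * q))).sub (((hs (U * q)).mul_left
    (cN β U V)).mul_left (cM p U * cΓ q p β U V))).add (((hs (U * q * q)).mul_left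
    (cN β U V * cN β (U * q) V)).mul_left (cE q p β U V * cM p (U * q) * cΓ q p β U V))).sub
    (((hs (U * q * q * q)).mul_left (cN β U V * cN β (U * q) V * cN β (U * q * q) V)).mul_left
    (cE q p β U V * cE q p β (U * q) V ^ 2 * cM p U))
  have hfin := HasSum.eq_sub_of_telescope (v := fun k => Y (x * q ^ k))
    (hsum.congr_fun fun k => ?_) hY
  · rw [hfin]
    simp only [pow_zero, mul_one, hY0, hτ]
    ring
  have hβX : 1 - β * (x * q ^ k) ≠ 0 := by
    simpa [mul_assoc] using one_sub_mul_pow_ne_zero hq0 hβx k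
  have hXβ : 1 - x * q ^ k / β ≠ 0 := by
    simpa [div_mul_eq_mul_div] using one_sub_mul_pow_ne_zero hq0 hxβ k
  have hXX : 1 - (x * q ^ k) ^ 2 ≠ 0 := by
    have := one_sub_mul_pow_ne_zero hq0 hxx (k * 2)
    rwa [_root_.mul_pow, ← pow_mul]
  have hqXX : 1 - q * (x * q ^ k) ^ 2 ≠ 0 := by
    have := one_sub_mul_pow_ne_zero hq0 hxx (k * 2 + 1)
    rwa [_root_.mul_pow, ← pow_mul, ← mul_assoc, mul_comm q, mul_assoc, ← pow_succ']
  have hD0 : 1 - U * (x * q ^ k) ≠ 0 := by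
    simpa [mul_assoc] using one_sub_mul_pow_ne_zero hq0 hUx k
  have hD1 : 1 - U * q * (x * q ^ k) ≠ 0 := by
    convert! one_sub_mul_pow_ne_zero hq0 hUx (k + 1) using 1; ring
  have hD2 : 1 - U * q * q * (x * q ^ k) ≠ 0 := by
    convert! one_sub_mul_pow_ne_zero hq0 hUx (k + 2) using 1; ring
  rw [pow_succ, ← mul_assoc x]
  generalize x * q ^ k = X at *
  -- 1-pX divides 1-qX² = (1-pX)(1+pX).
  have hpX : 1 - p * X ≠ 0 := by
    intro h0
    apply hqXX
    rw [← hpq]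
    linear_combination (1 + p * X) * h0
  rw [clausenKernel_shift hq0 hq1 hD2, clausenKernel_shift hq0 hq1 hD1,
    clausenKernel_shift hq0 hq1 hD0]
  have a0 := one_sub_ne_zero_of_notMem hq0 h.βU
  have a1 := one_sub_ne_zero_of_notMem hq0 (h.mul_q hq0).βU
  have a2 := one_sub_ne_zero_of_notMem hq0 ((h.mul_q hq0).mul_q hq0).βU
  have hb : ∀ u : ℂ, u / β ∉ OmegaSet q → β - u ≠ 0 := fun u hu h0 => by
    apply one_sub_ne_zero_of_notMem hq0 hu
    rw [← sub_eq_zero.1 h0, div_self h.hβ, sub_self]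
  have core := telescoping_certificate hpq hp h.hβ h.hU h.hV a0 a1 a2 (hb _ h.Uβ)
    (hb _ (h.mul_q hq0).Uβ) (hb _ ((h.mul_q hq0).mul_q hq0).Uβ) hD0 hD1 hD2
    (cM p U) (cM p (U * q)) (cE q p β U V) (cE q p β (U * q) V) (cΓ q p β U V)
    (cN β U V) (cN β (U * q) V) (cN β (U * q * q) V) _ _ _ τ rfl rfl rfl rfl rfl rfl rfl rfl
    rfl rfl rfl hτ
  have hK := clausenKernel_mul_q (U := U) (V := V) (p := p) hq1
    (mul_ne_zero (mul_ne_zero hβX hXβ) (mul_ne_zero hXX hqXX))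
  -- The common factor 1-pX is removed from the q-Pearson equation, so that it matches the
  -- certificate.
  have hK' : clausenKernel q p β U V X *
      ((1 - β * X) * (1 - X / β) * (1 - X ^ 2) * (1 + p * X)) =
      clausenKernel q p β U V (X * q) * ((1 - q * X / U) * (1 - q * X / V) * (1 - U * X) *
        (1 - V * X) * (1 - p * X)) := by
    apply mul_right_cancel₀ hpX
    rw [← hpq] at hK ⊢
    linear_combination hK
  have hYq : Y (X * q) = τ * (clausenKernel q p β U V X *
      ((1 - β * X) * (1 - X / β) * (1 - X ^ 2) * (1 + p * X))) /
        ((1 - U * X) * (1 - U * q * X) * (1 - U * q * q * X)) := by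
    rw [hK']
    simp only [Y]
    rw [show V * (X * q) / q = V * X by field_simp, show X * q / p = p * X by
      rw [← hpq]; field_simp, show U * (X * q) = U * q * X by ring,
      show U * q * (X * q) = U * q * q * X by ring, mul_comm X q]
    rw [div_eq_div_iff (mul_ne_zero hD1 hD2) (mul_ne_zero (mul_ne_zero hD0 hD1) hD2)]
    ring
  rw [hYq]
  simp only [Y]
  linear_combination -clausenKernel q p β U V X * core

end TwoTerm

/-! ### The third-order recurrence, for the square and for the Jackson integral. -/

section TwoTerm

variable {q p β U V : ℂ}

/-- The normalized well-poised series `(z, qa/b; q)_∞ ₂φ₁(a, b; qa/b; q, z)`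
with `a = βV`, `b = βp`, `z = U/β`. -/
noncomputable def clausenSeries (q p β U V : ℂ) : ℂ :=
  qPochInf (U / β) q * qPochInf (p * V) q * qHyp [β * V, β * p] [p * V] q (U / β)

/-- This is the q-difference equation in z, since U → Uq means z → zq. The normalizing product
(z;q)_∞ absorbs the leading coefficient 1-z. -/
theorem clausenSeries_rec_left (hpq : p ^ 2 = q) (hp : p ≠ 0) (hq1 : ‖q‖ < 1) (hβ : β ≠ 0)
    (hz : ‖U / β‖ < 1) (hc : p * V ∉ OmegaSet q) :
    clausenSeries q p β U V = (1 + V / p) * cM p U * clausenSeries q p β (U * q) V -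
      cE q p β U V * clausenSeries q p β (U * q * q) V := by
  have hq0 : q ≠ 0 := by rw [← hpq]; exact pow_ne_zero 2 hp
  have h := phi_qDifference hq0 hq1 (β * V) (β * p) hc hz
  unfold clausenSeries cM cE
  rw [show U * q / β = U / β * q by ring, show U * q * q / β = U / β * q * q by ring,
    qPochInf_step hq1 (U / β), qPochInf_step hq1 (U / β * q)]
  rw [show U / β * q ^ 2 = U / β * q * q by ring] at h
  have e1 : p * V / q = V / p := by rw [← hpq]; field_simp
  have e2 : (β * V + β * p) * (U / β) = (V + p) * U := by field_simp
  have e3 : β * V * (β * p) * (U / β) = β * V * p * U := by field_simp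
  have e4 : V / p * q = V * p := by rw [← hpq]; field_simp
  have e5 : V / p * p = V := by field_simp
  rw [e1, e2, e3] at h
  generalize qHyp [β * V, β * p] [p * V] q (U / β) = f0 at *
  generalize qHyp [β * V, β * p] [p * V] q (U / β * q) = f1 at *
  generalize qHyp [β * V, β * p] [p * V] q (U / β * q * q) = f2 at *
  generalize qPochInf (U / β * q * q) q = A at *
  generalize qPochInf (p * V) q = B at *
  generalize U / β * q = y at *
  generalize U / β = x at *
  generalize V / p = e at *
  linear_combination ((1 - y) * A * B) * h + (1 - y) * A * B * f1 * U * e5 +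
    β * U * (1 - y) * A * B * f2 * (- e4)

/-- V → Vq replaces a by aq and qa/b by q²a/b, so the contiguous relation applies. The result is the
recurrence in U with the letters exchanged; Heine's transformation explains this symmetry but is not
needed. -/
theorem clausenSeries_rec_right (hpq : p ^ 2 = q) (hp : p ≠ 0) (hq1 : ‖q‖ < 1) (hβ : β ≠ 0)
    (hz : ‖U / β‖ < 1) (hc : p * V ∉ OmegaSet q) :
    clausenSeries q p β U V = (1 + U / p) * cM p V * clausenSeries q p β U (V * q) -
      cE q p β V U * clausenSeries q p β U (V * q * q) := by
  have hq0 : q ≠ 0 := by rw [← hpq]; exact pow_ne_zero 2 hp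
  have e1 : q * (β * V) / (β * p) = p * V := by rw [← hpq]; field_simp
  have h := phi_contiguous (a := β * V) (b := β * p) hq0 hq1 (mul_ne_zero hβ hp)
    (by rwa [e1]) hz
  rw [e1] at h
  have e2 : β * p * (U / β) / q = U / p := by rw [← hpq]; field_simp
  have e3 : β * V * (U / β) = V * U := by field_simp
  have e4 : q * (p * V) / (β * p) = V * q / β := by field_simp
  have e5 : U / p * p = U := by field_simp
  rw [e2, e3, e4, show β * V * q ^ 2 = β * (V * q * q) by ring,
    show p * V * q ^ 2 = p * (V * q * q) by ring, show β * V * q = β * (V * q) by ring,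
    show p * V * q = p * (V * q) by ring] at h
  unfold clausenSeries cM cE
  rw [qPochInf_step hq1 (p * V), show p * V * q = p * (V * q) by ring,
    qPochInf_step hq1 (p * (V * q)), show p * (V * q) * q = p * (V * q * q) by ring]
  generalize qHyp [β * V, β * p] [p * V] q (U / β) = f0 at *
  generalize qHyp [β * (V * q), β * p] [p * (V * q)] q (U / β) = f1 at *
  generalize qHyp [β * (V * q * q), β * p] [p * (V * q * q)] q (U / β) = f2 at *
  generalize qPochInf (U / β) q = A at *
  generalize qPochInf (p * (V * q * q)) q = B at *
  generalize V * q / β = y at *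
  generalize U / p = e at *
  linear_combination (A * B) * h - (1 - p * (V * q)) * A * B * f1 * V * (-e5)

/-- The product G₁G₂ has coefficient -2g·m₀m₁e₀ both in m₁G₀² and in e₀e₁²m₀G₃², so it drops out of
their difference and only squares remain. This needs the same g in both recurrences. -/
theorem sq_recurrence {g m0 m1 e0 e1 G0 G1 G2 G3 : ℂ} (h0 : G0 = g * m0 * G1 - e0 * G2)
    (h1 : G1 = g * m1 * G2 - e1 * G3) :
    m1 * G0 ^ 2 - m0 * (g ^ 2 * (m0 * m1) - e0) * G1 ^ 2 +
      e0 * m1 * (g ^ 2 * (m0 * m1) - e0) * G2 ^ 2 - e0 * e1 ^ 2 * m0 * G3 ^ 2 = 0 := by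
  rw [h0, h1]; ring

/-- The third-order recurrence satisfied by the square. -/
def ClausenRec (q p β U V : ℂ) (S : ℂ → ℂ) : Prop :=
  cM p (U * q) * S U - cM p U * cΓ q p β U V * S (U * q) +
    cE q p β U V * cM p (U * q) * cΓ q p β U V * S (U * q * q) -
    cE q p β U V * cE q p β (U * q) V ^ 2 * cM p U * S (U * q * q * q) = 0

theorem norm_mul_q_div_lt_one (hq1 : ‖q‖ < 1) (hz : ‖U / β‖ < 1) : ‖U * q / β‖ < 1 := by
  simpa [div_mul_eq_mul_div] using norm_mul_pow_lt_one hq1 hz 1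

theorem clausenRec_series_left (hpq : p ^ 2 = q) (hp : p ≠ 0) (hq1 : ‖q‖ < 1) (hβ : β ≠ 0)
    (hz : ‖U / β‖ < 1) (hc : p * V ∉ OmegaSet q) :
    ClausenRec q p β U V fun u => clausenSeries q p β u V ^ 2 :=
  sq_recurrence (clausenSeries_rec_left hpq hp hq1 hβ hz hc)
    (clausenSeries_rec_left hpq hp hq1 hβ (norm_mul_q_div_lt_one hq1 hz) hc)

theorem clausenRec_series_right (hpq : p ^ 2 = q) (hp : p ≠ 0) (hq1 : ‖q‖ < 1) (hβ : β ≠ 0)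
    (hz : ‖U / β‖ < 1) (hc : p * V ∉ OmegaSet q) :
    ClausenRec q p β V U fun v => clausenSeries q p β U v ^ 2 :=
  sq_recurrence (clausenSeries_rec_right hpq hp hq1 hβ hz hc)
    (clausenSeries_rec_right hpq hp hq1 hβ hz (by
      have hq0 : q ≠ 0 := by rw [← hpq]; exact pow_ne_zero 2 hp
      simpa [mul_assoc] using mul_pow_notMem_OmegaSet hq0 hc 1))

/-- The constant in front of the Jackson integral. -/
noncomputable def clausenConst (q β U V : ℂ) : ℂ :=
  qPochInf (β * U) q * qPochInf (U / β) q * qPochInf (β * V) q * qPochInf (V / β) q /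
    (qPochInf q q * (U - V) * qPochInf (q * V / U) q * qPochInf (q * U / V) q)

/-- The two-term side of the formula for the square. -/
noncomputable def clausenIntegral (q p β U V : ℂ) : ℂ :=
  clausenConst q β U V * (jacksonSum q (clausenKernel q p β U V) U -
    jacksonSum q (clausenKernel q p β U V) V)

theorem clausenKernel_symm (X : ℂ) : clausenKernel q p β U V X = clausenKernel q p β V U X := by
  unfold clausenKernel; ring

/-- Both the constant and the difference of the two Jackson sums change sign. -/
theorem clausenIntegral_symm : clausenIntegral q p β U V = clausenIntegral q p β V U := by
  have h : clausenKernel q p β U V = clausenKernel q p β V U := funext clausenKernel_symm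
  unfold clausenIntegral clausenConst
  rw [h, show qPochInf q q * (U - V) * qPochInf (q * V / U) q * qPochInf (q * U / V) q =
    -(qPochInf q q * (V - U) * qPochInf (q * U / V) q * qPochInf (q * V / U) q) by ring, div_neg]
  ring

theorem clausenConst_shift (hq0 : q ≠ 0) (hq1 : ‖q‖ < 1) (h : ClausenGeneric q β U V) :
    clausenConst q β (U * q) V = clausenConst q β U V * cN β U V := by
  unfold clausenConst cN
  have a0 := one_sub_ne_zero_of_notMem hq0 h.βU
  have b0 := one_sub_ne_zero_of_notMem hq0 h.Uβ
  have hU := h.hU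
  have hV := h.hV
  have hUV : U - V ≠ 0 := fun h0 => h.hUV ⟨0, by
    simp [sub_eq_zero.1 h0, div_self hV]⟩
  have hqUV : V - U * q ≠ 0 := fun h0 => h.hUV (by
    refine mul_q_mem_UpsilonSet hq0 ⟨0, ?_⟩
    simp only [zpow_zero]; rw [sub_eq_zero.1 h0]; field_simp)
  rw [qPochInf_step hq1 (β * U), qPochInf_step hq1 (U / β), qPochInf_step hq1 (q * U / V),
    show q * V / (U * q) = V / U by field_simp, qPochInf_step hq1 (V / U),
    show V / U * q = q * V / U by ring, show q * U / V * q = q * (U * q) / V by ring,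
    show β * U * q = β * (U * q) by ring, show U / β * q = U * q / β by ring]
  have e1 : (1 - V / U) = (U - V) / U := by field_simp
  have e2 : (1 - q * U / V) = (V - U * q) / V := by field_simp
  rw [e1, e2, show U * q - V = -(V - U * q) by ring]
  generalize U - V = D at *
  generalize V - U * q = E at *
  generalize 1 - β * U = F at *
  generalize 1 - U / β = G at *
  field_simp

/-- The factor (qX/U;q)_∞ vanishes at X = Uq^{-1}, Uq^{-2}, …. This lets the starting point of a
Jackson sum be moved along its chain. -/
theorem clausenKernel_eq_zero (hq0 : q ≠ 0) (hq1 : ‖q‖ < 1) {X : ℂ} (k : ℕ)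
    (h : q * X / U * q ^ k = 1) : clausenKernel q p β U V X = 0 := by
  unfold clausenKernel
  rw [qPochInf_eq_zero hq0 hq1 ((mem_OmegaSet_iff hq0).2 ⟨k, h⟩)]
  simp

/-- Subtract `jackson_chain` at x = V from that at x = U. The integral for Uqⁿ starts at Uqⁿ rather
than at U, but the kernel for Uqⁿ vanishes at U, …, Uq^{n-1}, so the two sums agree. -/
theorem clausenRec_integral (hpq : p ^ 2 = q) (hp : p ≠ 0) (hq1 : ‖q‖ < 1)
    (h : ClausenGeneric q β U V) : ClausenRec q p β U V fun u => clausenIntegral q p β u V := by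
  have hq0 : q ≠ 0 := by rw [← hpq]; exact pow_ne_zero 2 hp
  have hU := h.hU
  have c1 := jackson_chain hpq hp hq1 h h.βU h.Uβ h.UU (by rw [← sq]; exact h.UU) (Or.inl rfl)
  have c2 := jackson_chain hpq hp hq1 h h.βV h.Vβ h.VV h.UV (Or.inr rfl)
  have step : ∀ (n : ℂ) (x : ℂ) (k : ℕ), q * x / n * q ^ k = 1 →
      jacksonSum q (clausenKernel q p β n V) x =
        jacksonSum q (clausenKernel q p β n V) (x * q) := fun n x k hk => by
    rw [jacksonSum_step hq1 (tendsto_clausenKernel hq1 x), clausenKernel_eq_zero hq0 hq1 k hk]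
    simp
  have s1 : jacksonSum q (clausenKernel q p β (U * q) V) U =
      jacksonSum q (clausenKernel q p β (U * q) V) (U * q) := by
    rw [step _ U 0 (by field_simp)]
  have s2 : jacksonSum q (clausenKernel q p β (U * q * q) V) U =
      jacksonSum q (clausenKernel q p β (U * q * q) V) (U * q * q) := by
    rw [step _ U 1 (by field_simp), step _ (U * q) 0 (by field_simp)]
  have s3 : jacksonSum q (clausenKernel q p β (U * q * q * q) V) U =
      jacksonSum q (clausenKernel q p β (U * q * q * q) V) (U * q * q * q) := by
    rw [step _ U 2 (by field_simp), step _ (U * q) 1 (by field_simp),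
      step _ (U * q * q) 0 (by field_simp)]
  rw [s1, s2, s3] at c1
  unfold ClausenRec clausenIntegral
  beta_reduce
  rw [clausenConst_shift hq0 hq1 ((h.mul_q hq0).mul_q hq0), clausenConst_shift hq0 hq1 (h.mul_q hq0),
    clausenConst_shift hq0 hq1 h]
  linear_combination clausenConst q β U V * (c1 - c2)

end TwoTerm

/-! ### Null solutions of an asymptotically constant recurrence. -/

section Uniqueness

/-- Iterating w_n = (w_n - c w_{n+1}) + c w_{n+1} gives a geometric series in ‖c‖, with a remainder
‖c‖^j B that tends to 0 since w is bounded. -/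
theorem norm_le_of_norm_sub_mul_le {w : ℕ → ℂ} {c : ℂ} {ε B : ℝ} (hc : ‖c‖ < 1)
    (hB : ∀ n, ‖w n‖ ≤ B) (h : ∀ n, ‖w n - c * w (n + 1)‖ ≤ ε) (n : ℕ) :
    ‖w n‖ ≤ ε / (1 - ‖c‖) := by
  have h1 : 0 < 1 - ‖c‖ := by linarith
  have hε : 0 ≤ ε := (norm_nonneg _).trans (h 0)
  have key : ∀ j n, ‖w n‖ ≤ ε / (1 - ‖c‖) + ‖c‖ ^ j * B := by
    intro j
    induction j with
    | zero => 
      intro n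
      have := hB n
      have h2 : 0 ≤ ε / (1 - ‖c‖) := by positivity
      simp only [pow_zero, one_mul]; linarith
    | succ j ih =>
      intro n
      calc ‖w n‖ = ‖(w n - c * w (n + 1)) + c * w (n + 1)‖ := by rw [sub_add_cancel]
        _ ≤ ε + ‖c‖ * ‖w (n + 1)‖ := by
          refine (norm_add_le _ _).trans ?_
          rw [norm_mul]; gcongr; exact h n
        _ ≤ ε + ‖c‖ * (ε / (1 - ‖c‖) + ‖c‖ ^ j * B) := by gcongr; exact ih _
        _ = ε / (1 - ‖c‖) + ‖c‖ ^ (j + 1) * B := by field_simp; ring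
  have hl : Tendsto (fun j : ℕ => ε / (1 - ‖c‖) + ‖c‖ ^ j * B) atTop (𝓝 (ε / (1 - ‖c‖) + 0 * B)) :=
    ((tendsto_pow_atTop_nhds_zero_of_lt_one (norm_nonneg c) hc).mul_const B).const_add _
  have := ge_of_tendsto' hl fun j => key j n
  simpa using this

/-- A null sequence satisfying a perturbation of the backward recurrence with characteristic roots
`1, e, e²`, `|e| < 1`, vanishes. -/
theorem eq_zero_of_recurrence {d A B C : ℕ → ℂ} {e : ℂ} {r : ℝ} (he : ‖e‖ < 1) (hr0 : 0 ≤ r)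
    (hr : r < 1) (hA : (fun n => A n - (1 + e + e ^ 2)) =O[atTop] fun n => r ^ n)
    (hB : (fun n => B n - (e + e ^ 2 + e ^ 3)) =O[atTop] fun n => r ^ n)
    (hC : (fun n => C n - e ^ 3) =O[atTop] fun n => r ^ n)
    (hd : ∀ n, d n = A n * d (n + 1) - B n * d (n + 2) + C n * d (n + 3))
    (hlim : Tendsto d atTop (𝓝 0)) (n : ℕ) : d n = 0 := by
  obtain ⟨K, hK, hA⟩ := hA.exists_pos
  obtain ⟨K', hK', hB⟩ := hB.exists_pos
  obtain ⟨K'', hK'', hC⟩ := hC.exists_pos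
  set L := K + K' + K'' with hL
  have h1e : 0 < 1 - ‖e‖ := by linarith
  have he2 : ‖e ^ 2‖ < 1 := by rw [norm_pow]; exact pow_lt_one₀ (norm_nonneg _) he two_ne_zero
  have h1e2 : 0 < 1 - ‖e ^ 2‖ := by linarith
  have h1r : 0 < 1 - r := by linarith
  -- The three divisions come from inverting 1-S, 1-e²S and 1-eS one after another, S being the
  -- shift.
  have hsmall : ∀ᶠ n : ℕ in atTop,
      L * r ^ n / (1 - r) / (1 - ‖e ^ 2‖) / (1 - ‖e‖) < 1 / 2 := by
    have : Tendsto (fun n : ℕ => L * r ^ n / (1 - r) / (1 - ‖e ^ 2‖) / (1 - ‖e‖)) atTop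
        (𝓝 (L * 0 / (1 - r) / (1 - ‖e ^ 2‖) / (1 - ‖e‖))) :=
      ((((tendsto_pow_atTop_nhds_zero_of_lt_one hr0 hr).const_mul L).div_const _).div_const
        _).div_const _
    refine this.eventually_lt_const ?_
    simp
  obtain ⟨N, hN⟩ := eventually_atTop.1 (hsmall.and ((hA.bound.and hB.bound).and hC.bound))
  obtain ⟨M, hM⟩ : ∃ M, ∀ n, ‖d n‖ ≤ M := by
    obtain ⟨M, hM⟩ := hlim.norm.bddAbove_range
    exact ⟨M, fun n => hM ⟨n, rfl⟩⟩
  -- The unperturbed operator is (1-S)(1-eS)(1-e²S). Here P = (1-eS)(1-e²S)d, so P_n - P_{n+1}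
  -- consists only of the perturbation.
  have hP : ∀ n, (d n - (e + e ^ 2) * d (n + 1) + e ^ 3 * d (n + 2)) -
      (d (n + 1) - (e + e ^ 2) * d (n + 2) + e ^ 3 * d (n + 3)) =
      (A n - (1 + e + e ^ 2)) * d (n + 1) - (B n - (e + e ^ 2 + e ^ 3)) * d (n + 2) +
        (C n - e ^ 3) * d (n + 3) := fun n => by
    rw [hd n]; ring
  -- A bound M for the tail feeds back through the small perturbation and returns as M/2. Iterating
  -- forces the tail to be zero.
  have halve : ∀ M : ℝ, (∀ n ≥ N, ‖d n‖ ≤ M) → ∀ n ≥ N, ‖d n‖ ≤ M / 2 := by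
    intro M hM
    have hM0 : 0 ≤ M := (norm_nonneg _).trans (hM N le_rfl)
    set P : ℕ → ℂ := fun n =>
      d (N + n) - (e + e ^ 2) * d (N + n + 1) + e ^ 3 * d (N + n + 2) with hPdef
    have hPlim : Tendsto P atTop (𝓝 0) := by
      have hs : ∀ k : ℕ, Tendsto (fun n => d (N + n + k)) atTop (𝓝 0) := fun k => by
        refine hlim.comp ?_
        exact tendsto_atTop_mono (fun n => by simp only [id]; omega) tendsto_id
      have := ((hs 0).sub ((hs 1).const_mul (e + e ^ 2))).add ((hs 2).const_mul (e ^ 3))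
      simpa using this
    have hPd : ∀ n, dist (P n) (P (n + 1)) ≤ L * r ^ N * M * r ^ n := by
      intro n
      rw [dist_eq_norm]
      have e1 : P n - P (n + 1) = _ := hP (N + n)
      obtain ⟨-, ⟨h1, h2⟩, h3⟩ := hN (N + n) (by omega)
      rw [Real.norm_of_nonneg (pow_nonneg hr0 _)] at h1 h2 h3
      rw [e1]
      calc _ ≤ ‖(A (N + n) - (1 + e + e ^ 2)) * d (N + n + 1)‖ +
            ‖(B (N + n) - (e + e ^ 2 + e ^ 3)) * d (N + n + 2)‖ +
            ‖(C (N + n) - e ^ 3) * d (N + n + 3)‖ :=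
            (norm_add_le _ _).trans (add_le_add_left (norm_sub_le _ _) _)
        _ ≤ K * r ^ (N + n) * M + K' * r ^ (N + n) * M + K'' * r ^ (N + n) * M := by
            simp only [norm_mul]
            gcongr <;> exact hM _ (by omega)
        _ = _ := by rw [hL, pow_add]; ring
    have hPb : ∀ n, ‖P n‖ ≤ L * r ^ N * M / (1 - r) := by
      intro n
      have := dist_le_of_le_geometric_of_tendsto r (L * r ^ N * M) hr hPd hPlim n
      rw [dist_zero_right] at this
      refine this.trans (div_le_div_of_nonneg_right ?_ h1r.le)
      exact mul_le_of_le_one_right (by positivity) (pow_le_one₀ hr0 hr.le)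
    -- With w = (1-eS)d one has P = w - e²Sw, so the bound for P passes to w, and afterwards from w
    -- to d.
    have hwb : ∀ n, ‖d (N + n) - e * d (N + n + 1)‖ ≤
        L * r ^ N * M / (1 - r) / (1 - ‖e ^ 2‖) := by
      refine norm_le_of_norm_sub_mul_le (c := e ^ 2) (B := M + ‖e‖ * M)
        (w := fun n => d (N + n) - e * d (N + n + 1)) he2 (fun n => ?_) (fun n => ?_)
      · refine (norm_sub_le _ _).trans ?_
        rw [norm_mul]
        gcongr <;> exact hM _ (by omega)
      · convert! hPb n using 2
        simp only [hPdef, ← add_assoc]; ring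
    have hdb := norm_le_of_norm_sub_mul_le (w := fun n => d (N + n)) he
      (fun n => hM _ (by omega)) hwb
    intro n hn
    obtain ⟨k, rfl⟩ := Nat.exists_eq_add_of_le hn
    refine (hdb k).trans ?_
    have h2 := (hN N le_rfl).1
    calc L * r ^ N * M / (1 - r) / (1 - ‖e ^ 2‖) / (1 - ‖e‖)
        = (L * r ^ N / (1 - r) / (1 - ‖e ^ 2‖) / (1 - ‖e‖)) * M := by ring
      _ ≤ 1 / 2 * M := by gcongr
      _ = M / 2 := by ring
  have hzero : ∀ n ≥ N, d n = 0 := by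
    have hj : ∀ j : ℕ, ∀ n ≥ N, ‖d n‖ ≤ M / 2 ^ j := by
      intro j
      induction j with
      | zero => intro n _; simpa using hM n
      | succ j ih => intro n hn; have := halve _ ih n hn; rwa [div_div, ← pow_succ] at this
    intro n hn
    have hl : Tendsto (fun j : ℕ => M / 2 ^ j) atTop (𝓝 0) := by
      have := (tendsto_pow_atTop_nhds_zero_of_lt_one (r := (1 / 2 : ℝ)) (by norm_num)
        (by norm_num)).const_mul M
      simpa [div_eq_mul_inv] using this
    exact norm_le_zero_iff.1 (ge_of_tendsto' hl fun j => hj j n hn)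
  -- The recurrence expresses each term by the next three, so vanishing propagates backwards from
  -- the tail.
  have hback : ∀ j : ℕ, ∀ n, N ≤ n + j → d n = 0 := by
    intro j
    induction j with
    | zero => intro n hn; exact hzero n (by omega)
    | succ j ih =>
      intro n hn
      rw [hd n, ih (n + 1) (by omega), ih (n + 2) (by omega), ih (n + 3) (by omega)]
      simp
  exact hback N n (by omega)

end Uniqueness

/-! ### Limits of both sides as U is replaced by Uqⁿ. -/

section TwoTermLimit

variable {q p β U V : ℂ}

/-- Along `Y q^{-n}` the inverse shifted factorials are eventually uniformly bounded. -/
theorem exists_norm_inv_qPoch_le (hq0 : q ≠ 0) (hq1 : ‖q‖ < 1) {Y : ℂ} (hY0 : Y ≠ 0)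
    (hY : Y ∉ UpsilonSet q) :
    ∃ C : ℝ, ∀ᶠ n : ℕ in atTop, ∀ k, ‖(qPoch (Y * (q ^ n)⁻¹) q k)⁻¹‖ ≤ C := by
  have hqn : Tendsto (fun n : ℕ => ‖q ^ n‖) atTop (𝓝 0) := by
    simpa using (tendsto_pow_atTop_nhds_zero_of_norm_lt_one hq1).norm
  -- Once ‖Yq^{-n}‖ ≥ 2, the factor 1-Yq^{-n} has norm at least 1. Passing from n to n+1 prepends
  -- such a factor, so the bound for the inverses is inherited.
  have hsm : ∀ᶠ n : ℕ in atTop, 2 ≤ ‖Y * (q ^ n)⁻¹‖ := by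
    filter_upwards [hqn.eventually_lt_const (half_pos (norm_pos_iff.2 hY0))] with n hn
    have : 0 < ‖q ^ n‖ := norm_pos_iff.2 (pow_ne_zero n hq0)
    rw [norm_mul, norm_inv, ← div_eq_mul_inv, le_div_iff₀ this]
    linarith
  obtain ⟨N, hN⟩ := eventually_atTop.1 hsm
  have hYN : ∀ n : ℕ, Y * (q ^ n)⁻¹ ∉ OmegaSet q := fun n h => hY (by
    refine zpow_mul_mem_UpsilonSet hq0 (-(n : ℤ)) ?_
    rw [zpow_neg, zpow_natCast, mul_comm]
    exact mem_UpsilonSet_of_mem_OmegaSet h)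
  refine ⟨max 1 (Real.exp (‖Y * (q ^ N)⁻¹‖ * (1 - ‖q‖)⁻¹) * ‖qPochInf (Y * (q ^ N)⁻¹) q‖⁻¹),
    eventually_atTop.2 ⟨N, fun n hn => ?_⟩⟩
  induction n, hn using Nat.le_induction with
  | base => exact fun k => (norm_inv_qPoch_le hq0 hq1 le_rfl (hYN N) k).trans (le_max_right _ _)
  | succ n hn ih =>
    intro k
    cases k with
    | zero => simp [qPoch_zero]
    | succ k =>
      have e : Y * (q ^ (n + 1))⁻¹ * q = Y * (q ^ n)⁻¹ := by rw [pow_succ]; field_simp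
      rw [qPoch_succ', e, mul_inv, norm_mul]
      have h1 : 1 ≤ ‖1 - Y * (q ^ (n + 1))⁻¹‖ := by
        have := norm_sub_norm_le (Y * (q ^ (n + 1))⁻¹) 1
        rw [norm_sub_rev, norm_one] at this
        linarith [hN (n + 1) (by omega)]
      rw [norm_inv]
      calc _ ≤ 1 * ‖(qPoch (Y * (q ^ n)⁻¹) q k)⁻¹‖ := by
            gcongr; exact inv_le_one_of_one_le₀ h1
        _ ≤ _ := by rw [one_mul]; exact ih k

theorem norm_inv_qPochInf_le_of_forall (hq1 : ‖q‖ < 1) {a : ℂ} {C : ℝ} (ha : qPochInf a q ≠ 0)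
    (h : ∀ k, ‖(qPoch a q k)⁻¹‖ ≤ C) : ‖(qPochInf a q)⁻¹‖ ≤ C :=
  le_of_tendsto' ((tendsto_qPoch hq1 a).inv₀ ha).norm h

theorem exists_norm_qPochInf_le_two (hq1 : ‖q‖ < 1) :
    ∃ δ > 0, ∀ a : ℂ, ‖a‖ < δ → ‖qPochInf a q‖ ≤ 2 ∧ ‖(qPochInf a q)⁻¹‖ ≤ 2 := by
  have h := (continuous_qPochInf hq1).continuousAt (x := 0)
  have h1 : Tendsto (fun a => ‖qPochInf a q‖) (𝓝 0) (𝓝 1) := by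
    simpa [ContinuousAt, qPochInf_zero] using h.norm
  have h2 : Tendsto (fun a => ‖(qPochInf a q)⁻¹‖) (𝓝 0) (𝓝 1) := by
    have := (h.inv₀ (by simp [qPochInf_zero])).norm
    simpa [ContinuousAt, qPochInf_zero] using this
  obtain ⟨δ, hδ, h⟩ := Metric.eventually_nhds_iff.1
    ((h1.eventually_le_const one_lt_two).and (h2.eventually_le_const one_lt_two))
  exact ⟨δ, hδ, fun a ha => h (by simpa using ha)⟩

/-- With u = Uqⁿ the kernel is bounded uniformly along the chain uq^k, so the sum is O(‖u‖). The
coefficients C n stand for the inverse products in the constant. -/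
theorem tendsto_jacksonSum_left (hq0 : q ≠ 0) (hq1 : ‖q‖ < 1) (hU : U ≠ 0) {C : ℕ → ℂ} {K : ℝ}
    (hC : ∀ᶠ n in atTop, ‖C n‖ ≤ K) :
    Tendsto (fun n : ℕ => C n *
      jacksonSum q (clausenKernel q p β (U * q ^ n) V) (U * q ^ n)) atTop (𝓝 0) := by
  obtain ⟨δ, hδ, hb⟩ := exists_norm_qPochInf_le_two hq1
  have hu : Tendsto (fun n : ℕ => U * q ^ n) atTop (𝓝 0) := tendsto_mul_pow_zero hq1 U
  have hsm : ∀ f : ℂ → ℂ, Continuous f → f 0 = 0 → ∀ᶠ n : ℕ in atTop, ‖f (U * q ^ n)‖ < δ := by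
    intro f hf h0
    have := ((hf.tendsto 0).comp hu).norm
    rw [h0, norm_zero] at this
    exact this.eventually_lt_const hδ
  set E := Real.exp (1 * (1 - ‖q‖)⁻¹)
  set B : ℝ := E * 2 * 2 * 2 * 2 ^ 2 * (2 * 2 * 2)
  have hB : 0 ≤ B := by positivity
  have hlim : Tendsto (fun n : ℕ => K * (‖U * q ^ n‖ * B * (1 - ‖q‖)⁻¹)) atTop (𝓝 0) := by
    simpa using (((hu.norm.mul_const B).mul_const (1 - ‖q‖)⁻¹).const_mul K)
  refine squeeze_zero_norm' ?_ hlim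
  filter_upwards [hC, hsm (fun u => q * u / V) (by fun_prop) (by simp),
    hsm (fun u => u * u) (by fun_prop) (by simp), hsm (fun u => V * u) (by fun_prop) (by simp),
    hsm (fun u => p * u) (by fun_prop) (by simp), hsm (fun u => β * u) (by fun_prop) (by simp),
    hsm (fun u => u / β) (by fun_prop) (by simp), hsm (fun u => u ^ 2) (by fun_prop) (by simp)]
    with n h0 h1 h2 h3 h4 h5 h6 h7
  have hne : U * q ^ n ≠ 0 := mul_ne_zero hU (pow_ne_zero n hq0)
  rw [norm_mul]
  refine mul_le_mul h0 ?_ (norm_nonneg _) ((norm_nonneg _).trans h0)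
  generalize U * q ^ n = u at *
  have hgeo := (hasSum_geometric_of_lt_one (norm_nonneg q) hq1).mul_left (‖u‖ * B)
  refine tsum_of_norm_bounded hgeo fun k => ?_
  have hk : ∀ x : ℂ, ‖x‖ < δ → ‖x * q ^ k‖ < δ := fun x hx => by
    rw [norm_mul, norm_pow]
    exact (mul_le_of_le_one_right (norm_nonneg _) (pow_le_one₀ (norm_nonneg _) hq1.le)).trans_lt hx
  suffices hW : ‖clausenKernel q p β u V (u * q ^ k)‖ ≤ B by
    rw [norm_mul, norm_mul, norm_pow, mul_right_comm]
    gcongr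
  unfold clausenKernel
  rw [div_eq_mul_inv, mul_inv, mul_inv]
  simp only [norm_mul, norm_pow]
  -- This argument does not depend on u. It is the only one that is not small, which is why its
  -- bound is E instead of 2.
  have e1 : q * (u * q ^ k) / u = q * q ^ k := by field_simp
  rw [e1]
  simp only [B]
  gcongr
  · refine norm_qPochInf_le hq1 ?_
    rw [← pow_succ', norm_pow]
    exact pow_le_one₀ (norm_nonneg _) hq1.le
  · refine (hb _ ?_).1; convert! hk _ h1 using 2; ring
  · refine (hb _ ?_).1; convert! hk _ h2 using 2; ring
  · refine (hb _ ?_).1; convert! hk _ h3 using 2; ring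
  · refine (hb _ ?_).1; convert! hk _ h4 using 2; ring
  · refine (hb _ ?_).2; convert! hk _ h5 using 2; ring
  · refine (hb _ ?_).2; convert! hk _ h6 using 2; ring
  · refine (hb _ ?_).2; convert! hk _ (hk _ h7) using 2; ring

/-- With Y = qV/U, dividing the factor (Yq^{-n}q^k;q)_∞ of the k-th summand by (Yq^{-n};q)_∞ leaves
1/(Yq^{-n};q)_k. This is 1 for k = 0 and tends to 0 for k ≥ 1, so by dominated convergence only the
first summand survives. -/
theorem tendsto_jacksonSum_right (hq0 : q ≠ 0) (hq1 : ‖q‖ < 1) (h : ClausenGeneric q β U V) :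
    Tendsto (fun n : ℕ => (qPochInf (q * V / U * (q ^ n)⁻¹) q)⁻¹ *
      jacksonSum q (clausenKernel q p β (U * q ^ n) V) V) atTop
      (𝓝 (V * (qPochInf q q * qPochInf (p * V) q ^ 2 /
        (qPochInf (β * V) q * qPochInf (V / β) q)))) := by
  have hU := h.hU
  have hV := h.hV
  set Y := q * V / U with hYdef
  have hY0 : Y ≠ 0 := div_ne_zero (mul_ne_zero hq0 hV) hU
  have hY : Y ∉ UpsilonSet q := fun h' => h.symm.hUV (by
    refine mul_q_mem_UpsilonSet hq0 ?_
    rwa [← mul_div_assoc])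
  obtain ⟨C, hC⟩ := exists_norm_inv_qPoch_le hq0 hq1 hY0 hY
  have hYN : ∀ n : ℕ, Y * (q ^ n)⁻¹ ∉ OmegaSet q := fun n h => hY (by
    refine zpow_mul_mem_UpsilonSet hq0 (-(n : ℤ)) ?_
    rw [zpow_neg, zpow_natCast, mul_comm]
    exact mem_UpsilonSet_of_mem_OmegaSet h)
  let Ψ : ℂ → ℂ := fun X => qPochInf (q * X / V) q * qPochInf (V * X) q * qPochInf (p * X) q ^ 2 /
    (qPochInf (β * X) q * qPochInf (X / β) q * qPochInf (X ^ 2) q)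
  have hx := tendsto_mul_pow_zero hq1 V
  have hΨ : Tendsto (fun k : ℕ => Ψ (V * q ^ k)) atTop (𝓝 1) := by
    have hc := continuous_qPochInf hq1
    have : ContinuousAt Ψ 0 := by
      refine ContinuousAt.div ?_ ?_ (by simp [qPochInf_zero]) <;>
        exact Continuous.continuousAt (by fun_prop)
    have := this.tendsto.comp hx
    simpa [Ψ, qPochInf_zero, Function.comp_def] using this
  obtain ⟨B, hB⟩ := hΨ.norm.bddAbove_range
  have hu : Tendsto (fun n : ℕ => U * q ^ n) atTop (𝓝 0) := tendsto_mul_pow_zero hq1 U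
  have huV : ∀ᶠ n : ℕ in atTop, ‖U * q ^ n * V‖ < 1 := by
    have := (hu.mul_const V).norm
    rw [zero_mul, norm_zero] at this
    exact this.eventually_lt_const one_pos
  set E := Real.exp (1 * (1 - ‖q‖)⁻¹)
  let f : ℕ → ℕ → ℂ := fun n k => V * q ^ k * ((qPoch (Y * (q ^ n)⁻¹) q k)⁻¹ *
    qPochInf (U * q ^ n * (V * q ^ k)) q * Ψ (V * q ^ k))
  have hf : ∀ n, (qPochInf (Y * (q ^ n)⁻¹) q)⁻¹ *
      jacksonSum q (clausenKernel q p β (U * q ^ n) V) V = ∑' k, f n k := by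
    intro n
    unfold jacksonSum
    rw [← tsum_mul_left]
    refine tsum_congr fun k => ?_
    have h1 := qPochInf_eq_qPoch_mul hq1 (Y * (q ^ n)⁻¹) k
    have h2 : q * (V * q ^ k) / (U * q ^ n) = Y * (q ^ n)⁻¹ * q ^ k := by
      rw [hYdef]; field_simp
    have h3 := qPochInf_ne_zero hq0 hq1 (mul_pow_notMem_OmegaSet hq0 (hYN n) k)
    simp only [f, Ψ, clausenKernel]
    rw [h1, h2, mul_inv]
    generalize qPochInf (Y * (q ^ n)⁻¹ * q ^ k) q = A at *
    generalize qPochInf (β * (V * q ^ k)) q * qPochInf (V * q ^ k / β) q *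
      qPochInf ((V * q ^ k) ^ 2) q = D
    generalize (qPoch (Y * (q ^ n)⁻¹) q k)⁻¹ = R
    generalize qPochInf (U * q ^ n * (V * q ^ k)) q = T
    generalize qPochInf (q * (V * q ^ k) / V) q = T'
    generalize qPochInf (V * (V * q ^ k)) q = T''
    rw [div_eq_mul_inv, div_eq_mul_inv]
    linear_combination (V * q ^ k * R * T * T' * T'' * qPochInf (p * (V * q ^ k)) q ^ 2 * D⁻¹) *
      inv_mul_cancel₀ h3
  simp_rw [hf]
  -- At X = V the factor (VX;q)_∞ cancels (X²;q)_∞.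
  have hg : V * (qPochInf q q * qPochInf (p * V) q ^ 2 /
      (qPochInf (β * V) q * qPochInf (V / β) q)) =
      ∑' k : ℕ, if k = 0 then V * Ψ V else 0 := by
    rw [tsum_ite_eq]
    have h1 := qPochInf_ne_zero hq0 hq1 h.VV
    simp only [Ψ]
    rw [mul_div_cancel_right₀ q hV, ← sq]
    congr 1
    rw [mul_right_comm, mul_div_mul_right _ _ h1]
  rw [hg]
  refine tendsto_tsum_of_dominated_convergence (bound := fun k => ‖V‖ * (C * E * B) * ‖q‖ ^ k)
    ((summable_geometric_of_lt_one (norm_nonneg _) hq1).mul_left _) (fun k => ?_) ?_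
  · have hinf : Tendsto (fun n : ℕ => qPochInf (U * q ^ n * (V * q ^ k)) q) atTop (𝓝 1) := by
      have := ((continuous_qPochInf hq1).tendsto 0).comp
        (by simpa using hu.mul_const (V * q ^ k) :
          Tendsto (fun n : ℕ => U * q ^ n * (V * q ^ k)) atTop (𝓝 0))
      simpa [qPochInf_zero, Function.comp_def] using this
    cases k with
    | zero =>
      simp only [pow_zero, mul_one] at hinf
      simpa [f, qPoch_zero] using (hinf.mul_const (Ψ V)).const_mul V
    | succ k =>
      simp only [Nat.succ_ne_zero, if_false]
      have hfac : Tendsto (fun n : ℕ => (1 - Y * (q ^ n)⁻¹)⁻¹) atTop (𝓝 0) := by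
        have hqn := tendsto_pow_atTop_nhds_zero_of_norm_lt_one hq1
        have h1 : Tendsto (fun n : ℕ => q ^ n / (q ^ n - Y)) atTop (𝓝 (0 / (0 - Y))) :=
          hqn.div (hqn.sub_const Y) (by simpa using hY0)
        rw [zero_div] at h1
        refine h1.congr fun n => ?_
        have : q ^ n ≠ 0 := pow_ne_zero n hq0
        have e : 1 - Y * (q ^ n)⁻¹ = (q ^ n - Y) / q ^ n := by field_simp
        rw [e, inv_div]
      have hz : Tendsto (fun n : ℕ => (qPoch (Y * (q ^ n)⁻¹) q (k + 1))⁻¹) atTop (𝓝 0) := by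
        -- The leading factor 1/(1-Yq^{-n-1}) tends to 0, and the remaining factors form
        -- 1/(Yq^{-n};q)_k, which is bounded by C.
        have hbd : Tendsto (fun n : ℕ => ‖(1 - Y * (q ^ (n + 1))⁻¹)⁻¹‖ * C) atTop (𝓝 0) := by
          simpa using ((hfac.comp (tendsto_add_atTop_nat 1)).norm.mul_const C)
        refine (tendsto_add_atTop_iff_nat 1).1 (squeeze_zero_norm' ?_ hbd)
        filter_upwards [hC] with n hn
        have e : Y * (q ^ (n + 1))⁻¹ * q = Y * (q ^ n)⁻¹ := by rw [pow_succ]; field_simp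
        rw [qPoch_succ', e, mul_inv, norm_mul]
        gcongr
        exact hn k
      have := ((hz.mul hinf).mul_const (Ψ (V * q ^ (k + 1)))).const_mul (V * q ^ (k + 1))
      simpa [f] using this
  · filter_upwards [hC, huV] with n hn hn' k
    simp only [f]
    have hΨk : ‖Ψ (V * q ^ k)‖ ≤ B := hB ⟨k, rfl⟩
    have hE : ‖qPochInf (U * q ^ n * (V * q ^ k)) q‖ ≤ E := by
      refine norm_qPochInf_le hq1 ?_
      rw [← mul_assoc]
      exact (norm_mul_pow_lt_one hq1 hn' k).le
    calc _ = ‖V‖ * (‖(qPoch (Y * (q ^ n)⁻¹) q k)⁻¹‖ * ‖qPochInf (U * q ^ n * (V * q ^ k)) q‖ *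
            ‖Ψ (V * q ^ k)‖) * ‖q‖ ^ k := by
          rw [norm_mul, norm_mul, norm_mul, norm_mul, norm_pow]; ring
      _ ≤ ‖V‖ * (C * E * B) * ‖q‖ ^ k := by
          have := (norm_nonneg _).trans (hn k)
          gcongr
          exact hn k

/-- The divergent product (Yq^{-n};q)_∞ in the denominator of the constant is assigned to the
Jackson sums: it kills the sum at U and normalizes the sum at V. What is left of the constant is
continuous at u = 0. -/
theorem tendsto_clausenIntegral (hq0 : q ≠ 0) (hq1 : ‖q‖ < 1) (h : ClausenGeneric q β U V) :
    Tendsto (fun n : ℕ => clausenIntegral q p β (U * q ^ n) V) atTop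
      (𝓝 (qPochInf (p * V) q ^ 2)) := by
  have hU := h.hU
  have hV := h.hV
  set Y := q * V / U with hYdef
  have hY0 : Y ≠ 0 := div_ne_zero (mul_ne_zero hq0 hV) hU
  have hY : Y ∉ UpsilonSet q := fun h' => h.symm.hUV (by
    refine mul_q_mem_UpsilonSet hq0 ?_
    rwa [← mul_div_assoc])
  obtain ⟨C, hC⟩ := exists_norm_inv_qPoch_le hq0 hq1 hY0 hY
  have hYN : ∀ n : ℕ, Y * (q ^ n)⁻¹ ∉ OmegaSet q := fun n h => hY (by
    refine zpow_mul_mem_UpsilonSet hq0 (-(n : ℤ)) ?_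
    rw [zpow_neg, zpow_natCast, mul_comm]
    exact mem_UpsilonSet_of_mem_OmegaSet h)
  have hK : ∀ᶠ n : ℕ in atTop, ‖(qPochInf (Y * (q ^ n)⁻¹) q)⁻¹‖ ≤ C := hC.mono fun n hn =>
    norm_inv_qPochInf_le_of_forall hq1 (qPochInf_ne_zero hq0 hq1 (hYN n)) hn
  have hu : Tendsto (fun n : ℕ => U * q ^ n) atTop (𝓝 0) := tendsto_mul_pow_zero hq1 U
  let P : ℂ → ℂ := fun u => qPochInf (β * u) q * qPochInf (u / β) q * qPochInf (β * V) q *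
    qPochInf (V / β) q / (qPochInf q q * (u - V) * qPochInf (q * u / V) q)
  have hqq := qPochInf_ne_zero_of_norm_lt_one hq0 hq1 hq1
  have hc := continuous_qPochInf hq1
  have hP : Tendsto (fun n : ℕ => P (U * q ^ n)) atTop (𝓝 (P 0)) := by
    have : ContinuousAt P 0 := by
      refine ContinuousAt.div ?_ ?_ (by simp [qPochInf_zero, hqq, hV]) <;>
        exact Continuous.continuousAt (by fun_prop)
    exact this.tendsto.comp hu
  have hl := hP.mul ((tendsto_jacksonSum_left (p := p) (β := β) (V := V) hq0 hq1 hU hK).sub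
    (tendsto_jacksonSum_right (p := p) hq0 hq1 h))
  convert! hl using 1
  · funext n
    have e : q * V / (U * q ^ n) = Y * (q ^ n)⁻¹ := by rw [hYdef]; field_simp
    have hconst : clausenConst q β (U * q ^ n) V =
        P (U * q ^ n) * (qPochInf (Y * (q ^ n)⁻¹) q)⁻¹ := by
      unfold clausenConst
      simp only [P]
      rw [e]
      generalize qPochInf (Y * (q ^ n)⁻¹) q = A
      generalize qPochInf (q * (U * q ^ n) / V) q = B
      generalize U * q ^ n - V = D
      ring
    unfold clausenIntegral
    rw [hconst]
    ring
  · have h1 := qPochInf_ne_zero hq0 hq1 h.βV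
    have h2 := qPochInf_ne_zero hq0 hq1 h.Vβ
    simp only [P, mul_zero, zero_div, qPochInf_zero, zero_sub, one_mul, mul_one]
    congr 1
    generalize qPochInf (β * V) q = A at *
    generalize qPochInf (V / β) q = B at *
    field_simp

theorem tendsto_clausenSeries (hq0 : q ≠ 0) (hq1 : ‖q‖ < 1) (hc : p * V ∉ OmegaSet q) :
    Tendsto (fun n : ℕ => clausenSeries q p β (U * q ^ n) V) atTop (𝓝 (qPochInf (p * V) q)) := by
  have h1 : ContinuousAt (fun u : ℂ => qHyp [β * V, β * p] [p * V] q (u / β)) 0 :=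
    continuousAt_qHyp hq0 hq1 [fun _ => β * V, fun _ => β * p] [fun _ => p * V] (fun u => u / β) rfl
      (by simp [continuousAt_const]) (by simp [continuousAt_const]) (by simpa using hc)
      (by fun_prop) (by simp)
  have h2 : ContinuousAt (fun u => clausenSeries q p β u V) 0 := by
    have hq := continuous_qPochInf hq1
    have : ContinuousAt (fun u : ℂ => qPochInf (u / β) q * qPochInf (p * V) q) 0 :=
      Continuous.continuousAt (by fun_prop)
    exact this.mul h1
  have := h2.tendsto.comp (tendsto_mul_pow_zero hq1 U)
  simpa [clausenSeries, qPochInf_zero, qHyp_zero, Function.comp_def] using this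

end TwoTermLimit

/-! ### The square as a Jackson integral. -/

section TwoTermFormula

variable {q p β U V : ℂ}

/-- 1-pUqⁿ divides 1-U²q^{2n+1}. -/
theorem cM_mul_pow_ne_zero (hpq : p ^ 2 = q) (hp : p ≠ 0) (hUU : U ^ 2 ∉ OmegaSet q) (n : ℕ) :
    cM p (U * q ^ n) ≠ 0 := by
  have hq0 : q ≠ 0 := by rw [← hpq]; exact pow_ne_zero 2 hp
  intro h
  refine one_sub_mul_pow_ne_zero hq0 hUU (2 * n + 1) ?_
  unfold cM at h
  have e : q ^ (2 * n + 1) = (q ^ n) ^ 2 * p ^ 2 := by rw [hpq]; ring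
  rw [e]
  linear_combination (1 + p * (U * q ^ n)) * h

theorem isBigO_comp_mul_pow (hq1 : ‖q‖ < 1) {f : ℂ → ℂ} (hf : DifferentiableAt ℂ f 0) :
    (fun n : ℕ => f (U * q ^ n) - f 0) =O[atTop] fun n => ‖q‖ ^ n := by
  have h := hf.isBigO_sub.comp_tendsto (tendsto_mul_pow_zero hq1 U)
  refine (h.trans ?_)
  refine Asymptotics.IsBigO.of_bound ‖U‖ (Eventually.of_forall fun n => ?_)
  simp

/-- Divide the recurrence by its leading coefficient. At u = 0, with e = V/p, one has M = 1, E = e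
and Γ = (1+e)²-e = 1+e+e², so the limiting coefficients are 1+e+e², e+e²+e³ and e³. By
differentiability they are approached at rate ‖q‖ⁿ. Both sides have the limit (pV;q)_∞², so their
difference is a null sequence. -/
theorem clausenSeries_sq_of_norm_lt (hpq : p ^ 2 = q) (hp : p ≠ 0) (hq1 : ‖q‖ < 1)
    (h : ClausenGeneric q β U V) (hz : ‖U / β‖ < 1) (hc : p * V ∉ OmegaSet q) (hVp : ‖V‖ < ‖p‖) :
    clausenSeries q p β U V ^ 2 = clausenIntegral q p β U V := by
  have hq0 : q ≠ 0 := by rw [← hpq]; exact pow_ne_zero 2 hp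
  have he : ‖V / p‖ < 1 := by
    rw [norm_div, div_lt_one (norm_pos_iff.2 hp)]; exact hVp
  have hz' : ∀ n : ℕ, ‖U * q ^ n / β‖ < 1 := fun n => by
    simpa [div_mul_eq_mul_div] using norm_mul_pow_lt_one hq1 hz n
  have key := eq_zero_of_recurrence
    (d := fun n => clausenSeries q p β (U * q ^ n) V ^ 2 - clausenIntegral q p β (U * q ^ n) V)
    (A := fun n => (fun u => cM p u * cΓ q p β u V / cM p (u * q)) (U * q ^ n))
    (B := fun n => (fun u => cE q p β u V * cΓ q p β u V) (U * q ^ n))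
    (C := fun n => (fun u => cE q p β u V * cE q p β (u * q) V ^ 2 * cM p u / cM p (u * q))
      (U * q ^ n)) he (norm_nonneg q) hq1 ?_ ?_ ?_ ?_ ?_ 0
  · simpa [sub_eq_zero] using key
  · convert! isBigO_comp_mul_pow (U := U) hq1
      (f := fun u => cM p u * cΓ q p β u V / cM p (u * q)) ?_ using 3
    · simp only [cM, cΓ, cE]; ring
    · simp only [cM, cΓ, cE]
      refine DifferentiableAt.div ?_ ?_ (by simp) <;> fun_prop
  · convert! isBigO_comp_mul_pow (U := U) hq1 (f := fun u => cE q p β u V * cΓ q p β u V) ?_ using 3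
    · simp only [cM, cΓ, cE]; ring
    · simp only [cM, cΓ, cE]; fun_prop
  · convert! isBigO_comp_mul_pow (U := U) hq1
      (f := fun u => cE q p β u V * cE q p β (u * q) V ^ 2 * cM p u / cM p (u * q)) ?_ using 3
    · simp only [cM, cE]; ring
    · simp only [cM, cE]
      refine DifferentiableAt.div ?_ ?_ (by simp) <;> fun_prop
  · intro n
    have h1 := clausenRec_series_left hpq hp hq1 h.hβ (hz' n) hc
    have h2 := clausenRec_integral hpq hp hq1 (h.mul_pow hq0 n)
    have hm : cM p (U * q ^ n * q) ≠ 0 := by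
      rw [mul_assoc, ← pow_succ]; exact cM_mul_pow_ne_zero hpq hp h.UU (n + 1)
    unfold ClausenRec at h1 h2
    beta_reduce at h1 h2 ⊢
    simp only [pow_succ, pow_zero, one_mul, ← mul_assoc]
    generalize U * q ^ n * q * q * q = u3 at *
    generalize U * q ^ n * q * q = u2 at *
    generalize U * q ^ n * q = u1 at *
    field_simp
    linear_combination h1 - h2
  · have h1 := (tendsto_clausenSeries (β := β) (U := U) hq0 hq1 hc).pow 2
    simpa using h1.sub (tendsto_clausenIntegral (p := p) hq0 hq1 h)

/-- The square of a well-poised `₂φ₁` as a two-term Jackson integral. -/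
theorem clausenSeries_sq (hpq : p ^ 2 = q) (hp : p ≠ 0) (hq1 : ‖q‖ < 1)
    (h : ClausenGeneric q β U V) (hz : ‖U / β‖ < 1) (hc : p * V ∉ OmegaSet q) :
    clausenSeries q p β U V ^ 2 = clausenIntegral q p β U V := by
  have hq0 : q ≠ 0 := by rw [← hpq]; exact pow_ne_zero 2 hp
  -- Induction on the number of q-shifts that bring V into the disc ‖V‖ < ‖p‖. The identity at Vq,
  -- Vq² and Vq³ gives it at V, because both sides satisfy the recurrence in V and its leading
  -- coefficient is nonzero.
  obtain ⟨N, hN⟩ : ∃ N : ℕ, ‖V * q ^ N‖ < ‖p‖ := by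
    have := (tendsto_mul_pow_zero hq1 V).norm
    rw [norm_zero] at this
    exact (this.eventually_lt_const (norm_pos_iff.2 hp)).exists
  induction N generalizing V with
  | zero => exact clausenSeries_sq_of_norm_lt hpq hp hq1 h hz hc (by simpa using hN)
  | succ N ih =>
    have hg := fun n => (h.symm.mul_pow hq0 n).symm
    have hcn : ∀ n : ℕ, p * (V * q ^ n) ∉ OmegaSet q := fun n => by
      rw [← mul_assoc]; exact mul_pow_notMem_OmegaSet hq0 hc n
    have key : ∀ n : ℕ, clausenSeries q p β U (V * q ^ (n + 1)) ^ 2 =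
        clausenIntegral q p β U (V * q ^ (n + 1)) := fun n => by
      refine ih (hg (n + 1)) (hcn (n + 1)) ?_
      refine lt_of_le_of_lt ?_ hN
      rw [mul_assoc, ← pow_add, norm_mul, norm_mul, norm_pow, norm_pow]
      exact mul_le_mul_of_nonneg_left
        (pow_le_pow_of_le_one (norm_nonneg _) hq1.le (by omega)) (norm_nonneg _)
    have h1 := clausenRec_series_right hpq hp hq1 h.hβ hz hc
    have h2 := clausenRec_integral hpq hp hq1 h.symm
    have hm : cM p (V * q) ≠ 0 := by simpa using cM_mul_pow_ne_zero hpq hp h.VV 1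
    have k1 := key 0
    have k2 := key 1
    have k3 := key 2
    simp only [clausenIntegral_symm (U := U)] at k1 k2 k3 ⊢
    unfold ClausenRec at h1 h2
    beta_reduce at h1 h2
    simp only [pow_succ, pow_zero, one_mul, ← mul_assoc, zero_add] at k1 k2 k3
    simp only [sq] at h1 ⊢
    rw [k1, k2, k3] at h1
    simp only [sq] at h2
    apply mul_left_cancel₀ hm
    linear_combination h1 - h2

end TwoTermFormula

/-! ### The residue theorem on annuli. -/

section Residues

open Complex Metric

theorem circleIntegral_inv_sub_of_lt {w : ℂ} {R : ℝ} (h : R < ‖w‖) (hR : 0 ≤ R) :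
    ∮ z in C(0, R), (z - w)⁻¹ = 0 := by
  have hne : ∀ z ∈ closedBall (0 : ℂ) R, z - w ≠ 0 := fun z hz h0 => by
    rw [mem_closedBall_zero_iff] at hz
    rw [sub_eq_zero.1 h0] at hz
    exact absurd hz (not_le.2 h)
  refine circleIntegral_eq_zero_of_differentiable_on_off_countable hR Set.countable_empty ?_ ?_
  · exact fun z hz => ((continuousAt_id.sub continuousAt_const).inv₀ (hne z hz)).continuousWithinAt
  · intro z hz
    exact (differentiableAt_id.sub_const w).inv (hne z (ball_subset_closedBall hz.1))

/-- The residue theorem for an annulus and finitely many simple poles. -/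
theorem circleIntegral_sub_eq_sum_residues {ι : Type*} (s : Finset ι) {x c : ι → ℂ}
    (hx : Function.Injective x) {f : ℂ → ℂ} {r R : ℝ} (hr : 0 < r) (hrR : r < R)
    (hs : ∀ i ∈ s, r < ‖x i‖ ∧ ‖x i‖ < R)
    (hd : ∀ X : ℂ, r ≤ ‖X‖ → ‖X‖ ≤ R → (∀ i ∈ s, X ≠ x i) → DifferentiableAt ℂ f X)
    (hres : ∀ i ∈ s, Tendsto (fun X => (X - x i) * f X) (𝓝[≠] x i) (𝓝 (c i))) :
    (∮ z in C(0, R), f z) = (∮ z in C(0, r), f z) + 2 * Real.pi * I * ∑ i ∈ s, c i := by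
  classical
  induction s using Finset.induction_on generalizing f with
  | empty =>
    simp only [Finset.sum_empty, mul_zero, add_zero]
    have hd' : ∀ X : ℂ, r ≤ ‖X‖ → ‖X‖ ≤ R → DifferentiableAt ℂ f X :=
      fun X h1 h2 => hd X h1 h2 (by simp)
    refine circleIntegral_eq_of_differentiable_on_annulus_off_countable hr hrR.le
      Set.countable_empty ?_ ?_
    · rintro z ⟨h1, h2⟩
      rw [mem_closedBall_zero_iff] at h1
      rw [mem_ball_zero_iff, not_lt] at h2
      exact (hd' z h2 h1).continuousAt.continuousWithinAt
    · rintro z ⟨⟨h1, h2⟩, -⟩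
      rw [mem_ball_zero_iff] at h1
      rw [mem_closedBall_zero_iff, not_le] at h2
      exact hd' z h2.le h1.le
  | insert j s hj ih =>
    obtain ⟨hj1, hj2⟩ := hs j (Finset.mem_insert_self _ _)
    have hxne : ∀ i ∈ s, x i ≠ x j := fun i hi h => hj (hx h ▸ hi)
    -- Subtracting the principal part at x_j makes that singularity removable; updating by the limit
    -- fills it in, and the induction hypothesis applies to the remaining poles.
    set f1 : ℂ → ℂ := fun X => f X - c j * (X - x j)⁻¹ with hf1
    set f2 := Function.update f1 (x j) (limUnder (𝓝[≠] x j) f1) with hf2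
    have hf21 : ∀ X, X ≠ x j → f2 X = f1 X := fun X hX => Function.update_of_ne hX _ _
    have hev : ∀ X, X ≠ x j → f2 =ᶠ[𝓝 X] f1 := fun X hX =>
      (isOpen_ne.mem_nhds hX : {Y | Y ≠ x j} ∈ 𝓝 X) |> fun h => by
        filter_upwards [h] with Y hY using hf21 Y hY
    have hf1d : ∀ X : ℂ, r ≤ ‖X‖ → ‖X‖ ≤ R → (∀ i ∈ s, X ≠ x i) → X ≠ x j →
        DifferentiableAt ℂ f1 X := by
      intro X h1 h2 h3 h4
      have h5 : X - x j ≠ 0 := sub_ne_zero.2 h4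
      have h6 : DifferentiableAt ℂ (fun X => c j * (X - x j)⁻¹) X := by
        fun_prop (disch := assumption)
      refine (hd X h1 h2 fun i hi => ?_).sub h6
      rcases Finset.mem_insert.1 hi with rfl | hi
      · exact h4
      · exact h3 i hi
    have hsum : (∮ z in C(0, R), f2 z) = (∮ z in C(0, r), f2 z) +
        2 * Real.pi * I * ∑ i ∈ s, c i := by
      refine ih (fun i hi => hs i (Finset.mem_insert_of_mem hi)) (fun X h1 h2 h3 => ?_)
        fun i hi => ?_
      · by_cases hX : X = x j
        · rw [hX]
          have ht : {X : ℂ | r < ‖X‖ ∧ ‖X‖ < R ∧ ∀ i ∈ s, X ≠ x i} ∈ 𝓝 (x j) := by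
            have h1 : ∀ᶠ X : ℂ in 𝓝 (x j), r < ‖X‖ :=
              continuous_norm.continuousAt.eventually_const_lt hj1
            have h2 : ∀ᶠ X : ℂ in 𝓝 (x j), ‖X‖ < R :=
              continuous_norm.continuousAt.eventually_lt_const hj2
            have h3 : ∀ᶠ X : ℂ in 𝓝 (x j), ∀ i ∈ s, X ≠ x i :=
              (Finset.eventually_all s).2 fun i hi => isOpen_ne.mem_nhds (hxne i hi).symm
            filter_upwards [h1, h2, h3] with X a b c using ⟨a, b, c⟩
          refine (differentiableOn_update_limUnder_of_isLittleO ht ?_ ?_).differentiableAt ht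
          · rintro X ⟨⟨a, b, c⟩, hX⟩
            exact (hf1d X a.le b.le c hX).differentiableWithinAt
          · refine Asymptotics.isLittleO_of_tendsto' ?_ ?_
            · filter_upwards [self_mem_nhdsWithin] with X hX h0
              exact absurd (inv_eq_zero.1 h0) (sub_ne_zero.2 hX)
            · have hid : Tendsto (fun X : ℂ => X - x j) (𝓝[≠] x j) (𝓝 0) := by
                have : Tendsto (fun X : ℂ => X - x j) (𝓝 (x j)) (𝓝 (x j - x j)) :=
                  tendsto_id.sub_const _
                rw [sub_self] at this
                exact this.mono_left nhdsWithin_le_nhds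
              have h := ((hres j (Finset.mem_insert_self _ _)).sub_const (c j)).sub
                (hid.mul_const (f1 (x j)))
              simp only [sub_self, zero_mul] at h
              refine h.congr' ?_
              filter_upwards [self_mem_nhdsWithin] with X hX
              have : X - x j ≠ 0 := sub_ne_zero.2 hX
              simp only [hf1, div_inv_eq_mul, sub_self, inv_zero, mul_zero, sub_zero]
              field_simp
        · exact (hf1d X h1 h2 h3 hX).congr_of_eventuallyEq (hev X hX)
      · have hne := hxne i hi
        have h1 : Tendsto (fun X : ℂ => (X - x i) * (c j * (X - x j)⁻¹)) (𝓝[≠] x i) (𝓝 0) := by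
          have : ContinuousAt (fun X : ℂ => (X - x i) * (c j * (X - x j)⁻¹)) (x i) := by
            have : x i - x j ≠ 0 := sub_ne_zero.2 hne
            fun_prop (disch := assumption)
          have h := this.tendsto
          simp only [sub_self, zero_mul] at h
          exact h.mono_left nhdsWithin_le_nhds
        have h2 := (hres i (Finset.mem_insert_of_mem hi)).sub h1
        rw [sub_zero] at h2
        refine h2.congr' ?_
        filter_upwards [nhdsWithin_le_nhds (hev (x i) hne)] with X hX
        rw [hX]; simp only [hf1]; ring
    have hcirc : ∀ ρ : ℝ, r ≤ ρ → ρ ≤ R → ρ ≠ ‖x j‖ → (∀ i ∈ s, ρ ≠ ‖x i‖) →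
        (∮ z in C(0, ρ), f2 z) = (∮ z in C(0, ρ), f z) - c j * ∮ z in C(0, ρ), (z - x j)⁻¹ := by
      intro ρ h1 h2 h3 h4
      have hρ : 0 < ρ := hr.trans_le h1
      have hne : ∀ z ∈ sphere (0 : ℂ) ρ, z ≠ x j := fun z hz h => by
        rw [mem_sphere_zero_iff_norm, h] at hz; exact h3 hz.symm
      have hne' : ∀ z ∈ sphere (0 : ℂ) ρ, z - x j ≠ 0 := fun z hz => sub_ne_zero.2 (hne z hz)
      rw [circleIntegral.integral_congr hρ.le (g := f1) fun z hz => hf21 z (hne z hz)]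
      have hfi : CircleIntegrable f 0 ρ := by
        refine ContinuousOn.circleIntegrable hρ.le fun z hz => ?_
        have hz' := mem_sphere_zero_iff_norm.1 hz
        refine (hd z (hz' ▸ h1) (hz' ▸ h2) fun i hi => ?_).continuousAt.continuousWithinAt
        rcases Finset.mem_insert.1 hi with rfl | hi
        · exact hne z hz
        · exact fun h => h4 i hi (by rw [← hz', h])
      have hgi : CircleIntegrable (fun z => c j * (z - x j)⁻¹) 0 ρ := by
        refine ContinuousOn.circleIntegrable hρ.le fun z hz => ?_
        have := hne' z hz
        have h : ContinuousAt (fun z => c j * (z - x j)⁻¹) z := by fun_prop (disch := assumption)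
        exact h.continuousWithinAt
      simp only [hf1]
      rw [circleIntegral.integral_sub hfi hgi, circleIntegral.integral_const_mul]
    have hR := hcirc R hrR.le le_rfl hj2.ne' fun i hi =>
      (hs i (Finset.mem_insert_of_mem hi)).2.ne'
    have hr' := hcirc r le_rfl hrR.le hj1.ne fun i hi =>
      (hs i (Finset.mem_insert_of_mem hi)).1.ne
    -- The subtracted term 1/(X-x_j) integrates to 2πi over the outer circle and to 0 over the inner
    -- one.
    rw [circleIntegral.integral_sub_inv_of_mem_ball (by simpa using hj2)] at hR
    rw [circleIntegral_inv_sub_of_lt hj1 hr.le] at hr'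
    rw [Finset.sum_insert hj]
    linear_combination hsum - hR + hr'

/-- The residue theorem for an exhausting sequence of annuli. -/
theorem tsum_residues {ι : Type*} {x c : ι → ℂ} (hx : Function.Injective x) {f : ℂ → ℂ}
    {r R : ℕ → ℝ} (hr : ∀ n, 0 < r n) (hrR : ∀ n, r n < R n) (hra : Antitone r) (hRm : Monotone R)
    (hfin : ∀ n, {i | r n ≤ ‖x i‖ ∧ ‖x i‖ ≤ R n}.Finite)
    (hne : ∀ n i, ‖x i‖ ≠ r n ∧ ‖x i‖ ≠ R n) (hex : ∀ i, ∃ n, r n < ‖x i‖ ∧ ‖x i‖ < R n)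
    (hd : ∀ n X, r n ≤ ‖X‖ → ‖X‖ ≤ R n → (∀ i, X ≠ x i) → DifferentiableAt ℂ f X)
    (hres : ∀ i, Tendsto (fun X => (X - x i) * f X) (𝓝[≠] x i) (𝓝 (c i))) {L : ℂ}
    (hlr : Tendsto (fun n => ∮ z in C(0, r n), f z) atTop (𝓝 0))
    (hlR : Tendsto (fun n => ∮ z in C(0, R n), f z) atTop (𝓝 L)) (hs : Summable c) :
    L = 2 * Real.pi * I * ∑' i, c i := by
  -- The poles in the n-th annulus form an increasing family of finite sets exhausting ι, so the
  -- finite residue sums tend to the full sum.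
  let F : ℕ → Finset ι := fun n => (hfin n).toFinset
  have hF : ∀ n i, i ∈ F n ↔ r n ≤ ‖x i‖ ∧ ‖x i‖ ≤ R n := fun n i => by simp [F]
  have hFt : Tendsto F atTop atTop := by
    refine tendsto_atTop_finset_of_monotone (fun m n hmn i hi => ?_) fun i => ?_
    · rw [hF] at hi ⊢
      exact ⟨(hra hmn).trans hi.1, hi.2.trans (hRm hmn)⟩
    · obtain ⟨n, h1, h2⟩ := hex i
      exact ⟨n, (hF n i).2 ⟨h1.le, h2.le⟩⟩
  have h1 := hlr.add ((hs.hasSum.comp hFt).const_mul (2 * Real.pi * I))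
  rw [zero_add] at h1
  refine tendsto_nhds_unique hlR (h1.congr fun n => ?_)
  refine (circleIntegral_sub_eq_sum_residues (F n) hx (hr n) (hrR n) (fun i hi => ?_)
    (fun X a b h => ?_) fun i _ => hres i).symm
  · obtain ⟨a, b⟩ := (hF n i).1 hi
    exact ⟨lt_of_le_of_ne a (hne n i).1.symm, lt_of_le_of_ne b (hne n i).2⟩
  · exact hd n X a b fun i hi => h i ((hF n i).2 (hi ▸ ⟨a, b⟩)) hi

end Residues

/-! ### Chains of simple poles of theta quotients. -/

section ThetaQuotient

variable {q : ℂ}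

theorem qTheta_div_q (hq0 : q ≠ 0) (hq1 : ‖q‖ < 1) {x : ℂ} (hx : x ≠ 0) :
    qTheta (x / q) q = -(x / q) * qTheta x q := by
  have h := qTheta_mul_q hq0 hq1 (div_ne_zero hx hq0)
  rw [div_mul_cancel₀ x hq0] at h
  rw [h]
  field_simp

theorem qTheta_one_sub (hq1 : ‖q‖ < 1) (x : ℂ) :
    qTheta x q = (1 - x) * (qPochInf (q * x) q * qPochInf (q / x) q) := by
  rw [qTheta, qPochInf_step hq1 x, mul_comm x q, mul_assoc]

theorem differentiableAt_qTheta (hq1 : ‖q‖ < 1) {x : ℂ} (hx : x ≠ 0) :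
    DifferentiableAt ℂ (fun y => qTheta y q) x := by
  have h := differentiable_qPochInf hq1
  have h1 : DifferentiableAt ℂ (fun y : ℂ => q / y) x := by fun_prop (disch := assumption)
  exact (h x).mul ((h (q / x)).comp x h1)

/-- Split off the vanishing factor: ϑ(c/Y) = ((Y-c)/Y)·(qc/Y, qY/c;q)_∞. The prefactor cancels, and
both remaining products equal (q;q)_∞ at Y = c. -/
theorem tendsto_residue_qTheta (hq0 : q ≠ 0) (hq1 : ‖q‖ < 1) {c : ℂ} (hc : c ≠ 0) :
    Tendsto (fun Y => (Y - c) * (qTheta (c / Y) q)⁻¹ / Y) (𝓝[≠] c) (𝓝 (qPochInf q q ^ 2)⁻¹) := by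
  have hq := continuous_qPochInf hq1
  have h0 := qPochInf_ne_zero_of_norm_lt_one hq0 hq1 hq1
  have hcont : ContinuousAt (fun Y : ℂ => (qPochInf (q * (c / Y)) q * qPochInf (q / (c / Y)) q)⁻¹)
      c := by
    have h1 : ContinuousAt (fun Y : ℂ => q * (c / Y)) c := by fun_prop (disch := assumption)
    have h2 : ContinuousAt (fun Y : ℂ => q / (c / Y)) c := by
      have : (fun Y : ℂ => q / (c / Y)) = fun Y => q * Y / c := by
        funext Y; rw [div_div_eq_mul_div]
      rw [this]; fun_prop
    refine ((hq.continuousAt.comp h1).mul (hq.continuousAt.comp h2)).inv₀ ?_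
    simp [div_self hc, h0]
  have h := hcont.tendsto
  simp only [div_self hc, mul_one, div_one, ← sq] at h
  refine (h.mono_left nhdsWithin_le_nhds).congr' ?_
  have hne : ∀ᶠ Y in 𝓝[≠] c, Y ≠ 0 := nhdsWithin_le_nhds (isOpen_ne.mem_nhds hc)
  filter_upwards [self_mem_nhdsWithin, hne] with Y hY hY0
  have h1 : Y - c ≠ 0 := sub_ne_zero.2 hY
  have h2 : 1 - c / Y = (Y - c) / Y := by field_simp
  rw [qTheta_one_sub hq1, h2]
  generalize qPochInf (q * (c / Y)) q * qPochInf (q / (c / Y)) q = A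
  generalize Y - c = D at *
  rw [mul_inv, inv_div]
  field_simp

/-- A function `f` on the punctured plane which near `0` is of the form `E(X) W(X) / X` with `E`
multiplicatively quasi-periodic, with simple poles at the points `c_j q^k`. -/
structure ChainData (q : ℂ) {J : Type*} (c e : J → ℂ) (E W f : ℂ → ℂ) : Prop where
  ne : ∀ j, c j ≠ 0
  inj : ∀ i j, i ≠ j → c i / c j ∉ UpsilonSet q
  shift : ∀ X, X ≠ 0 → E (X * q) = q * E X
  cont : ∀ X, X ≠ 0 → (∀ j, c j / X ∉ UpsilonSet q) → ContinuousAt E X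
  res : ∀ j, Tendsto (fun Y => (Y - c j) * E Y / Y) (𝓝[≠] c j) (𝓝 (e j))
  cont_zero : ContinuousAt W 0
  cont_chain : ∀ j (k : ℕ), ContinuousAt W (c j * q ^ k)
  eq_zero : ∀ᶠ X in 𝓝[≠] 0, f X = E X * W X / X
  eq_chain : ∀ j (k : ℕ), ∀ᶠ X in 𝓝[≠] (c j * q ^ k), f X = E X * W X / X

namespace ChainData

variable {J : Type*} {c e : J → ℂ} {E W f : ℂ → ℂ}

theorem shift_pow (h : ChainData q c e E W f) (hq0 : q ≠ 0) {X : ℂ} (hX : X ≠ 0) (n : ℕ) :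
    E (X * q ^ n) = q ^ n * E X := by
  induction n with
  | zero => simp
  | succ n ih =>
    rw [pow_succ, ← mul_assoc, h.shift _ (mul_ne_zero hX (pow_ne_zero n hq0)), ih]
    ring

/-- The substitution X = q^k Y and the multiplier of E reduce the pole at c_j q^k to the one at c_j.
The resulting factor q^k is the weight of a Jackson sum. -/
theorem tendsto_residue (h : ChainData q c e E W f) (hq0 : q ≠ 0) (j : J) (k : ℕ) :
    Tendsto (fun X => (X - c j * q ^ k) * f X) (𝓝[≠] (c j * q ^ k))
      (𝓝 (q ^ k * (e j * W (c j * q ^ k)))) := by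
  have hk : q ^ k ≠ 0 := pow_ne_zero k hq0
  have hφ : Tendsto (fun X : ℂ => X / q ^ k) (𝓝[≠] (c j * q ^ k)) (𝓝[≠] c j) := by
    refine tendsto_nhdsWithin_iff.2 ⟨?_, ?_⟩
    · have : Tendsto (fun X : ℂ => X / q ^ k) (𝓝 (c j * q ^ k)) (𝓝 (c j * q ^ k / q ^ k)) :=
        tendsto_id.div_const _
      rw [mul_div_cancel_right₀ _ hk] at this
      exact this.mono_left nhdsWithin_le_nhds
    · filter_upwards [self_mem_nhdsWithin] with X hX h0
      exact hX (by rw [Set.mem_singleton_iff] at h0 ⊢; rw [← h0, div_mul_cancel₀ _ hk])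
  have h1 := (((h.res j).comp hφ).mul ((h.cont_chain j k).tendsto.mono_left
    nhdsWithin_le_nhds)).const_mul (q ^ k)
  refine h1.congr' ?_
  have hne : ∀ᶠ X in 𝓝[≠] (c j * q ^ k), X ≠ 0 :=
    nhdsWithin_le_nhds (isOpen_ne.mem_nhds (mul_ne_zero (h.ne j) hk))
  filter_upwards [h.eq_chain j k, hne] with X hX hX0
  have e1 : E X = q ^ k * E (X / q ^ k) := by
    rw [← h.shift_pow hq0 (div_ne_zero hX0 hk), div_mul_cancel₀ _ hk]
  rw [hX, e1]
  simp only [Function.comp]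
  field_simp

theorem summable (h : ChainData q c e E W f) (hq1 : ‖q‖ < 1) (j : J) :
    Summable fun k : ℕ => q ^ k * (e j * W (c j * q ^ k)) := by
  have h1 := (summable_jackson hq1 (h.cont_zero.tendsto.comp
    (tendsto_mul_pow_zero hq1 (c j)))).mul_left (e j / c j)
  have hc := h.ne j
  refine h1.congr fun k => ?_
  field_simp

theorem injective (h : ChainData q c e E W f) (hq0 : q ≠ 0) (hq1 : ‖q‖ < 1) :
    Function.Injective fun i : J × ℕ => c i.1 * q ^ i.2 := by
  rintro ⟨i, k⟩ ⟨j, l⟩ hij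
  simp only at hij
  by_cases hne : i = j
  · subst hne
    have h1 := mul_left_cancel₀ (h.ne i) hij
    have h2 : ‖q‖ ^ k = ‖q‖ ^ l := by rw [← norm_pow, ← norm_pow, h1]
    rw [pow_right_injective₀ (norm_pos_iff.2 hq0) hq1.ne h2]
  · refine absurd ⟨(l : ℤ) - k, ?_⟩ (h.inj i j hne)
    have hj := h.ne j
    simp only
    rw [zpow_sub₀ hq0, zpow_natCast, zpow_natCast, div_eq_div_iff (pow_ne_zero k hq0) hj,
      hij, mul_comm]

/-- On one circle that avoids all chains E is bounded by compactness. Quasi-periodicity carries this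
bound, with a factor ‖q‖ⁿ, to the circles shrunk by ‖q‖ⁿ, where W stays near W(0). -/
theorem exists_bound (h : ChainData q c e E W f) (hq0 : q ≠ 0) (hq1 : ‖q‖ < 1) :
    ∃ ε > 0, ∀ r : ℝ, 0 < r → r < ε → (∀ j (m : ℤ), ‖c j‖ ≠ r * ‖q‖ ^ m) →
      ∃ K, ∀ (n : ℕ) (X : ℂ), ‖X‖ = r * ‖q‖ ^ n → ‖X * f X‖ ≤ K * ‖q‖ ^ n := by
  have hW : ∀ᶠ X in 𝓝 (0 : ℂ), ‖W X‖ ≤ ‖W 0‖ + 1 :=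
    h.cont_zero.norm.eventually_le_const (by linarith)
  have h0 := eventually_nhdsWithin_iff.1 h.eq_zero
  obtain ⟨ε, hε, hb⟩ := Metric.eventually_nhds_iff.1 (hW.and h0)
  refine ⟨ε, hε, fun r hr hrε hne => ?_⟩
  have hE : ContinuousOn E (Metric.sphere 0 r) := fun X hX => by
    rw [mem_sphere_zero_iff_norm] at hX
    have hX0 : X ≠ 0 := by rw [← norm_pos_iff, hX]; exact hr
    refine (h.cont X hX0 ?_).continuousWithinAt
    rintro j ⟨m, hm⟩
    apply hne j m
    simp only at hm
    rw [← hX, ← norm_zpow, hm, ← norm_mul, mul_div_cancel₀ _ hX0]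
  obtain ⟨C, hC⟩ := (isCompact_sphere (0 : ℂ) r).exists_bound_of_continuousOn hE
  refine ⟨C * (‖W 0‖ + 1), fun n X hX => ?_⟩
  have hqn : q ^ n ≠ 0 := pow_ne_zero n hq0
  have hX0 : X ≠ 0 := by
    rw [← norm_pos_iff, hX]; have := norm_pos_iff.2 hq0; positivity
  have hXε : dist X 0 < ε := by
    rw [dist_zero_right, hX]
    exact (mul_le_of_le_one_right hr.le (pow_le_one₀ (norm_nonneg _) hq1.le)).trans_lt hrε
  obtain ⟨h1, h2⟩ := hb hXε
  have hY : X / q ^ n ∈ Metric.sphere (0 : ℂ) r := by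
    rw [mem_sphere_zero_iff_norm, norm_div, hX, norm_pow, mul_div_cancel_right₀]
    rw [← norm_pow]; exact norm_ne_zero_iff.2 hqn
  have e1 : E X = q ^ n * E (X / q ^ n) := by
    rw [← h.shift_pow hq0 (div_ne_zero hX0 hqn), div_mul_cancel₀ _ hqn]
  rw [h2 hX0, mul_div_cancel₀ _ hX0, e1, norm_mul, norm_mul, norm_pow]
  have hC0 := (norm_nonneg _).trans (hC _ hY)
  calc _ ≤ ‖q‖ ^ n * C * (‖W 0‖ + 1) := by gcongr; exact hC _ hY
    _ = _ := by ring

theorem finite_chain [Finite J] (_h : ChainData q c e E W f) (hq1 : ‖q‖ < 1) {r : ℝ} (hr : 0 < r) :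
    {i : J × ℕ | r ≤ ‖c i.1 * q ^ i.2‖}.Finite := by
  have h1 : ∀ᶠ k : ℕ in atTop, ∀ j, ‖c j * q ^ k‖ < r := by
    refine eventually_all.2 fun j => ?_
    have := (tendsto_mul_pow_zero hq1 (c j)).norm
    rw [norm_zero] at this
    exact this.eventually_lt_const hr
  obtain ⟨N, hN⟩ := eventually_atTop.1 h1
  refine (Set.finite_univ.prod (Set.finite_Iio N)).subset ?_
  rintro ⟨j, k⟩ hjk
  refine ⟨Set.mem_univ _, ?_⟩
  by_contra hk
  exact absurd (hN k (not_lt.1 hk) j) (not_lt.2 hjk)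

end ChainData

/-- The forbidden radii are countable, so their complement is dense. -/
theorem exists_radius {J : Type*} [Countable J] (c : J → ℂ) (hq0 : q ≠ 0) {ε : ℝ} (hε : 0 < ε) :
    ∃ r : ℝ, 0 < r ∧ r < ε ∧ ∀ j (m : ℤ), ‖c j‖ ≠ r * ‖q‖ ^ m := by
  have hcount : (Set.range fun i : J × ℤ => ‖c i.1‖ / ‖q‖ ^ i.2).Countable :=
    Set.countable_range _
  obtain ⟨r, hr, hr1, hr2⟩ := (hcount.dense_compl ℝ).exists_between hε
  refine ⟨r, hr1, hr2, fun j m h => ?_⟩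
  have hm : ‖q‖ ^ m ≠ 0 := zpow_ne_zero m (norm_ne_zero_iff.2 hq0)
  exact hr ⟨(j, m), by simp only; rw [h, mul_div_cancel_right₀ _ hm]⟩

/-- The bound is on X f(X), so the length 2πρ of the circle cancels the division by ‖X‖ and the
estimate is independent of the radius. It thus applies to shrinking and to growing circles. -/
theorem tendsto_circleIntegral_zero (hq1 : ‖q‖ < 1) {f : ℂ → ℂ} {ρ : ℕ → ℝ} (hρ : ∀ n, 0 < ρ n)
    {K : ℝ} (h : ∀ n X, ‖X‖ = ρ n → ‖X * f X‖ ≤ K * ‖q‖ ^ n) :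
    Tendsto (fun n => ∮ z in C(0, ρ n), f z) atTop (𝓝 0) := by
  have hlim : Tendsto (fun n : ℕ => 2 * Real.pi * (K * ‖q‖ ^ n)) atTop (𝓝 0) := by
    simpa using (((tendsto_pow_atTop_nhds_zero_of_lt_one (norm_nonneg q) hq1).const_mul
      K).const_mul (2 * Real.pi))
  refine squeeze_zero_norm (fun n => ?_) hlim
  have h1 := circleIntegral.norm_integral_le_of_norm_le_const (f := f) (c := 0) (hρ n).le
    (C := K * ‖q‖ ^ n / ρ n) fun z hz => ?_
  · refine h1.trans_eq ?_
    have := (hρ n).ne'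
    field_simp
  · rw [mem_sphere_zero_iff_norm] at hz
    have := h n z hz
    rw [norm_mul, hz] at this
    rw [le_div_iff₀ (hρ n)]
    linarith

end ThetaQuotient

/-! ### Residue sums inside a circle, and their balance between 0 and infinity. -/

section ResidueSums

namespace ChainData

variable {q : ℂ} {J J' : Type*} {c e : J → ℂ} {E W f : ℂ → ℂ} {d e' : J' → ℂ} {E' W' : ℂ → ℂ}

theorem norm_mul_pow_le (hq1 : ‖q‖ < 1) (x : ℂ) (k : ℕ) : ‖x * q ^ k‖ ≤ ‖x‖ := by
  rw [norm_mul, norm_pow]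
  exact mul_le_of_le_one_right (norm_nonneg _) (pow_le_one₀ (norm_nonneg _) hq1.le)

theorem summable_prod [Finite J] (h : ChainData q c e E W f) (hq1 : ‖q‖ < 1) :
    Summable fun i : J × ℕ => q ^ i.2 * (e i.1 * W (c i.1 * q ^ i.2)) := by
  have := Fintype.ofFinite J
  rw [← (Equiv.prodComm ℕ J).summable_iff]
  have h1 : ∀ j, Summable fun k : ℕ => ‖q ^ k * (e j * W (c j * q ^ k))‖ :=
    fun j => (h.summable hq1 j).norm
  refine Summable.of_norm ?_
  rw [← (Equiv.prodComm J ℕ).summable_iff]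
  refine (summable_prod_of_nonneg fun _ => norm_nonneg _).2 ⟨fun j => h1 j, ?_⟩
  exact (hasSum_fintype _).summable

theorem tsum_prod_eq [Fintype J] (h : ChainData q c e E W f) (hq1 : ‖q‖ < 1) :
    ∑' i : J × ℕ, q ^ i.2 * (e i.1 * W (c i.1 * q ^ i.2)) =
      ∑ j, ∑' k : ℕ, q ^ k * (e j * W (c j * q ^ k)) := by
  rw [(h.summable_prod hq1).tsum_prod, tsum_fintype]

theorem norm_ne_radius {r : ℝ} (hq0 : q ≠ 0) (hr : ∀ j (m : ℤ), ‖c j‖ ≠ r * ‖q‖ ^ m) (j : J)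
    (k n : ℕ) : ‖c j * q ^ k‖ ≠ r * ‖q‖ ^ n := by
  intro h0
  have hq : ‖q‖ ≠ 0 := norm_ne_zero_iff.2 hq0
  refine hr j ((n : ℤ) - k) ?_
  rw [norm_mul, norm_pow] at h0
  rw [zpow_sub₀ hq, zpow_natCast, zpow_natCast, ← mul_div_assoc, ← h0,
    mul_div_cancel_right₀ _ (pow_ne_zero k hq)]

/-- The residues inside a circle which separates the poles. -/
theorem circleIntegral_eq [Fintype J] (h : ChainData q c e E W f) (hq0 : q ≠ 0) (hq1 : ‖q‖ < 1)
    {ρ : ℝ} (hρ : 0 < ρ) (hc : ∀ j, ‖c j‖ < ρ)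
    (hd : ∀ X, X ≠ 0 → ‖X‖ ≤ ρ → (∀ j (k : ℕ), X ≠ c j * q ^ k) → DifferentiableAt ℂ f X) :
    ∮ z in C(0, ρ), f z = 2 * Real.pi * Complex.I *
      ∑ j, ∑' k : ℕ, q ^ k * (e j * W (c j * q ^ k)) := by
  obtain ⟨ε, hε, hb⟩ := h.exists_bound hq0 hq1
  obtain ⟨r, hr0, hrε, hr⟩ := exists_radius c hq0 (lt_min hε hρ)
  obtain ⟨K, hK⟩ := hb r hr0 (hrε.trans_le (min_le_left _ _)) hr
  have hqn : 0 < ‖q‖ := norm_pos_iff.2 hq0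
  have hpos : ∀ n : ℕ, 0 < r * ‖q‖ ^ n := fun n => by positivity
  have hrn : ∀ n : ℕ, r * ‖q‖ ^ n < ρ := fun n =>
    (mul_le_of_le_one_right hr0.le (pow_le_one₀ (norm_nonneg _) hq1.le)).trans_lt
      (hrε.trans_le (min_le_right _ _))
  rw [← h.tsum_prod_eq hq1]
  have hlt : ∀ i : J × ℕ, ‖c i.1 * q ^ i.2‖ < ρ := fun i =>
    (norm_mul_pow_le hq1 _ _).trans_lt (hc i.1)
  refine tsum_residues (r := fun n => r * ‖q‖ ^ n) (R := fun _ => ρ) (h.injective hq0 hq1) hpos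
    hrn ?_ monotone_const ?_ ?_ ?_ ?_ ?_ (tendsto_circleIntegral_zero hq1 hpos hK)
    tendsto_const_nhds (h.summable_prod hq1)
  · intro m n hmn
    exact mul_le_mul_of_nonneg_left (pow_le_pow_of_le_one hqn.le hq1.le hmn) hr0.le
  · exact fun n => (h.finite_chain hq1 (hpos n)).subset fun i hi => hi.1
  · exact fun n i => ⟨norm_ne_radius hq0 hr _ _ _, (hlt i).ne⟩
  · intro i
    have h1 : Tendsto (fun n : ℕ => r * ‖q‖ ^ n) atTop (𝓝 0) := by
      simpa using (tendsto_pow_atTop_nhds_zero_of_lt_one hqn.le hq1).const_mul r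
    have h2 : 0 < ‖c i.1 * q ^ i.2‖ :=
      norm_pos_iff.2 (mul_ne_zero (h.ne _) (pow_ne_zero _ hq0))
    obtain ⟨n, hn⟩ := (h1.eventually_lt_const h2).exists
    exact ⟨n, hn, hlt i⟩
  · intro n X h1 h2 h3
    refine hd X (fun h0 => ?_) h2 fun j k => h3 (j, k)
    rw [h0, norm_zero] at h1
    exact absurd h1 (not_le.2 (hpos n))
  · exact fun i => h.tendsto_residue hq0 i.1 i.2

/-- Under X = 1/Y one has dX = -dY/Y², so residues change sign. -/
theorem tendsto_residue_inv {y C : ℂ} (hy : y ≠ 0) {F : ℂ → ℂ}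
    (h : Tendsto (fun Y => (Y - y) * (F Y⁻¹ / Y ^ 2)) (𝓝[≠] y) (𝓝 C)) :
    Tendsto (fun X => (X - y⁻¹) * F X) (𝓝[≠] y⁻¹) (𝓝 (-C)) := by
  have hinv : Tendsto (fun X : ℂ => X⁻¹) (𝓝[≠] y⁻¹) (𝓝[≠] y) := by
    refine tendsto_nhdsWithin_iff.2 ⟨?_, ?_⟩
    · have := (continuousAt_inv₀ (inv_ne_zero hy)).tendsto
      rw [inv_inv] at this
      exact this.mono_left nhdsWithin_le_nhds
    · filter_upwards [self_mem_nhdsWithin] with X hX h0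
      exact hX (by rw [Set.mem_singleton_iff] at h0 ⊢; rw [← h0, inv_inv])
  have h1 : Tendsto (fun X : ℂ => -(X⁻¹ / y)) (𝓝[≠] y⁻¹) (𝓝 (-1)) := by
    have := ((hinv.mono_right nhdsWithin_le_nhds).div_const y).neg
    rwa [div_self hy] at this
  have h2 := (h.comp hinv).mul h1
  rw [mul_neg_one] at h2
  refine h2.congr' ?_
  have hne : ∀ᶠ X in 𝓝[≠] y⁻¹, X ≠ 0 := nhdsWithin_le_nhds (isOpen_ne.mem_nhds (inv_ne_zero hy))
  filter_upwards [hne] with X hX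
  simp only [Function.comp, inv_inv]
  field_simp
  ring

/-- The residues at the poles accumulating at `0` balance those accumulating at `∞`. -/
theorem sum_eq_sum [Fintype J] [Fintype J'] (h : ChainData q c e E W f)
    (h' : ChainData q d e' E' W' fun Y => f Y⁻¹ / Y ^ 2) (hq0 : q ≠ 0) (hq1 : ‖q‖ < 1)
    (hcd : ∀ i j, c i * d j ∉ OmegaSet q)
    (hdiff : ∀ X, X ≠ 0 → (∀ j (k : ℕ), X ≠ c j * q ^ k) → (∀ j (k : ℕ), X⁻¹ ≠ d j * q ^ k) →
      DifferentiableAt ℂ f X) :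
    ∑ j, ∑' k : ℕ, q ^ k * (e j * W (c j * q ^ k)) =
      ∑ j, ∑' k : ℕ, q ^ k * (e' j * W' (d j * q ^ k)) := by
  obtain ⟨ε, hε, hb⟩ := h.exists_bound hq0 hq1
  obtain ⟨ε', hε', hb'⟩ := h'.exists_bound hq0 hq1
  -- For r < δ, the chains from 0 lie inside every outer circle of radius 1/(r‖q‖ⁿ), and the
  -- inverted chains lie outside every inner circle of radius r‖q‖ⁿ.
  have hfin : ∃ δ : ℝ, 0 < δ ∧ δ < 1 ∧ (∀ j, δ * ‖c j‖ < 1) ∧ ∀ j, δ * ‖d j‖ < 1 := by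
    have hz : ∀ a : ℝ, Tendsto (fun δ : ℝ => δ * a) (𝓝[>] 0) (𝓝 0) := fun a => by
      have : Tendsto (fun δ : ℝ => δ * a) (𝓝 0) (𝓝 (0 * a)) := tendsto_id.mul_const a
      rw [zero_mul] at this
      exact this.mono_left nhdsWithin_le_nhds
    have h1 : ∀ᶠ δ : ℝ in 𝓝[>] 0, ∀ j, δ * ‖c j‖ < 1 := eventually_all.2 fun j =>
      (hz ‖c j‖).eventually_lt_const one_pos
    have h2 : ∀ᶠ δ : ℝ in 𝓝[>] 0, ∀ j, δ * ‖d j‖ < 1 := eventually_all.2 fun j =>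
      (hz ‖d j‖).eventually_lt_const one_pos
    have h3 : ∀ᶠ δ : ℝ in 𝓝[>] 0, δ < 1 := by
      simpa using (hz 1).eventually_lt_const one_pos
    have h4 : ∀ᶠ δ : ℝ in 𝓝[>] 0, 0 < δ := self_mem_nhdsWithin
    obtain ⟨δ, a⟩ := (((h4.and h3).and h1).and h2).exists
    exact ⟨δ, a.1.1.1, a.1.1.2, a.1.2, a.2⟩
  obtain ⟨δ, hδ, hδ1, hδc, hδd⟩ := hfin
  -- A single radius must avoid both families of chains, since the outer circles are the inverses of
  -- the inner ones.
  obtain ⟨r, hr0, hrε, hr⟩ := exists_radius (Sum.elim c d) hq0 (lt_min (lt_min hε hε') hδ)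
  have hrc : ∀ j (m : ℤ), ‖c j‖ ≠ r * ‖q‖ ^ m := fun j => hr (Sum.inl j)
  have hrd : ∀ j (m : ℤ), ‖d j‖ ≠ r * ‖q‖ ^ m := fun j => hr (Sum.inr j)
  have hrδ : r < δ := hrε.trans_le (min_le_right _ _)
  obtain ⟨K, hK⟩ := hb r hr0 (hrε.trans_le ((min_le_left _ _).trans (min_le_left _ _))) hrc
  obtain ⟨K', hK'⟩ := hb' r hr0 (hrε.trans_le ((min_le_left _ _).trans (min_le_right _ _))) hrd
  have hqn : 0 < ‖q‖ := norm_pos_iff.2 hq0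
  have hpos : ∀ n : ℕ, 0 < r * ‖q‖ ^ n := fun n => by positivity
  have hrn : ∀ n : ℕ, r * ‖q‖ ^ n ≤ r := fun n =>
    mul_le_of_le_one_right hr0.le (pow_le_one₀ (norm_nonneg _) hq1.le)
  have hanti : Antitone fun n : ℕ => r * ‖q‖ ^ n := fun m n hmn =>
    mul_le_mul_of_nonneg_left (pow_le_pow_of_le_one hqn.le hq1.le hmn) hr0.le
  have hlim0 : Tendsto (fun n : ℕ => r * ‖q‖ ^ n) atTop (𝓝 0) := by
    simpa using (tendsto_pow_atTop_nhds_zero_of_lt_one hqn.le hq1).const_mul r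
  have hsmall : ∀ {x : ℂ}, δ * ‖x‖ < 1 → ∀ k n : ℕ, r * ‖q‖ ^ n * ‖x * q ^ k‖ < 1 := by
    intro x hx k n
    calc _ ≤ δ * ‖x‖ := mul_le_mul ((hrn n).trans hrδ.le) (norm_mul_pow_le hq1 _ _)
          (norm_nonneg _) hδ.le
      _ < 1 := hx
  have hdne : ∀ i : J' × ℕ, d i.1 * q ^ i.2 ≠ 0 := fun i =>
    mul_ne_zero (h'.ne _) (pow_ne_zero _ hq0)
  have hcne : ∀ i : J × ℕ, c i.1 * q ^ i.2 ≠ 0 := fun i =>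
    mul_ne_zero (h.ne _) (pow_ne_zero _ hq0)
  let x : (J × ℕ) ⊕ (J' × ℕ) → ℂ :=
    Sum.elim (fun i => c i.1 * q ^ i.2) fun i => (d i.1 * q ^ i.2)⁻¹
  let C : (J × ℕ) ⊕ (J' × ℕ) → ℂ := Sum.elim
    (fun i => q ^ i.2 * (e i.1 * W (c i.1 * q ^ i.2)))
    fun i => -(q ^ i.2 * (e' i.1 * W' (d i.1 * q ^ i.2)))
  have hx : Function.Injective x := by
    refine Function.Injective.sumElim (h.injective hq0 hq1)
      (inv_injective.comp (h'.injective hq0 hq1)) ?_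
    rintro ⟨i, k⟩ ⟨j, l⟩ hij
    -- A coincidence c_i q^k = (d_j q^l)⁻¹ would mean c_i d_j q^{k+l} = 1.
    refine hcd i j ((mem_OmegaSet_iff hq0).2 ⟨k + l, ?_⟩)
    have h1 := hdne (j, l)
    simp only at hij h1
    have h2 : c i * q ^ k * (d j * q ^ l) = 1 := by rw [hij, inv_mul_cancel₀ h1]
    rw [← h2]; ring
  have hsC : Summable C := (h.summable_prod hq1).sum _ (h'.summable_prod hq1).neg
  have main := tsum_residues (x := x) (c := C) (f := f) (r := fun n => r * ‖q‖ ^ n)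
    (R := fun n => (r * ‖q‖ ^ n)⁻¹) (L := 0) hx hpos (fun n => ?_) hanti (fun m n hmn => ?_) ?_ ?_
    ?_ ?_ ?_ (tendsto_circleIntegral_zero hq1 hpos hK)
    (tendsto_circleIntegral_zero (K := K') hq1 (fun n => inv_pos.2 (hpos n)) ?_) hsC
  · have hsum : ∑' i, C i = ∑ j, ∑' k : ℕ, q ^ k * (e j * W (c j * q ^ k)) -
        ∑ j, ∑' k : ℕ, q ^ k * (e' j * W' (d j * q ^ k)) := by
      rw [← h.tsum_prod_eq hq1, ← h'.tsum_prod_eq hq1, sub_eq_add_neg, ← tsum_neg]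
      exact Summable.tsum_sum (f := C) (h.summable_prod hq1) (h'.summable_prod hq1).neg
    rw [hsum] at main
    have h2 := (mul_eq_zero.1 main.symm).resolve_left Complex.two_pi_I_ne_zero
    exact sub_eq_zero.1 h2
  · rw [lt_inv_comm₀ (hpos n) (hpos n)]
    have h1 : r * ‖q‖ ^ n < 1 := (hrn n).trans_lt (hrδ.trans hδ1)
    exact h1.trans (one_lt_inv₀ (hpos n) |>.2 h1)
  · exact inv_anti₀ (hpos n) (hanti hmn)
  · intro n
    have h1 := (h.finite_chain hq1 (hpos n)).image (Sum.inl (β := J' × ℕ))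
    have h2 := (h'.finite_chain hq1 (hpos n)).image (Sum.inr (α := J × ℕ))
    refine (h1.union h2).subset ?_
    rintro (i | i) ⟨a, b⟩
    · exact Or.inl ⟨i, a, rfl⟩
    · refine Or.inr ⟨i, ?_, rfl⟩
      simp only [x, Sum.elim_inr, norm_inv] at b
      exact (inv_le_inv₀ (norm_pos_iff.2 (hdne i)) (hpos n)).1 b
  · rintro n (i | i)
    · refine ⟨norm_ne_radius hq0 hrc _ _ _, fun h0 => ?_⟩
      have := hsmall (hδc i.1) i.2 n
      simp only [x, Sum.elim_inl] at h0
      rw [h0, mul_inv_cancel₀ (hpos n).ne'] at this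
      exact lt_irrefl _ this
    · simp only [x, Sum.elim_inr, norm_inv]
      refine ⟨fun h0 => ?_, fun h0 => norm_ne_radius hq0 hrd i.1 i.2 n (inv_injective h0)⟩
      have := hsmall (hδd i.1) i.2 n
      rw [← h0, inv_mul_cancel₀ (norm_ne_zero_iff.2 (hdne i))] at this
      exact lt_irrefl _ this
  · rintro (i | i)
    · obtain ⟨n, hn⟩ := (hlim0.eventually_lt_const (norm_pos_iff.2 (hcne i))).exists
      refine ⟨n, hn, ?_⟩
      rw [← one_div, lt_div_iff₀ (hpos n), mul_comm]
      exact hsmall (hδc i.1) i.2 n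
    · obtain ⟨n, hn⟩ := (hlim0.eventually_lt_const (norm_pos_iff.2 (hdne i))).exists
      refine ⟨n, ?_, ?_⟩ <;> simp only [x, Sum.elim_inr, norm_inv]
      · rw [← one_div, lt_div_iff₀ (norm_pos_iff.2 (hdne i))]
        exact hsmall (hδd i.1) i.2 n
      · exact inv_strictAnti₀ (hpos n) hn
  · intro n X h1 h2 h3
    refine hdiff X (fun h0 => ?_) (fun j k => h3 (Sum.inl (j, k))) fun j k h0 => ?_
    · rw [h0, norm_zero] at h1
      exact absurd h1 (not_le.2 (hpos n))
    · exact h3 (Sum.inr (j, k)) (by simp only [x, Sum.elim_inr]; rw [← h0, inv_inv])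
  · rintro (i | i)
    · exact h.tendsto_residue hq0 i.1 i.2
    · exact tendsto_residue_inv (hdne i) (h'.tendsto_residue hq0 i.1 i.2)
  -- With Y = X⁻¹ one has X f(X) = Y · f(Y⁻¹)/Y², so the estimate near 0 in Y bounds the outer
  -- circles.
  · intro n X hX
    have hX0 : X ≠ 0 := by rw [← norm_pos_iff, hX]; exact inv_pos.2 (hpos n)
    have := hK' n X⁻¹ (by rw [norm_inv, hX, inv_inv])
    rw [inv_inv] at this
    convert! this using 2
    field_simp

end ChainData

end ResidueSums

/-! ### The Mellin–Barnes kernel and its inner residues. -/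

section MellinBarnes

variable {q p β h U V : ℂ}

theorem ContinuousAt.qTheta {X : Type*} [TopologicalSpace X] {f : X → ℂ} {x : X}
    (hf : ContinuousAt f x) (hq1 : ‖q‖ < 1) (h0 : f x ≠ 0) :
    ContinuousAt (fun y => qTheta (f y) q) x :=
  ContinuousAt.comp (f := f) (differentiableAt_qTheta hq1 h0).continuousAt hf

/-- The integrand of the Mellin–Barnes integral in the variable `X = t w / σ`. -/
noncomputable def mbKernel (q p β h U V X : ℂ) : ℂ :=
  qTheta (h * V / X) q * qTheta (h * X / U) q *
      (qPochInf (p * X) q * qPochInf (U * X) q * qPochInf (V * X) q) /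
    (qPochInf (U / X) q * qPochInf (V / X) q * (qPochInf (β * X) q * qPochInf (X / β) q *
      qPochInf X q * qPochInf (-X) q * qPochInf (-(p * X)) q))

/-- The quasi-periodic part of `mbKernel`. -/
noncomputable def mbTheta (q h U V X : ℂ) : ℂ :=
  qTheta (h * V / X) q * qTheta (h * X / U) q / (qTheta (U / X) q * qTheta (V / X) q)

/-- The residues of `mbTheta` at `U` and `V`. -/
noncomputable def mbResidue (q h U V : ℂ) : Fin 2 → ℂ :=
  ![(qPochInf q q ^ 2)⁻¹ * (qTheta (h * V / U) q * qTheta h q / qTheta (V / U) q),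
    (qPochInf q q ^ 2)⁻¹ * (qTheta h q * qTheta (h * V / U) q / qTheta (U / V) q)]

/-- Write 1/(U/X;q)_∞ = (qX/U;q)_∞/ϑ(U/X), likewise for V, and split (X²;q)_∞ = (X,-X,pX,-pX;q)_∞.
The last factorization accounts for the square of (pX;q)_∞ in the Jackson kernel. -/
theorem mbKernel_eq (hpq : p ^ 2 = q) (hq1 : ‖q‖ < 1) {X : ℂ}
    (hU : qPochInf (q * X / U) q ≠ 0) (hV : qPochInf (q * X / V) q ≠ 0)
    (hp : qPochInf (p * X) q ≠ 0) :
    mbKernel q p β h U V X = mbTheta q h U V X * clausenKernel q p β U V X := by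
  unfold mbKernel mbTheta clausenKernel
  have e : ∀ c, qTheta (c / X) q = qPochInf (c / X) q * qPochInf (q / (c / X)) q := fun _ => rfl
  rw [qPochInf_sq hpq hq1 X, e U, e V, div_div_eq_mul_div,
    div_div_eq_mul_div, div_mul_div_comm,
    ← mul_div_mul_right _ _ (mul_ne_zero (mul_ne_zero hU hV) hp)]
  congr 1 <;> ring

/-- The multiplier of the numerator is UV/(qX²) and that of the denominator UV/(q²X²). The free
parameter h cancels. -/
theorem mbTheta_mul_q (hq0 : q ≠ 0) (hq1 : ‖q‖ < 1) (hh : h ≠ 0) (hU : U ≠ 0) (hV : V ≠ 0)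
    {X : ℂ} (hX : X ≠ 0) : mbTheta q h U V (X * q) = q * mbTheta q h U V X := by
  unfold mbTheta
  have e : ∀ c, c / (X * q) = c / X / q := fun c => (div_div c X q).symm
  rw [e, e, e, ← mul_assoc h X q, mul_div_right_comm (h * X) q U,
    qTheta_div_q hq0 hq1 (div_ne_zero (mul_ne_zero hh hV) hX),
    qTheta_mul_q hq0 hq1 (div_ne_zero (mul_ne_zero hh hX) hU),
    qTheta_div_q hq0 hq1 (div_ne_zero hU hX), qTheta_div_q hq0 hq1 (div_ne_zero hV hX)]
  generalize qTheta (h * V / X) q = a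
  generalize qTheta (h * X / U) q = b
  generalize qTheta (U / X) q = c
  generalize qTheta (V / X) q = d
  field_simp

theorem clausenKernel_denom_ne_zero (hq0 : q ≠ 0) (hq1 : ‖q‖ < 1) {x : ℂ} (h1 : β * x ∉ OmegaSet q)
    (h2 : x / β ∉ OmegaSet q) (h3 : x ^ 2 ∉ OmegaSet q) (k : ℕ) :
    qPochInf (β * (x * q ^ k)) q * qPochInf (x * q ^ k / β) q *
      qPochInf ((x * q ^ k) ^ 2) q ≠ 0 := by
  refine mul_ne_zero (mul_ne_zero ?_ ?_) ?_ <;> refine qPochInf_ne_zero hq0 hq1 ?_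
  · rw [← mul_assoc]; exact mul_pow_notMem_OmegaSet hq0 h1 k
  · rw [mul_div_right_comm]; exact mul_pow_notMem_OmegaSet hq0 h2 k
  · rw [mul_pow, ← pow_mul]; exact mul_pow_notMem_OmegaSet hq0 h3 _

theorem eventually_mbKernel_eq (hpq : p ^ 2 = q) (hq1 : ‖q‖ < 1) {x : ℂ}
    (hU : qPochInf (q * x / U) q ≠ 0) (hV : qPochInf (q * x / V) q ≠ 0)
    (hp : qPochInf (p * x) q ≠ 0) :
    ∀ᶠ X in 𝓝[≠] x, mbKernel q p β h U V X / X =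
      mbTheta q h U V X * clausenKernel q p β U V X / X := by
  have hc := continuous_qPochInf hq1
  have h1 : ∀ᶠ X in 𝓝 x, qPochInf (q * X / U) q ≠ 0 :=
    ContinuousAt.eventually_ne (g := fun X => qPochInf (q * X / U) q)
      (Continuous.continuousAt (by fun_prop)) hU
  have h2 : ∀ᶠ X in 𝓝 x, qPochInf (q * X / V) q ≠ 0 :=
    ContinuousAt.eventually_ne (g := fun X => qPochInf (q * X / V) q)
      (Continuous.continuousAt (by fun_prop)) hV
  have h3 : ∀ᶠ X in 𝓝 x, qPochInf (p * X) q ≠ 0 :=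
    ContinuousAt.eventually_ne (g := fun X => qPochInf (p * X) q)
      (Continuous.continuousAt (by fun_prop)) hp
  filter_upwards [nhdsWithin_le_nhds h1, nhdsWithin_le_nhds h2, nhdsWithin_le_nhds h3]
    with X a b c
  rw [mbKernel_eq hpq hq1 a b c]

/-- The two chains are Uq^k and Vq^k. Genericity keeps them disjoint and away from the poles of the
Jackson kernel. -/
theorem chainData_mbKernel (hpq : p ^ 2 = q) (hq0 : q ≠ 0) (hq1 : ‖q‖ < 1) (hh : h ≠ 0)
    (hg : ClausenGeneric q β U V) :
    ChainData q ![U, V] (mbResidue q h U V) (mbTheta q h U V) (clausenKernel q p β U V)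
      fun X => mbKernel q p β h U V X / X := by
  have hU := hg.hU
  have hV := hg.hV
  have hVU := hg.symm.hUV
  have hN : ∀ X : ℂ, X ≠ 0 →
      ContinuousAt (fun X : ℂ => qTheta (h * V / X) q * qTheta (h * X / U) q) X := fun X hX => by
    have h1 : ContinuousAt (fun X : ℂ => h * V / X) X := by fun_prop (disch := assumption)
    have h2 : ContinuousAt (fun X : ℂ => h * X / U) X := by fun_prop
    exact (h1.qTheta hq1 (div_ne_zero (mul_ne_zero hh hV) hX)).mul
      (h2.qTheta hq1 (div_ne_zero (mul_ne_zero hh hX) hU))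
  have hD : ∀ c X : ℂ, c ≠ 0 → X ≠ 0 → ContinuousAt (fun X : ℂ => qTheta (c / X) q) X :=
    fun c X hc hX => by
      have h1 : ContinuousAt (fun X : ℂ => c / X) X := by fun_prop (disch := assumption)
      exact h1.qTheta hq1 (div_ne_zero hc hX)
  have hq := notMem_OmegaSet_of_norm_lt_one hq0 hq1 hq1
  have hchain : ∀ x y : ℂ, x ≠ 0 → x / y ∉ UpsilonSet q → ∀ k : ℕ,
      qPochInf (q * (x * q ^ k) / y) q ≠ 0 := fun x y hx hxy k => by
    refine qPochInf_ne_zero hq0 hq1 fun h0 => hxy ?_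
    refine zpow_mul_mem_UpsilonSet hq0 ((k : ℤ) + 1) ?_
    convert! mem_UpsilonSet_of_mem_OmegaSet h0 using 1
    rw [zpow_add_one₀ hq0, zpow_natCast]; ring
  have hself : ∀ x : ℂ, x ≠ 0 → ∀ k : ℕ, qPochInf (q * (x * q ^ k) / x) q ≠ 0 := fun x hx k => by
    rw [show q * (x * q ^ k) / x = q * q ^ k by field_simp]
    exact qPochInf_ne_zero hq0 hq1 (mul_pow_notMem_OmegaSet hq0 hq k)
  have hpx : ∀ x : ℂ, x ^ 2 ∉ OmegaSet q → ∀ k : ℕ, qPochInf (p * (x * q ^ k)) q ≠ 0 :=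
    fun x hx k h0 => by
      have h1 := qPochInf_ne_zero hq0 hq1 (mul_pow_notMem_OmegaSet hq0 hx (2 * k))
      apply h1
      rw [show x ^ 2 * q ^ (2 * k) = (x * q ^ k) ^ 2 by ring, qPochInf_sq hpq hq1, h0]
      ring
  refine ⟨?_, ?_, fun X hX => mbTheta_mul_q hq0 hq1 hh hU hV hX, ?_, ?_, ?_, ?_, ?_, ?_⟩
  · intro j; fin_cases j; exacts [hU, hV]
  · intro i j hij
    fin_cases i <;> fin_cases j
    exacts [absurd rfl hij, hg.hUV, hVU, absurd rfl hij]
  · intro X hX hj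
    exact (hN X hX).div ((hD U X hU hX).mul (hD V X hV hX))
      (mul_ne_zero (qTheta_ne_zero hq0 hq1 (hj 0)) (qTheta_ne_zero hq0 hq1 (hj 1)))
  · intro j
    fin_cases j
    · have h1 := ((hN U hU).div (hD V U hV hU) (qTheta_ne_zero hq0 hq1 hVU)).tendsto
      have h2 := (tendsto_residue_qTheta hq0 hq1 hU).mul (h1.mono_left nhdsWithin_le_nhds)
      simp only [Pi.div_apply, mul_div_cancel_right₀ h hU] at h2
      refine h2.congr fun Y => ?_
      simp only [mbTheta, Fin.zero_eta, Matrix.cons_val_zero]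
      rw [div_eq_mul_inv _ (qTheta (U / Y) q * qTheta (V / Y) q), mul_inv]
      ring
    · have h1 := ((hN V hV).div (hD U V hU hV) (qTheta_ne_zero hq0 hq1 hg.hUV)).tendsto
      have h2 := (tendsto_residue_qTheta hq0 hq1 hV).mul (h1.mono_left nhdsWithin_le_nhds)
      simp only [Pi.div_apply, mul_div_cancel_right₀ h hV] at h2
      refine h2.congr fun Y => ?_
      simp only [mbTheta, Fin.mk_one, Matrix.cons_val_one, Matrix.cons_val_fin_one]
      rw [div_eq_mul_inv _ (qTheta (U / Y) q * qTheta (V / Y) q), mul_inv]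
      ring
  · exact continuousAt_clausenKernel hq1 (by simp [qPochInf_zero])
  · intro j k
    refine continuousAt_clausenKernel hq1 ?_
    fin_cases j
    · exact clausenKernel_denom_ne_zero hq0 hq1 hg.βU hg.Uβ hg.UU k
    · exact clausenKernel_denom_ne_zero hq0 hq1 hg.βV hg.Vβ hg.VV k
  · exact eventually_mbKernel_eq hpq hq1 (by simp [qPochInf_zero]) (by simp [qPochInf_zero])
      (by simp [qPochInf_zero])
  · intro j k
    fin_cases j
    · exact eventually_mbKernel_eq hpq hq1 (hself U hU k) (hchain U V hU hg.hUV k)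
        (hpx U hg.UU k)
    · exact eventually_mbKernel_eq hpq hq1 (hchain V U hV hVU k) (hself V hV k)
        (hpx V hg.VV k)

/-- Each residue is a constant times a Jackson summand. In the denominators, ϑ(V/U) and ϑ(U/V)
contain 1-V/U = (U-V)/U and 1-U/V = -(U-V)/V; hence the opposite signs that turn the two sums into
an integral from V to U. -/
theorem sum_residues_mbKernel (hq0 : q ≠ 0) (hq1 : ‖q‖ < 1) (hg : ClausenGeneric q β U V) :
    ∑ j, ∑' k : ℕ, q ^ k * (mbResidue q h U V j *
        clausenKernel q p β U V ((![U, V] : Fin 2 → ℂ) j * q ^ k)) =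
      qTheta h q * qTheta (h * V / U) q / (qPochInf q q * (qPochInf (β * U) q *
        qPochInf (U / β) q * qPochInf (β * V) q * qPochInf (V / β) q)) *
        clausenIntegral q p β U V := by
  have hU := hg.hU
  have hV := hg.hV
  have hj : ∀ e x : ℂ, x ≠ 0 → ∑' k : ℕ, q ^ k * (e * clausenKernel q p β U V (x * q ^ k)) =
      e / x * jacksonSum q (clausenKernel q p β U V) x := fun e x hx => by
    unfold jacksonSum
    rw [← tsum_mul_left]
    refine tsum_congr fun k => ?_
    field_simp
  rw [Fin.sum_univ_two]
  simp only [mbResidue, Matrix.cons_val_zero, Matrix.cons_val_one]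
  rw [hj _ U hU, hj _ V hV, qTheta_one_sub hq1 (V / U), qTheta_one_sub hq1 (U / V)]
  unfold clausenIntegral clausenConst
  have e1 : q / (V / U) = q * U / V := by rw [div_div_eq_mul_div]
  have e2 : q / (U / V) = q * V / U := by rw [div_div_eq_mul_div]
  rw [e1, e2, ← mul_div_assoc q V U, ← mul_div_assoc q U V]
  have hUV : U - V ≠ 0 := fun h0 => hg.hUV ⟨0, by simp [sub_eq_zero.1 h0, div_self hV]⟩
  have f1 : 1 - V / U = (U - V) / U := by field_simp
  have f2 : 1 - U / V = -((U - V) / V) := by field_simp; ring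
  rw [f1, f2]
  have h0 := qPochInf_ne_zero_of_norm_lt_one hq0 hq1 hq1
  have h1 := qPochInf_ne_zero hq0 hq1 hg.βU
  have h2 := qPochInf_ne_zero hq0 hq1 hg.Uβ
  have h3 := qPochInf_ne_zero hq0 hq1 hg.βV
  have h4 := qPochInf_ne_zero hq0 hq1 hg.Vβ
  have h5 : qPochInf (q * U / V) q ≠ 0 := qPochInf_ne_zero hq0 hq1 fun h' => hg.hUV (by
    refine mul_q_mem_UpsilonSet hq0 ?_
    rw [← mul_div_assoc]; exact mem_UpsilonSet_of_mem_OmegaSet h')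
  have h6 : qPochInf (q * V / U) q ≠ 0 := qPochInf_ne_zero hq0 hq1 fun h' => hg.symm.hUV (by
    refine mul_q_mem_UpsilonSet hq0 ?_
    rw [← mul_div_assoc]; exact mem_UpsilonSet_of_mem_OmegaSet h')
  generalize U - V = D at *
  generalize qPochInf (β * U) q = A1 at *
  generalize qPochInf (U / β) q = A2 at *
  generalize qPochInf (β * V) q = A3 at *
  generalize qPochInf (V / β) q = A4 at *
  generalize qPochInf (q * U / V) q = A5 at *
  generalize qPochInf (q * V / U) q = A6 at *
  generalize qPochInf q q = A7 at *
  generalize qTheta h q = T1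
  generalize qTheta (h * V / U) q = T2
  generalize jacksonSum q (clausenKernel q p β U V) U = J1
  generalize jacksonSum q (clausenKernel q p β U V) V = J2
  field_simp
  ring

theorem differentiableAt_mbKernel (hq1 : ‖q‖ < 1) (hh : h ≠ 0) (hU : U ≠ 0) (hV : V ≠ 0) {X : ℂ}
    (hX : X ≠ 0) (h0 : qPochInf (U / X) q * qPochInf (V / X) q * (qPochInf (β * X) q *
      qPochInf (X / β) q * qPochInf X q * qPochInf (-X) q * qPochInf (-(p * X)) q) ≠ 0) :
    DifferentiableAt ℂ (mbKernel q p β h U V) X := by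
  have hq := differentiable_qPochInf hq1
  have h1 : DifferentiableAt ℂ (fun X => qTheta (h * V / X) q) X :=
    DifferentiableAt.comp X (differentiableAt_qTheta hq1 (div_ne_zero (mul_ne_zero hh hV) hX))
      (by fun_prop (disch := assumption))
  have h2 : DifferentiableAt ℂ (fun X => qTheta (h * X / U) q) X :=
    DifferentiableAt.comp (g := fun y => qTheta y q) X
      (differentiableAt_qTheta hq1 (div_ne_zero (mul_ne_zero hh hX) hU)) (by fun_prop)
  have h3 : ∀ c : ℂ, DifferentiableAt ℂ (fun X => qPochInf (c / X) q) X := fun c =>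
    DifferentiableAt.comp (g := fun y => qPochInf y q) X (hq _) (by fun_prop (disch := assumption))
  have h4 := h3 U
  have h5 := h3 V
  have h6 : ∀ c : ℂ, DifferentiableAt ℂ (fun X => qPochInf (c * X) q) X := fun c => by fun_prop
  have h7 : DifferentiableAt ℂ (fun X => qPochInf (X / β) q) X := by fun_prop
  have h8 : DifferentiableAt ℂ (fun X => qPochInf (-X) q) X := by fun_prop
  have h9 : DifferentiableAt ℂ (fun X => qPochInf (-(p * X)) q) X := by fun_prop
  exact ((h1.mul h2).mul (((h6 p).mul (h6 U)).mul (h6 V))).div ((h4.mul h5).mul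
    (((((h6 β).mul h7).mul (hq X)).mul h8).mul h9)) h0

/-- The contour integral in the generic case. -/
theorem circleIntegral_mbKernel_of_generic (hpq : p ^ 2 = q) (hp : p ≠ 0) (hq1 : ‖q‖ < 1)
    (hh : h ≠ 0) (hg : ClausenGeneric q β U V) {ρ : ℝ} (hρ : 0 < ρ) (hU : ‖U‖ < ρ) (hV : ‖V‖ < ρ)
    (hβ : ‖β‖ * ρ < 1) (hβ' : ρ / ‖β‖ < 1) (hρ1 : ρ < 1) (hpV : p * V ∉ OmegaSet q) :
    ∮ X in C(0, ρ), mbKernel q p β h U V X / X = 2 * Real.pi * Complex.I *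
      (qTheta h q * qTheta (h * V / U) q / (qPochInf q q * (qPochInf (β * U) q *
        qPochInf (U / β) q * qPochInf (β * V) q * qPochInf (V / β) q)) *
        clausenSeries q p β U V ^ 2) := by
  have hq0 : q ≠ 0 := by rw [← hpq]; exact pow_ne_zero 2 hp
  have hp1 : ‖p‖ < 1 := by
    have : ‖p‖ ^ 2 < 1 := by rw [← norm_pow, hpq]; exact hq1
    exact (sq_lt_one_iff₀ (norm_nonneg _)).1 this
  have hz : ‖U / β‖ < 1 := by
    rw [norm_div]
    exact (div_le_div_of_nonneg_right hU.le (norm_nonneg _)).trans_lt hβ'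
  rw [(chainData_mbKernel (p := p) hpq hq0 hq1 hh hg).circleIntegral_eq hq0 hq1 hρ ?_ ?_,
    sum_residues_mbKernel hq0 hq1 hg, ← clausenSeries_sq hpq hp hq1 hg hz hpV]
  · intro j; fin_cases j; exacts [hU, hV]
  · intro X hX hXρ hne
    have hX1 : ‖X‖ < 1 := hXρ.trans_lt hρ1
    have hout : ∀ y : ℂ, ‖y‖ < 1 → qPochInf y q ≠ 0 := fun y hy =>
      qPochInf_ne_zero_of_norm_lt_one hq0 hq1 hy
    have hin : ∀ c : ℂ, (∀ k : ℕ, X ≠ c * q ^ k) → qPochInf (c / X) q ≠ 0 := fun c hc => by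
      refine qPochInf_ne_zero hq0 hq1 fun h0 => ?_
      obtain ⟨k, hk⟩ := (mem_OmegaSet_iff hq0).1 h0
      apply hc k
      rw [div_mul_eq_mul_div, div_eq_one_iff_eq hX] at hk
      exact hk.symm
    refine (differentiableAt_mbKernel hq1 hh hg.hU hg.hV hX ?_).div differentiableAt_id hX
    refine mul_ne_zero (mul_ne_zero (hin U (hne 0)) (hin V (hne 1))) (mul_ne_zero (mul_ne_zero
      (mul_ne_zero (mul_ne_zero (hout _ ?_) (hout _ ?_)) (hout _ hX1)) (hout _ ?_)) (hout _ ?_))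
    · rw [norm_mul]
      exact (mul_le_mul_of_nonneg_left hXρ (norm_nonneg _)).trans_lt hβ
    · rw [norm_div]
      exact (div_le_div_of_nonneg_right hXρ (norm_nonneg _)).trans_lt hβ'
    · rwa [norm_neg]
    · rw [norm_neg, norm_mul]
      exact (mul_le_of_le_one_left (norm_nonneg _) hp1.le).trans_lt hX1

end MellinBarnes

/-! ### The contour integral for all admissible parameters; formula (1). -/

section MellinBarnesIntegral

variable {q p β h U V : ℂ}

theorem continuousAt_clausenSeries {X : Type*} [TopologicalSpace X] {x₀ : X} (hq0 : q ≠ 0)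
    (hq1 : ‖q‖ < 1) {f g : X → ℂ} (hf : ContinuousAt f x₀) (hg : ContinuousAt g x₀)
    (hz : ‖f x₀ / β‖ < 1) (hc : p * g x₀ ∉ OmegaSet q) :
    ContinuousAt (fun x => clausenSeries q p β (f x) (g x)) x₀ := by
  have hq := continuous_qPochInf hq1
  have h1 : ContinuousAt (fun x => β * g x) x₀ := by fun_prop
  have h2 : ContinuousAt (fun x => p * g x) x₀ := by fun_prop
  have h3 : ContinuousAt (fun x => f x / β) x₀ := by fun_prop
  have h4 : ContinuousAt (fun x => qHyp [β * g x, β * p] [p * g x] q (f x / β)) x₀ :=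
    continuousAt_qHyp hq0 hq1 [fun x => β * g x, fun _ => β * p] [fun x => p * g x]
      (fun x => f x / β) rfl (by simp [h1, continuousAt_const]) (by simp [h2]) (by simpa using hc)
      h3 hz
  exact ((hq.continuousAt.comp h3).mul (hq.continuousAt.comp h2)).mul h4

theorem Continuous.qTheta {X : Type*} [TopologicalSpace X] {f : X → ℂ}
    (hf : Continuous f) (hq1 : ‖q‖ < 1) (h0 : ∀ x, f x ≠ 0) :
    Continuous fun y => qTheta (f y) q :=
  continuous_iff_continuousAt.2 fun x => hf.continuousAt.qTheta hq1 (h0 x)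

/-- V is a function of the point as well, so that the contour integral can be shown continuous along
a deformation of V. -/
theorem continuous_mbKernel {Z : Type*} [TopologicalSpace Z] (hq0 : q ≠ 0) (hq1 : ‖q‖ < 1)
    (hh : h ≠ 0) (hU : U ≠ 0) {v x : Z → ℂ} (hv : Continuous v) (hx : Continuous x)
    (hv0 : ∀ y, v y ≠ 0) (hx0 : ∀ y, x y ≠ 0) (hUx : ∀ y, ‖U / x y‖ < 1)
    (hvx : ∀ y, ‖v y / x y‖ < 1) (hβ : ∀ y, ‖β * x y‖ < 1) (hβ' : ∀ y, ‖x y / β‖ < 1)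
    (hx1 : ∀ y, ‖x y‖ < 1) (hpx : ∀ y, ‖p * x y‖ < 1) :
    Continuous fun y => mbKernel q p β h U (v y) (x y) := by
  have hq := continuous_qPochInf hq1
  have hne : ∀ y : ℂ, ‖y‖ < 1 → qPochInf y q ≠ 0 := fun y hy =>
    qPochInf_ne_zero_of_norm_lt_one hq0 hq1 hy
  have h1 : Continuous fun y => qTheta (h * v y / x y) q :=
    Continuous.qTheta (by fun_prop (disch := assumption)) hq1 fun y =>
      div_ne_zero (mul_ne_zero hh (hv0 y)) (hx0 y)
  have h2 : Continuous fun y => qTheta (h * x y / U) q :=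
    Continuous.qTheta (by fun_prop) hq1 fun y => div_ne_zero (mul_ne_zero hh (hx0 y)) hU
  have h3 : Continuous fun y => qPochInf (U / x y) q :=
    hq.comp (by fun_prop (disch := assumption))
  have h4 : Continuous fun y => qPochInf (v y / x y) q :=
    hq.comp (by fun_prop (disch := assumption))
  unfold mbKernel
  refine Continuous.div ?_ ?_ fun y => ?_
  · exact (h1.mul h2).mul (by fun_prop)
  · exact (h3.mul h4).mul (by fun_prop)
  · refine mul_ne_zero (mul_ne_zero (hne _ (hUx y)) (hne _ (hvx y))) (mul_ne_zero (mul_ne_zero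
      (mul_ne_zero (mul_ne_zero (hne _ (hβ y)) (hne _ (hβ' y))) (hne _ (hx1 y))) (hne _ ?_))
      (hne _ ?_))
    · rw [norm_neg]; exact hx1 y
    · rw [norm_neg]; exact hpx y

/-- The contour integral of `mbKernel`. -/
theorem circleIntegral_mbKernel (hpq : p ^ 2 = q) (hp : p ≠ 0) (hq1 : ‖q‖ < 1)
    (hh : h ≠ 0) (hβ0 : β ≠ 0) (hU0 : U ≠ 0) (hV0 : V ≠ 0) {ρ : ℝ} (hρ : 0 < ρ) (hU : ‖U‖ < ρ)
    (hV : ‖V‖ < ρ) (hβ : ‖β‖ * ρ < 1) (hβ' : ρ / ‖β‖ < 1) (hρ1 : ρ < 1) :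
    ∮ X in C(0, ρ), mbKernel q p β h U V X / X = 2 * Real.pi * Complex.I *
      (qTheta h q * qTheta (h * V / U) q / (qPochInf q q * (qPochInf (β * U) q *
        qPochInf (U / β) q * qPochInf (β * V) q * qPochInf (V / β) q)) *
        clausenSeries q p β U V ^ 2) := by
  have hq0 : q ≠ 0 := by rw [← hpq]; exact pow_ne_zero 2 hp
  have hp1 : ‖p‖ < 1 := by
    have : ‖p‖ ^ 2 < 1 := by rw [← norm_pow, hpq]; exact hq1
    exact (sq_lt_one_iff₀ (norm_nonneg _)).1 this
  have hmulβ : ∀ y : ℂ, ‖y‖ ≤ ρ → ‖β * y‖ < 1 := fun y hy => by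
    rw [norm_mul]
    exact (mul_le_mul_of_nonneg_left hy (norm_nonneg _)).trans_lt hβ
  have hdivβ : ∀ y : ℂ, ‖y‖ ≤ ρ → ‖y / β‖ < 1 := fun y hy => by
    rw [norm_div]
    exact (div_le_div_of_nonneg_right hy (norm_nonneg _)).trans_lt hβ'
  have hmul1 : ∀ x y : ℂ, ‖x‖ < 1 → ‖y‖ < 1 → ‖x * y‖ < 1 := fun x y hx hy => by
    rw [norm_mul]; exact mul_lt_one_of_nonneg_of_lt_one_left (norm_nonneg _) hx hy.le
  have hΩ : ∀ y : ℂ, ‖y‖ < 1 → y ∉ OmegaSet q := fun y hy =>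
    notMem_OmegaSet_of_norm_lt_one hq0 hq1 hy
  -- Only the coincidence U/V ∈ Υ_q has to be avoided. The factor e^{-|x|} moves V inward, so every
  -- inequality on ‖V‖ is preserved.
  let v : ℝ → ℂ := fun x => V * Complex.exp ((-|x| : ℝ) : ℂ)
  have hv : Continuous v := by fun_prop
  have hv0 : ∀ x, v x ≠ 0 := fun x => mul_ne_zero hV0 (Complex.exp_ne_zero _)
  have hvn : ∀ x, ‖v x‖ < ρ := fun x => by
    refine lt_of_le_of_lt ?_ hV
    simp only [v]
    rw [norm_mul, Complex.norm_exp, Complex.ofReal_re]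
    exact mul_le_of_le_one_right (norm_nonneg _) (Real.exp_le_one_iff.2 (by simp))
  have hvΩ : ∀ x, p * v x ∉ OmegaSet q := fun x => hΩ _ (hmul1 _ _ hp1 ((hvn x).trans hρ1))
  let F : ℝ → ℂ := fun x => ∮ X in C(0, ρ), mbKernel q p β h U (v x) X / X
  let G : ℝ → ℂ := fun x => 2 * Real.pi * Complex.I *
      (qTheta h q * qTheta (h * v x / U) q / (qPochInf q q * (qPochInf (β * U) q *
        qPochInf (U / β) q * qPochInf (β * v x) q * qPochInf (v x / β) q)) *
        clausenSeries q p β U (v x) ^ 2)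
  have hne : ∀ y : ℂ, ‖y‖ < 1 → qPochInf y q ≠ 0 := fun y hy =>
    qPochInf_ne_zero_of_norm_lt_one hq0 hq1 hy
  have hF : Continuous F := by
    have hx : Continuous fun y : ℝ × ℝ => circleMap 0 ρ y.2 :=
      (continuous_circleMap 0 ρ).comp continuous_snd
    have hxn : ∀ y : ℝ × ℝ, ‖circleMap 0 ρ y.2‖ = ρ := fun y => by
      rw [norm_circleMap_zero, abs_of_pos hρ]
    have hx0 : ∀ y : ℝ × ℝ, circleMap 0 ρ y.2 ≠ 0 := fun y => circleMap_ne_center hρ.ne'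
    have hk := continuous_mbKernel (p := p) (β := β) hq0 hq1 hh hU0 (hv.comp continuous_fst) hx
      (fun y => hv0 _) hx0
      (fun y => by rw [norm_div, hxn, div_lt_one hρ]; exact hU)
      (fun y => by rw [norm_div, hxn, div_lt_one hρ]; exact hvn _)
      (fun y => hmulβ _ (hxn y).le) (fun y => hdivβ _ (hxn y).le)
      (fun y => (hxn y).trans_lt hρ1) (fun y => hmul1 _ _ hp1 ((hxn y).trans_lt hρ1))
    simp only [F, circleIntegral]
    refine intervalIntegral.continuous_parametric_intervalIntegral_of_continuous' ?_ _ _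
    simp only [Function.uncurry_def, deriv_circleMap, smul_eq_mul]
    exact (hx.mul continuous_const).mul (hk.div hx hx0)
  have hG : ContinuousAt G 0 := by
    have hq := continuous_qPochInf hq1
    have h1 := continuousAt_clausenSeries (p := p) (β := β) (f := fun _ => U) (x₀ := (0 : ℝ)) hq0
      hq1 continuousAt_const hv.continuousAt (hdivβ _ hU.le) (hvΩ 0)
    have h2 : ContinuousAt (fun x => qTheta (h * v x / U) q) 0 :=
      ContinuousAt.qTheta (by fun_prop) hq1 (div_ne_zero (mul_ne_zero hh (hv0 0)) hU0)
    have h3 : ContinuousAt (fun x => qPochInf q q * (qPochInf (β * U) q *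
        qPochInf (U / β) q * qPochInf (β * v x) q * qPochInf (v x / β) q)) 0 :=
      Continuous.continuousAt (by fun_prop)
    refine continuousAt_const.mul (((continuousAt_const.mul h2).div h3 ?_).mul (h1.pow 2))
    exact mul_ne_zero (hne _ hq1) (mul_ne_zero (mul_ne_zero (mul_ne_zero (hne _ (hmulβ _ hU.le))
      (hne _ (hdivβ _ hU.le))) (hne _ (hmulβ _ (hvn 0).le))) (hne _ (hdivβ _ (hvn 0).le)))
  have hUV0 : U / V ≠ 0 := div_ne_zero hU0 hV0
  have key := eq_of_eq_off_countable (F := F) (G := G) (x₀ := 0) hF.continuousAt hG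
    ((countable_setOf_exp_mem_UpsilonSet (q := q) (U / V) 1 hUV0 one_ne_zero).union
      (countable_setOf_exp_mem_UpsilonSet (q := q) (U / V) (-1) hUV0 (by norm_num)))
    (Eventually.of_forall fun x hx => ?_)
  · simpa [F, G, v] using key
  · have hUv : U / v x ∉ UpsilonSet q := fun h0 => hx (by
      have e : U / v x = U / V * Complex.exp ((|x| : ℝ) : ℂ) := by
        simp only [v]
        rw [Complex.ofReal_neg, Complex.exp_neg]
        have := Complex.exp_ne_zero ((|x| : ℝ) : ℂ)
        field_simp
      rw [e] at h0
      rcases abs_cases x with ⟨h1, -⟩ | ⟨h1, -⟩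
      · left; show _ ∈ UpsilonSet q; rwa [one_mul, ← h1]
      · right; show _ ∈ UpsilonSet q; rwa [neg_one_mul, ← h1])
    have hg : ClausenGeneric q β U (v x) :=
      ⟨hβ0, hU0, hv0 x, hΩ _ (hmulβ _ hU.le), hΩ _ (hdivβ _ hU.le), hΩ _ (hmulβ _ (hvn x).le),
        hΩ _ (hdivβ _ (hvn x).le), hΩ _ (by rw [sq]; exact hmul1 _ _ (hU.trans hρ1) (hU.trans hρ1)),
        hΩ _ (by rw [sq]; exact hmul1 _ _ ((hvn x).trans hρ1) ((hvn x).trans hρ1)),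
        hΩ _ (hmul1 _ _ (hU.trans hρ1) ((hvn x).trans hρ1)), hUv⟩
    exact circleIntegral_mbKernel_of_generic hpq hp hq1 hh hg hρ hU (hvn x) hβ hβ' hρ1 (hvΩ x)

/-- The argument of τ only shifts the starting angle, which is immaterial by 2π-periodicity. -/
theorem integral_circle_rotate {G : ℂ → ℂ} {τ : ℂ} (hτ : τ ≠ 0) :
    ∫ ψ in (-Real.pi)..Real.pi, G (τ * Complex.exp (Complex.I * (ψ : ℂ))) =
      -Complex.I * ∮ X in C(0, ‖τ‖), G X / X := by
  set H : ℝ → ℂ := fun θ => G (circleMap 0 ‖τ‖ θ) with hH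
  have hper : Function.Periodic H (2 * Real.pi) := fun θ => by
    simp only [hH]
    rw [periodic_circleMap]
  have h1 : ∀ ψ : ℝ, G (τ * Complex.exp (Complex.I * (ψ : ℂ))) = H (ψ + τ.arg) := fun ψ => by
    simp only [hH, circleMap, zero_add]
    congr 1
    conv_lhs => rw [← Complex.norm_mul_exp_arg_mul_I τ]
    rw [mul_assoc, ← Complex.exp_add]
    congr 2
    push_cast; ring
  have h2 : ∮ X in C(0, ‖τ‖), G X / X = Complex.I * ∫ θ in 0..2 * Real.pi, H θ := by
    rw [circleIntegral, ← intervalIntegral.integral_const_mul]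
    refine intervalIntegral.integral_congr fun θ _ => ?_
    have : circleMap 0 ‖τ‖ θ ≠ 0 := circleMap_ne_center (norm_ne_zero_iff.2 hτ)
    simp only [deriv_circleMap, smul_eq_mul, hH]
    field_simp
  rw [h2, ← mul_assoc, neg_mul, Complex.I_mul_I, neg_neg, one_mul]
  simp_rw [h1]
  rw [intervalIntegral.integral_comp_add_right]
  have h3 := hper.intervalIntegral_add_eq (-Real.pi + τ.arg) 0
  rw [zero_add] at h3
  rw [← h3]
  congr 1
  ring

/-- The dictionary is X = (t/σ)w, p = sz/t, β = bt/(sz), U = bt/s, V = st/b. Each pair of numerator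
factors containing h forms one theta function. -/
theorem mbIntegrand_eq (hq0 : q ≠ 0) {z a b s t : ℂ} {σ : ℝ} (hz : z ≠ 0)
    (hb : b ≠ 0) (hh : h ≠ 0) (hσ : σ ≠ 0) (hs : s ≠ 0) (ht : t ≠ 0)
    (hs2 : s ^ 2 = q * a / z) (ht2 : t ^ 2 = a * z) (ψ : ℝ) :
    mbIntegrand a b h q z s t σ ψ =
      mbKernel q (s * z / t) (b * t / (s * z)) h (b * t / s) (s * t / b)
        (t / σ * Complex.exp (Complex.I * (ψ : ℂ))) := by
  unfold mbIntegrand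
  have hw := Complex.exp_ne_zero (Complex.I * (ψ : ℂ))
  have hσ' : (σ : ℂ) ≠ 0 := by exact_mod_cast hσ
  simp only [qPochInfL, List.map_cons, List.map_nil, List.prod_cons, List.prod_nil, mul_one,
    mbKernel, qTheta]
  generalize Complex.exp (Complex.I * (ψ : ℂ)) = w at *
  have ha : a = s ^ 2 * z / q := by rw [hs2]; field_simp
  have ht3 : t ^ 2 = s ^ 2 * z ^ 2 / q := by rw [ht2, ha]; ring
  have e1 : h * (s * t / b) / (t / σ * w) = h * s / b * (σ / w) := by field_simp
  have e2 : q / (h * s / b * (σ / w)) = q * b / (h * s) * (w / σ) := by field_simp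
  have e3 : h * (t / σ * w) / (b * t / s) = h * s / b * (w / σ) := by field_simp
  have e4 : q / (h * s / b * (w / σ)) = q * b / (h * s) * (σ / w) := by field_simp
  have e5 : s * z / t * (t / σ * w) = s * z * (w / σ) := by field_simp
  have e6 : b * t / s * (t / σ * w) = b * (s * z ^ 2 / q) * (w / σ) := by
    rw [show b * t / s * (t / σ * w) = b * t ^ 2 / s * (w / σ) by field_simp, ht3]; field_simp
  have e7 : s * t / b * (t / σ * w) = a * s * z / b * (w / σ) := by
    rw [show s * t / b * (t / σ * w) = s * t ^ 2 / b * (w / σ) by field_simp, ht2]; field_simp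
  have e8 : b * t / s / (t / σ * w) = b / s * (σ / w) := by field_simp
  have e9 : s * t / b / (t / σ * w) = s / b * (σ / w) := by field_simp
  have e10 : b * t / (s * z) * (t / σ * w) = b * (s * z / q) * (w / σ) := by
    rw [show b * t / (s * z) * (t / σ * w) = b * t ^ 2 / (s * z) * (w / σ) by field_simp, ht3]
    field_simp
  have e11 : t / σ * w / (b * t / (s * z)) = s * z / b * (w / σ) := by field_simp
  have e12 : t / σ * w = t * (w / σ) := by field_simp
  have e13 : -(s * z * (w / σ)) = -(s * z) * (w / σ) := by ring
  have e14 : -(t * (w / σ)) = -t * (w / σ) := by ring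
  rw [e1, e2, e3, e4, e5, e6, e7, e8, e9, e10, e11, e12, e13, e14]
  congr 1 <;> ring

/-- The integral representation of the square. -/
theorem integral_mbIntegrand (hq0 : q ≠ 0) (hq1 : ‖q‖ < 1) {z a b s t : ℂ} {σ : ℝ} (hz : z ≠ 0)
    (ha : a ≠ 0) (hb : b ≠ 0) (hh : h ≠ 0) (hσ : 0 < σ)
    (hs2 : s ^ 2 = q * a / z) (ht2 : t ^ 2 = a * z) (h1 : ‖b / s‖ * σ < 1) (h2 : ‖s / b‖ * σ < 1)
    (h3 : ‖b * (s * z / q)‖ < σ) (h4 : ‖t‖ < σ) (h5 : ‖s * z / b‖ < σ) :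
    IntervalIntegrable (mbIntegrand a b h q z s t σ) MeasureTheory.volume (-Real.pi) Real.pi ∧
      ∫ ψ in (-Real.pi)..Real.pi, mbIntegrand a b h q z s t σ ψ =
        2 * (Real.pi : ℂ) * qThetaL [h, h * (q * a / (b ^ 2 * z))] q *
            qPochInfL [z, q * a / b, q * a / b] q /
          qPochInfL [q, a, q * a / b ^ 2, b ^ 2 * z / q] q *
          qHyp [a, b] [q * a / b] q z ^ 2 := by
  have hs : s ≠ 0 := fun h0 => by
    rw [h0] at hs2
    exact div_ne_zero (mul_ne_zero hq0 ha) hz (by rw [← hs2]; simp)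
  have ht : t ≠ 0 := fun h0 => by
    rw [h0] at ht2
    exact mul_ne_zero ha hz (by rw [← ht2]; simp)
  have hσ' : (σ : ℂ) ≠ 0 := by exact_mod_cast hσ.ne'
  have has : a = s ^ 2 * z / q := by rw [hs2]; field_simp
  have hts : t ^ 2 = s ^ 2 * z ^ 2 / q := by rw [ht2, has]; ring
  -- The choices of s and t determine which square root of q serves as p.
  have hpq : (s * z / t) ^ 2 = q := by
    rw [div_pow, hts]; field_simp
  have hp : s * z / t ≠ 0 := div_ne_zero (mul_ne_zero hs hz) ht
  have hτ : t / σ ≠ 0 := div_ne_zero ht hσ'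
  have hσn : ‖(σ : ℂ)‖ = σ := by rw [Complex.norm_real, Real.norm_of_nonneg hσ.le]
  have hτn : ‖t / σ‖ = ‖t‖ / σ := by rw [norm_div, hσn]
  have ht0 : 0 < ‖t‖ := norm_pos_iff.2 ht
  have hρ : 0 < ‖t / (σ : ℂ)‖ := norm_pos_iff.2 hτ
  have hUn : ‖b * t / s‖ < ‖t / (σ : ℂ)‖ := by
    rw [hτn, lt_div_iff₀ hσ, show b * t / s = b / s * t by ring, norm_mul, mul_right_comm]
    exact mul_lt_of_lt_one_left ht0 h1
  have hVn : ‖s * t / b‖ < ‖t / (σ : ℂ)‖ := by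
    rw [hτn, lt_div_iff₀ hσ, show s * t / b = s / b * t by ring, norm_mul, mul_right_comm]
    exact mul_lt_of_lt_one_left ht0 h2
  have hβ : ‖b * t / (s * z)‖ * ‖t / (σ : ℂ)‖ < 1 := by
    rw [hτn, ← mul_div_assoc, ← norm_mul, div_lt_one hσ]
    rwa [show b * t / (s * z) * t = b * t ^ 2 / (s * z) by ring, hts,
      show b * (s ^ 2 * z ^ 2 / q) / (s * z) = b * (s * z / q) by field_simp]
  have hβ' : ‖t / (σ : ℂ)‖ / ‖b * t / (s * z)‖ < 1 := by
    rw [hτn, div_right_comm, ← norm_div, div_lt_one hσ]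
    rwa [show t / (b * t / (s * z)) = s * z / b by field_simp]
  have hρ1 : ‖t / (σ : ℂ)‖ < 1 := by rwa [hτn, div_lt_one hσ]
  have hfun : mbIntegrand a b h q z s t σ = fun ψ : ℝ =>
      mbKernel q (s * z / t) (b * t / (s * z)) h (b * t / s) (s * t / b)
        (t / σ * Complex.exp (Complex.I * (ψ : ℂ))) :=
    funext fun ψ => mbIntegrand_eq hq0 hz hb hh hσ.ne' hs ht hs2 ht2 ψ
  have hp1 : ‖s * z / t‖ < 1 := by
    have : ‖s * z / t‖ ^ 2 < 1 := by rw [← norm_pow, hpq]; exact hq1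
    exact (sq_lt_one_iff₀ (norm_nonneg _)).1 this
  refine ⟨?_, ?_⟩
  · rw [hfun]
    have hxn : ∀ ψ : ℝ, ‖t / σ * Complex.exp (Complex.I * (ψ : ℂ))‖ = ‖t / (σ : ℂ)‖ := fun ψ => by
      rw [norm_mul, mul_comm Complex.I, Complex.norm_exp_ofReal_mul_I, mul_one]
    refine (continuous_mbKernel hq0 hq1 hh (div_ne_zero (mul_ne_zero hb ht) hs) continuous_const
      (by fun_prop) (fun _ => div_ne_zero (mul_ne_zero hs ht) hb)
      (fun _ => mul_ne_zero hτ (Complex.exp_ne_zero _)) ?_ ?_ ?_ ?_ ?_ ?_).intervalIntegrable _ _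
      <;> intro ψ
    · rwa [norm_div, hxn, div_lt_one hρ]
    · rwa [norm_div, hxn, div_lt_one hρ]
    · rwa [norm_mul, hxn]
    · rwa [norm_div, hxn]
    · rwa [hxn]
    · rw [norm_mul, hxn]
      exact mul_lt_one_of_nonneg_of_lt_one_left (norm_nonneg _) hp1 hρ1.le
  · rw [hfun, integral_circle_rotate (G := mbKernel q (s * z / t) (b * t / (s * z)) h (b * t / s)
      (s * t / b)) hτ, circleIntegral_mbKernel hpq hp hq1 hh (div_ne_zero (mul_ne_zero hb ht)
      (mul_ne_zero hs hz)) (div_ne_zero (mul_ne_zero hb ht) hs) (div_ne_zero (mul_ne_zero hs ht) hb)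
      hρ hUn hVn hβ hβ' hρ1]
    have e1 : b * t / s / (b * t / (s * z)) = z := by field_simp
    have e2 : s * z / t * (s * t / b) = q * a / b := by rw [has]; field_simp
    have e3 : b * t / (s * z) * (s * t / b) = a := by
      rw [show b * t / (s * z) * (s * t / b) = t ^ 2 / z by field_simp, ht2]; field_simp
    have e4 : b * t / (s * z) * (s * z / t) = b := by field_simp
    have e5 : b * t / (s * z) * (b * t / s) = b ^ 2 * z / q := by
      rw [show b * t / (s * z) * (b * t / s) = b ^ 2 * t ^ 2 / (s ^ 2 * z) by field_simp, hts]
      field_simp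
    have e6 : s * t / b / (b * t / (s * z)) = q * a / b ^ 2 := by rw [has]; field_simp
    have e7 : h * (s * t / b) / (b * t / s) = h * (q * a / (b ^ 2 * z)) := by rw [has]; field_simp
    have hz1 : ‖z‖ < 1 := by
      rw [← e1, norm_div]
      exact (div_le_div_of_nonneg_right hUn.le (norm_nonneg _)).trans_lt hβ'
    have hz0 := qPochInf_ne_zero_of_norm_lt_one hq0 hq1 hz1
    unfold clausenSeries
    rw [e1, e2, e3, e4, e5, e6, e7]
    simp only [qThetaL, qPochInfL, List.map_cons, List.map_nil, List.prod_cons, List.prod_nil,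
      mul_one]
    generalize qHyp [a, b] [q * a / b] q z = φ
    generalize qPochInf (b ^ 2 * z / q) q = A1
    generalize qPochInf (q * a / b ^ 2) q = A2
    generalize qPochInf (q * a / b) q = A3
    generalize qPochInf q q = A4
    generalize qPochInf a q = A5
    generalize qPochInf z q = A6 at *
    generalize qTheta h q = T1
    generalize qTheta (h * (q * a / (b ^ 2 * z))) q = T2
    have hc : A4 * (A1 * A6 * A5 * A2) = A4 * (A5 * (A2 * A1)) * A6 := by ring
    have hI : -Complex.I * Complex.I = 1 := by rw [neg_mul, Complex.I_mul_I, neg_neg]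
    rw [hc, show -Complex.I * (2 * Real.pi * Complex.I * (T1 * T2 / (A4 * (A5 * (A2 * A1)) * A6) *
      (A6 * A3 * φ) ^ 2)) = (-Complex.I * Complex.I) * (2 * Real.pi * (T1 * T2 /
      (A4 * (A5 * (A2 * A1)) * A6) * (A6 * A3 * φ) ^ 2)) by ring, hI]
    generalize A4 * (A5 * (A2 * A1)) = D
    rw [div_mul_eq_div_div]
    field_simp

end MellinBarnesIntegral

/-! ### The five chains of poles running to infinity. -/

section OuterPoles

variable {q p β h U V : ℂ}

/-- Up to powers of `q`, the inverses of the poles of `mbKernel` which accumulate at infinity. -/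
noncomputable def mbPole (p β : ℂ) : Fin 5 → ℂ := ![β, 1 / β, 1, -1, -p]

/-- The theta factors in the numerator of `mbKernel` at `Y⁻¹`. -/
noncomputable def outerNum (q p h U V Y : ℂ) : ℂ :=
  qTheta (h * V * Y) q * qTheta (h / (U * Y)) q *
    (qTheta (p / Y) q * qTheta (U / Y) q * qTheta (V / Y) q)

/-- The quasi-periodic part of `mbKernel` at `Y⁻¹`. -/
noncomputable def outerTheta (q p β h U V Y : ℂ) : ℂ :=
  outerNum q p h U V Y / ∏ j, qTheta (mbPole p β j / Y) q

/-- The remaining part of `mbKernel` at `Y⁻¹`. -/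
noncomputable def outerKernel (q p β U V Y : ℂ) : ℂ :=
  (∏ j, qPochInf (q * Y / mbPole p β j) q) / (qPochInf (q * Y / p) q * qPochInf (q * Y / U) q *
    qPochInf (q * Y / V) q * qPochInf (U * Y) q * qPochInf (V * Y) q)

/-- The residues of `outerTheta`. -/
noncomputable def outerResidue (q p β h U V : ℂ) (j : Fin 5) : ℂ :=
  (qPochInf q q ^ 2)⁻¹ * (outerNum q p h U V (mbPole p β j) /
    ∏ i ∈ Finset.univ.erase j, qTheta (mbPole p β i / mbPole p β j) q)

theorem mbPole_ne_zero (hp : p ≠ 0) (hβ : β ≠ 0) (j : Fin 5) : mbPole p β j ≠ 0 := by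
  fin_cases j <;> simp [mbPole, hp, hβ]

/-- Genericity of the parameters with respect to the outer poles. -/
structure OuterGeneric (q p β U V : ℂ) : Prop where
  pole : ∀ i j, i ≠ j → mbPole p β i / mbPole p β j ∉ UpsilonSet q
  p_notMem : ∀ j, q * mbPole p β j / p ∉ OmegaSet q
  U_notMem : ∀ j, q * mbPole p β j / U ∉ OmegaSet q
  V_notMem : ∀ j, q * mbPole p β j / V ∉ OmegaSet q
  Ud : ∀ j, U * mbPole p β j ∉ OmegaSet q
  Vd : ∀ j, V * mbPole p β j ∉ OmegaSet q

/-- Each factor (c/Y;q)_∞ becomes ϑ(c/Y)/(qY/c;q)_∞: five of them in the denominator, from the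
poles, and three in the numerator, from p, U and V. -/
theorem mbKernel_inv_eq {Y : ℂ}
    (hd : ∏ j, qPochInf (q * Y / mbPole p β j) q ≠ 0)
    (hp : qPochInf (q * Y / p) q ≠ 0) (hU : qPochInf (q * Y / U) q ≠ 0)
    (hV : qPochInf (q * Y / V) q ≠ 0) :
    mbKernel q p β h U V Y⁻¹ = outerTheta q p β h U V Y * outerKernel q p β U V Y := by
  have hθ : ∀ c, qTheta (c / Y) q = qPochInf (c / Y) q * qPochInf (q * Y / c) q := fun c => by
    rw [qTheta, div_div_eq_mul_div]
  have e0 : mbKernel q p β h U V Y⁻¹ = qTheta (h * V * Y) q * qTheta (h / (U * Y)) q *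
      (qPochInf (p / Y) q * qPochInf (U / Y) q * qPochInf (V / Y) q) /
      (qPochInf (U * Y) q * qPochInf (V * Y) q * ∏ j, qPochInf (mbPole p β j / Y) q) := by
    unfold mbKernel
    rw [Fin.prod_univ_five]
    simp only [mbPole, Matrix.cons_val]
    rw [div_inv_eq_mul, div_inv_eq_mul, div_inv_eq_mul, ← div_eq_mul_inv, ← div_eq_mul_inv,
      ← div_eq_mul_inv, ← div_eq_mul_inv, ← div_eq_mul_inv, div_div, mul_comm Y U,
      show Y⁻¹ / β = 1 / β / Y by ring, show Y⁻¹ = 1 / Y by ring, show -(1 / Y) = -1 / Y by ring,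
      show -(p / Y) = -p / Y by ring]
  rw [e0]
  unfold outerTheta outerKernel outerNum
  simp only [hθ, Finset.prod_mul_distrib]
  generalize ∏ j, qPochInf (q * Y / mbPole p β j) q = D at *
  generalize ∏ j, qPochInf (mbPole p β j / Y) q = D'
  rw [div_mul_div_comm, ← mul_div_mul_right _ _ (mul_ne_zero hd (mul_ne_zero (mul_ne_zero hp hU)
    hV))]
  congr 1 <;> ring

/-- The five poles multiply to p. The multiplier is therefore -p/(Y⁵q⁴) for the numerator and
-p/(Y⁵q⁵) for the denominator, with quotient q as for the inner chains. -/
theorem outerTheta_mul_q (hq0 : q ≠ 0) (hq1 : ‖q‖ < 1) (hp : p ≠ 0) (hβ : β ≠ 0) (hh : h ≠ 0)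
    (hU : U ≠ 0) (hV : V ≠ 0) {Y : ℂ} (hY : Y ≠ 0) :
    outerTheta q p β h U V (Y * q) = q * outerTheta q p β h U V Y := by
  have e : ∀ c : ℂ, c ≠ 0 → qTheta (c / (Y * q)) q = -(c / Y / q) * qTheta (c / Y) q :=
    fun c hc => by
      rw [← div_div]; exact qTheta_div_q hq0 hq1 (div_ne_zero hc hY)
  have e1 : qTheta (h * V * (Y * q)) q = -(h * V * Y)⁻¹ * qTheta (h * V * Y) q := by
    rw [← mul_assoc]; exact qTheta_mul_q hq0 hq1 (mul_ne_zero (mul_ne_zero hh hV) hY)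
  have e2 : qTheta (h / (U * (Y * q))) q = -(h / (U * Y) / q) * qTheta (h / (U * Y)) q := by
    rw [← mul_assoc, ← div_div h]
    exact qTheta_div_q hq0 hq1 (div_ne_zero hh (mul_ne_zero hU hY))
  unfold outerTheta outerNum
  rw [Finset.prod_congr rfl fun j _ => e _ (mbPole_ne_zero hp hβ j), Finset.prod_mul_distrib, e1,
    e2, e p hp, e U hU, e V hV]
  have e3 : ∏ j, -(mbPole p β j / Y / q) = -p / (Y ^ 5 * q ^ 5) := by
    rw [Fin.prod_univ_five]
    simp only [mbPole, Matrix.cons_val]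
    field_simp
  rw [e3]
  generalize ∏ j, qTheta (mbPole p β j / Y) q = D
  generalize qTheta (h * V * Y) q = a
  generalize qTheta (h / (U * Y)) q = b
  generalize qTheta (p / Y) q = c
  generalize qTheta (U / Y) q = d
  generalize qTheta (V / Y) q = g
  field_simp

theorem continuousAt_outerNum (hq1 : ‖q‖ < 1) (hp : p ≠ 0) (hh : h ≠ 0)
    (hU : U ≠ 0) (hV : V ≠ 0) {Y : ℂ} (hY : Y ≠ 0) : ContinuousAt (outerNum q p h U V) Y := by
  have h1 : ∀ c : ℂ, c ≠ 0 → ContinuousAt (fun Y => qTheta (c / Y) q) Y := fun c hc =>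
    ContinuousAt.qTheta (by fun_prop (disch := assumption)) hq1 (div_ne_zero hc hY)
  have hUY : U * Y ≠ 0 := mul_ne_zero hU hY
  have h2 : ContinuousAt (fun Y => qTheta (h * V * Y) q) Y :=
    ContinuousAt.qTheta (by fun_prop) hq1 (mul_ne_zero (mul_ne_zero hh hV) hY)
  have h3 : ContinuousAt (fun Y => qTheta (h / (U * Y)) q) Y :=
    ContinuousAt.qTheta (by fun_prop (disch := assumption)) hq1 (div_ne_zero hh hUY)
  exact (h2.mul h3).mul (((h1 p hp).mul (h1 U hU)).mul (h1 V hV))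

theorem outerKernel_factors (hq0 : q ≠ 0) (hq1 : ‖q‖ < 1) (hg : OuterGeneric q p β U V) (j : Fin 5)
    (k : ℕ) : qPochInf (q * (mbPole p β j * q ^ k) / p) q ≠ 0 ∧
      qPochInf (q * (mbPole p β j * q ^ k) / U) q ≠ 0 ∧
      qPochInf (q * (mbPole p β j * q ^ k) / V) q ≠ 0 ∧
      qPochInf (U * (mbPole p β j * q ^ k)) q ≠ 0 ∧
      qPochInf (V * (mbPole p β j * q ^ k)) q ≠ 0 := by
  have e : ∀ c, q * (mbPole p β j * q ^ k) / c = q * mbPole p β j / c * q ^ k := fun c => by ring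
  have H : ∀ x : ℂ, x ∉ OmegaSet q → qPochInf (x * q ^ k) q ≠ 0 := fun x hx =>
    qPochInf_ne_zero hq0 hq1 (mul_pow_notMem_OmegaSet hq0 hx k)
  rw [e, e, e, ← mul_assoc, ← mul_assoc]
  exact ⟨H _ (hg.p_notMem j), H _ (hg.U_notMem j), H _ (hg.V_notMem j), H _ (hg.Ud j),
    H _ (hg.Vd j)⟩

theorem continuousAt_outerKernel (hq1 : ‖q‖ < 1) {Y : ℂ}
    (h : qPochInf (q * Y / p) q * qPochInf (q * Y / U) q *
    qPochInf (q * Y / V) q * qPochInf (U * Y) q * qPochInf (V * Y) q ≠ 0) :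
    ContinuousAt (outerKernel q p β U V) Y := by
  have hq := continuous_qPochInf hq1
  have h1 : ∀ c : ℂ, ContinuousAt (fun Y => qPochInf (q * Y / c) q) Y := fun c =>
    Continuous.continuousAt (by fun_prop)
  have h2 : ∀ c : ℂ, ContinuousAt (fun Y => qPochInf (c * Y) q) Y := fun c =>
    Continuous.continuousAt (by fun_prop)
  exact (tendsto_finsetProd _ fun j _ => h1 _).div
    (((((h1 p).mul (h1 U)).mul (h1 V)).mul (h2 U)).mul (h2 V)) h

theorem eventually_mbKernel_inv_eq (hq1 : ‖q‖ < 1) {y : ℂ}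
    (hd : ∏ j, qPochInf (q * y / mbPole p β j) q ≠ 0)
    (hp : qPochInf (q * y / p) q ≠ 0) (hU : qPochInf (q * y / U) q ≠ 0)
    (hV : qPochInf (q * y / V) q ≠ 0) :
    ∀ᶠ Y in 𝓝[≠] y, mbKernel q p β h U V Y⁻¹ / Y⁻¹ / Y ^ 2 =
      outerTheta q p β h U V Y * outerKernel q p β U V Y / Y := by
  have hc := continuous_qPochInf hq1
  have h0 : ∀ c : ℂ, Continuous fun Y => qPochInf (q * Y / c) q := fun c => by fun_prop
  have h1 : ∀ᶠ Y in 𝓝 y, ∏ j, qPochInf (q * Y / mbPole p β j) q ≠ 0 :=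
    ContinuousAt.eventually_ne (g := fun Y => ∏ j, qPochInf (q * Y / mbPole p β j) q)
      (tendsto_finsetProd _ fun j _ => (h0 _).continuousAt) hd
  have h2 : ∀ c : ℂ, qPochInf (q * y / c) q ≠ 0 → ∀ᶠ Y in 𝓝 y, qPochInf (q * Y / c) q ≠ 0 :=
    fun c hc => ContinuousAt.eventually_ne (g := fun Y => qPochInf (q * Y / c) q)
      (h0 c).continuousAt hc
  filter_upwards [nhdsWithin_le_nhds h1, nhdsWithin_le_nhds (h2 p hp),
    nhdsWithin_le_nhds (h2 U hU), nhdsWithin_le_nhds (h2 V hV)] with Y a b c d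
  rw [mbKernel_inv_eq a b c d, div_inv_eq_mul, sq]
  by_cases hY : Y = 0
  · simp [hY]
  · field_simp

theorem prod_chain_ne_zero (hq0 : q ≠ 0) (hq1 : ‖q‖ < 1) (hp : p ≠ 0) (hβ : β ≠ 0)
    (hg : OuterGeneric q p β U V) (j : Fin 5) (k : ℕ) :
    ∏ i, qPochInf (q * (mbPole p β j * q ^ k) / mbPole p β i) q ≠ 0 := by
  refine Finset.prod_ne_zero_iff.2 fun i _ => ?_
  have e : q * (mbPole p β j * q ^ k) / mbPole p β i =
      q * (mbPole p β j / mbPole p β i) * q ^ k := by ring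
  rw [e]
  refine qPochInf_ne_zero hq0 hq1 (mul_pow_notMem_OmegaSet hq0 (fun h0 => ?_) k)
  by_cases hij : j = i
  · subst hij
    rw [div_self (mbPole_ne_zero hp hβ j), mul_one] at h0
    exact notMem_OmegaSet_of_norm_lt_one hq0 hq1 hq1 h0
  · exact hg.pole j i hij (mul_q_mem_UpsilonSet hq0 (mem_UpsilonSet_of_mem_OmegaSet h0))

theorem chainData_outer (hq0 : q ≠ 0) (hq1 : ‖q‖ < 1) (hp : p ≠ 0) (hβ : β ≠ 0) (hh : h ≠ 0)
    (hU : U ≠ 0) (hV : V ≠ 0) (hg : OuterGeneric q p β U V) :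
    ChainData q (mbPole p β) (outerResidue q p β h U V) (outerTheta q p β h U V)
      (outerKernel q p β U V) fun Y => mbKernel q p β h U V Y⁻¹ / Y⁻¹ / Y ^ 2 := by
  have hd := mbPole_ne_zero hp hβ
  have hD : ∀ c Y : ℂ, c ≠ 0 → Y ≠ 0 → ContinuousAt (fun Y : ℂ => qTheta (c / Y) q) Y :=
    fun c Y hc hY => ContinuousAt.qTheta (by fun_prop (disch := assumption)) hq1
      (div_ne_zero hc hY)
  refine ⟨hd, hg.pole, fun Y hY => outerTheta_mul_q hq0 hq1 hp hβ hh hU hV hY, ?_, ?_, ?_, ?_, ?_,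
    ?_⟩
  · intro Y hY hj
    exact (continuousAt_outerNum hq1 hp hh hU hV hY).div
      (tendsto_finsetProd _ fun j _ => hD _ Y (hd j) hY)
      (Finset.prod_ne_zero_iff.2 fun j _ => qTheta_ne_zero hq0 hq1 (hj j))
  · intro j
    have h1 : ContinuousAt (fun Y => outerNum q p h U V Y /
        ∏ i ∈ Finset.univ.erase j, qTheta (mbPole p β i / Y) q) (mbPole p β j) :=
      (continuousAt_outerNum hq1 hp hh hU hV (hd j)).div
        (tendsto_finsetProd _ fun i _ => hD _ _ (hd i) (hd j))
        (Finset.prod_ne_zero_iff.2 fun i hi =>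
          qTheta_ne_zero hq0 hq1 (hg.pole i j (Finset.ne_of_mem_erase hi)))
    have h2 := (tendsto_residue_qTheta hq0 hq1 (hd j)).mul
      (h1.tendsto.mono_left nhdsWithin_le_nhds)
    refine h2.congr fun Y => ?_
    unfold outerTheta
    rw [← Finset.mul_prod_erase Finset.univ (fun i => qTheta (mbPole p β i / Y) q)
      (Finset.mem_univ j)]
    generalize ∏ i ∈ Finset.univ.erase j, qTheta (mbPole p β i / Y) q = D
    generalize qTheta (mbPole p β j / Y) q = A
    rw [div_eq_mul_inv _ D, div_eq_mul_inv _ (A * D), mul_inv]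
    ring
  · exact continuousAt_outerKernel hq1 (by simp [qPochInf_zero])
  · intro j k
    obtain ⟨h1, h2, h3, h4, h5⟩ := outerKernel_factors hq0 hq1 hg j k
    exact continuousAt_outerKernel hq1 (mul_ne_zero (mul_ne_zero (mul_ne_zero (mul_ne_zero h1 h2)
      h3) h4) h5)
  · exact eventually_mbKernel_inv_eq hq1 (by simp [qPochInf_zero]) (by simp [qPochInf_zero])
      (by simp [qPochInf_zero]) (by simp [qPochInf_zero])
  · intro j k
    obtain ⟨h1, h2, h3, -, -⟩ := outerKernel_factors hq0 hq1 hg j k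
    exact eventually_mbKernel_inv_eq hq1 (prod_chain_ne_zero hq0 hq1 hp hβ hg j k) h1 h2 h3

/-- The term of the outer pole `d`, the other poles being `d₁, …, d₄`. -/
noncomputable def outerTerm (q p h U V d d₁ d₂ d₃ d₄ : ℂ) : ℂ :=
  qTheta (h * V * d) q * qTheta (h / (U * d)) q *
      (qPochInf (p / d) q * qPochInf (U / d) q * qPochInf (V / d) q) /
    (qPochInf q q * (qPochInf (d₁ / d) q * qPochInf (d₂ / d) q * qPochInf (d₃ / d) q *
      qPochInf (d₄ / d) q) * qPochInf (U * d) q * qPochInf (V * d) q) *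
    qHyp [q * d / p, q * d / U, q * d / V, U * d, V * d]
      [q * d / d₁, q * d / d₂, q * d / d₃, q * d / d₄] q q

/-- Splitting (x;q)_∞ = (x;q)_k (xq^k;q)_∞ in every factor separates the prefactor of the k = 0
residue from the k-th term of a ₅φ₄. The argument `hprod` enumerates the other four poles, so that
one computation serves all five. -/
theorem tsum_outer (hq0 : q ≠ 0) (hq1 : ‖q‖ < 1) (hp : p ≠ 0) (hβ : β ≠ 0)
    (hg : OuterGeneric q p β U V) (j : Fin 5) {d d₁ d₂ d₃ d₄ : ℂ} (hd : mbPole p β j = d)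
    (hprod : ∀ F : ℂ → ℂ, ∏ i ∈ Finset.univ.erase j, F (mbPole p β i) =
      F d₁ * F d₂ * F d₃ * F d₄) :
    ∑' k : ℕ, q ^ k * (outerResidue q p β h U V j *
      outerKernel q p β U V (mbPole p β j * q ^ k)) = outerTerm q p h U V d d₁ d₂ d₃ d₄ := by
  have hd0 := mbPole_ne_zero hp hβ j
  have hθ : ∀ c, qTheta (c / d) q = qPochInf (c / d) q * qPochInf (q * d / c) q := fun c => by
    rw [qTheta, div_div_eq_mul_div]
  have hall : ∀ F : ℂ → ℂ, ∏ i, F (mbPole p β i) = F d * (F d₁ * F d₂ * F d₃ * F d₄) :=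
    fun F => by
      rw [← hprod, ← hd]
      exact (Finset.mul_prod_erase Finset.univ (fun i => F (mbPole p β i)) (Finset.mem_univ j)).symm
  unfold outerTerm
  rw [qHyp_eq_tsum rfl, ← tsum_mul_left]
  refine tsum_congr fun k => ?_
  have hne := prod_chain_ne_zero hq0 hq1 hp hβ hg j k
  obtain ⟨n1, n2, n3, n4, n5⟩ := outerKernel_factors hq0 hq1 hg j k
  have hne0 := prod_chain_ne_zero hq0 hq1 hp hβ hg j 0
  obtain ⟨m1, m2, m3, m4, m5⟩ := outerKernel_factors hq0 hq1 hg j 0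
  rw [pow_zero, mul_one] at hne0 m1 m2 m3 m4 m5
  unfold outerResidue outerKernel outerNum
  rw [hprod fun x => qTheta (x / mbPole p β j) q,
    hall fun x => qPochInf (q * (mbPole p β j * q ^ k) / x) q]
  rw [hall fun x => qPochInf (q * (mbPole p β j * q ^ k) / x) q] at hne
  rw [hall fun x => qPochInf (q * mbPole p β j / x) q] at hne0
  rw [hd] at *
  simp only [qPochL, List.map_cons, List.map_nil, List.prod_cons, List.prod_nil, mul_one, hθ]
  have hs : ∀ x, qPochInf (q * d / x) q = qPoch (q * d / x) q k *
      qPochInf (q * (d * q ^ k) / x) q := fun x => by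
    rw [qPochInf_eq_qPoch_mul hq1 _ k]; congr 2; ring
  have hs' : ∀ x, qPochInf (x * d) q = qPoch (x * d) q k *
      qPochInf (x * (d * q ^ k)) q := fun x => by
    rw [qPochInf_eq_qPoch_mul hq1 _ k]; congr 2; ring
  have hdd : q * d / d = q := mul_div_cancel_right₀ q hd0
  rw [hs p] at m1; rw [hs U] at m2; rw [hs V] at m3; rw [hs' U] at m4; rw [hs' V] at m5
  rw [hs d, hs d₁, hs d₂, hs d₃, hs d₄] at hne0
  have hqq := hs d
  rw [hdd] at hqq hne0
  rw [hqq, hs p, hs U, hs V, hs' U, hs' V, hs d₁, hs d₂, hs d₃, hs d₄]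
  clear hs hs' hθ hall hprod hqq
  generalize qPochInf (q * (d * q ^ k) / d) q = A0 at *
  generalize qPochInf (q * (d * q ^ k) / d₁) q = A1 at *
  generalize qPochInf (q * (d * q ^ k) / d₂) q = A2 at *
  generalize qPochInf (q * (d * q ^ k) / d₃) q = A3 at *
  generalize qPochInf (q * (d * q ^ k) / d₄) q = A4 at *
  generalize qPochInf (q * (d * q ^ k) / p) q = B1 at *
  generalize qPochInf (q * (d * q ^ k) / U) q = B2 at *
  generalize qPochInf (q * (d * q ^ k) / V) q = B3 at *
  generalize qPochInf (U * (d * q ^ k)) q = B4 at *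
  generalize qPochInf (V * (d * q ^ k)) q = B5 at *
  generalize qPoch q q k = a0 at *
  generalize qPoch (q * d / d₁) q k = a1 at *
  generalize qPoch (q * d / d₂) q k = a2 at *
  generalize qPoch (q * d / d₃) q k = a3 at *
  generalize qPoch (q * d / d₄) q k = a4 at *
  generalize qPoch (q * d / p) q k = b1 at *
  generalize qPoch (q * d / U) q k = b2 at *
  generalize qPoch (q * d / V) q k = b3 at *
  generalize qPoch (U * d) q k = b4 at *
  generalize qPoch (V * d) q k = b5 at *
  generalize qPochInf (d₁ / d) q = D1
  generalize qPochInf (d₂ / d) q = D2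
  generalize qPochInf (d₃ / d) q = D3
  generalize qPochInf (d₄ / d) q = D4
  generalize qPochInf (p / d) q = N1
  generalize qPochInf (U / d) q = N2
  generalize qPochInf (V / d) q = N3
  generalize qTheta (h * V * d) q = T1
  generalize qTheta (h / (U * d)) q = T2
  simp only [mul_ne_zero_iff] at *
  obtain ⟨⟨ha0, hA0⟩, (⟨⟨⟨ha1, hA1⟩, ha2, hA2⟩, ha3, hA3⟩), ha4, hA4⟩ := hne0
  obtain ⟨hb1, hB1⟩ := m1
  obtain ⟨hb2, hB2⟩ := m2
  obtain ⟨hb3, hB3⟩ := m3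
  obtain ⟨hb4, hB4⟩ := m4
  obtain ⟨hb5, hB5⟩ := m5
  have hA : A1 * A2 * A3 * A4 ≠ 0 := mul_ne_zero (mul_ne_zero (mul_ne_zero hA1 hA2) hA3) hA4
  have hB : B1 * B2 * B3 ≠ 0 := mul_ne_zero (mul_ne_zero hB1 hB2) hB3
  clear hne n1 n2 n3 n4 n5 hA1 hA2 hA3 hA4 hB1 hB2 hB3 ha1 ha2 ha3 ha4 hb1 hb2 hb3
  rw [show N1 * (b1 * B1) * (N2 * (b2 * B2)) * (N3 * (b3 * B3)) =
      N1 * N2 * N3 * (b1 * b2 * b3 * (B1 * B2 * B3)) by ring,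
    show D1 * (a1 * A1) * (D2 * (a2 * A2)) * (D3 * (a3 * A3)) * (D4 * (a4 * A4)) =
      D1 * D2 * D3 * D4 * (a1 * (a2 * (a3 * a4)) * (A1 * A2 * A3 * A4)) by ring,
    show b1 * (b2 * (b3 * (b4 * b5))) = b1 * b2 * b3 * (b4 * b5) by ring]
  generalize A1 * A2 * A3 * A4 = A at *
  generalize B1 * B2 * B3 = B at *
  generalize D1 * D2 * D3 * D4 = D
  generalize a1 * (a2 * (a3 * a4)) = a
  generalize b1 * b2 * b3 = b
  generalize N1 * N2 * N3 = N
  generalize T1 * T2 = T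
  simp only [div_eq_mul_inv, mul_inv]
  generalize D⁻¹ = D'
  generalize a⁻¹ = a'
  field_simp

end OuterPoles

/-! ### The five-term relation for generic parameters. -/

section FiveTerm

variable {q p β h U V : ℂ}

theorem qHyp_perm {as as' bs bs' : List ℂ} (ha : as.Perm as') (hb : bs.Perm bs') (z : ℂ) :
    qHyp as bs q z = qHyp as' bs' q z := by
  unfold qHyp qPochL
  rw [ha.length_eq, hb.length_eq]
  refine tsum_congr fun k => ?_
  rw [(ha.map fun a => qPoch a q k).prod_eq,
    ((hb.cons q).map fun a => qPoch a q k).prod_eq]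

theorem notMem_UpsilonSet_of_sq (hq0 : q ≠ 0) (hq1 : ‖q‖ < 1) {x : ℂ} (hx : x ^ 2 = q) :
    x ∉ UpsilonSet q := by
  rintro ⟨k, rfl⟩
  simp only at hx
  have h1 : ‖q‖ ^ (2 * k) = ‖q‖ ^ (1 : ℤ) := by
    rw [zpow_one, mul_comm, zpow_mul, ← norm_zpow]
    exact_mod_cast (norm_pow _ 2).symm.trans (congrArg norm hx)
  have := zpow_right_injective₀ (norm_pos_iff.2 hq0) hq1.ne h1
  omega

theorem neg_one_notMem_UpsilonSet (hq0 : q ≠ 0) (hq1 : ‖q‖ < 1) : (-1 : ℂ) ∉ UpsilonSet q := by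
  rintro ⟨k, hk⟩
  simp only at hk
  have h1 : ‖q‖ ^ k = ‖q‖ ^ (0 : ℤ) := by rw [zpow_zero, ← norm_zpow, hk]; simp
  have := zpow_right_injective₀ (norm_pos_iff.2 hq0) hq1.ne h1
  rw [this, zpow_zero] at hk
  norm_num at hk

theorem notMem_UpsilonSet_of_sq_eq (hq0 : q ≠ 0) {x y : ℂ} (hy : y ∉ UpsilonSet q) (k : ℤ)
    (h : x ^ 2 = q ^ k * y) : x ∉ UpsilonSet q := fun hx =>
  hy (zpow_mul_mem_UpsilonSet hq0 k (h ▸ sq_mem_UpsilonSet hx))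

/-- Up to inversion every ratio of poles is β² itself, or has a square of the form q^kβ^{±2}, or is
-1 or the inverse of ±p. So β² ∉ Υ_q is the only condition needed. -/
theorem mbPole_div_notMem (hpq : p ^ 2 = q) (hp : p ≠ 0) (hq1 : ‖q‖ < 1) (hβ0 : β ≠ 0)
    (hβ : β ^ 2 ∉ UpsilonSet q) (i j : Fin 5) (hij : i ≠ j) :
    mbPole p β i / mbPole p β j ∉ UpsilonSet q := by
  have hq0 : q ≠ 0 := by rw [← hpq]; exact pow_ne_zero 2 hp
  have hp' := notMem_UpsilonSet_of_sq hq0 hq1 hpq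
  have hnp := notMem_UpsilonSet_of_sq hq0 hq1 (x := -p) (by rw [neg_sq, hpq])
  have hβ' : (β ^ 2)⁻¹ ∉ UpsilonSet q := fun h => hβ (by simpa using inv_mem_UpsilonSet h)
  have key : ∀ i j : Fin 5, i < j → mbPole p β i / mbPole p β j ∉ UpsilonSet q := by
    intro i j hij
    fin_cases i <;> fin_cases j <;> first
      | exact absurd hij (by decide)
      | skip
    · simpa [mbPole, sq] using hβ
    · exact notMem_UpsilonSet_of_sq_eq hq0 hβ 0 (by simp [mbPole])
    · exact notMem_UpsilonSet_of_sq_eq hq0 hβ 0 (by simp [mbPole, div_neg])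
    · refine notMem_UpsilonSet_of_sq_eq hq0 hβ (-1) ?_
      simp only [mbPole, Matrix.cons_val, Fin.zero_eta, Fin.reduceFinMk, zpow_neg_one]
      rw [← hpq]; field_simp
    · exact notMem_UpsilonSet_of_sq_eq hq0 hβ' 0 (by simp [mbPole])
    · exact notMem_UpsilonSet_of_sq_eq hq0 hβ' 0 (by simp [mbPole, div_neg])
    · refine notMem_UpsilonSet_of_sq_eq hq0 hβ' (-1) ?_
      simp only [mbPole, Matrix.cons_val, Fin.mk_one, Fin.reduceFinMk, zpow_neg_one]
      rw [← hpq]; field_simp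
    · have := neg_one_notMem_UpsilonSet hq0 hq1
      simpa [mbPole] using this
    · intro h
      apply hnp
      simpa [mbPole] using inv_mem_UpsilonSet h
    · intro h
      apply hp'
      simpa [mbPole] using inv_mem_UpsilonSet h
  rcases lt_or_gt_of_ne hij with h | h
  · exact key i j h
  · intro h'
    exact key j i h (by simpa using inv_mem_UpsilonSet h')

/-- Here qd/p = pd. For d = β^{±1} its square is qβ^{±2}, and for the other three poles its norm is
less than 1. -/
theorem mul_mbPole_div_notMem (hpq : p ^ 2 = q) (hp : p ≠ 0) (hq1 : ‖q‖ < 1)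
    (hβ : β ^ 2 ∉ UpsilonSet q) (j : Fin 5) : q * mbPole p β j / p ∉ OmegaSet q := by
  have hq0 : q ≠ 0 := by rw [← hpq]; exact pow_ne_zero 2 hp
  have hp1 : ‖p‖ < 1 := by
    have : ‖p‖ ^ 2 < 1 := by rw [← norm_pow, hpq]; exact hq1
    exact (sq_lt_one_iff₀ (norm_nonneg _)).1 this
  have hβ' : (β ^ 2)⁻¹ ∉ UpsilonSet q := fun h => hβ (by simpa using inv_mem_UpsilonSet h)
  have e : q * mbPole p β j / p = p * mbPole p β j := by rw [← hpq]; field_simp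
  rw [e]
  fin_cases j <;> simp only [mbPole, Matrix.cons_val, Fin.zero_eta, Fin.mk_one, Fin.reduceFinMk]
  · exact fun h => notMem_UpsilonSet_of_sq_eq hq0 hβ 1 (by rw [mul_pow, hpq, zpow_one])
      (mem_UpsilonSet_of_mem_OmegaSet h)
  · exact fun h => notMem_UpsilonSet_of_sq_eq hq0 hβ' 1 (by
      rw [mul_pow, hpq, zpow_one, one_div, inv_pow]) (mem_UpsilonSet_of_mem_OmegaSet h)
  · exact notMem_OmegaSet_of_norm_lt_one hq0 hq1 (by simpa using hp1)
  · exact notMem_OmegaSet_of_norm_lt_one hq0 hq1 (by simpa using hp1)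
  · refine notMem_OmegaSet_of_norm_lt_one hq0 hq1 ?_
    rw [mul_neg, ← sq, hpq, norm_neg]; exact hq1

/-- The parameters are generic after a perturbation. -/
theorem exists_countable_generic (hpq : p ^ 2 = q) (hp : p ≠ 0) (hq1 : ‖q‖ < 1) (hβ0 : β ≠ 0)
    (hβ : β ^ 2 ∉ UpsilonSet q) (hU : U ≠ 0) (hV : V ≠ 0) :
    ∃ s : Set ℝ, s.Countable ∧ ∀ x : ℝ, x ∉ s →
      ClausenGeneric q β (U * Complex.exp ((2 * x : ℝ) : ℂ)) (V * Complex.exp ((1 * x : ℝ) : ℂ)) ∧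
      OuterGeneric q p β (U * Complex.exp ((2 * x : ℝ) : ℂ))
        (V * Complex.exp ((1 * x : ℝ) : ℂ)) := by
  have hq0 : q ≠ 0 := by rw [← hpq]; exact pow_ne_zero 2 hp
  let S : ℂ → ℝ → Set ℝ := fun C m => {x | C * Complex.exp ((m * x : ℝ) : ℂ) ∈ UpsilonSet q}
  have hS : ∀ C m, C ≠ 0 → m ≠ 0 → (S C m).Countable := fun C m =>
    countable_setOf_exp_mem_UpsilonSet C m
  have hd := mbPole_ne_zero hp hβ0
  let T : Set ℝ := ⋃ j, (S (U * mbPole p β j) 2 ∪ S (V * mbPole p β j) 1) ∪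
    (S (q * mbPole p β j / U) (-2) ∪ S (q * mbPole p β j / V) (-1))
  have hT : T.Countable := Set.countable_iUnion fun j =>
    ((hS _ _ (mul_ne_zero hU (hd j)) two_ne_zero).union
      (hS _ _ (mul_ne_zero hV (hd j)) one_ne_zero)).union
    ((hS _ _ (div_ne_zero (mul_ne_zero hq0 (hd j)) hU) (by norm_num)).union
      (hS _ _ (div_ne_zero (mul_ne_zero hq0 (hd j)) hV) (by norm_num)))
  -- Scaling U by e^{2x} and V by e^{x} makes U², V², UV and U/V vary with exponents 4, 2, 3 and 1.
  -- None of them is zero, so each condition fails only for countably many x.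
  refine ⟨T ∪ ((S (U ^ 2) 4 ∪ S (V ^ 2) 2) ∪ (S (U * V) 3 ∪ S (U / V) 1)),
    hT.union (((hS _ _ (pow_ne_zero 2 hU) (by norm_num)).union
      (hS _ _ (pow_ne_zero 2 hV) (by norm_num))).union
      ((hS _ _ (mul_ne_zero hU hV) (by norm_num)).union
      (hS _ _ (div_ne_zero hU hV) one_ne_zero))), fun x hx => ?_⟩
  simp only [Set.mem_union, not_or] at hx
  obtain ⟨hxT, ⟨h1, h2⟩, h3, h4⟩ := hx
  have hxj : ∀ j, x ∉ S (U * mbPole p β j) 2 ∧ x ∉ S (V * mbPole p β j) 1 ∧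
      x ∉ S (q * mbPole p β j / U) (-2) ∧ x ∉ S (q * mbPole p β j / V) (-1) := fun j => by
    have : ¬ _ := fun h0 => hxT (Set.mem_iUnion.2 ⟨j, h0⟩)
    simp only [Set.mem_union, not_or] at this
    exact ⟨this.1.1, this.1.2, this.2.1, this.2.2⟩
  have hE : ∀ m : ℝ, ((m * x : ℝ) : ℂ) = (m : ℂ) * (x : ℂ) := fun m => by push_cast; ring
  have use : ∀ {C : ℂ} {m : ℝ} {y : ℂ}, x ∉ S C m → y = C * Complex.exp ((m * x : ℝ) : ℂ) →
      y ∉ UpsilonSet q := fun h1 h2 h3 => h1 (by show _ ∈ UpsilonSet q; rw [← h2]; exact h3)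
  have useΩ : ∀ {C : ℂ} {m : ℝ} {y : ℂ}, x ∉ S C m → y = C * Complex.exp ((m * x : ℝ) : ℂ) →
      y ∉ OmegaSet q := fun h1 h2 h3 => use h1 h2 (mem_UpsilonSet_of_mem_OmegaSet h3)
  have hUd : ∀ j, U * Complex.exp ((2 * x : ℝ) : ℂ) * mbPole p β j ∉ OmegaSet q := fun j =>
    useΩ (hxj j).1 (by ring)
  have hVd : ∀ j, V * Complex.exp ((1 * x : ℝ) : ℂ) * mbPole p β j ∉ OmegaSet q := fun j =>
    useΩ (hxj j).2.1 (by ring)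
  refine ⟨⟨hβ0, mul_ne_zero hU (Complex.exp_ne_zero _), mul_ne_zero hV (Complex.exp_ne_zero _),
    ?_, ?_, ?_, ?_, ?_, ?_, ?_, ?_⟩, ⟨mbPole_div_notMem hpq hp hq1 hβ0 hβ,
    mul_mbPole_div_notMem hpq hp hq1 hβ, fun j => ?_, fun j => ?_, hUd, hVd⟩⟩
  · have := hUd 0; rwa [mul_comm] at this
  · have := hUd 1; simpa [mbPole, div_eq_mul_inv] using this
  · have := hVd 0; rwa [mul_comm] at this
  · have := hVd 1; simpa [mbPole, div_eq_mul_inv] using this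
  · refine useΩ h1 ?_
    rw [mul_pow, ← Complex.exp_nat_mul]; congr 2; push_cast; ring
  · refine useΩ h2 ?_
    rw [mul_pow, ← Complex.exp_nat_mul]; congr 2; push_cast; ring
  · refine useΩ h3 ?_
    rw [mul_mul_mul_comm, ← Complex.exp_add]; congr 2; push_cast; ring
  · refine use h4 ?_
    rw [mul_div_mul_comm, ← Complex.exp_sub]; congr 2; push_cast; ring
  · refine useΩ (hxj j).2.2.1 ?_
    rw [← div_div, div_eq_mul_inv _ (Complex.exp _), ← Complex.exp_neg]; congr 2; push_cast; ring
  · refine useΩ (hxj j).2.2.2 ?_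
    rw [← div_div, div_eq_mul_inv _ (Complex.exp _), ← Complex.exp_neg]; congr 2; push_cast; ring

/-- The five-term relation for generic parameters. -/
theorem five_term_of_generic (hpq : p ^ 2 = q) (hp : p ≠ 0) (hq1 : ‖q‖ < 1) (hh : h ≠ 0)
    (hg : ClausenGeneric q β U V) (hO : OuterGeneric q p β U V) (hz : ‖U / β‖ < 1)
    (hpV : p * V ∉ OmegaSet q) :
    qTheta h q * qTheta (h * V / U) q / (qPochInf q q * (qPochInf (β * U) q *
        qPochInf (U / β) q * qPochInf (β * V) q * qPochInf (V / β) q)) *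
        clausenSeries q p β U V ^ 2 =
      outerTerm q p h U V β (1 / β) 1 (-1) (-p) + outerTerm q p h U V (1 / β) β 1 (-1) (-p) +
        outerTerm q p h U V 1 β (1 / β) (-1) (-p) + outerTerm q p h U V (-1) β (1 / β) 1 (-p) +
        outerTerm q p h U V (-p) β (1 / β) 1 (-1) := by
  have hq0 : q ≠ 0 := by rw [← hpq]; exact pow_ne_zero 2 hp
  -- The inner residues give the Jackson integral, hence the square; the outer ones give the five
  -- series.
  have key := (chainData_mbKernel (p := p) hpq hq0 hq1 hh hg).sum_eq_sum
    (chainData_outer hq0 hq1 hp hg.hβ hh hg.hU hg.hV hO) hq0 hq1 ?_ ?_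
  · rw [sum_residues_mbKernel hq0 hq1 hg, ← clausenSeries_sq hpq hp hq1 hg hz hpV,
      Fin.sum_univ_five] at key
    rw [key,
      tsum_outer (h := h) hq0 hq1 hp hg.hβ hO 0 (d := β) (d₁ := 1 / β) (d₂ := 1) (d₃ := -1)
        (d₄ := -p) rfl fun F => ?_,
      tsum_outer (h := h) hq0 hq1 hp hg.hβ hO 1 (d := 1 / β) (d₁ := β) (d₂ := 1) (d₃ := -1)
        (d₄ := -p) rfl fun F => ?_,
      tsum_outer (h := h) hq0 hq1 hp hg.hβ hO 2 (d := 1) (d₁ := β) (d₂ := 1 / β) (d₃ := -1)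
        (d₄ := -p) rfl fun F => ?_,
      tsum_outer (h := h) hq0 hq1 hp hg.hβ hO 3 (d := -1) (d₁ := β) (d₂ := 1 / β) (d₃ := 1)
        (d₄ := -p) rfl fun F => ?_,
      tsum_outer (h := h) hq0 hq1 hp hg.hβ hO 4 (d := -p) (d₁ := β) (d₂ := 1 / β) (d₃ := 1)
        (d₄ := -1) rfl fun F => ?_]
    · rw [show Finset.univ.erase (4 : Fin 5) = {0, 1, 2, 3} by decide]
      simp [mbPole, mul_assoc]
    · rw [show Finset.univ.erase (3 : Fin 5) = {0, 1, 2, 4} by decide]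
      simp [mbPole, mul_assoc]
    · rw [show Finset.univ.erase (2 : Fin 5) = {0, 1, 3, 4} by decide]
      simp [mbPole, mul_assoc]
    · rw [show Finset.univ.erase (1 : Fin 5) = {0, 2, 3, 4} by decide]
      simp [mbPole, mul_assoc]
    · rw [show Finset.univ.erase (0 : Fin 5) = {1, 2, 3, 4} by decide]
      simp [mbPole, mul_assoc]
  · intro i j
    fin_cases i
    · exact hO.Ud j
    · exact hO.Vd j
  · intro X hX h1 h2
    have hin : ∀ c : ℂ, (∀ k : ℕ, X ≠ c * q ^ k) → qPochInf (c / X) q ≠ 0 := fun c hc => by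
      refine qPochInf_ne_zero hq0 hq1 fun h0 => ?_
      obtain ⟨k, hk⟩ := (mem_OmegaSet_iff hq0).1 h0
      apply hc k
      rw [div_mul_eq_mul_div, div_eq_one_iff_eq hX] at hk
      exact hk.symm
    have hout : ∀ d : ℂ, (∀ k : ℕ, X⁻¹ ≠ d * q ^ k) → qPochInf (d * X) q ≠ 0 := fun d hd => by
      refine qPochInf_ne_zero hq0 hq1 fun h0 => ?_
      obtain ⟨k, hk⟩ := (mem_OmegaSet_iff hq0).1 h0
      apply hd k
      rw [inv_eq_iff_eq_inv, ← one_div, eq_div_iff]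
      · rw [← hk]; ring
      · intro h3
        rw [mul_right_comm, h3, zero_mul] at hk
        exact zero_ne_one hk
    refine (differentiableAt_mbKernel hq1 hh hg.hU hg.hV hX ?_).div differentiableAt_id hX
    refine mul_ne_zero (mul_ne_zero (hin U (h1 0)) (hin V (h1 1))) (mul_ne_zero (mul_ne_zero
      (mul_ne_zero (mul_ne_zero (hout _ (h2 0)) ?_) ?_) ?_) ?_)
    · have := hout _ (h2 1); simpa [mbPole, div_eq_inv_mul] using this
    · have := hout _ (h2 2); simpa [mbPole] using this
    · have := hout _ (h2 3); simpa [mbPole] using this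
    · have := hout _ (h2 4); simpa [mbPole] using this

end FiveTerm

/-! ### Continuity of a theta quotient times a hypergeometric series. -/

section Continuity

variable {q : ℂ} {X : Type*} [TopologicalSpace X] {x₀ : X}

theorem continuousAt_qPochInfL (hq1 : ‖q‖ < 1) (fs : List (X → ℂ))
    (h : ∀ f ∈ fs, ContinuousAt f x₀) :
    ContinuousAt (fun x => qPochInfL (fs.map (· x)) q) x₀ := by
  induction fs with
  | nil => simp [qPochInfL, continuousAt_const]
  | cons f fs ih =>
    simp only [List.mem_cons, forall_eq_or_imp] at h
    simp only [qPochInfL, List.map_cons, List.prod_cons]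
    exact ((continuous_qPochInf hq1).continuousAt.comp h.1).mul (ih h.2)

theorem qPochInfL_ne_zero (hq0 : q ≠ 0) (hq1 : ‖q‖ < 1) {as : List ℂ}
    (h : ∀ a ∈ as, a ∉ OmegaSet q) : qPochInfL as q ≠ 0 := by
  unfold qPochInfL
  intro h0
  rw [List.prod_eq_zero_iff] at h0
  obtain ⟨a, ha, h1⟩ := List.mem_map.1 h0
  exact qPochInf_ne_zero hq0 hq1 (h a ha) h1

theorem continuousAt_qThetaL (hq1 : ‖q‖ < 1) (fs : List (X → ℂ))
    (h : ∀ f ∈ fs, ContinuousAt f x₀ ∧ f x₀ ≠ 0) :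
    ContinuousAt (fun x => qThetaL (fs.map (· x)) q) x₀ := by
  induction fs with
  | nil => simp [qThetaL, continuousAt_const]
  | cons f fs ih =>
    simp only [List.mem_cons, forall_eq_or_imp] at h
    simp only [qThetaL, List.map_cons, List.prod_cons]
    exact (h.1.1.qTheta hq1 h.1.2).mul (ih h.2)

theorem continuousAt_residueTerm (hq0 : q ≠ 0) (hq1 : ‖q‖ < 1) (ts ns ds as bs : List (X → ℂ))
    (hlen : as.length = bs.length + 1) (hts : ∀ f ∈ ts, ContinuousAt f x₀ ∧ f x₀ ≠ 0)
    (hns : ∀ f ∈ ns, ContinuousAt f x₀) (hds : ∀ f ∈ ds, ContinuousAt f x₀ ∧ f x₀ ∉ OmegaSet q)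
    (has : ∀ f ∈ as, ContinuousAt f x₀)
    (hbs : ∀ f ∈ bs, ContinuousAt f x₀ ∧ f x₀ ∉ OmegaSet q) :
    ContinuousAt (fun x => qThetaL (ts.map (· x)) q * qPochInfL (ns.map (· x)) q /
      qPochInfL (ds.map (· x)) q * qHyp (as.map (· x)) (bs.map (· x)) q q) x₀ := by
  refine (((continuousAt_qThetaL hq1 ts hts).mul (continuousAt_qPochInfL hq1 ns hns)).div
    (continuousAt_qPochInfL hq1 ds fun f hf => (hds f hf).1) ?_).mul
    (continuousAt_qHyp hq0 hq1 as bs (fun _ => q) hlen has (fun f hf => (hbs f hf).1)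
      (fun f hf => (hbs f hf).2) continuousAt_const hq1)
  refine qPochInfL_ne_zero hq0 hq1 fun a ha => ?_
  obtain ⟨f, hf, rfl⟩ := List.mem_map.1 ha
  exact (hds f hf).2

end Continuity

/-! ### The five outer terms in the original parameters. -/

section SquareTerms

variable {q p a b h z : ℂ}

/-- The term of the five-term formula belonging to the pole `b / p`. -/
noncomputable def squareTerm₁ (q p a b h z : ℂ) : ℂ :=
  qThetaL [h * a, h * (q / (b ^ 2 * z))] q *
    qPochInfL [q / b, q / b, q * a / b ^ 2, q * a / b ^ 2] q /
    qPochInfL [q * a / b, q * a / b, q / b ^ 2, q / b ^ 2] q *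
    qHyp [a, b, b ^ 2 / a, b ^ 2 * z / q, q / z]
      [b ^ 2, b * p, -(b * p), -b] q q

/-- The term of the five-term formula belonging to the pole `p / b`. -/
noncomputable def squareTerm₂ (q p a b h z : ℂ) : ℂ :=
  qThetaL [h * (q * a / b ^ 2), h / z] q *
    qPochInfL [a, a, b, b, b ^ 2 * z / q, b ^ 2 * z / q] q /
    qPochInfL [z, z, b ^ 2 / q, b ^ 2 / q, q * a / b, q * a / b] q *
    qHyp [q / a, q / b, q * a / b ^ 2, z, q ^ 2 / (b ^ 2 * z)]
      [q ^ 2 / b ^ 2, p ^ 3 / b, -(p ^ 3 / b), -(q / b)] q q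

/-- The term of the five-term formula belonging to the pole `1`. -/
noncomputable def squareTerm₃ (q p a b h z : ℂ) : ℂ :=
  qThetaL [h * (a * p / b), h * (p / (b * z))] q *
    qPochInfL [p, a, q * a / b ^ 2, b ^ 2 * z / q] q /
    qPochInfL [-1, -p, z, q * a / b, q * a / b, b / p, p / b] q *
    qHyp [p, a * p / b, b * p / a, b * z / p, p ^ 3 / (b * z)]
      [-q, -p, b * p, p ^ 3 / b] q q

/-- The term of the five-term formula belonging to the pole `-1`. -/
noncomputable def squareTerm₄ (q p a b h z : ℂ) : ℂ :=
  qThetaL [-(h * (a * p / b)), -(h * (p / (b * z)))] q *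
    qPochInfL [-p, a, q * a / b ^ 2, b ^ 2 * z / q] q /
    qPochInfL [-1, p, z, q * a / b, q * a / b, -(b / p), -(p / b)] q *
    qHyp [-p, -(a * p / b), -(b * p / a), -(b * z / p), -(p ^ 3 / (b * z))]
      [-q, p, -(b * p), -(p ^ 3 / b)] q q

/-- The term of the five-term formula belonging to the pole `-p`. -/
noncomputable def squareTerm₅ (q p a b h z : ℂ) : ℂ :=
  qThetaL [-(h * (q * a / b)), -(h / (b * z))] q *
    qPochInfL [-1, a, -(a / b), q * a / b ^ 2, -(b * z / q), b ^ 2 * z / q] q /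
    qPochInfL [z, -(b * z), 1 / p, -(1 / p), q * a / b, q * a / b, -(q * a / b), -(1 / b), -(b /
    q)] q *
    qHyp [-q, -(b * z), -(q * a / b), -(q * b / a), -(q ^ 2 / (b * z))]
      [-(q * b), p ^ 3, -(p ^ 3), -(q ^ 2 / b)] q q

/-- Replaces every composite argument by a prescribed normal form and reorders the parameter lists,
so that the five translations reduce to monomial identities. -/
theorem outerTerm_congr {U V d d₁ d₂ d₃ d₄ x₁ x₂ n₁ n₂ n₃ c₁ c₂ c₃ c₄ u v a₁ a₂ a₃ b₁ b₂ b₃ b₄ : ℂ}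
    {as bs : List ℂ} (hx₁ : h * V * d = x₁) (hx₂ : h / (U * d) = x₂) (hn₁ : p / d = n₁)
    (hn₂ : U / d = n₂) (hn₃ : V / d = n₃) (hc₁ : d₁ / d = c₁) (hc₂ : d₂ / d = c₂)
    (hc₃ : d₃ / d = c₃) (hc₄ : d₄ / d = c₄) (hu : U * d = u) (hv : V * d = v)
    (ha₁ : q * d / p = a₁) (ha₂ : q * d / U = a₂) (ha₃ : q * d / V = a₃) (hb₁ : q * d / d₁ = b₁)
    (hb₂ : q * d / d₂ = b₂) (hb₃ : q * d / d₃ = b₃) (hb₄ : q * d / d₄ = b₄)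
    (has : [a₁, a₂, a₃, u, v].Perm as) (hbs : [b₁, b₂, b₃, b₄].Perm bs) :
    outerTerm q p h U V d d₁ d₂ d₃ d₄ = qTheta x₁ q * qTheta x₂ q *
      (qPochInf n₁ q * qPochInf n₂ q * qPochInf n₃ q) /
      (qPochInf q q * (qPochInf c₁ q * qPochInf c₂ q * qPochInf c₃ q * qPochInf c₄ q) *
        qPochInf u q * qPochInf v q) * qHyp as bs q q := by
  rw [← qHyp_perm has hbs]
  subst_vars
  rfl

/-- The ratio between `squareTerm` and `outerTerm`. -/
noncomputable def squareFactor (q a b z : ℂ) : ℂ :=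
  qPochInf q q * (qPochInf (b ^ 2 * z / q) q * qPochInf z q * qPochInf a q *
    qPochInf (q * a / b ^ 2) q) / (qPochInf z q ^ 2 * qPochInf (q * a / b) q ^ 2)

/-- All five terms carry the same factor relative to the residue sums, which is what lets it be
cancelled from the whole relation. Genericity of the poles gives the nonvanishing of the products
divided by. -/
theorem squareTerm₁_eq (hpq : p ^ 2 = q) (hp : p ≠ 0) (hq1 : ‖q‖ < 1) (ha : a ≠ 0) (hb : b ≠ 0)
    (hz : z ≠ 0) (hO : OuterGeneric q p (b / p) (b * z / p) (p * a / b))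
    (hc : q * a / b ∉ OmegaSet q) :
    squareTerm₁ q p a b h z = squareFactor q a b z *
      outerTerm q p h (b * z / p) (p * a / b) (b / p) (1 / (b / p)) 1 (-1) (-p) := by
  have hq0 : q ≠ 0 := by rw [← hpq]; exact pow_ne_zero 2 hp
  have hqq := qPochInf_ne_zero_of_norm_lt_one hq0 hq1 hq1
  have hcc := qPochInf_ne_zero hq0 hq1 hc
  have k1 : qPochInf (q / b ^ 2) q ≠ 0 := by
    refine qPochInf_ne_zero hq0 hq1 ?_
    convert! (fun h0 => hO.pole 1 0 (by decide) (mem_UpsilonSet_of_mem_OmegaSet h0)) using 1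
    simp only [mbPole, Matrix.cons_val]
    rw [← hpq]; field_simp
  have k2 : qPochInf (p / b) q ≠ 0 := by
    refine qPochInf_ne_zero hq0 hq1 ?_
    convert! (fun h0 => hO.pole 2 0 (by decide) (mem_UpsilonSet_of_mem_OmegaSet h0)) using 1
    simp only [mbPole, Matrix.cons_val]
    field_simp
  have k3 : qPochInf (-(p / b)) q ≠ 0 := by
    refine qPochInf_ne_zero hq0 hq1 ?_
    convert! (fun h0 => hO.pole 3 0 (by decide) (mem_UpsilonSet_of_mem_OmegaSet h0)) using 1
    simp only [mbPole, Matrix.cons_val]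
    field_simp
  have k4 : qPochInf (-(q / b)) q ≠ 0 := by
    refine qPochInf_ne_zero hq0 hq1 ?_
    convert! (fun h0 => hO.pole 4 0 (by decide) (mem_UpsilonSet_of_mem_OmegaSet h0)) using 1
    simp only [mbPole, Matrix.cons_val]
    rw [← hpq]; field_simp
  have k5 : qPochInf (b ^ 2 * z / q) q ≠ 0 := by
    refine qPochInf_ne_zero hq0 hq1 ?_
    convert! hO.Ud 0 using 1
    simp only [mbPole, Matrix.cons_val]
    rw [← hpq]; field_simp
  have k6 : qPochInf a q ≠ 0 := by
    refine qPochInf_ne_zero hq0 hq1 ?_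
    convert! hO.Vd 0 using 1
    simp only [mbPole, Matrix.cons_val]
    field_simp
  have k7 : qPochInf z q ≠ 0 := by
    refine qPochInf_ne_zero hq0 hq1 ?_
    convert! hO.Ud 1 using 1
    simp only [mbPole, Matrix.cons_val]
    field_simp
  -- The stated term has (q/b²;q)_∞² in the denominator, the residue only one such product together
  -- with (p/b, -p/b, -q/b;q)_∞. Splitting (q/b²;q)_∞ into four products reconciles them.
  have hsq := qPochInf_sq hpq hq1 (p / b)
  rw [show (p / b) ^ 2 = q / b ^ 2 by rw [div_pow, hpq],
    show p * (p / b) = q / b by rw [← hpq]; ring] at hsq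
  have hsq0 := k1
  rw [hsq] at hsq0
  simp only [mul_ne_zero_iff] at hsq0
  obtain ⟨⟨-, m1⟩, -⟩ := hsq0
  rw [outerTerm_congr (x₁ := h * a) (x₂ := h * (q / (b ^ 2 * z))) (n₁ := q / b) (n₂ := z)
    (n₃ := q * a / b ^ 2) (c₁ := q / b ^ 2) (c₂ := p / b) (c₃ := -(p / b)) (c₄ := -(q / b))
    (u := b ^ 2 * z / q) (v := a) (a₁ := b) (a₂ := q / z) (a₃ := b ^ 2 / a) (b₁ := b ^ 2)
    (b₂ := b * p) (b₃ := -(b * p)) (b₄ := -b)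
    (as := [a, b, b ^ 2 / a, b ^ 2 * z / q, q / z])
    (bs := [b ^ 2, b * p, -(b * p), -b])]
  · unfold squareFactor
    simp only [squareTerm₁, qThetaL, qPochInfL, List.map_cons, List.map_nil, List.prod_cons,
      List.prod_nil, mul_one]
    rw [hsq]
    clear hsq k1
    generalize qHyp [a, b, b ^ 2 / a, b ^ 2 * z / q, q / z]
      [b ^ 2, b * p, -(b * p), -b] q q = H
    generalize qPochInf q q = X0 at *
    generalize qPochInf (b ^ 2 * z / q) q = X1 at *
    generalize qPochInf a q = X2 at *
    generalize qPochInf (q / b) q = X3 at *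
    generalize qPochInf z q = X4 at *
    generalize qPochInf (q * a / b ^ 2) q = X5 at *
    generalize qPochInf (p / b) q = X7 at *
    generalize qPochInf (-(p / b)) q = X8 at *
    generalize qPochInf (-(q / b)) q = X9 at *
    generalize qPochInf (q * a / b) q = X10 at *
    generalize qTheta (h * a) q = T0
    generalize qTheta (h * (q / (b ^ 2 * z))) q = T1
    field_simp
  all_goals first | (field_simp; done) | (rw [← hpq]; field_simp; done) |
    exact List.Perm.refl _ |
    (simp only [← Multiset.coe_eq_coe, ← Multiset.cons_coe, ← Multiset.singleton_add]; abel)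

theorem squareTerm₂_eq (hpq : p ^ 2 = q) (hp : p ≠ 0) (hq1 : ‖q‖ < 1) (ha : a ≠ 0) (hb : b ≠ 0)
    (hz : z ≠ 0) (hO : OuterGeneric q p (b / p) (b * z / p) (p * a / b))
    (hc : q * a / b ∉ OmegaSet q) :
    squareTerm₂ q p a b h z = squareFactor q a b z *
      outerTerm q p h (b * z / p) (p * a / b) (1 / (b / p)) (b / p) 1 (-1) (-p) := by
  have hq0 : q ≠ 0 := by rw [← hpq]; exact pow_ne_zero 2 hp
  have hqq := qPochInf_ne_zero_of_norm_lt_one hq0 hq1 hq1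
  have hcc := qPochInf_ne_zero hq0 hq1 hc
  have k1 : qPochInf (b ^ 2 / q) q ≠ 0 := by
    refine qPochInf_ne_zero hq0 hq1 ?_
    convert! (fun h0 => hO.pole 0 1 (by decide) (mem_UpsilonSet_of_mem_OmegaSet h0)) using 1
    simp only [mbPole, Matrix.cons_val]
    rw [← hpq]; field_simp
  have k2 : qPochInf (b / p) q ≠ 0 := by
    refine qPochInf_ne_zero hq0 hq1 ?_
    convert! (fun h0 => hO.pole 2 1 (by decide) (mem_UpsilonSet_of_mem_OmegaSet h0)) using 1
    simp only [mbPole, Matrix.cons_val]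
    field_simp
  have k3 : qPochInf (-(b / p)) q ≠ 0 := by
    refine qPochInf_ne_zero hq0 hq1 ?_
    convert! (fun h0 => hO.pole 3 1 (by decide) (mem_UpsilonSet_of_mem_OmegaSet h0)) using 1
    simp only [mbPole, Matrix.cons_val]
    field_simp
  have k4 : qPochInf (-b) q ≠ 0 := by
    refine qPochInf_ne_zero hq0 hq1 ?_
    convert! (fun h0 => hO.pole 4 1 (by decide) (mem_UpsilonSet_of_mem_OmegaSet h0)) using 1
    simp only [mbPole, Matrix.cons_val]
    field_simp
  have k5 : qPochInf z q ≠ 0 := by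
    refine qPochInf_ne_zero hq0 hq1 ?_
    convert! hO.Ud 1 using 1
    simp only [mbPole, Matrix.cons_val]
    field_simp
  have k6 : qPochInf (q * a / b ^ 2) q ≠ 0 := by
    refine qPochInf_ne_zero hq0 hq1 ?_
    convert! hO.Vd 1 using 1
    simp only [mbPole, Matrix.cons_val]
    rw [← hpq]; field_simp
  -- The same splitting, now of (b²/q;q)_∞ into (b/p, -b/p, b, -b;q)_∞.
  have hsq := qPochInf_sq hpq hq1 (b / p)
  rw [show (b / p) ^ 2 = b ^ 2 / q by rw [div_pow, hpq],
    show p * (b / p) = b by field_simp] at hsq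
  have hsq0 := k1
  rw [hsq] at hsq0
  simp only [mul_ne_zero_iff] at hsq0
  obtain ⟨⟨-, m1⟩, -⟩ := hsq0
  rw [outerTerm_congr (x₁ := h * (q * a / b ^ 2)) (x₂ := h / z) (n₁ := b) (n₂ := b ^ 2 * z / q)
    (n₃ := a) (c₁ := b ^ 2 / q) (c₂ := b / p) (c₃ := -(b / p)) (c₄ := -b) (u := z)
    (v := q * a / b ^ 2) (a₁ := q / b) (a₂ := q ^ 2 / (b ^ 2 * z)) (a₃ := q / a)
    (b₁ := q ^ 2 / b ^ 2) (b₂ := p ^ 3 / b) (b₃ := -(p ^ 3 / b)) (b₄ := -(q / b))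
    (as := [q / a, q / b, q * a / b ^ 2, z, q ^ 2 / (b ^ 2 * z)])
    (bs := [q ^ 2 / b ^ 2, p ^ 3 / b, -(p ^ 3 / b), -(q / b)])]
  · unfold squareFactor
    simp only [squareTerm₂, qThetaL, qPochInfL, List.map_cons, List.map_nil, List.prod_cons,
      List.prod_nil, mul_one]
    rw [hsq]
    clear hsq k1
    generalize qHyp [q / a, q / b, q * a / b ^ 2, z, q ^ 2 / (b ^ 2 * z)]
      [q ^ 2 / b ^ 2, p ^ 3 / b, -(p ^ 3 / b), -(q / b)] q q = H
    generalize qPochInf q q = X0 at *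
    generalize qPochInf z q = X1 at *
    generalize qPochInf (q * a / b ^ 2) q = X2 at *
    generalize qPochInf b q = X3 at *
    generalize qPochInf (b ^ 2 * z / q) q = X4 at *
    generalize qPochInf a q = X5 at *
    generalize qPochInf (b / p) q = X7 at *
    generalize qPochInf (-(b / p)) q = X8 at *
    generalize qPochInf (-b) q = X9 at *
    generalize qPochInf (q * a / b) q = X10 at *
    generalize qTheta (h * (q * a / b ^ 2)) q = T0
    generalize qTheta (h / z) q = T1
    field_simp
  all_goals first | (field_simp; done) | (rw [← hpq]; field_simp; done) |
    exact List.Perm.refl _ |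
    (simp only [← Multiset.coe_eq_coe, ← Multiset.cons_coe, ← Multiset.singleton_add]; abel)

theorem squareTerm₃_eq (hpq : p ^ 2 = q) (hp : p ≠ 0) (hq1 : ‖q‖ < 1) (ha : a ≠ 0) (hb : b ≠ 0)
    (hz : z ≠ 0) (hO : OuterGeneric q p (b / p) (b * z / p) (p * a / b))
    (hc : q * a / b ∉ OmegaSet q) :
    squareTerm₃ q p a b h z = squareFactor q a b z *
      outerTerm q p h (b * z / p) (p * a / b) 1 (b / p) (1 / (b / p)) (-1) (-p) := by
  have hq0 : q ≠ 0 := by rw [← hpq]; exact pow_ne_zero 2 hp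
  have hqq := qPochInf_ne_zero_of_norm_lt_one hq0 hq1 hq1
  have hcc := qPochInf_ne_zero hq0 hq1 hc
  have k1 : qPochInf (b / p) q ≠ 0 := by
    refine qPochInf_ne_zero hq0 hq1 ?_
    convert! (fun h0 => hO.pole 0 2 (by decide) (mem_UpsilonSet_of_mem_OmegaSet h0)) using 1
    simp only [mbPole, Matrix.cons_val]
    field_simp
  have k2 : qPochInf (p / b) q ≠ 0 := by
    refine qPochInf_ne_zero hq0 hq1 ?_
    convert! (fun h0 => hO.pole 1 2 (by decide) (mem_UpsilonSet_of_mem_OmegaSet h0)) using 1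
    simp only [mbPole, Matrix.cons_val]
    field_simp
  have k3 : qPochInf (-1) q ≠ 0 := by
    refine qPochInf_ne_zero hq0 hq1 ?_
    convert! (fun h0 => hO.pole 3 2 (by decide) (mem_UpsilonSet_of_mem_OmegaSet h0)) using 1
    simp only [mbPole, Matrix.cons_val]
    field_simp
  have k4 : qPochInf (-p) q ≠ 0 := by
    refine qPochInf_ne_zero hq0 hq1 ?_
    convert! (fun h0 => hO.pole 4 2 (by decide) (mem_UpsilonSet_of_mem_OmegaSet h0)) using 1
    simp only [mbPole, Matrix.cons_val]
    field_simp
  have k5 : qPochInf (b * z / p) q ≠ 0 := by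
    refine qPochInf_ne_zero hq0 hq1 ?_
    convert! hO.Ud 2 using 1
    simp only [mbPole, Matrix.cons_val]
    field_simp
  have k6 : qPochInf (a * p / b) q ≠ 0 := by
    refine qPochInf_ne_zero hq0 hq1 ?_
    convert! hO.Vd 2 using 1
    simp only [mbPole, Matrix.cons_val]
    field_simp
  have k7 : qPochInf z q ≠ 0 := by
    refine qPochInf_ne_zero hq0 hq1 ?_
    convert! hO.Ud 1 using 1
    simp only [mbPole, Matrix.cons_val]
    field_simp
  rw [outerTerm_congr (x₁ := h * (a * p / b)) (x₂ := h * (p / (b * z))) (n₁ := p)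
    (n₂ := b * z / p) (n₃ := a * p / b) (c₁ := b / p) (c₂ := p / b) (c₃ := -1) (c₄ := -p)
    (u := b * z / p) (v := a * p / b) (a₁ := p) (a₂ := p ^ 3 / (b * z)) (a₃ := b * p / a)
    (b₁ := p ^ 3 / b) (b₂ := b * p) (b₃ := -q) (b₄ := -p)
    (as := [p, a * p / b, b * p / a, b * z / p, p ^ 3 / (b * z)])
    (bs := [-q, -p, b * p, p ^ 3 / b])]
  · unfold squareFactor
    simp only [squareTerm₃, qThetaL, qPochInfL, List.map_cons, List.map_nil, List.prod_cons,
      List.prod_nil, mul_one]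
    generalize qHyp [p, a * p / b, b * p / a, b * z / p, p ^ 3 / (b * z)]
      [-q, -p, b * p, p ^ 3 / b] q q = H
    generalize qPochInf q q = X0 at *
    generalize qPochInf (b * z / p) q = X1 at *
    generalize qPochInf (a * p / b) q = X2 at *
    generalize qPochInf p q = X3 at *
    generalize qPochInf (b / p) q = X4 at *
    generalize qPochInf (p / b) q = X5 at *
    generalize qPochInf (-1) q = X6 at *
    generalize qPochInf (-p) q = X7 at *
    generalize qPochInf a q = X8 at *
    generalize qPochInf (q * a / b ^ 2) q = X9 at *
    generalize qPochInf (b ^ 2 * z / q) q = X10 at *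
    generalize qPochInf z q = X11 at *
    generalize qPochInf (q * a / b) q = X12 at *
    generalize qTheta (h * (a * p / b)) q = T0
    generalize qTheta (h * (p / (b * z))) q = T1
    field_simp
  all_goals first | (field_simp; done) | (rw [← hpq]; field_simp; done) |
    exact List.Perm.refl _ |
    (simp only [← Multiset.coe_eq_coe, ← Multiset.cons_coe, ← Multiset.singleton_add]; abel)

theorem squareTerm₄_eq (hpq : p ^ 2 = q) (hp : p ≠ 0) (hq1 : ‖q‖ < 1) (ha : a ≠ 0) (hb : b ≠ 0)
    (hz : z ≠ 0) (hO : OuterGeneric q p (b / p) (b * z / p) (p * a / b))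
    (hc : q * a / b ∉ OmegaSet q) :
    squareTerm₄ q p a b h z = squareFactor q a b z *
      outerTerm q p h (b * z / p) (p * a / b) (-1) (b / p) (1 / (b / p)) 1 (-p) := by
  have hq0 : q ≠ 0 := by rw [← hpq]; exact pow_ne_zero 2 hp
  have hqq := qPochInf_ne_zero_of_norm_lt_one hq0 hq1 hq1
  have hcc := qPochInf_ne_zero hq0 hq1 hc
  have k1 : qPochInf (-(b / p)) q ≠ 0 := by
    refine qPochInf_ne_zero hq0 hq1 ?_
    convert! (fun h0 => hO.pole 0 3 (by decide) (mem_UpsilonSet_of_mem_OmegaSet h0)) using 1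
    simp only [mbPole, Matrix.cons_val]
    field_simp
  have k2 : qPochInf (-(p / b)) q ≠ 0 := by
    refine qPochInf_ne_zero hq0 hq1 ?_
    convert! (fun h0 => hO.pole 1 3 (by decide) (mem_UpsilonSet_of_mem_OmegaSet h0)) using 1
    simp only [mbPole, Matrix.cons_val]
    field_simp
  have k3 : qPochInf (-1) q ≠ 0 := by
    refine qPochInf_ne_zero hq0 hq1 ?_
    convert! (fun h0 => hO.pole 2 3 (by decide) (mem_UpsilonSet_of_mem_OmegaSet h0)) using 1
    simp only [mbPole, Matrix.cons_val]
    field_simp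
  have k4 : qPochInf p q ≠ 0 := by
    refine qPochInf_ne_zero hq0 hq1 ?_
    convert! (fun h0 => hO.pole 4 3 (by decide) (mem_UpsilonSet_of_mem_OmegaSet h0)) using 1
    simp only [mbPole, Matrix.cons_val]
    field_simp
  have k5 : qPochInf (-(b * z / p)) q ≠ 0 := by
    refine qPochInf_ne_zero hq0 hq1 ?_
    convert! hO.Ud 3 using 1
    simp only [mbPole, Matrix.cons_val]
    field_simp
  have k6 : qPochInf (-(a * p / b)) q ≠ 0 := by
    refine qPochInf_ne_zero hq0 hq1 ?_
    convert! hO.Vd 3 using 1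
    simp only [mbPole, Matrix.cons_val]
    field_simp
  have k7 : qPochInf z q ≠ 0 := by
    refine qPochInf_ne_zero hq0 hq1 ?_
    convert! hO.Ud 1 using 1
    simp only [mbPole, Matrix.cons_val]
    field_simp
  rw [outerTerm_congr (x₁ := -(h * (a * p / b))) (x₂ := -(h * (p / (b * z)))) (n₁ := -p)
    (n₂ := -(b * z / p)) (n₃ := -(a * p / b)) (c₁ := -(b / p)) (c₂ := -(p / b)) (c₃ := -1)
    (c₄ := p) (u := -(b * z / p)) (v := -(a * p / b)) (a₁ := -p) (a₂ := -(p ^ 3 / (b * z)))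
    (a₃ := -(b * p / a)) (b₁ := -(p ^ 3 / b)) (b₂ := -(b * p)) (b₃ := -q) (b₄ := p)
    (as := [-p, -(a * p / b), -(b * p / a), -(b * z / p), -(p ^ 3 / (b * z))])
    (bs := [-q, p, -(b * p), -(p ^ 3 / b)])]
  · unfold squareFactor
    simp only [squareTerm₄, qThetaL, qPochInfL, List.map_cons, List.map_nil, List.prod_cons,
      List.prod_nil, mul_one]
    generalize qHyp [-p, -(a * p / b), -(b * p / a), -(b * z / p), -(p ^ 3 / (b * z))]
      [-q, p, -(b * p), -(p ^ 3 / b)] q q = H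
    generalize qPochInf q q = X0 at *
    generalize qPochInf (-(b * z / p)) q = X1 at *
    generalize qPochInf (-(a * p / b)) q = X2 at *
    generalize qPochInf (-p) q = X3 at *
    generalize qPochInf (-(b / p)) q = X4 at *
    generalize qPochInf (-(p / b)) q = X5 at *
    generalize qPochInf (-1) q = X6 at *
    generalize qPochInf p q = X7 at *
    generalize qPochInf a q = X8 at *
    generalize qPochInf (q * a / b ^ 2) q = X9 at *
    generalize qPochInf (b ^ 2 * z / q) q = X10 at *
    generalize qPochInf z q = X11 at *
    generalize qPochInf (q * a / b) q = X12 at *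
    generalize qTheta (-(h * (a * p / b))) q = T0
    generalize qTheta (-(h * (p / (b * z)))) q = T1
    field_simp
  all_goals first | (field_simp; done) | (rw [← hpq]; field_simp; done) |
    exact List.Perm.refl _ |
    (simp only [← Multiset.coe_eq_coe, ← Multiset.cons_coe, ← Multiset.singleton_add]; abel)

theorem squareTerm₅_eq (hpq : p ^ 2 = q) (hp : p ≠ 0) (hq1 : ‖q‖ < 1) (ha : a ≠ 0) (hb : b ≠ 0)
    (hz : z ≠ 0) (hO : OuterGeneric q p (b / p) (b * z / p) (p * a / b))
    (hc : q * a / b ∉ OmegaSet q) :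
    squareTerm₅ q p a b h z = squareFactor q a b z *
      outerTerm q p h (b * z / p) (p * a / b) (-p) (b / p) (1 / (b / p)) 1 (-1) := by
  have hq0 : q ≠ 0 := by rw [← hpq]; exact pow_ne_zero 2 hp
  have hqq := qPochInf_ne_zero_of_norm_lt_one hq0 hq1 hq1
  have hcc := qPochInf_ne_zero hq0 hq1 hc
  have k1 : qPochInf (-(b / q)) q ≠ 0 := by
    refine qPochInf_ne_zero hq0 hq1 ?_
    convert! (fun h0 => hO.pole 0 4 (by decide) (mem_UpsilonSet_of_mem_OmegaSet h0)) using 1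
    simp only [mbPole, Matrix.cons_val]
    rw [← hpq]; field_simp
  have k2 : qPochInf (-(1 / b)) q ≠ 0 := by
    refine qPochInf_ne_zero hq0 hq1 ?_
    convert! (fun h0 => hO.pole 1 4 (by decide) (mem_UpsilonSet_of_mem_OmegaSet h0)) using 1
    simp only [mbPole, Matrix.cons_val]
    field_simp
  have k3 : qPochInf (-(1 / p)) q ≠ 0 := by
    refine qPochInf_ne_zero hq0 hq1 ?_
    convert! (fun h0 => hO.pole 2 4 (by decide) (mem_UpsilonSet_of_mem_OmegaSet h0)) using 1
    simp only [mbPole, Matrix.cons_val]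
    field_simp
  have k4 : qPochInf (1 / p) q ≠ 0 := by
    refine qPochInf_ne_zero hq0 hq1 ?_
    convert! (fun h0 => hO.pole 3 4 (by decide) (mem_UpsilonSet_of_mem_OmegaSet h0)) using 1
    simp only [mbPole, Matrix.cons_val]
    field_simp
  have k5 : qPochInf (-(b * z)) q ≠ 0 := by
    refine qPochInf_ne_zero hq0 hq1 ?_
    convert! hO.Ud 4 using 1
    simp only [mbPole, Matrix.cons_val]
    field_simp
  have k6 : qPochInf (-(q * a / b)) q ≠ 0 := by
    refine qPochInf_ne_zero hq0 hq1 ?_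
    convert! hO.Vd 4 using 1
    simp only [mbPole, Matrix.cons_val]
    rw [← hpq]; field_simp
  have k7 : qPochInf z q ≠ 0 := by
    refine qPochInf_ne_zero hq0 hq1 ?_
    convert! hO.Ud 1 using 1
    simp only [mbPole, Matrix.cons_val]
    field_simp
  rw [outerTerm_congr (x₁ := -(h * (q * a / b))) (x₂ := -(h / (b * z))) (n₁ := -1)
    (n₂ := -(b * z / q)) (n₃ := -(a / b)) (c₁ := -(b / q)) (c₂ := -(1 / b)) (c₃ := -(1 / p))
    (c₄ := 1 / p) (u := -(b * z)) (v := -(q * a / b)) (a₁ := -q) (a₂ := -(q ^ 2 / (b * z)))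
    (a₃ := -(q * b / a)) (b₁ := -(q ^ 2 / b)) (b₂ := -(q * b)) (b₃ := -p ^ 3) (b₄ := p ^ 3)
    (as := [-q, -(b * z), -(q * a / b), -(q * b / a), -(q ^ 2 / (b * z))])
    (bs := [-(q * b), p ^ 3, -(p ^ 3), -(q ^ 2 / b)])]
  · unfold squareFactor
    simp only [squareTerm₅, qThetaL, qPochInfL, List.map_cons, List.map_nil, List.prod_cons,
      List.prod_nil, mul_one]
    generalize qHyp [-q, -(b * z), -(q * a / b), -(q * b / a), -(q ^ 2 / (b * z))]
      [-(q * b), p ^ 3, -(p ^ 3), -(q ^ 2 / b)] q q = H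
    generalize qPochInf q q = X0 at *
    generalize qPochInf (-(b * z)) q = X1 at *
    generalize qPochInf (-(q * a / b)) q = X2 at *
    generalize qPochInf (-1) q = X3 at *
    generalize qPochInf (-(b * z / q)) q = X4 at *
    generalize qPochInf (-(a / b)) q = X5 at *
    generalize qPochInf (-(b / q)) q = X6 at *
    generalize qPochInf (-(1 / b)) q = X7 at *
    generalize qPochInf (-(1 / p)) q = X8 at *
    generalize qPochInf (1 / p) q = X9 at *
    generalize qPochInf a q = X10 at *
    generalize qPochInf (q * a / b ^ 2) q = X11 at *
    generalize qPochInf (b ^ 2 * z / q) q = X12 at *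
    generalize qPochInf z q = X13 at *
    generalize qPochInf (q * a / b) q = X14 at *
    generalize qTheta (-(h * (q * a / b))) q = T0
    generalize qTheta (-(h / (b * z))) q = T1
    field_simp
  all_goals first | (field_simp; done) | (rw [← hpq]; field_simp; done) |
    exact List.Perm.refl _ |
    (simp only [← Multiset.coe_eq_coe, ← Multiset.cons_coe, ← Multiset.singleton_add]; abel)

end SquareTerms

/-! ### The five-term formula for generic parameters. -/

section SquareFormula

variable {q p a b h z : ℂ}

/-- The five-term formula for generic parameters. -/
theorem square_eq_of_generic (hpq : p ^ 2 = q) (hp : p ≠ 0) (hq1 : ‖q‖ < 1) (ha : a ≠ 0)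
    (hb : b ≠ 0) (hz : z ≠ 0) (hh : h ≠ 0) (hz1 : ‖z‖ < 1)
    (hg : ClausenGeneric q (b / p) (b * z / p) (p * a / b))
    (hO : OuterGeneric q p (b / p) (b * z / p) (p * a / b)) (hc : q * a / b ∉ OmegaSet q) :
    qThetaL [h, h * (q * a / (b ^ 2 * z))] q * qHyp [a, b] [q * a / b] q z ^ 2 =
      squareTerm₁ q p a b h z + squareTerm₂ q p a b h z + squareTerm₃ q p a b h z +
        squareTerm₄ q p a b h z + squareTerm₅ q p a b h z := by
  have hq0 : q ≠ 0 := by rw [← hpq]; exact pow_ne_zero 2 hp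
  have e1 : b * z / p / (b / p) = z := by field_simp
  have e2 : b / p * (b * z / p) = b ^ 2 * z / q := by rw [← hpq]; field_simp
  have e3 : b / p * (p * a / b) = a := by field_simp
  have e4 : p * a / b / (b / p) = q * a / b ^ 2 := by rw [← hpq]; field_simp
  have e5 : p * (p * a / b) = q * a / b := by rw [← hpq]; ring
  have e6 : h * (p * a / b) / (b * z / p) = h * (q * a / (b ^ 2 * z)) := by
    rw [← hpq]; field_simp
  have e7 : b / p * p = b := by field_simp
  have key := five_term_of_generic hpq hp hq1 hh hg hO (by rwa [e1]) (by rwa [e5])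
  rw [squareTerm₁_eq hpq hp hq1 ha hb hz hO hc, squareTerm₂_eq hpq hp hq1 ha hb hz hO hc,
    squareTerm₃_eq hpq hp hq1 ha hb hz hO hc, squareTerm₄_eq hpq hp hq1 ha hb hz hO hc,
    squareTerm₅_eq hpq hp hq1 ha hb hz hO hc, ← mul_add, ← mul_add, ← mul_add, ← mul_add, ← key]
  have n1 := qPochInf_ne_zero hq0 hq1 (hO.Ud 0)
  have n2 := qPochInf_ne_zero hq0 hq1 (hO.Ud 1)
  have n3 := qPochInf_ne_zero hq0 hq1 (hO.Vd 0)
  have n4 := qPochInf_ne_zero hq0 hq1 (hO.Vd 1)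
  simp only [mbPole, Matrix.cons_val, mul_one_div] at n1 n2 n3 n4
  rw [mul_comm, e2] at n1
  rw [e1] at n2
  rw [mul_comm, e3] at n3
  rw [e4] at n4
  have n5 := qPochInf_ne_zero_of_norm_lt_one hq0 hq1 hq1
  have n6 := qPochInf_ne_zero hq0 hq1 hc
  unfold clausenSeries squareFactor
  simp only [e1, e2, e3, e4, e5, e6, e7, qThetaL, List.map_cons, List.map_nil, List.prod_cons,
    List.prod_nil, mul_one]
  field_simp

end SquareFormula

/-! ### Continuity of the five terms in a and z. -/

section SquareContinuity

variable {q p b h : ℂ} {X : Type*} [TopologicalSpace X] {x₀ : X} {A Z : X → ℂ}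

/-- Υ_q is closed under squaring, inversion and multiplication by powers of q, so x ∈ Ω_q would
force b² ∈ Υ_q. This settles the denominator parameters with square q^k b^{±2}. -/
theorem notMem_OmegaSet_of_sq_eq (hq0 : q ≠ 0) (hb : b ^ 2 ∉ UpsilonSet q) {x : ℂ} (k : ℤ)
    (hx : x ^ 2 = q ^ k * b ^ 2 ∨ x ^ 2 = q ^ k / b ^ 2) : x ∉ OmegaSet q := by
  intro h0
  have h1 := mem_UpsilonSet_of_mem_OmegaSet h0
  rcases hx with hx | hx
  · exact notMem_UpsilonSet_of_sq_eq hq0 hb k hx h1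
  · refine notMem_UpsilonSet_of_sq_eq hq0 (y := (b ^ 2)⁻¹) (fun h2 => hb ?_) k hx h1
    simpa using inv_mem_UpsilonSet h2

theorem continuousAt_squareTerm₁ (hpq : p ^ 2 = q) (hp : p ≠ 0) (hq1 : ‖q‖ < 1) (hb : b ≠ 0)
    (hh : h ≠ 0) (hb2 : b ^ 2 ∉ UpsilonSet q) (hA : ContinuousAt A x₀) (hZ : ContinuousAt Z x₀)
    (hA0 : A x₀ ≠ 0) (hZ0 : Z x₀ ≠ 0) (hc : q * A x₀ / b ∉ OmegaSet q) :
    ContinuousAt (fun x => squareTerm₁ q p (A x) b h (Z x)) x₀ := by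
  have hq0 : q ≠ 0 := by rw [← hpq]; exact pow_ne_zero 2 hp
  have b1 : q / b ^ 2 ∉ OmegaSet q := fun h0 => hb2 (by
    simpa using inv_mem_UpsilonSet (zpow_mul_mem_UpsilonSet hq0 1 (a := (b ^ 2)⁻¹) (by
      simpa [div_eq_mul_inv] using mem_UpsilonSet_of_mem_OmegaSet h0)))
  refine continuousAt_residueTerm hq0 hq1
    [fun x => h * A x, fun x => h * (q / (b ^ 2 * Z x))]
    [fun _ => q / b, fun _ => q / b, fun x => q * A x / b ^ 2, fun x => q * A x / b ^ 2]
    [fun x => q * A x / b, fun x => q * A x / b, fun _ => q / b ^ 2, fun _ => q / b ^ 2]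
    [fun x => A x, fun _ => b, fun x => b ^ 2 / A x, fun x => b ^ 2 * Z x / q, fun x => q / Z x]
    [fun _ => b ^ 2, fun _ => b * p, fun _ => -(b * p),
      fun _ => -b] rfl ?_ ?_ ?_ ?_ ?_ <;> simp only [List.forall_mem_cons]
  · exact ⟨⟨(by fun_prop (disch := simp [*])), by simp [*]⟩, ⟨(by fun_prop (disch := simp [*])),
      by simp [*]⟩, fun _ h0 => absurd h0 List.not_mem_nil⟩
  · exact ⟨(by fun_prop (disch := simp [*])), (by fun_prop (disch := simp [*])),
      (by fun_prop (disch := simp [*])), (by fun_prop (disch := simp [*])),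
      fun _ h0 => absurd h0 List.not_mem_nil⟩
  · exact 
      ⟨⟨(by fun_prop (disch := simp [*])), hc⟩,
      ⟨(by fun_prop (disch := simp [*])), hc⟩,
      ⟨(by fun_prop (disch := simp [*])), b1⟩,
      ⟨(by fun_prop (disch := simp [*])), b1⟩,
      fun _ h0 => absurd h0 List.not_mem_nil⟩
  · exact ⟨(by fun_prop (disch := simp [*])), (by fun_prop (disch := simp [*])),
      (by fun_prop (disch := simp [*])), (by fun_prop (disch := simp [*])),
      (by fun_prop (disch := simp [*])), fun _ h0 => absurd h0 List.not_mem_nil⟩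
  · exact 
      ⟨⟨(by fun_prop (disch := simp [*])), (fun h0 => hb2 (mem_UpsilonSet_of_mem_OmegaSet h0))⟩,
      ⟨(by fun_prop (disch := simp [*])), (notMem_OmegaSet_of_sq_eq hq0 hb2 1 (Or.inl (by
      rw [← hpq]; field_simp)))⟩,
      ⟨(by fun_prop (disch := simp [*])), (notMem_OmegaSet_of_sq_eq hq0 hb2 1 (Or.inl (by
      rw [← hpq]; field_simp)))⟩,
      ⟨(by fun_prop (disch := simp [*])), (notMem_OmegaSet_of_sq_eq hq0 hb2 0 (Or.inl (by
      rw [← hpq]; field_simp)))⟩,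
      fun _ h0 => absurd h0 List.not_mem_nil⟩

theorem continuousAt_squareTerm₂ (hpq : p ^ 2 = q) (hp : p ≠ 0) (hq1 : ‖q‖ < 1) (hb : b ≠ 0)
    (hh : h ≠ 0) (hb2 : b ^ 2 ∉ UpsilonSet q) (hA : ContinuousAt A x₀) (hZ : ContinuousAt Z x₀)
    (hA0 : A x₀ ≠ 0) (hZ0 : Z x₀ ≠ 0) (hc : q * A x₀ / b ∉ OmegaSet q) (hz : Z x₀ ∉ OmegaSet q) :
    ContinuousAt (fun x => squareTerm₂ q p (A x) b h (Z x)) x₀ := by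
  have hq0 : q ≠ 0 := by rw [← hpq]; exact pow_ne_zero 2 hp
  have b2 : q ^ 2 / b ^ 2 ∉ OmegaSet q := fun h0 => hb2 (by
    simpa using inv_mem_UpsilonSet (zpow_mul_mem_UpsilonSet hq0 2 (a := (b ^ 2)⁻¹) (by
      simpa [div_eq_mul_inv] using mem_UpsilonSet_of_mem_OmegaSet h0)))
  have b3 : b ^ 2 / q ∉ OmegaSet q := fun h0 => hb2 (zpow_mul_mem_UpsilonSet hq0 (-1) (by
    simpa [div_eq_inv_mul] using mem_UpsilonSet_of_mem_OmegaSet h0))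
  refine continuousAt_residueTerm hq0 hq1
    [fun x => h * (q * A x / b ^ 2), fun x => h / Z x]
    [fun x => A x, fun x => A x, fun _ => b, fun _ => b, fun x => b ^ 2 * Z x / q,
      fun x => b ^ 2 * Z x / q]
    [fun x => Z x, fun x => Z x, fun _ => b ^ 2 / q, fun _ => b ^ 2 / q, fun x => q * A x / b,
      fun x => q * A x / b]
    [fun x => q / A x, fun _ => q / b, fun x => q * A x / b ^ 2, fun x => Z x,
      fun x => q ^ 2 / (b ^ 2 * Z x)]
    [fun _ => q ^ 2 / b ^ 2, fun _ => p ^ 3 / b, fun _ => -(p ^ 3 / b),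
      fun _ => -(q / b)] rfl ?_ ?_ ?_ ?_ ?_ <;> simp only [List.forall_mem_cons]
  · exact ⟨⟨(by fun_prop (disch := simp [*])), by simp [*]⟩, ⟨(by fun_prop (disch := simp [*])),
      by simp [*]⟩, fun _ h0 => absurd h0 List.not_mem_nil⟩
  · exact ⟨(by fun_prop (disch := simp [*])), (by fun_prop (disch := simp [*])),
      (by fun_prop (disch := simp [*])), (by fun_prop (disch := simp [*])),
      (by fun_prop (disch := simp [*])), (by fun_prop (disch := simp [*])),
      fun _ h0 => absurd h0 List.not_mem_nil⟩
  · exact 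
      ⟨⟨(by fun_prop (disch := simp [*])), hz⟩,
      ⟨(by fun_prop (disch := simp [*])), hz⟩,
      ⟨(by fun_prop (disch := simp [*])), b3⟩,
      ⟨(by fun_prop (disch := simp [*])), b3⟩,
      ⟨(by fun_prop (disch := simp [*])), hc⟩,
      ⟨(by fun_prop (disch := simp [*])), hc⟩,
      fun _ h0 => absurd h0 List.not_mem_nil⟩
  · exact ⟨(by fun_prop (disch := simp [*])), (by fun_prop (disch := simp [*])),
      (by fun_prop (disch := simp [*])), (by fun_prop (disch := simp [*])),
      (by fun_prop (disch := simp [*])), fun _ h0 => absurd h0 List.not_mem_nil⟩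
  · exact 
      ⟨⟨(by fun_prop (disch := simp [*])), b2⟩,
      ⟨(by fun_prop (disch := simp [*])), (notMem_OmegaSet_of_sq_eq hq0 hb2 3 (Or.inr (by
      rw [← hpq]; field_simp)))⟩,
      ⟨(by fun_prop (disch := simp [*])), (notMem_OmegaSet_of_sq_eq hq0 hb2 3 (Or.inr (by
      rw [← hpq]; field_simp)))⟩,
      ⟨(by fun_prop (disch := simp [*])), (notMem_OmegaSet_of_sq_eq hq0 hb2 2 (Or.inr (by
      rw [← hpq]; field_simp)))⟩,
      fun _ h0 => absurd h0 List.not_mem_nil⟩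

theorem continuousAt_squareTerm₃ (hpq : p ^ 2 = q) (hp : p ≠ 0) (hq1 : ‖q‖ < 1) (hb : b ≠ 0)
    (hh : h ≠ 0) (hb2 : b ^ 2 ∉ UpsilonSet q) (hA : ContinuousAt A x₀) (hZ : ContinuousAt Z x₀)
    (hA0 : A x₀ ≠ 0) (hZ0 : Z x₀ ≠ 0) (hc : q * A x₀ / b ∉ OmegaSet q) (hz : Z x₀ ∉ OmegaSet q) :
    ContinuousAt (fun x => squareTerm₃ q p (A x) b h (Z x)) x₀ := by
  have hq0 : q ≠ 0 := by rw [← hpq]; exact pow_ne_zero 2 hp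
  have hp1 : ‖p‖ < 1 := by
    have : ‖p‖ ^ 2 < 1 := by rw [← norm_pow, hpq]; exact hq1
    exact (sq_lt_one_iff₀ (norm_nonneg _)).1 this
  have m1 : (-1 : ℂ) ∉ OmegaSet q := fun h0 =>
    neg_one_notMem_UpsilonSet hq0 hq1 (mem_UpsilonSet_of_mem_OmegaSet h0)
  have p2 : -p ∉ OmegaSet q := notMem_OmegaSet_of_norm_lt_one hq0 hq1 (by rwa [norm_neg])
  have q1 : -q ∉ OmegaSet q := notMem_OmegaSet_of_norm_lt_one hq0 hq1 (by rwa [norm_neg])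
  refine continuousAt_residueTerm hq0 hq1
    [fun x => h * (A x * p / b), fun x => h * (p / (b * Z x))]
    [fun _ => p, fun x => A x, fun x => q * A x / b ^ 2, fun x => b ^ 2 * Z x / q]
    [fun _ => -1, fun _ => -p, fun x => Z x, fun x => q * A x / b, fun x => q * A x / b,
      fun _ => b / p, fun _ => p / b]
    [fun _ => p, fun x => A x * p / b, fun x => b * p / A x, fun x => b * Z x / p,
      fun x => p ^ 3 / (b * Z x)]
    [fun _ => -q, fun _ => -p, fun _ => b * p,
      fun _ => p ^ 3 / b] rfl ?_ ?_ ?_ ?_ ?_ <;> simp only [List.forall_mem_cons]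
  · exact ⟨⟨(by fun_prop (disch := simp [*])), by simp [*]⟩, ⟨(by fun_prop (disch := simp [*])),
      by simp [*]⟩, fun _ h0 => absurd h0 List.not_mem_nil⟩
  · exact ⟨(by fun_prop (disch := simp [*])), (by fun_prop (disch := simp [*])),
      (by fun_prop (disch := simp [*])), (by fun_prop (disch := simp [*])),
      fun _ h0 => absurd h0 List.not_mem_nil⟩
  · exact 
      ⟨⟨(by fun_prop (disch := simp [*])), m1⟩,
      ⟨(by fun_prop (disch := simp [*])), p2⟩,
      ⟨(by fun_prop (disch := simp [*])), hz⟩,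
      ⟨(by fun_prop (disch := simp [*])), hc⟩,
      ⟨(by fun_prop (disch := simp [*])), hc⟩,
      ⟨(by fun_prop (disch := simp [*])), (notMem_OmegaSet_of_sq_eq hq0 hb2 (-1) (Or.inl (by
      rw [← hpq]; field_simp)))⟩,
      ⟨(by fun_prop (disch := simp [*])), (notMem_OmegaSet_of_sq_eq hq0 hb2 1 (Or.inr (by
      rw [← hpq]; field_simp)))⟩,
      fun _ h0 => absurd h0 List.not_mem_nil⟩
  · exact ⟨(by fun_prop (disch := simp [*])), (by fun_prop (disch := simp [*])),
      (by fun_prop (disch := simp [*])), (by fun_prop (disch := simp [*])),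
      (by fun_prop (disch := simp [*])), fun _ h0 => absurd h0 List.not_mem_nil⟩
  · exact 
      ⟨⟨(by fun_prop (disch := simp [*])), q1⟩,
      ⟨(by fun_prop (disch := simp [*])), p2⟩,
      ⟨(by fun_prop (disch := simp [*])), (notMem_OmegaSet_of_sq_eq hq0 hb2 1 (Or.inl (by
      rw [← hpq]; field_simp)))⟩,
      ⟨(by fun_prop (disch := simp [*])), (notMem_OmegaSet_of_sq_eq hq0 hb2 3 (Or.inr (by
      rw [← hpq]; field_simp)))⟩,
      fun _ h0 => absurd h0 List.not_mem_nil⟩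

theorem continuousAt_squareTerm₄ (hpq : p ^ 2 = q) (hp : p ≠ 0) (hq1 : ‖q‖ < 1) (hb : b ≠ 0)
    (hh : h ≠ 0) (hb2 : b ^ 2 ∉ UpsilonSet q) (hA : ContinuousAt A x₀) (hZ : ContinuousAt Z x₀)
    (hA0 : A x₀ ≠ 0) (hZ0 : Z x₀ ≠ 0) (hc : q * A x₀ / b ∉ OmegaSet q) (hz : Z x₀ ∉ OmegaSet q) :
    ContinuousAt (fun x => squareTerm₄ q p (A x) b h (Z x)) x₀ := by
  have hq0 : q ≠ 0 := by rw [← hpq]; exact pow_ne_zero 2 hp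
  have hp1 : ‖p‖ < 1 := by
    have : ‖p‖ ^ 2 < 1 := by rw [← norm_pow, hpq]; exact hq1
    exact (sq_lt_one_iff₀ (norm_nonneg _)).1 this
  have m1 : (-1 : ℂ) ∉ OmegaSet q := fun h0 =>
    neg_one_notMem_UpsilonSet hq0 hq1 (mem_UpsilonSet_of_mem_OmegaSet h0)
  have p1 : p ∉ OmegaSet q := notMem_OmegaSet_of_norm_lt_one hq0 hq1 hp1
  have q1 : -q ∉ OmegaSet q := notMem_OmegaSet_of_norm_lt_one hq0 hq1 (by rwa [norm_neg])
  refine continuousAt_residueTerm hq0 hq1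
    [fun x => -(h * (A x * p / b)), fun x => -(h * (p / (b * Z x)))]
    [fun _ => -p, fun x => A x, fun x => q * A x / b ^ 2, fun x => b ^ 2 * Z x / q]
    [fun _ => -1, fun _ => p, fun x => Z x, fun x => q * A x / b, fun x => q * A x / b,
      fun _ => -(b / p), fun _ => -(p / b)]
    [fun _ => -p, fun x => -(A x * p / b), fun x => -(b * p / A x), fun x => -(b * Z x / p),
      fun x => -(p ^ 3 / (b * Z x))]
    [fun _ => -q, fun _ => p, fun _ => -(b * p),
      fun _ => -(p ^ 3 / b)] rfl ?_ ?_ ?_ ?_ ?_ <;> simp only [List.forall_mem_cons]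
  · exact ⟨⟨(by fun_prop (disch := simp [*])), by simp [*]⟩, ⟨(by fun_prop (disch := simp [*])),
      by simp [*]⟩, fun _ h0 => absurd h0 List.not_mem_nil⟩
  · exact ⟨(by fun_prop (disch := simp [*])), (by fun_prop (disch := simp [*])),
      (by fun_prop (disch := simp [*])), (by fun_prop (disch := simp [*])),
      fun _ h0 => absurd h0 List.not_mem_nil⟩
  · exact 
      ⟨⟨(by fun_prop (disch := simp [*])), m1⟩,
      ⟨(by fun_prop (disch := simp [*])), p1⟩,
      ⟨(by fun_prop (disch := simp [*])), hz⟩,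
      ⟨(by fun_prop (disch := simp [*])), hc⟩,
      ⟨(by fun_prop (disch := simp [*])), hc⟩,
      ⟨(by fun_prop (disch := simp [*])), (notMem_OmegaSet_of_sq_eq hq0 hb2 (-1) (Or.inl (by
      rw [← hpq]; field_simp)))⟩,
      ⟨(by fun_prop (disch := simp [*])), (notMem_OmegaSet_of_sq_eq hq0 hb2 1 (Or.inr (by
      rw [← hpq]; field_simp)))⟩,
      fun _ h0 => absurd h0 List.not_mem_nil⟩
  · exact ⟨(by fun_prop (disch := simp [*])), (by fun_prop (disch := simp [*])),
      (by fun_prop (disch := simp [*])), (by fun_prop (disch := simp [*])),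
      (by fun_prop (disch := simp [*])), fun _ h0 => absurd h0 List.not_mem_nil⟩
  · exact 
      ⟨⟨(by fun_prop (disch := simp [*])), q1⟩,
      ⟨(by fun_prop (disch := simp [*])), p1⟩,
      ⟨(by fun_prop (disch := simp [*])), (notMem_OmegaSet_of_sq_eq hq0 hb2 1 (Or.inl (by
      rw [← hpq]; field_simp)))⟩,
      ⟨(by fun_prop (disch := simp [*])), (notMem_OmegaSet_of_sq_eq hq0 hb2 3 (Or.inr (by
      rw [← hpq]; field_simp)))⟩,
      fun _ h0 => absurd h0 List.not_mem_nil⟩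

theorem continuousAt_squareTerm₅ (hpq : p ^ 2 = q) (hp : p ≠ 0) (hq1 : ‖q‖ < 1) (hb : b ≠ 0)
    (hh : h ≠ 0) (hb2 : b ^ 2 ∉ UpsilonSet q) (hA : ContinuousAt A x₀) (hZ : ContinuousAt Z x₀)
    (hA0 : A x₀ ≠ 0) (hZ0 : Z x₀ ≠ 0) (hc : q * A x₀ / b ∉ OmegaSet q) (hz : Z x₀ ∉ OmegaSet q) (hc' : -(q * A x₀ / b) ∉ OmegaSet q)
    (hbz : -(b * Z x₀) ∉ OmegaSet q) :
    ContinuousAt (fun x => squareTerm₅ q p (A x) b h (Z x)) x₀ := by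
  have hq0 : q ≠ 0 := by rw [← hpq]; exact pow_ne_zero 2 hp
  have hp1 : ‖p‖ < 1 := by
    have : ‖p‖ ^ 2 < 1 := by rw [← norm_pow, hpq]; exact hq1
    exact (sq_lt_one_iff₀ (norm_nonneg _)).1 this
  have p3 : 1 / p ∉ OmegaSet q := fun h0 => notMem_UpsilonSet_of_sq hq0 hq1 hpq (by
    simpa using inv_mem_UpsilonSet (mem_UpsilonSet_of_mem_OmegaSet h0))
  have p4 : -(1 / p) ∉ OmegaSet q := fun h0 =>
    notMem_UpsilonSet_of_sq hq0 hq1 (x := -p) (by rw [neg_sq, hpq]) (by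
      simpa using inv_mem_UpsilonSet (mem_UpsilonSet_of_mem_OmegaSet h0))
  have p5 : p ^ 3 ∉ OmegaSet q := notMem_OmegaSet_of_norm_lt_one hq0 hq1 (by
    rw [norm_pow]; exact pow_lt_one₀ (norm_nonneg _) hp1 (by norm_num))
  have p6 : -(p ^ 3) ∉ OmegaSet q := notMem_OmegaSet_of_norm_lt_one hq0 hq1 (by
    rw [norm_neg, norm_pow]; exact pow_lt_one₀ (norm_nonneg _) hp1 (by norm_num))
  refine continuousAt_residueTerm hq0 hq1
    [fun x => -(h * (q * A x / b)), fun x => -(h / (b * Z x))]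
    [fun _ => -1, fun x => A x, fun x => -(A x / b), fun x => q * A x / b ^ 2,
      fun x => -(b * Z x / q), fun x => b ^ 2 * Z x / q]
    [fun x => Z x, fun x => -(b * Z x), fun _ => 1 / p, fun _ => -(1 / p), fun x => q * A x / b,
      fun x => q * A x / b, fun x => -(q * A x / b), fun _ => -(1 / b), fun _ => -(b / q)]
    [fun _ => -q, fun x => -(b * Z x), fun x => -(q * A x / b), fun x => -(q * b / A x),
      fun x => -(q ^ 2 / (b * Z x))]
    [fun _ => -(q * b), fun _ => p ^ 3, fun _ => -(p ^ 3),
      fun _ => -(q ^ 2 / b)] rfl ?_ ?_ ?_ ?_ ?_ <;> simp only [List.forall_mem_cons]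
  · exact ⟨⟨(by fun_prop (disch := simp [*])), by simp [*]⟩, ⟨(by fun_prop (disch := simp [*])),
      by simp [*]⟩, fun _ h0 => absurd h0 List.not_mem_nil⟩
  · exact ⟨(by fun_prop (disch := simp [*])), (by fun_prop (disch := simp [*])),
      (by fun_prop (disch := simp [*])), (by fun_prop (disch := simp [*])),
      (by fun_prop (disch := simp [*])), (by fun_prop (disch := simp [*])),
      fun _ h0 => absurd h0 List.not_mem_nil⟩
  · exact 
      ⟨⟨(by fun_prop (disch := simp [*])), hz⟩,
      ⟨(by fun_prop (disch := simp [*])), hbz⟩,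
      ⟨(by fun_prop (disch := simp [*])), p3⟩,
      ⟨(by fun_prop (disch := simp [*])), p4⟩,
      ⟨(by fun_prop (disch := simp [*])), hc⟩,
      ⟨(by fun_prop (disch := simp [*])), hc⟩,
      ⟨(by fun_prop (disch := simp [*])), hc'⟩,
      ⟨(by fun_prop (disch := simp [*])), (notMem_OmegaSet_of_sq_eq hq0 hb2 0 (Or.inr (by
      rw [← hpq]; field_simp)))⟩,
      ⟨(by fun_prop (disch := simp [*])), (notMem_OmegaSet_of_sq_eq hq0 hb2 (-2) (Or.inl (by
      rw [← hpq]; field_simp)))⟩,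
      fun _ h0 => absurd h0 List.not_mem_nil⟩
  · exact ⟨(by fun_prop (disch := simp [*])), (by fun_prop (disch := simp [*])),
      (by fun_prop (disch := simp [*])), (by fun_prop (disch := simp [*])),
      (by fun_prop (disch := simp [*])), fun _ h0 => absurd h0 List.not_mem_nil⟩
  · exact 
      ⟨⟨(by fun_prop (disch := simp [*])), (notMem_OmegaSet_of_sq_eq hq0 hb2 2 (Or.inl (by
      rw [← hpq]; field_simp)))⟩,
      ⟨(by fun_prop (disch := simp [*])), p5⟩,
      ⟨(by fun_prop (disch := simp [*])), p6⟩,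
      ⟨(by fun_prop (disch := simp [*])), (notMem_OmegaSet_of_sq_eq hq0 hb2 4 (Or.inr (by
      rw [← hpq]; field_simp)))⟩,
      fun _ h0 => absurd h0 List.not_mem_nil⟩

end SquareContinuity

/-! ### The five-term formula in full; formula (2). -/

section SquareFormula

variable {q p a b h z : ℂ}

theorem div_sq_notMem_UpsilonSet (hb : b ^ 2 ∉ UpsilonSet q) (hh : h ^ 2 = q)
    (hq0 : q ≠ 0) : (b / h) ^ 2 ∉ UpsilonSet q := by
  rw [div_pow, hh]
  exact fun h0 => hb (zpow_mul_mem_UpsilonSet hq0 (-1) (by simpa [div_eq_inv_mul] using h0))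

/-- Deform a to ae^{x} and z to ze^{2x}, which moves V and U with the exponents 1 and 2 of
`exists_countable_generic` and keeps b fixed. The hypotheses make both sides continuous at x = 0. -/
theorem square_eq (hpq : p ^ 2 = q) (hp : p ≠ 0) (hq1 : ‖q‖ < 1) (ha : a ≠ 0)
    (hb : b ≠ 0) (hz : z ≠ 0) (hh : h ≠ 0) (hz1 : ‖z‖ < 1) (hb2 : b ^ 2 ∉ UpsilonSet q)
    (hc : q * a / b ∉ OmegaSet q) (hc' : -(q * a / b) ∉ OmegaSet q)
    (hbz : -(b * z) ∉ OmegaSet q) :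
    qThetaL [h, h * (q * a / (b ^ 2 * z))] q * qHyp [a, b] [q * a / b] q z ^ 2 =
      squareTerm₁ q p a b h z + squareTerm₂ q p a b h z + squareTerm₃ q p a b h z +
        squareTerm₄ q p a b h z + squareTerm₅ q p a b h z := by
  have hq0 : q ≠ 0 := by rw [← hpq]; exact pow_ne_zero 2 hp
  let A : ℝ → ℂ := fun x => a * Complex.exp ((1 * x : ℝ) : ℂ)
  let Z : ℝ → ℂ := fun x => z * Complex.exp ((2 * x : ℝ) : ℂ)
  have hA : ContinuousAt A 0 := by fun_prop
  have hZ : ContinuousAt Z 0 := by fun_prop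
  have hA0 : A 0 = a := by simp [A]
  have hZ0 : Z 0 = z := by simp [Z]
  have hAne : A 0 ≠ 0 := by rwa [hA0]
  have hZne : Z 0 ≠ 0 := by rwa [hZ0]
  have hcA : q * A 0 / b ∉ OmegaSet q := by rwa [hA0]
  have hzn : Z 0 ∉ OmegaSet q := by
    rw [hZ0]; exact notMem_OmegaSet_of_norm_lt_one hq0 hq1 hz1
  obtain ⟨s, hs, hgen⟩ := exists_countable_generic (U := b * z / p) (V := p * a / b) hpq hp hq1
    (div_ne_zero hb hp) (div_sq_notMem_UpsilonSet hb2 hpq hq0)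
    (div_ne_zero (mul_ne_zero hb hz) hp) (div_ne_zero (mul_ne_zero hp ha) hb)
  have hcont : ContinuousAt (fun x => qThetaL [h, h * (q * A x / (b ^ 2 * Z x))] q *
      qHyp [A x, b] [q * A x / b] q (Z x) ^ 2) 0 := by
    refine ContinuousAt.mul (continuousAt_qThetaL hq1
      [fun _ => h, fun x => h * (q * A x / (b ^ 2 * Z x))] ?_) (ContinuousAt.pow
      (continuousAt_qHyp hq0 hq1 [A, fun _ => b] [fun x => q * A x / b] Z rfl ?_ ?_ ?_ hZ
        (by rwa [hZ0])) 2) <;> simp only [List.forall_mem_cons]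
    · exact ⟨⟨continuousAt_const, hh⟩, ⟨by fun_prop (disch := simp [*]), by simp [*]⟩,
        fun _ h0 => absurd h0 List.not_mem_nil⟩
    · exact ⟨hA, continuousAt_const, fun _ h0 => absurd h0 List.not_mem_nil⟩
    · exact ⟨by fun_prop (disch := simp [*]), fun _ h0 => absurd h0 List.not_mem_nil⟩
    · exact ⟨hcA, fun _ h0 => absurd h0 List.not_mem_nil⟩
  have key := eq_of_eq_off_countable hcont
    ((((continuousAt_squareTerm₁ (h := h) hpq hp hq1 hb hh hb2 hA hZ hAne hZne hcA).add
      (continuousAt_squareTerm₂ hpq hp hq1 hb hh hb2 hA hZ hAne hZne hcA hzn)).add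
      (continuousAt_squareTerm₃ hpq hp hq1 hb hh hb2 hA hZ hAne hZne hcA hzn)).add
      (continuousAt_squareTerm₄ hpq hp hq1 hb hh hb2 hA hZ hAne hZne hcA hzn) |>.add
      (continuousAt_squareTerm₅ hpq hp hq1 hb hh hb2 hA hZ hAne hZne hcA hzn (by rwa [hA0])
        (by rwa [hZ0]))) hs ?_
  · simpa only [Pi.add_apply, hA0, hZ0] using key
  · have hzx : ∀ᶠ x in 𝓝 (0 : ℝ), ‖Z x‖ < 1 :=
      hZ.norm.eventually_lt_const (show ‖Z 0‖ < 1 by rwa [hZ0])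
    have hcx : ∀ᶠ x in 𝓝 (0 : ℝ), q * A x / b ∉ OmegaSet q :=
      eventually_notMem_OmegaSet hq0 hq1 (b := fun x => q * A x / b)
        (by fun_prop (disch := simp [*])) hcA
    filter_upwards [hzx, hcx] with x hx hx' hxs
    obtain ⟨h1, h2⟩ := hgen x hxs
    have eU : b * z / p * Complex.exp ((2 * x : ℝ) : ℂ) = b * Z x / p := by simp only [Z]; ring
    have eV : p * a / b * Complex.exp ((1 * x : ℝ) : ℂ) = p * A x / b := by simp only [A]; ring
    rw [eU, eV] at h1 h2
    exact square_eq_of_generic hpq hp hq1 (mul_ne_zero ha (Complex.exp_ne_zero _)) hb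
      (mul_ne_zero hz (Complex.exp_ne_zero _)) hh hx h1 h2 hx'

theorem qThetaL_pair_ne_zero (hq0 : q ≠ 0) (hq1 : ‖q‖ < 1) {x y : ℂ} (hx : x ∉ UpsilonSet q) (hy : y ∉ UpsilonSet q) : qThetaL [x, y] q ≠ 0 := by
  simpa [qThetaL] using ⟨qTheta_ne_zero hq0 hq1 hx, qTheta_ne_zero hq0 hq1 hy⟩

end SquareFormula

/-! ### The Bailey–Daum sum from the second-order recurrences. -/

section BaileyDaum

variable {q p a b β U V : ℂ}

theorem qHyp_cancel (hq0 : q ≠ 0) {x : ℂ} (hx : x ∉ OmegaSet q) (as bs : List ℂ) (z : ℂ) :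
    qHyp (x :: as) (x :: bs) q z = qHyp as bs q z := by
  unfold qHyp
  refine tsum_congr fun k => ?_
  have hne : qPoch x q k ≠ 0 := by
    simpa [qPochL] using qPochL_ne_zero hq0 (bs := [x]) (by simpa using hx) k
  have e : ((bs.length + 1 : ℕ) : ℤ) + 1 - ((as.length + 1 : ℕ) : ℤ) =
      (bs.length : ℤ) + 1 - (as.length : ℤ) := by push_cast; ring
  rw [List.length_cons, List.length_cons, e]
  simp only [qPochL_cons]
  rw [mul_left_comm (qPoch q q k), mul_div_mul_left _ _ hne]

/-- At V = 0 the coefficient E vanishes and the recurrence becomes f(U) = (1-pU) f(Uq). Iterating it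
gives the product; this is the q-binomial theorem for ₁φ₀(b;z). -/
theorem clausenSeries_zero_right (hpq : p ^ 2 = q) (hp : p ≠ 0) (hq1 : ‖q‖ < 1) (hβ : β ≠ 0)
    (hz : ‖U / β‖ < 1) : clausenSeries q p β U 0 = qPochInf (p * U) q := by
  have hq0 : q ≠ 0 := by rw [← hpq]; exact pow_ne_zero 2 hp
  have h0 : p * 0 ∉ OmegaSet q := notMem_OmegaSet_of_norm_lt_one hq0 hq1 (by simp)
  have key : ∀ n : ℕ, qPoch (p * U) q n * clausenSeries q p β (U * q ^ n) 0 =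
      clausenSeries q p β U 0 := by
    intro n
    induction n with
    | zero => simp [qPoch_zero]
    | succ n ih =>
      rw [← ih, clausenSeries_rec_left hpq hp hq1 hβ (U := U * q ^ n) (by
        simpa [div_mul_eq_mul_div] using norm_mul_pow_lt_one hq1 hz n) h0, qPoch_succ, cE, cM,
        pow_succ, ← mul_assoc U]
      ring
  have hlim := (tendsto_qPoch hq1 (p * U)).mul
    (tendsto_clausenSeries (β := β) (U := U) hq0 hq1 h0)
  have := tendsto_nhds_unique (tendsto_const_nhds.congr fun n => (key n).symm) hlim
  simpa [qPochInf_zero] using this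

/-- The Bailey–Daum summation formula. -/
theorem clausenSeries_neg (hpq : p ^ 2 = q) (hp : p ≠ 0) (hq1 : ‖q‖ < 1) (hβ : β ≠ 0)
    (hz : ‖-p / β‖ < 1) (hc : p * V ∉ OmegaSet q) :
    clausenSeries q p β (-p) V = qPochInf (-q) q *
      (qPochInf (q * (β * V)) (q ^ 2) * qPochInf (q * (V / β)) (q ^ 2)) := by
  have hq0 : q ≠ 0 := by rw [← hpq]; exact pow_ne_zero 2 hp
  have hq2 : ‖q ^ 2‖ < 1 := by
    rw [norm_pow]; exact pow_lt_one₀ (norm_nonneg _) hq1 two_ne_zero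
  -- For U = -p the factor 1+U/p is zero, so the recurrence in V reads f(V) = (1-qβV)(1-qV/β)
  -- f(Vq²). Hence the base q².
  have key : ∀ n : ℕ, qPoch (q * (β * V)) (q ^ 2) n * qPoch (q * (V / β)) (q ^ 2) n *
      clausenSeries q p β (-p) (V * (q ^ 2) ^ n) = clausenSeries q p β (-p) V := by
    intro n
    induction n with
    | zero => simp [qPoch_zero]
    | succ n ih =>
      rw [← ih, clausenSeries_rec_right hpq hp hq1 hβ (V := V * (q ^ 2) ^ n) hz (by
        rw [← pow_mul, ← mul_assoc]; exact mul_pow_notMem_OmegaSet hq0 hc _),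
        qPoch_succ, qPoch_succ, cE, neg_div, div_self hp, pow_succ (q ^ 2) n,
        show V * ((q ^ 2) ^ n * q ^ 2) = V * (q ^ 2) ^ n * q * q by ring]
      ring
  have hlim := ((tendsto_qPoch hq2 (q * (β * V))).mul (tendsto_qPoch hq2 (q * (V / β)))).mul
    (show Tendsto (fun n : ℕ => clausenSeries q p β (-p) (V * (q ^ 2) ^ n)) atTop
      (𝓝 (clausenSeries q p β (-p) 0)) from by
      have h1 : ContinuousAt (fun v : ℂ => clausenSeries q p β (-p) v) 0 :=
        continuousAt_clausenSeries (f := fun _ => -p) (g := fun v => v) hq0 hq1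
          continuousAt_const continuousAt_id hz
          (notMem_OmegaSet_of_norm_lt_one hq0 hq1 (by simp))
      exact h1.tendsto.comp (tendsto_mul_pow_zero hq2 V))
  have := tendsto_nhds_unique (tendsto_const_nhds.congr fun n => (key n).symm) hlim
  rw [this, clausenSeries_zero_right hpq hp hq1 hβ hz, show p * -p = -q by rw [← hpq]; ring]
  ring

/-- The left-hand side of the summation formulas. -/
theorem baileyDaum_sq (hpq : p ^ 2 = q) (hp : p ≠ 0) (hq1 : ‖q‖ < 1) (hb : b ≠ 0)
    (hz : ‖q / b‖ < 1) (hc : q * a / b ∉ OmegaSet q) :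
    qPochInfL [-q, -q] q *
          qPochInfL [q * a, q * a, q ^ 2 * a / b ^ 2, q ^ 2 * a / b ^ 2] (q ^ 2) /
          qPochInfL [-(q / b), -(q / b), q * a / b, q * a / b] q =
      qHyp [a, b] [q * a / b] q (-(q / b)) ^ 2 := by
  have hq0 : q ≠ 0 := by rw [← hpq]; exact pow_ne_zero 2 hp
  have e1 : -p / (b / p) = -(q / b) := by rw [← hpq]; field_simp
  have e3 : b / p * (p * a / b) = a := by field_simp
  have e4 : q * (p * a / b / (b / p)) = q ^ 2 * a / b ^ 2 := by rw [← hpq]; field_simp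
  have e5 : p * (p * a / b) = q * a / b := by rw [← hpq]; ring
  have e7 : b / p * p = b := by field_simp
  have key := clausenSeries_neg (β := b / p) (V := p * a / b) hpq hp hq1 (div_ne_zero hb hp)
    (by rwa [e1, norm_neg]) (by rwa [e5])
  unfold clausenSeries at key
  rw [e1, e3, e4, e5, e7] at key
  have n1 := qPochInf_ne_zero hq0 hq1 hc
  have n2 := qPochInf_ne_zero_of_norm_lt_one hq0 hq1 (a := -(q / b)) (by rwa [norm_neg])
  rw [div_eq_iff (by simp [qPochInfL, n1, n2])]
  simp only [qPochInfL, List.map_cons, List.map_nil, List.prod_cons, List.prod_nil, mul_one]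
  linear_combination (-(qPochInf (-q) q *
      (qPochInf (q * a) (q ^ 2) * qPochInf (q ^ 2 * a / b ^ 2) (q ^ 2))) -
    qPochInf (-(q / b)) q * qPochInf (q * a / b) q * qHyp [a, b] [q * a / b] q (-(q / b))) * key

end BaileyDaum

/-! ### The two Jackson sums at z = -q/b as ₄φ₃ series. -/

section TwoTermSum

variable {q p a b β V : ℂ}

/-- Each infinite product at xq^k is the product at x divided by a finite shifted factorial. The
upper and lower parameters trade places: a product in the denominator of the kernel yields an upper
parameter of the series. -/
theorem jacksonSum_eq_qHyp (hq0 : q ≠ 0) (hq1 : ‖q‖ < 1) {F : ℂ → ℂ}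
    {x n₁ n₂ n₃ d₁ d₂ d₃ d₄ : ℂ} (hn₁ : n₁ ∉ OmegaSet q) (hn₂ : n₂ ∉ OmegaSet q)
    (hn₃ : n₃ ∉ OmegaSet q) (hd₁ : d₁ ∉ OmegaSet q) (hd₂ : d₂ ∉ OmegaSet q)
    (hd₃ : d₃ ∉ OmegaSet q) (hd₄ : d₄ ∉ OmegaSet q)
    (hF : ∀ k : ℕ, F (x * q ^ k) = qPochInf (q * q ^ k) q * qPochInf (n₁ * q ^ k) q *
      qPochInf (n₂ * q ^ k) q * qPochInf (n₃ * q ^ k) q / (qPochInf (d₁ * q ^ k) q *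
      qPochInf (d₂ * q ^ k) q * qPochInf (d₃ * q ^ k) q * qPochInf (d₄ * q ^ k) q)) :
    jacksonSum q F x = x * (qPochInf q q * qPochInf n₁ q * qPochInf n₂ q * qPochInf n₃ q /
      (qPochInf d₁ q * qPochInf d₂ q * qPochInf d₃ q * qPochInf d₄ q)) *
      qHyp [d₁, d₂, d₃, d₄] [n₁, n₂, n₃] q q := by
  unfold jacksonSum
  rw [qHyp_eq_tsum rfl, ← tsum_mul_left]
  refine tsum_congr fun k => ?_
  have hsplit : ∀ y, y ∉ OmegaSet q → qPochInf y q = qPoch y q k * qPochInf (y * q ^ k) q ∧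
      qPoch y q k ≠ 0 ∧ qPochInf (y * q ^ k) q ≠ 0 := fun y hy => by
    have h := qPochInf_eq_qPoch_mul hq1 y k
    have h0 := qPochInf_ne_zero hq0 hq1 hy
    rw [h] at h0
    exact ⟨h, left_ne_zero_of_mul h0, right_ne_zero_of_mul h0⟩
  obtain ⟨e0, a0, b0⟩ := hsplit q (notMem_OmegaSet_of_norm_lt_one hq0 hq1 hq1)
  obtain ⟨e1, a1, b1⟩ := hsplit _ hn₁
  obtain ⟨e2, a2, b2⟩ := hsplit _ hn₂
  obtain ⟨e3, a3, b3⟩ := hsplit _ hn₃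
  obtain ⟨f1, c1, g1⟩ := hsplit _ hd₁
  obtain ⟨f2, c2, g2⟩ := hsplit _ hd₂
  obtain ⟨f3, c3, g3⟩ := hsplit _ hd₃
  obtain ⟨f4, c4, g4⟩ := hsplit _ hd₄
  rw [hF, e0, e1, e2, e3, f1, f2, f3, f4]
  simp only [qPochL, List.map_cons, List.map_nil, List.prod_cons, List.prod_nil, mul_one]
  clear hsplit hF e0 e1 e2 e3 f1 f2 f3 f4
  generalize qPochInf (q * q ^ k) q = B0 at *
  generalize qPochInf (n₁ * q ^ k) q = B1 at *
  generalize qPochInf (n₂ * q ^ k) q = B2 at *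
  generalize qPochInf (n₃ * q ^ k) q = B3 at *
  generalize qPochInf (d₁ * q ^ k) q = G1 at *
  generalize qPochInf (d₂ * q ^ k) q = G2 at *
  generalize qPochInf (d₃ * q ^ k) q = G3 at *
  generalize qPochInf (d₄ * q ^ k) q = G4 at *
  field_simp

/-- For U = -p both (qX/U;q)_∞ and (UX;q)_∞ equal (-pX;q)_∞. After (X²;q)_∞ is split, one copy each
of (pX;q)_∞ and (-pX;q)_∞ cancels. -/
theorem clausenKernel_neg (hpq : p ^ 2 = q) (hp : p ≠ 0) (hq1 : ‖q‖ < 1) {X : ℂ}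
    (h1 : p * X ∉ OmegaSet q) (h2 : -(p * X) ∉ OmegaSet q) :
    clausenKernel q p β (-p) V X = qPochInf (q * X / V) q * qPochInf (V * X) q *
      qPochInf (p * X) q * qPochInf (-(p * X)) q / (qPochInf (β * X) q * qPochInf (X / β) q *
        qPochInf X q * qPochInf (-X) q) := by
  have hq0 : q ≠ 0 := by rw [← hpq]; exact pow_ne_zero 2 hp
  have n1 := qPochInf_ne_zero hq0 hq1 h1
  have n2 := qPochInf_ne_zero hq0 hq1 h2
  unfold clausenKernel
  rw [qPochInf_sq hpq hq1, show q * X / -p = -(p * X) by rw [← hpq]; field_simp,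
    show -p * X = -(p * X) by ring]
  rw [← mul_div_mul_right _ (qPochInf (β * X) q * qPochInf (X / β) q * qPochInf X q *
    qPochInf (-X) q) (mul_ne_zero n1 n2)]
  congr 1 <;> ring

/-- Euler's identity (-q;q)_∞ (q;q²)_∞ = 1 with (q;q²)_∞ = (p,-p;q)_∞. It follows by splitting
(p²;q)_∞ = (q;q)_∞ and cancelling (q;q)_∞. -/
theorem qPochInf_neg_q_mul (hpq : p ^ 2 = q) (hp : p ≠ 0) (hq1 : ‖q‖ < 1) :
    qPochInf (-q) q * (qPochInf p q * qPochInf (-p) q) = 1 := by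
  have hq0 : q ≠ 0 := by rw [← hpq]; exact pow_ne_zero 2 hp
  have h := qPochInf_sq hpq hq1 p
  rw [hpq, ← sq, hpq] at h
  refine mul_left_cancel₀ (qPochInf_ne_zero_of_norm_lt_one hq0 hq1 hq1) ?_
  rw [mul_one]
  conv_rhs => rw [h]
  ring

/-- The two-term summation formula for generic parameters. -/
theorem two_term_sum_of_generic (hpq : p ^ 2 = q) (hp : p ≠ 0) (hq1 : ‖q‖ < 1) (ha : a ≠ 0)
    (hb : b ≠ 0) (hz : ‖q / b‖ < 1) (hg : ClausenGeneric q (b / p) (-p) (p * a / b))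
    (hc : q * a / b ∉ OmegaSet q) :
    qHyp [a, b] [q * a / b] q (-(q / b)) ^ 2 =
      qThetaL [] q * qPochInfL [-b, -(q * a / b)] q / qPochInfL [-(q / b), -(b / a)] q *
            qHyp [a * p / b, -(a * p / b), q * a / b ^ 2, a]
              [q * a / b, -(q * a / b), q * a ^ 2 / b ^ 2] q q +
          qThetaL [] q * qPochInfL [-q, -q, a, -(q * a / b), q * a / b ^ 2] q /
            qPochInfL [q * a / b, q * a / b, -(q / b), -(q / b), -(a / b)] q *
            qHyp [p, -p, -b, -(q / b)] [-q, -(q * a / b), -(q * b / a)] q q := by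
  have hq0 : q ≠ 0 := by rw [← hpq]; exact pow_ne_zero 2 hp
  have hp1 : ‖p‖ < 1 := by
    have : ‖p‖ ^ 2 < 1 := by rw [← norm_pow, hpq]; exact hq1
    exact (sq_lt_one_iff₀ (norm_nonneg _)).1 this
  have e1 : -p / (b / p) = -(q / b) := by rw [← hpq]; field_simp
  have e2 : b / p * -p = -b := by field_simp
  have e3 : b / p * (p * a / b) = a := by field_simp
  have e4 : p * a / b / (b / p) = q * a / b ^ 2 := by rw [← hpq]; field_simp
  have e5 : p * (p * a / b) = q * a / b := by rw [← hpq]; ring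
  have e6 : p * a / b = a * p / b := by ring
  have e7 : b / p * p = b := by field_simp
  have e8 : (a * p / b) ^ 2 = q * a ^ 2 / b ^ 2 := by rw [← hpq]; ring
  have key := clausenSeries_sq hpq hp hq1 hg (by rwa [e1, norm_neg]) (by rwa [e5])
  have hβU := hg.βU
  have hUβ := hg.Uβ
  have hβV := hg.βV
  have hVβ := hg.Vβ
  have hVV := hg.VV
  have hUV := hg.UV
  have hUVd := hg.hUV
  rw [e2] at hβU
  rw [e1] at hUβ
  rw [e3] at hβV
  rw [e4] at hVβ
  rw [e6, e8] at hVV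
  rw [neg_mul, e5] at hUV
  have hqU : -(q * b / a) ∉ OmegaSet q := fun h0 => hUVd (mul_q_mem_UpsilonSet hq0 (by
    convert! mem_UpsilonSet_of_mem_OmegaSet h0 using 1
    field_simp))
  have hV : a * p / b ∉ OmegaSet q := fun ⟨k, hk⟩ => hVV ⟨k * 2, by
    simp only at hk ⊢
    rw [← e8, ← hk, inv_pow, ← pow_mul]⟩
  have hV' : -(a * p / b) ∉ OmegaSet q := fun ⟨k, hk⟩ => hVV ⟨k * 2, by
    simp only at hk ⊢
    rw [← e8, ← neg_sq, ← hk, inv_pow, ← pow_mul]⟩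
  have hpΩ : p ∉ OmegaSet q := notMem_OmegaSet_of_norm_lt_one hq0 hq1 hp1
  have hpΩ' : -p ∉ OmegaSet q := notMem_OmegaSet_of_norm_lt_one hq0 hq1 (by rwa [norm_neg])
  have hqΩ' : -q ∉ OmegaSet q := notMem_OmegaSet_of_norm_lt_one hq0 hq1 (by rwa [norm_neg])
  have hqΩ : q ∉ OmegaSet q := notMem_OmegaSet_of_norm_lt_one hq0 hq1 hq1
  have J1 := jacksonSum_eq_qHyp (F := clausenKernel q p (b / p) (-p) (p * a / b)) (x := -p) hq0 hq1
    hqΩ' hUV hqU hpΩ hpΩ' hβU hUβ fun k => by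
      have x1 : p * (-p * q ^ k) = -q * q ^ k := by rw [← hpq]; ring
      have x2 : -(-q * q ^ k) = q * q ^ k := by ring
      have x3 : q * (-p * q ^ k) / (p * a / b) = -(q * b / a) * q ^ k := by field_simp
      have x4 : p * a / b * (-p * q ^ k) = -(q * a / b) * q ^ k := by rw [← hpq]; ring
      have x5 : b / p * (-p * q ^ k) = -b * q ^ k := by field_simp
      have x6 : -p * q ^ k / (b / p) = -(q / b) * q ^ k := by
        rw [← e1]; field_simp
      have x7 : -(-p * q ^ k) = p * q ^ k := by ring
      rw [clausenKernel_neg hpq hp hq1 (by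
        rw [x1]; exact mul_pow_notMem_OmegaSet hq0 hqΩ' k) (by
        rw [x1, x2]; exact mul_pow_notMem_OmegaSet hq0 hqΩ k), x1, x2, x3, x4, x5, x6, x7]
      congr 1 <;> ring
  have J2 := jacksonSum_eq_qHyp (F := clausenKernel q p (b / p) (-p) (p * a / b))
    (x := a * p / b) hq0 hq1 hc hUV hVV hV hV' hVβ hβV fun k => by
      have x1 : p * (a * p / b * q ^ k) = q * a / b * q ^ k := by rw [← hpq]; ring
      have x2 : -(q * a / b * q ^ k) = -(q * a / b) * q ^ k := by ring
      have x3 : q * (a * p / b * q ^ k) / (p * a / b) = q * q ^ k := by field_simp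
      have x4 : p * a / b * (a * p / b * q ^ k) = q * a ^ 2 / b ^ 2 * q ^ k := by
        rw [← hpq]; ring
      have x5 : b / p * (a * p / b * q ^ k) = a * q ^ k := by field_simp
      have x6 : a * p / b * q ^ k / (b / p) = q * a / b ^ 2 * q ^ k := by
        rw [← e4]; ring
      have x7 : -(a * p / b * q ^ k) = -(a * p / b) * q ^ k := by ring
      rw [clausenKernel_neg hpq hp hq1 (by
        rw [x1]; exact mul_pow_notMem_OmegaSet hq0 hc k) (by
        rw [x1, x2]; exact mul_pow_notMem_OmegaSet hq0 hUV k), x1, x2, x3, x4, x5, x6, x7]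
      congr 1 <;> ring
  unfold clausenIntegral clausenConst clausenSeries at key
  rw [e6] at key e3 e4 e5 J1 J2
  have e9 : q * (a * p / b) / -p = -(q * a / b) := by rw [div_neg]; field_simp
  have e10 : q * -p / (a * p / b) = -(q * b / a) := by field_simp
  rw [J1, J2, e1, e2, e3, e4, e5, e7, e9, e10] at key
  have hsq := qPochInf_sq hpq hq1 (a * p / b)
  rw [e8, e5] at hsq
  have s1 := qPochInf_step hq1 (-(a / b))
  have s2 := qPochInf_step hq1 (-(b / a))
  have nz : ∀ y, y ∉ OmegaSet q → qPochInf y q ≠ 0 := fun y hy => qPochInf_ne_zero hq0 hq1 hy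
  have hE := eq_div_of_mul_eq (mul_ne_zero (nz _ hpΩ) (nz _ hpΩ')) (qPochInf_neg_q_mul hpq hp hq1)
  -- The factor U-V of the constant is -p(1+w), and 1+w also appears as the first factor of
  -- (-a/b;q)_∞ and, divided by w, of (-b/a;q)_∞. Naming w lets these cancel.
  obtain ⟨w, hw⟩ : ∃ w, w = a / b := ⟨_, rfl⟩
  have hw0 : w ≠ 0 := hw ▸ div_ne_zero ha hb
  have hw1 : 1 + w ≠ 0 := fun h0 => hUVd ⟨0, by
    simp only [zpow_zero]
    rw [e6, show a * p / b = p * w by rw [hw]; ring, show w = -1 by linear_combination h0]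
    field_simp⟩
  rw [sub_neg_eq_add, ← hw, show -w * q = -(q * a / b) by rw [hw]; ring] at s1
  rw [sub_neg_eq_add, show -(b / a) * q = -(q * b / a) by ring,
    show 1 + b / a = (1 + w) / w by rw [hw]; field_simp; ring] at s2
  rw [show -p - a * p / b = -(p * (1 + w)) by rw [hw]; ring,
    show a * p / b = w * p by rw [hw]; ring] at key
  simp only [qThetaL, qPochInfL, List.map_cons, List.map_nil, List.prod_cons, List.prod_nil,
    mul_one, one_mul]
  rw [show a * p / b = w * p by rw [hw]; ring, ← hw, s1, s2, hE]
  rw [show a * p / b = w * p by rw [hw]; ring] at hsq hV hV'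
  rw [hE, hsq] at key
  have n1 := nz _ hβU
  have n2 := nz _ hUβ
  have n3 := nz _ hβV
  have n4 := nz _ hVβ
  have n5 := nz _ hUV
  have n6 := nz _ hqU
  have n7 := nz _ hV
  have n8 := nz _ hV'
  have n9 := nz _ hpΩ
  have n10 := nz _ hpΩ'
  have n11 := nz _ hqΩ
  have n12 := nz _ hc
  clear hsq s1 s2 hE J1 J2 hg nz
  generalize qHyp [a, b] [q * a / b] q (-(q / b)) = φ at *
  generalize qHyp [p, -p, -b, -(q / b)] [-q, -(q * a / b), -(q * b / a)] q q = φ₁ at *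
  generalize qHyp [w * p, -(w * p), q * a / b ^ 2, a]
    [q * a / b, -(q * a / b), q * a ^ 2 / b ^ 2] q q = φ₂ at *
  generalize qPochInf (-b) q = X1 at *
  generalize qPochInf (-(q / b)) q = X2 at *
  generalize qPochInf a q = X3 at *
  generalize qPochInf (q * a / b ^ 2) q = X4 at *
  generalize qPochInf (-(q * a / b)) q = X5 at *
  generalize qPochInf (-(q * b / a)) q = X6 at *
  generalize qPochInf (w * p) q = X7 at *
  generalize qPochInf (-(w * p)) q = X8 at *
  generalize qPochInf p q = X9 at *
  generalize qPochInf (-p) q = X10 at *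
  generalize qPochInf q q = X11 at *
  generalize qPochInf (q * a / b) q = X12 at *
  -- The Jackson formula concerns the normalized series, so its normalizing products are restored
  -- here.
  have h2 : φ ^ 2 = (X2 * X12 * φ) ^ 2 / (X2 ^ 2 * X12 ^ 2) := by field_simp
  rw [h2, key]
  generalize 1 + w = W at *
  clear key h2
  field_simp
  ring

end TwoTermSum

/-! ### The two-term summation for all admissible parameters; formula (3). -/

section TwoTermSum

variable {q p a b : ℂ}

/-- U stays at -p, so only a and b can move. With a scaled by e^{3x} and b by e^{x}, the quantities
b, q/b, a, qa/b², qa²/b², qa/b and b/a vary with exponents 1, -1, 3, 1, 4, 2 and -2, none of them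
zero. -/
theorem exists_countable_generic_neg (hpq : p ^ 2 = q) (hp : p ≠ 0) (hq1 : ‖q‖ < 1) (ha : a ≠ 0)
    (hb : b ≠ 0) : ∃ s : Set ℝ, s.Countable ∧ ∀ x : ℝ, x ∉ s →
      ClausenGeneric q (b * Complex.exp ((1 * x : ℝ) : ℂ) / p) (-p)
        (p * (a * Complex.exp ((3 * x : ℝ) : ℂ)) / (b * Complex.exp ((1 * x : ℝ) : ℂ))) := by
  have hq0 : q ≠ 0 := by rw [← hpq]; exact pow_ne_zero 2 hp
  let S : ℂ → ℝ → Set ℝ := fun C m => {x | C * Complex.exp ((m * x : ℝ) : ℂ) ∈ UpsilonSet q}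
  have hS : ∀ C m, C ≠ 0 → m ≠ 0 → (S C m).Countable := fun C m =>
    countable_setOf_exp_mem_UpsilonSet C m
  refine ⟨(S (-b) 1 ∪ S (-(q / b)) (-1) ∪ S a 3) ∪ ((S (q * a / b ^ 2) 1 ∪
    S (q * a ^ 2 / b ^ 2) 4) ∪ (S (-(q * a / b)) 2 ∪ S (-(b / a)) (-2))),
    (((hS _ _ ?_ ?_).union (hS _ _ ?_ ?_)).union (hS _ _ ?_ ?_)).union
      (((hS _ _ ?_ ?_).union (hS _ _ ?_ ?_)).union ((hS _ _ ?_ ?_).union (hS _ _ ?_ ?_))),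
    fun x hx => ?_⟩
  any_goals norm_num; done
  any_goals simp [*]; done
  simp only [Set.mem_union, not_or] at hx
  obtain ⟨⟨⟨h1, h2⟩, h3⟩, ⟨h4, h5⟩, h6, h7⟩ := hx
  have hexp : ∀ n : ℕ, Complex.exp (((n : ℝ) * x : ℝ) : ℂ) = Complex.exp (x : ℂ) ^ n := fun n => by
    rw [← Complex.exp_nat_mul]; congr 1; push_cast; ring
  have hexp' : ∀ n : ℕ, Complex.exp (((-(n : ℝ)) * x : ℝ) : ℂ) = (Complex.exp (x : ℂ) ^ n)⁻¹ :=
    fun n => by rw [← hexp, ← Complex.exp_neg]; congr 1; push_cast; ring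
  have x1 := hexp 1
  have x2 := hexp 2
  have x3 := hexp 3
  have x4 := hexp 4
  have y1 := hexp' 1
  have y2 := hexp' 2
  norm_num only [Nat.cast_ofNat, Nat.cast_one] at x1 x2 x3 x4 y1 y2
  have he := Complex.exp_ne_zero (x : ℂ)
  have use : ∀ {C : ℂ} {m : ℝ} {y : ℂ}, x ∉ S C m → y = C * Complex.exp ((m * x : ℝ) : ℂ) →
      y ∉ UpsilonSet q := fun h1 h2 h3 => h1 (by show _ ∈ UpsilonSet q; rw [← h2]; exact h3)
  have useΩ : ∀ {C : ℂ} {m : ℝ} {y : ℂ}, x ∉ S C m → y = C * Complex.exp ((m * x : ℝ) : ℂ) →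
      y ∉ OmegaSet q := fun h1 h2 h3 => use h1 h2 (mem_UpsilonSet_of_mem_OmegaSet h3)
  have hbx : b * Complex.exp ((1 * x : ℝ) : ℂ) ≠ 0 := mul_ne_zero hb (Complex.exp_ne_zero _)
  have hax : a * Complex.exp ((3 * x : ℝ) : ℂ) ≠ 0 := mul_ne_zero ha (Complex.exp_ne_zero _)
  refine ⟨div_ne_zero hbx hp, neg_ne_zero.2 hp, div_ne_zero (mul_ne_zero hp hax) hbx,
    useΩ h1 ?_, useΩ h2 ?_, useΩ h3 ?_, useΩ h4 ?_, ?_, useΩ h5 ?_, useΩ h6 ?_, use h7 ?_⟩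
  · field_simp
  · rw [y1, x1, ← hpq]; field_simp
  · field_simp
  · rw [x1, x3, ← hpq]; field_simp
  · rw [neg_sq, hpq]; exact notMem_OmegaSet_of_norm_lt_one hq0 hq1 hq1
  · rw [x1, x3, x4, ← hpq]; field_simp
  · rw [x1, x2, x3, ← hpq]; field_simp
  · rw [x1, x3, y2]; field_simp

/-- Both sides are continuous along a curve in (a,b) on which z = -q/b moves together with b, and
they agree off a countable set. -/
theorem two_term_sum_of_norm_lt (hpq : p ^ 2 = q) (hp : p ≠ 0) (hq1 : ‖q‖ < 1) (ha : a ≠ 0)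
    (hb : b ≠ 0) (hz : ‖q / b‖ < 1) (hc : q * a / b ∉ OmegaSet q)
    (hd : q * a ^ 2 / b ^ 2 ∉ OmegaSet q) (hab : -(a / b) ∉ UpsilonSet q) :
    qHyp [a, b] [q * a / b] q (-(q / b)) ^ 2 =
      qThetaL [] q * qPochInfL [-b, -(q * a / b)] q / qPochInfL [-(q / b), -(b / a)] q *
            qHyp [a * p / b, -(a * p / b), q * a / b ^ 2, a]
              [q * a / b, -(q * a / b), q * a ^ 2 / b ^ 2] q q +
          qThetaL [] q * qPochInfL [-q, -q, a, -(q * a / b), q * a / b ^ 2] q /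
            qPochInfL [q * a / b, q * a / b, -(q / b), -(q / b), -(a / b)] q *
            qHyp [p, -p, -b, -(q / b)] [-q, -(q * a / b), -(q * b / a)] q q := by
  have hq0 : q ≠ 0 := by rw [← hpq]; exact pow_ne_zero 2 hp
  let A : ℝ → ℂ := fun x => a * Complex.exp ((3 * x : ℝ) : ℂ)
  let B : ℝ → ℂ := fun x => b * Complex.exp ((1 * x : ℝ) : ℂ)
  have hA : ContinuousAt A 0 := by fun_prop
  have hB : ContinuousAt B 0 := by fun_prop
  have hA0 : A 0 = a := by simp [A]
  have hB0 : B 0 = b := by simp [B]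
  have hAne : A 0 ≠ 0 := by rwa [hA0]
  have hBne : B 0 ≠ 0 := by rwa [hB0]
  have hzB : ‖q / B 0‖ < 1 := by rwa [hB0]
  have c1 : q * A 0 / B 0 ∉ OmegaSet q := by rwa [hA0, hB0]
  have c2 : q * A 0 ^ 2 / B 0 ^ 2 ∉ OmegaSet q := by rwa [hA0, hB0]
  have hab' : -(b / a) ∉ UpsilonSet q := fun h0 => hab (by
    convert! inv_mem_UpsilonSet h0 using 1
    rw [inv_neg, inv_div])
  have c3 : -(A 0 / B 0) ∉ OmegaSet q := by
    rw [hA0, hB0]; exact fun h0 => hab (mem_UpsilonSet_of_mem_OmegaSet h0)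
  have c4 : -(B 0 / A 0) ∉ OmegaSet q := by
    rw [hA0, hB0]; exact fun h0 => hab' (mem_UpsilonSet_of_mem_OmegaSet h0)
  have c5 : -(q * A 0 / B 0) ∉ OmegaSet q := by
    rw [hA0, hB0]
    refine fun h0 => hab (mul_q_mem_UpsilonSet hq0 ?_)
    rw [mul_neg, ← mul_div_assoc]; exact mem_UpsilonSet_of_mem_OmegaSet h0
  have c6 : -(q * B 0 / A 0) ∉ OmegaSet q := by
    rw [hA0, hB0]
    refine fun h0 => hab' (mul_q_mem_UpsilonSet hq0 ?_)
    rw [mul_neg, ← mul_div_assoc]; exact mem_UpsilonSet_of_mem_OmegaSet h0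
  have c7 : -(q / B 0) ∉ OmegaSet q :=
    notMem_OmegaSet_of_norm_lt_one hq0 hq1 (by rwa [norm_neg])
  have c8 : -q ∉ OmegaSet q := notMem_OmegaSet_of_norm_lt_one hq0 hq1 (by rwa [norm_neg])
  obtain ⟨s, hs, hgen⟩ := exists_countable_generic_neg hpq hp hq1 ha hb
  have hcont : ContinuousAt (fun x => qHyp [A x, B x] [q * A x / B x] q (-(q / B x)) ^ 2) 0 := by
    refine ContinuousAt.pow (continuousAt_qHyp hq0 hq1 [A, B] [fun x => q * A x / B x]
      (fun x => -(q / B x)) rfl ?_ ?_ ?_ (by fun_prop (disch := assumption))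
      (by rwa [norm_neg])) 2 <;>
      simp only [List.forall_mem_cons]
    · exact ⟨hA, hB, fun _ h0 => absurd h0 List.not_mem_nil⟩
    · exact ⟨by fun_prop (disch := assumption), fun _ h0 => absurd h0 List.not_mem_nil⟩
    · exact ⟨c1, fun _ h0 => absurd h0 List.not_mem_nil⟩
  have hB2 : B 0 ^ 2 ≠ 0 := pow_ne_zero 2 hBne
  have hT1 := continuousAt_residueTerm (x₀ := (0 : ℝ)) hq0 hq1 []
    [fun x => -B x, fun x => -(q * A x / B x)] [fun x => -(q / B x), fun x => -(B x / A x)]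
    [fun x => A x * p / B x, fun x => -(A x * p / B x), fun x => q * A x / B x ^ 2, A]
    [fun x => q * A x / B x, fun x => -(q * A x / B x), fun x => q * A x ^ 2 / B x ^ 2] rfl
    (fun _ h0 => absurd h0 List.not_mem_nil) (by
      simp only [List.forall_mem_cons]
      exact ⟨by fun_prop, by fun_prop (disch := assumption),
        fun _ h0 => absurd h0 List.not_mem_nil⟩) (by
      simp only [List.forall_mem_cons]
      exact ⟨⟨by fun_prop (disch := assumption), c7⟩, ⟨by fun_prop (disch := assumption), c4⟩,
        fun _ h0 => absurd h0 List.not_mem_nil⟩) (by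
      simp only [List.forall_mem_cons]
      exact ⟨by fun_prop (disch := assumption), by fun_prop (disch := assumption),
        by fun_prop (disch := assumption), hA, fun _ h0 => absurd h0 List.not_mem_nil⟩) (by
      simp only [List.forall_mem_cons]
      exact ⟨⟨by fun_prop (disch := assumption), c1⟩, ⟨by fun_prop (disch := assumption), c5⟩,
        ⟨by fun_prop (disch := assumption), c2⟩, fun _ h0 => absurd h0 List.not_mem_nil⟩)
  have hT2 := continuousAt_residueTerm (x₀ := (0 : ℝ)) hq0 hq1 []
    [fun _ => -q, fun _ => -q, A, fun x => -(q * A x / B x), fun x => q * A x / B x ^ 2]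
    [fun x => q * A x / B x, fun x => q * A x / B x, fun x => -(q / B x), fun x => -(q / B x),
      fun x => -(A x / B x)]
    [fun _ => p, fun _ => -p, fun x => -B x, fun x => -(q / B x)]
    [fun _ => -q, fun x => -(q * A x / B x), fun x => -(q * B x / A x)] rfl
    (fun _ h0 => absurd h0 List.not_mem_nil) (by
      simp only [List.forall_mem_cons]
      exact ⟨continuousAt_const, continuousAt_const, hA, by fun_prop (disch := assumption),
        by fun_prop (disch := assumption), fun _ h0 => absurd h0 List.not_mem_nil⟩) (by
      simp only [List.forall_mem_cons]
      exact ⟨⟨by fun_prop (disch := assumption), c1⟩, ⟨by fun_prop (disch := assumption), c1⟩,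
        ⟨by fun_prop (disch := assumption), c7⟩, ⟨by fun_prop (disch := assumption), c7⟩,
        ⟨by fun_prop (disch := assumption), c3⟩,
        fun _ h0 => absurd h0 List.not_mem_nil⟩) (by
      simp only [List.forall_mem_cons]
      exact ⟨continuousAt_const, continuousAt_const, hB.neg, by fun_prop (disch := assumption),
        fun _ h0 => absurd h0 List.not_mem_nil⟩) (by
      simp only [List.forall_mem_cons]
      exact ⟨⟨continuousAt_const, c8⟩, ⟨by fun_prop (disch := assumption), c5⟩,
        ⟨by fun_prop (disch := assumption), c6⟩, fun _ h0 => absurd h0 List.not_mem_nil⟩)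
  have key := eq_of_eq_off_countable hcont (hT1.add hT2) hs ?_
  · simpa only [Pi.add_apply, List.map_cons, List.map_nil, hA0, hB0] using key
  · have hzx : ∀ᶠ x in 𝓝 (0 : ℝ), ‖q / B x‖ < 1 :=
      (show ContinuousAt (fun x => ‖q / B x‖) 0 by
        fun_prop (disch := assumption)).eventually_lt_const hzB
    have hcx : ∀ᶠ x in 𝓝 (0 : ℝ), q * A x / B x ∉ OmegaSet q :=
      eventually_notMem_OmegaSet hq0 hq1 (b := fun x => q * A x / B x)
        (by fun_prop (disch := assumption)) c1
    filter_upwards [hzx, hcx] with x hx hx' hxs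
    exact two_term_sum_of_generic hpq hp hq1 (mul_ne_zero ha (Complex.exp_ne_zero _))
      (mul_ne_zero hb (Complex.exp_ne_zero _)) hx (hgen x hxs) hx'

/-- The two-term nonterminating summation formula. -/
theorem two_term_sum (hpq : p ^ 2 = q) (hp : p ≠ 0) (hq1 : ‖q‖ < 1) (ha : a ≠ 0)
    (hb : b ≠ 0) (hqb : -(q / b) ∉ OmegaSet q) (hc : q * a / b ∉ OmegaSet q)
    (hd : q * a ^ 2 / b ^ 2 ∉ OmegaSet q) (hab : -(a / b) ∉ UpsilonSet q) :
    qPochInfL [-q, -q] q *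
          qPochInfL [q * a, q * a, q ^ 2 * a / b ^ 2, q ^ 2 * a / b ^ 2] (q ^ 2) /
          qPochInfL [-(q / b), -(q / b), q * a / b, q * a / b] q =
      qPochInfL [-b, -(q * a / b)] q / qPochInfL [-(q / b), -(b / a)] q *
            qHyp [a * p / b, -(a * p / b), q * a / b ^ 2, a]
              [q * a / b, -(q * a / b), q * a ^ 2 / b ^ 2] q q +
          qPochInfL [-q, -q, a, -(q * a / b), q * a / b ^ 2] q /
            qPochInfL [q * a / b, q * a / b, -(q / b), -(q / b), -(a / b)] q *
            qHyp [p, -p, -b, -(q / b)] [-q, -(q * a / b), -(q * b / a)] q q := by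
  have hq0 : q ≠ 0 := by rw [← hpq]; exact pow_ne_zero 2 hp
  rcases lt_or_ge ‖q / b‖ 1 with hz | hz
  · rw [baileyDaum_sq hpq hp hq1 hb hz hc,
      two_term_sum_of_norm_lt hpq hp hq1 ha hb hz hc hd hab]
    simp only [qThetaL, List.map_nil, List.prod_nil, one_mul]
  -- Here ‖b‖ ≤ ‖q‖, so the proved case applies to (qa/b², q/b). This involution fixes a/b and
  -- exchanges b with q/b and a with qa/b².
  · have hb1 : ‖b‖ < 1 := by
      rw [norm_div, le_div_iff₀ (norm_pos_iff.2 hb), one_mul] at hz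
      exact hz.trans_lt hq1
    have e1 : q / (q / b) = b := by field_simp
    have e2 : q * (q * a / b ^ 2) / (q / b) = q * a / b := by field_simp
    have e3 : q * (q * a / b ^ 2) ^ 2 / (q / b) ^ 2 = q * a ^ 2 / b ^ 2 := by field_simp
    have e4 : q * a / b ^ 2 / (q / b) = a / b := by field_simp
    have e5 : q * a / b ^ 2 * p / (q / b) = a * p / b := by field_simp
    have e6 : q * (q * a / b ^ 2) / (q / b) ^ 2 = a := by field_simp
    have e7 : q / b / (q * a / b ^ 2) = b / a := by field_simp
    have e8 : q * (q / b) / (q * a / b ^ 2) = q * b / a := by field_simp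
    have e9 : q * (q * a / b ^ 2) = q ^ 2 * a / b ^ 2 := by ring
    have e10 : q ^ 2 * (q * a / b ^ 2) / (q / b) ^ 2 = q * a := by field_simp
    have ha' : q * a / b ^ 2 ≠ 0 := div_ne_zero (mul_ne_zero hq0 ha) (pow_ne_zero 2 hb)
    have hb' : q / b ≠ 0 := div_ne_zero hq0 hb
    have hz' : ‖q / (q / b)‖ < 1 := by rwa [e1]
    have hc' : q * (q * a / b ^ 2) / (q / b) ∉ OmegaSet q := by rwa [e2]
    have key := (baileyDaum_sq hpq hp hq1 hb' hz' hc').trans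
      (two_term_sum_of_norm_lt hpq hp hq1 ha' hb' hz' hc' (by rwa [e3]) (by rwa [e4]))
    rw [qHyp_perm (as' := [a * p / b, -(a * p / b), q * a / b ^ 2, a])
      (bs' := [q * a / b, -(q * a / b), q * a ^ 2 / b ^ 2]) ?_ (by rw [e2, e3]),
      qHyp_perm (as := [p, -p, -(q / b), -(q / (q / b))]) (as' := [p, -p, -b, -(q / b)])
      (bs' := [-q, -(q * a / b), -(q * b / a)]) ?_ (by rw [e2, e8])] at key
    · simp only [qThetaL, qPochInfL, List.map_cons, List.map_nil, List.prod_cons, List.prod_nil,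
        mul_one, one_mul, e1, e2, e4, e6, e7, e10] at key ⊢
      rw [e9] at key
      have n1 := qPochInf_ne_zero hq0 hq1 hqb
      have n2 := qPochInf_ne_zero_of_norm_lt_one hq0 hq1 (a := -b) (by rwa [norm_neg])
      have n3 := qPochInf_ne_zero hq0 hq1 hc
      have n4 := qPochInf_ne_zero hq0 hq1 fun h0 => hab (mem_UpsilonSet_of_mem_OmegaSet h0)
      have n5 : qPochInf (-(b / a)) q ≠ 0 := qPochInf_ne_zero hq0 hq1 fun h0 => hab (by
        convert! inv_mem_UpsilonSet (mem_UpsilonSet_of_mem_OmegaSet h0) using 1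
        rw [inv_neg, inv_div])
      generalize qPochInf (-(q / b)) q = X1 at *
      generalize qPochInf (-b) q = X2 at *
      generalize qPochInf (q * a / b) q = X3 at *
      generalize qPochInf (-(a / b)) q = X4 at *
      generalize qPochInf (-(b / a)) q = X5 at *
      clear e1 e2 e3 e4 e5 e6 e7 e8 e9 e10
      -- Under the involution (-q/b;q)_∞² in S becomes (-b;q)_∞². The factor (-b;q)_∞²/(-q/b;q)_∞²
      -- restores it.
      linear_combination (norm := (field_simp; ring)) (X2 ^ 2 / X1 ^ 2) * key
    · rw [e1]
      simp only [← Multiset.coe_eq_coe, ← Multiset.cons_coe, ← Multiset.singleton_add]; abel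
    · rw [e5, e6]
      simp only [← Multiset.coe_eq_coe, ← Multiset.cons_coe, ← Multiset.singleton_add]; abel

end TwoTermSum

/-! ### The four-term summation; formula (4). -/

section FourTermSum

variable {q p a b h : ℂ}

/-- The first term of the four-term summation formula. -/
noncomputable def sumTerm₁ (q p a b h : ℂ) : ℂ :=
  qThetaL [h * a, -(h / b)] q *
    qPochInfL [q / b, q / b, q * a / b ^ 2, q * a / b ^ 2] q /
    qPochInfL [q * a / b, q * a / b, q / b ^ 2, q / b ^ 2] q *
    qHyp [a, b, -b, b ^ 2 / a] [b ^ 2, b * p, -(b * p)] q q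

/-- The second term of the four-term summation formula. -/
noncomputable def sumTerm₂ (q p a b h : ℂ) : ℂ :=
  qThetaL [h * (q * a / b ^ 2), -(h * (b / q))] q *
    qPochInfL [a, a, b, -b, b, -b] q /
    qPochInfL [-(q / b), -(q / b), b ^ 2 / q, b ^ 2 / q, q * a / b, q * a / b] q *
    qHyp [q * a / b ^ 2, q / b, -(q / b), q / a]
      [q ^ 2 / b ^ 2, p ^ 3 / b, -(p ^ 3 / b)] q q

/-- The third term of the four-term summation formula. -/
noncomputable def sumTerm₃ (q p a b h : ℂ) : ℂ :=
  qThetaL [h * (a * p / b), -(h / p)] q *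
    qPochInfL [p, a, -b, q * a / b ^ 2] q /
    qPochInfL [-1, -p, -(q / b), q * a / b, q * a / b, b / p, p / b] q *
    qHyp [a * p / b, b * p / a, p, -p] [-q, b * p, p ^ 3 / b] q q

/-- The fourth term of the four-term summation formula. -/
noncomputable def sumTerm₄ (q p a b h : ℂ) : ℂ :=
  qThetaL [-(h * (a * p / b)), h / p] q *
    qPochInfL [-p, a, -b, q * a / b ^ 2] q /
    qPochInfL [-1, p, -(q / b), q * a / b, q * a / b, -(b / p), -(p / b)] q *
    qHyp [-(a * p / b), -(b * p / a), p, -p] [-q, -(b * p), -(p ^ 3 / b)] q q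

/-- At z = -q/b both b²z/q and q/z equal -b. One copy cancels the lower parameter -b, reducing the
₅φ₄ to a ₄φ₃; the next three terms reduce in the same way. -/
theorem squareTerm₁_neg (hq0 : q ≠ 0) (hb : b ≠ 0) (hb' : -b ∉ OmegaSet q) :
    squareTerm₁ q p a b h (-(q / b)) = sumTerm₁ q p a b h := by
  have e1 : q / (b ^ 2 * -(q / b)) = -(1 / b) := by field_simp
  have e2 : b ^ 2 * -(q / b) / q = -b := by field_simp
  have e3 : q / -(q / b) = -b := by field_simp
  unfold squareTerm₁ sumTerm₁
  rw [e1, e2, e3, qHyp_perm (as' := -b :: [a, b, -b, b ^ 2 / a])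
    (bs' := -b :: [b ^ 2, b * p, -(b * p)]) ?_ ?_, qHyp_cancel hq0 hb',
    show h * -(1 / b) = -(h / b) by ring] <;>
  simp only [← Multiset.coe_eq_coe, ← Multiset.cons_coe, ← Multiset.singleton_add] <;> abel

theorem squareTerm₂_neg (hq0 : q ≠ 0) (hb : b ≠ 0) (hb' : -(q / b) ∉ OmegaSet q) :
    squareTerm₂ q p a b h (-(q / b)) = sumTerm₂ q p a b h := by
  have e1 : h / -(q / b) = -(h * (b / q)) := by field_simp
  have e2 : b ^ 2 * -(q / b) / q = -b := by field_simp
  have e3 : q ^ 2 / (b ^ 2 * -(q / b)) = -(q / b) := by field_simp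
  unfold squareTerm₂ sumTerm₂
  rw [e1, e2, e3, qHyp_perm (as' := -(q / b) :: [q * a / b ^ 2, q / b, -(q / b), q / a])
    (bs' := -(q / b) :: [q ^ 2 / b ^ 2, p ^ 3 / b, -(p ^ 3 / b)]) ?_ ?_, qHyp_cancel hq0 hb']
  · congr 3
    simp only [qPochInfL, List.map_cons, List.map_nil, List.prod_cons, List.prod_nil]
    ring
  all_goals
    simp only [← Multiset.coe_eq_coe, ← Multiset.cons_coe, ← Multiset.singleton_add]; abel

theorem squareTerm₃_neg (hpq : p ^ 2 = q) (hp : p ≠ 0) (hb : b ≠ 0) (hp' : -p ∉ OmegaSet q) :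
    squareTerm₃ q p a b h (-(q / b)) = sumTerm₃ q p a b h := by
  have hq0 : q ≠ 0 := by rw [← hpq]; exact pow_ne_zero 2 hp
  have e1 : h * (p / (b * -(q / b))) = -(h / p) := by rw [← hpq]; field_simp
  have e2 : b ^ 2 * -(q / b) / q = -b := by field_simp
  have e3 : p ^ 3 / (b * -(q / b)) = -p := by rw [← hpq]; field_simp
  have e4 : b * -(q / b) / p = -p := by rw [← hpq]; field_simp
  unfold squareTerm₃ sumTerm₃
  rw [e1, e2, e3, e4, qHyp_perm (as' := -p :: [a * p / b, b * p / a, p, -p])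
    (bs' := -p :: [-q, b * p, p ^ 3 / b]) ?_ ?_, qHyp_cancel hq0 hp']
  · congr 3
    simp only [qPochInfL, List.map_cons, List.map_nil, List.prod_cons, List.prod_nil]
    ring
  all_goals
    simp only [← Multiset.coe_eq_coe, ← Multiset.cons_coe, ← Multiset.singleton_add]; abel

theorem squareTerm₄_neg (hpq : p ^ 2 = q) (hp : p ≠ 0) (hb : b ≠ 0) (hp' : p ∉ OmegaSet q) :
    squareTerm₄ q p a b h (-(q / b)) = sumTerm₄ q p a b h := by
  have hq0 : q ≠ 0 := by rw [← hpq]; exact pow_ne_zero 2 hp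
  have e1 : -(h * (p / (b * -(q / b)))) = h / p := by rw [← hpq]; field_simp
  have e2 : b ^ 2 * -(q / b) / q = -b := by field_simp
  have e3 : -(p ^ 3 / (b * -(q / b))) = p := by rw [← hpq]; field_simp
  have e4 : -(b * -(q / b) / p) = p := by rw [← hpq]; field_simp
  unfold squareTerm₄ sumTerm₄
  rw [e1, e2, e3, e4, qHyp_perm (as' := p :: [-(a * p / b), -(b * p / a), p, -p])
    (bs' := p :: [-q, -(b * p), -(p ^ 3 / b)]) ?_ ?_, qHyp_cancel hq0 hp']
  · congr 3
    simp only [qPochInfL, List.map_cons, List.map_nil, List.prod_cons, List.prod_nil]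
    ring
  all_goals
    simp only [← Multiset.coe_eq_coe, ← Multiset.cons_coe, ← Multiset.singleton_add]; abel

/-- The numerator contains (-bz/q;q)_∞, which is (1;q)_∞ = 0 at z = -q/b. -/
theorem squareTerm₅_neg (hq0 : q ≠ 0) (hb : b ≠ 0) (hq1 : ‖q‖ < 1) :
    squareTerm₅ q p a b h (-(q / b)) = 0 := by
  have e1 : -(b * -(q / b) / q) = 1 := by field_simp
  unfold squareTerm₅
  rw [e1]
  simp [qPochInfL, qPochInf_one hq0 hq1]

/-- The five-term formula at z = -q/b asks for -qa/b ∉ Ω_q, a condition that concerns only the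
vanishing fifth term. A deformation of a avoids it, and the other four terms are continuous. -/
theorem four_term_sum_of_norm_lt (hpq : p ^ 2 = q) (hp : p ≠ 0) (hq1 : ‖q‖ < 1) (ha : a ≠ 0)
    (hb : b ≠ 0) (hh : h ≠ 0) (hz : ‖q / b‖ < 1) (hb2 : b ^ 2 ∉ UpsilonSet q)
    (hc : q * a / b ∉ OmegaSet q) :
    qThetaL [h, -(h * (a / b))] q * qHyp [a, b] [q * a / b] q (-(q / b)) ^ 2 =
      sumTerm₁ q p a b h + sumTerm₂ q p a b h + sumTerm₃ q p a b h + sumTerm₄ q p a b h := by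
  have hq0 : q ≠ 0 := by rw [← hpq]; exact pow_ne_zero 2 hp
  have hp1 : ‖p‖ < 1 := by
    have : ‖p‖ ^ 2 < 1 := by rw [← norm_pow, hpq]; exact hq1
    exact (sq_lt_one_iff₀ (norm_nonneg _)).1 this
  let A : ℝ → ℂ := fun x => a * Complex.exp ((1 * x : ℝ) : ℂ)
  have hA : ContinuousAt A 0 := by fun_prop
  have hA0 : A 0 = a := by simp [A]
  have hAne : A 0 ≠ 0 := by rwa [hA0]
  have hcA : q * A 0 / b ∉ OmegaSet q := by rwa [hA0]
  have hz0 : -(q / b) ≠ 0 := neg_ne_zero.2 (div_ne_zero hq0 hb)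
  have hz1 : ‖-(q / b)‖ < 1 := by rwa [norm_neg]
  have hzn : -(q / b) ∉ OmegaSet q := notMem_OmegaSet_of_norm_lt_one hq0 hq1 hz1
  have hcont : ContinuousAt (fun x => qThetaL [h, -(h * (A x / b))] q *
      qHyp [A x, b] [q * A x / b] q (-(q / b)) ^ 2) 0 := by
    refine ContinuousAt.mul (continuousAt_qThetaL hq1
      [fun _ => h, fun x => -(h * (A x / b))] ?_) (ContinuousAt.pow
      (continuousAt_qHyp hq0 hq1 [A, fun _ => b] [fun x => q * A x / b] (fun _ => -(q / b)) rfl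
        ?_ ?_ ?_ continuousAt_const hz1) 2) <;> simp only [List.forall_mem_cons]
    · exact ⟨⟨continuousAt_const, hh⟩, ⟨by fun_prop (disch := assumption), by simp [*]⟩,
        fun _ h0 => absurd h0 List.not_mem_nil⟩
    · exact ⟨hA, continuousAt_const, fun _ h0 => absurd h0 List.not_mem_nil⟩
    · exact ⟨by fun_prop (disch := assumption), fun _ h0 => absurd h0 List.not_mem_nil⟩
    · exact ⟨hcA, fun _ h0 => absurd h0 List.not_mem_nil⟩
  have hZ : ContinuousAt (fun _ : ℝ => -(q / b)) 0 := continuousAt_const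
  have key := eq_of_eq_off_countable hcont
    (((continuousAt_squareTerm₁ (h := h) hpq hp hq1 hb hh hb2 hA hZ hAne hz0 hcA).add
      (continuousAt_squareTerm₂ hpq hp hq1 hb hh hb2 hA hZ hAne hz0 hcA hzn)).add
      (continuousAt_squareTerm₃ hpq hp hq1 hb hh hb2 hA hZ hAne hz0 hcA hzn) |>.add
      (continuousAt_squareTerm₄ hpq hp hq1 hb hh hb2 hA hZ hAne hz0 hcA hzn))
    (countable_setOf_exp_mem_UpsilonSet (q := q) (-(q * a / b)) 1 (by simp [*]) one_ne_zero) ?_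
  · simp only [Pi.add_apply, hA0] at key
    rwa [squareTerm₁_neg hq0 hb (notMem_OmegaSet_of_sq_eq hq0 hb2 0 (Or.inl (by simp))),
      squareTerm₂_neg hq0 hb hzn, squareTerm₃_neg hpq hp hb
        (notMem_OmegaSet_of_norm_lt_one hq0 hq1 (by rwa [norm_neg])),
      squareTerm₄_neg hpq hp hb (notMem_OmegaSet_of_norm_lt_one hq0 hq1 hp1)] at key
  · have hcx : ∀ᶠ x in 𝓝 (0 : ℝ), q * A x / b ∉ OmegaSet q :=
      eventually_notMem_OmegaSet hq0 hq1 (b := fun x => q * A x / b)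
        (by fun_prop (disch := assumption)) hcA
    filter_upwards [hcx] with x hx hxs
    have e1 : h * (q * A x / (b ^ 2 * -(q / b))) = -(h * (A x / b)) := by field_simp
    have e2 : -(b * -(q / b)) = q := by field_simp
    have := square_eq (h := h) hpq hp hq1 (mul_ne_zero ha (Complex.exp_ne_zero _)) hb hz0 hh hz1
      hb2 hx (fun h0 => hxs (by
        have h1 := mem_UpsilonSet_of_mem_OmegaSet h0
        show _ ∈ UpsilonSet q
        convert! h1 using 1
        ring)) (by rw [e2]; exact notMem_OmegaSet_of_norm_lt_one hq0 hq1 hq1)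
    rw [squareTerm₅_neg hq0 hb hq1, add_zero, e1] at this
    exact this

/-- The involution (a,b) → (qa/b², q/b) exchanges the first two terms and fixes the last two, each
up to the ratio (-q/b;q)_∞²/(-b;q)_∞² by which S changes as well. -/
theorem sumTerm₁_reflect (hpq : p ^ 2 = q) (hp : p ≠ 0) (hb : b ≠ 0)
    (h1 : qPochInf (-(q / b)) q ≠ 0) (h2 : qPochInf (-b) q ≠ 0) :
    qPochInf (-b) q ^ 2 * sumTerm₁ q p (q * a / b ^ 2) (q / b) h =
      qPochInf (-(q / b)) q ^ 2 * sumTerm₂ q p a b h := by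
  have hq0 : q ≠ 0 := by rw [← hpq]; exact pow_ne_zero 2 hp
  have e2 : q * (q * a / b ^ 2) / (q / b) = q * a / b := by field_simp
  have e3 : q * (q * a / b ^ 2) / (q / b) ^ 2 = a := by field_simp
  have e4 : q / (q / b) ^ 2 = b ^ 2 / q := by field_simp
  have e5 : (q / b) ^ 2 / (q * a / b ^ 2) = q / a := by field_simp
  have e6 : h / (q / b) = h * (b / q) := by field_simp
  have e7 : (q / b) ^ 2 = q ^ 2 / b ^ 2 := by field_simp
  have e8 : q / b * p = p ^ 3 / b := by rw [← hpq]; field_simp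
  have e1 : q / (q / b) = b := by field_simp
  unfold sumTerm₁ sumTerm₂
  rw [e2, e3, e4, e5, e6, e7, e8, e1]
  simp only [qThetaL, qPochInfL, List.map_cons, List.map_nil, List.prod_cons, List.prod_nil,
    mul_one, div_eq_mul_inv (_ * _) (_ * _), mul_inv]
  field_simp

theorem sumTerm₂_reflect (hpq : p ^ 2 = q) (hp : p ≠ 0) (hb : b ≠ 0)
    (h1 : qPochInf (-(q / b)) q ≠ 0) (h2 : qPochInf (-b) q ≠ 0) :
    qPochInf (-b) q ^ 2 * sumTerm₂ q p (q * a / b ^ 2) (q / b) h =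
      qPochInf (-(q / b)) q ^ 2 * sumTerm₁ q p a b h := by
  have hq0 : q ≠ 0 := by rw [← hpq]; exact pow_ne_zero 2 hp
  have e9 : q / b / q = 1 / b := by field_simp
  have f1 : (q / b) ^ 2 / q = q / b ^ 2 := by field_simp
  have f2 : q / (q * a / b ^ 2) = b ^ 2 / a := by field_simp
  have f3 : q ^ 2 / (q / b) ^ 2 = b ^ 2 := by field_simp
  have f4 : p ^ 3 / (q / b) = b * p := by rw [← hpq]; field_simp
  have e2 : q * (q * a / b ^ 2) / (q / b) = q * a / b := by field_simp
  have e3 : q * (q * a / b ^ 2) / (q / b) ^ 2 = a := by field_simp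
  have e1 : q / (q / b) = b := by field_simp
  have g5 : h * (1 / b) = h / b := by ring
  unfold sumTerm₂ sumTerm₁
  rw [e9, f1, f2, f3, f4, e2, e3, e1, g5]
  simp only [qThetaL, qPochInfL, List.map_cons, List.map_nil, List.prod_cons, List.prod_nil,
    mul_one, div_eq_mul_inv (_ * _) (_ * _), mul_inv]
  field_simp

theorem sumTerm₃_reflect (hpq : p ^ 2 = q) (hp : p ≠ 0) (hb : b ≠ 0)
    (h1 : qPochInf (-(q / b)) q ≠ 0) (h2 : qPochInf (-b) q ≠ 0) :
    qPochInf (-b) q ^ 2 * sumTerm₃ q p (q * a / b ^ 2) (q / b) h =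
      qPochInf (-(q / b)) q ^ 2 * sumTerm₃ q p a b h := by
  have hq0 : q ≠ 0 := by rw [← hpq]; exact pow_ne_zero 2 hp
  have g1 : q * a / b ^ 2 * p / (q / b) = a * p / b := by field_simp
  have g2 : q / b * p / (q * a / b ^ 2) = b * p / a := by field_simp
  have g3 : q / b / p = p / b := by rw [← hpq]; field_simp
  have g4 : p / (q / b) = b / p := by rw [← hpq]; field_simp
  have e2 : q * (q * a / b ^ 2) / (q / b) = q * a / b := by field_simp
  have e3 : q * (q * a / b ^ 2) / (q / b) ^ 2 = a := by field_simp
  have e8 : q / b * p = p ^ 3 / b := by rw [← hpq]; field_simp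
  have f4 : p ^ 3 / (q / b) = b * p := by rw [← hpq]; field_simp
  have e1 : q / (q / b) = b := by field_simp
  unfold sumTerm₃
  rw [g1, g2, g3, g4, e2, e3, e8, f4, e1]
  rw [qHyp_perm (List.Perm.refl [a * p / b, b * p / a, p, -p])
    (show [-q, p ^ 3 / b, b * p].Perm [-q, b * p, p ^ 3 / b] from (List.Perm.swap _ _ _).cons _)]
  simp only [qThetaL, qPochInfL, List.map_cons, List.map_nil, List.prod_cons, List.prod_nil,
    mul_one, div_eq_mul_inv (_ * _) (_ * _), mul_inv]
  -- Everything else in the term is invariant; only the quotient of (-b;q)_∞ and (-q/b;q)_∞ is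
  -- inverted.
  have hx : qPochInf (-b) q ^ 2 * qPochInf (-(q / b)) q * (qPochInf (-b) q)⁻¹ =
      qPochInf (-(q / b)) q ^ 2 * qPochInf (-b) q * (qPochInf (-(q / b)) q)⁻¹ := by field_simp
  linear_combination (qTheta (h * (a * p / b)) q * qTheta (-(h / p)) q *
    (qPochInf p q * qPochInf a q * qPochInf (q * a / b ^ 2) q) *
    ((qPochInf (-1) q)⁻¹ * (qPochInf (-p) q)⁻¹ * (qPochInf (q * a / b) q)⁻¹ ^ 2 *
      (qPochInf (b / p) q)⁻¹ * (qPochInf (p / b) q)⁻¹) *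
    qHyp [a * p / b, b * p / a, p, -p] [-q, b * p, p ^ 3 / b] q q) * hx

theorem sumTerm₄_reflect (hpq : p ^ 2 = q) (hp : p ≠ 0) (hb : b ≠ 0)
    (h1 : qPochInf (-(q / b)) q ≠ 0) (h2 : qPochInf (-b) q ≠ 0) :
    qPochInf (-b) q ^ 2 * sumTerm₄ q p (q * a / b ^ 2) (q / b) h =
      qPochInf (-(q / b)) q ^ 2 * sumTerm₄ q p a b h := by
  have hq0 : q ≠ 0 := by rw [← hpq]; exact pow_ne_zero 2 hp
  have g1 : q * a / b ^ 2 * p / (q / b) = a * p / b := by field_simp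
  have g2 : q / b * p / (q * a / b ^ 2) = b * p / a := by field_simp
  have g3 : q / b / p = p / b := by rw [← hpq]; field_simp
  have g4 : p / (q / b) = b / p := by rw [← hpq]; field_simp
  have e2 : q * (q * a / b ^ 2) / (q / b) = q * a / b := by field_simp
  have e3 : q * (q * a / b ^ 2) / (q / b) ^ 2 = a := by field_simp
  have e8 : q / b * p = p ^ 3 / b := by rw [← hpq]; field_simp
  have f4 : p ^ 3 / (q / b) = b * p := by rw [← hpq]; field_simp
  have e1 : q / (q / b) = b := by field_simp
  unfold sumTerm₄
  rw [g1, g2, g3, g4, e2, e3, e8, f4, e1]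
  rw [qHyp_perm (List.Perm.refl [-(a * p / b), -(b * p / a), p, -p])
    (show [-q, -(p ^ 3 / b), -(b * p)].Perm [-q, -(b * p), -(p ^ 3 / b)] from (List.Perm.swap _ _ _).cons _)]
  simp only [qThetaL, qPochInfL, List.map_cons, List.map_nil, List.prod_cons, List.prod_nil,
    mul_one, div_eq_mul_inv (_ * _) (_ * _), mul_inv]
  have hx : qPochInf (-b) q ^ 2 * qPochInf (-(q / b)) q * (qPochInf (-b) q)⁻¹ =
      qPochInf (-(q / b)) q ^ 2 * qPochInf (-b) q * (qPochInf (-(q / b)) q)⁻¹ := by field_simp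
  linear_combination (qTheta (-(h * (a * p / b))) q * qTheta (h / p) q *
    (qPochInf (-p) q * qPochInf a q * qPochInf (q * a / b ^ 2) q) *
    ((qPochInf (-1) q)⁻¹ * (qPochInf p q)⁻¹ * (qPochInf (q * a / b) q)⁻¹ ^ 2 *
      (qPochInf (-(b / p)) q)⁻¹ * (qPochInf (-(p / b)) q)⁻¹) *
    qHyp [-(a * p / b), -(b * p / a), p, -p] [-q, -(b * p), -(p ^ 3 / b)] q q) * hx

/-- The four-term nonterminating summation formula. -/
theorem four_term_sum (hpq : p ^ 2 = q) (hp : p ≠ 0) (hq1 : ‖q‖ < 1) (ha : a ≠ 0) (hb : b ≠ 0)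
    (hh : h ≠ 0) (hb2 : b ^ 2 ∉ UpsilonSet q) (hc : q * a / b ∉ OmegaSet q) :
    qThetaL [h, -(h * (a / b))] q * (qPochInfL [-q, -q] q *
          qPochInfL [q * a, q * a, q ^ 2 * a / b ^ 2, q ^ 2 * a / b ^ 2] (q ^ 2) /
          qPochInfL [-(q / b), -(q / b), q * a / b, q * a / b] q) =
      sumTerm₁ q p a b h + sumTerm₂ q p a b h + sumTerm₃ q p a b h + sumTerm₄ q p a b h := by
  have hq0 : q ≠ 0 := by rw [← hpq]; exact pow_ne_zero 2 hp
  rcases lt_or_ge ‖q / b‖ 1 with hz | hz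
  · rw [baileyDaum_sq hpq hp hq1 hb hz hc]
    exact four_term_sum_of_norm_lt hpq hp hq1 ha hb hh hz hb2 hc
  · have hb1 : ‖b‖ < 1 := by
      rw [norm_div, le_div_iff₀ (norm_pos_iff.2 hb), one_mul] at hz
      exact hz.trans_lt hq1
    have e1 : q / (q / b) = b := by field_simp
    have e2 : q * (q * a / b ^ 2) / (q / b) = q * a / b := by field_simp
    have e3 : q * a / b ^ 2 / (q / b) = a / b := by field_simp
    have e4 : q * (q * a / b ^ 2) = q ^ 2 * a / b ^ 2 := by ring
    have e5 : q ^ 2 * (q * a / b ^ 2) / (q / b) ^ 2 = q * a := by field_simp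
    have ha' : q * a / b ^ 2 ≠ 0 := div_ne_zero (mul_ne_zero hq0 ha) (pow_ne_zero 2 hb)
    have hb' : q / b ≠ 0 := div_ne_zero hq0 hb
    have hz' : ‖q / (q / b)‖ < 1 := by rwa [e1]
    have hc' : q * (q * a / b ^ 2) / (q / b) ∉ OmegaSet q := by rwa [e2]
    have hb2' : (q / b) ^ 2 ∉ UpsilonSet q := fun h0 => hb2 (by
      simpa using inv_mem_UpsilonSet (zpow_mul_mem_UpsilonSet hq0 2 (a := (b ^ 2)⁻¹) (by
        rwa [div_pow, div_eq_mul_inv] at h0)))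
    have n1 : qPochInf (-(q / b)) q ≠ 0 := qPochInf_ne_zero hq0 hq1
      (notMem_OmegaSet_of_sq_eq hq0 hb2 2 (Or.inr (by rw [neg_sq, div_pow]; norm_cast)))
    have n2 := qPochInf_ne_zero_of_norm_lt_one hq0 hq1 (a := -b) (by rwa [norm_neg])
    have n3 := qPochInf_ne_zero hq0 hq1 hc
    have key := four_term_sum_of_norm_lt hpq hp hq1 ha' hb' hh hz' hb2' hc'
    rw [← baileyDaum_sq hpq hp hq1 hb' hz' hc', e3] at key
    have r1 := sumTerm₁_reflect (a := a) (h := h) hpq hp hb n1 n2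
    have r2 := sumTerm₂_reflect (a := a) (h := h) hpq hp hb n1 n2
    have r3 := sumTerm₃_reflect (a := a) (h := h) hpq hp hb n1 n2
    have r4 := sumTerm₄_reflect (a := a) (h := h) hpq hp hb n1 n2
    -- Multiplying by (-q/b;q)_∞² turns the goal into the reflected identity multiplied by
    -- (-b;q)_∞².
    refine mul_left_cancel₀ (pow_ne_zero 2 n1) ?_
    have r := congrArg (qPochInf (-b) q ^ 2 * ·) key
    simp only [mul_add, r1, r2, r3, r4] at r
    have hl : qPochInf (-(q / b)) q ^ 2 * (qPochInfL [-q, -q] q *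
          qPochInfL [q * a, q * a, q ^ 2 * a / b ^ 2, q ^ 2 * a / b ^ 2] (q ^ 2) /
          qPochInfL [-(q / b), -(q / b), q * a / b, q * a / b] q) =
        qPochInf (-b) q ^ 2 * (qPochInfL [-q, -q] q *
          qPochInfL [q * (q * a / b ^ 2), q * (q * a / b ^ 2),
            q ^ 2 * (q * a / b ^ 2) / (q / b) ^ 2, q ^ 2 * (q * a / b ^ 2) / (q / b) ^ 2] (q ^ 2) /
          qPochInfL [-(q / (q / b)), -(q / (q / b)), q * (q * a / b ^ 2) / (q / b),
            q * (q * a / b ^ 2) / (q / b)] q) := by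
      simp only [e1, e2, e5]
      rw [e4]
      simp only [qPochInfL, List.map_cons, List.map_nil, List.prod_cons, List.prod_nil, mul_one]
      field_simp
    linear_combination qThetaL [h, -(h * (a / b))] q * hl + r

end FourTermSum

/-! ### The four formulas together. -/

theorem mainTheorem9 (q : ℂ) (hq0 : q ≠ 0) (hq1 : ‖q‖ < 1) :
    -- the integral representation of the square
    (∀ (z a b h s t : ℂ) (σ : ℝ), z ≠ 0 → ‖z‖ < 1 → a ≠ 0 → b ≠ 0 → h ≠ 0 → 0 < σ →
      s ^ 2 = q * a / z → t ^ 2 = a * z →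
      ‖b / s‖ * σ < 1 → ‖s / b‖ * σ < 1 →
      ‖b * (s * z / q)‖ < σ → ‖t‖ < σ → ‖s * z / b‖ < σ → ‖s * z‖ < σ →
      IntervalIntegrable (mbIntegrand a b h q z s t σ) MeasureTheory.volume
          (-Real.pi) Real.pi ∧
      ∫ ψ in (-Real.pi)..Real.pi, mbIntegrand a b h q z s t σ ψ =
        2 * (Real.pi : ℂ) * qThetaL [h, h * (q * a / (b ^ 2 * z))] q *
            qPochInfL [z, q * a / b, q * a / b] q /
          qPochInfL [q, a, q * a / b ^ 2, b ^ 2 * z / q] q *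
          qHyp [a, b] [q * a / b] q z ^ 2) ∧
    -- the five-term representation of the square; `p` is a square root of `q`
    (∀ z a b h p : ℂ, z ≠ 0 → ‖z‖ < 1 → a ≠ 0 → b ≠ 0 → h ≠ 0 → p ^ 2 = q →
      h ∉ UpsilonSet q → h * (q * a / (b ^ 2 * z)) ∉ UpsilonSet q →
      b ^ 2 ∉ UpsilonSet q → q * a / b ∉ OmegaSet q → -(q * a / b) ∉ OmegaSet q →
      -(b * z) ∉ OmegaSet q →
      qHyp [a, b] [q * a / b] q z ^ 2 =
        1 / qThetaL [h, h * (q * a / (b ^ 2 * z))] q *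
        (qThetaL [h * a, h * (q / (b ^ 2 * z))] q *
            qPochInfL [q / b, q / b, q * a / b ^ 2, q * a / b ^ 2] q /
            qPochInfL [q * a / b, q * a / b, q / b ^ 2, q / b ^ 2] q *
            qHyp [a, b, b ^ 2 / a, b ^ 2 * z / q, q / z] [b ^ 2, b * p, -(b * p), -b] q q +
          qThetaL [h * (q * a / b ^ 2), h / z] q *
            qPochInfL [a, a, b, b, b ^ 2 * z / q, b ^ 2 * z / q] q /
            qPochInfL [z, z, b ^ 2 / q, b ^ 2 / q, q * a / b, q * a / b] q *
            qHyp [q / a, q / b, q * a / b ^ 2, z, q ^ 2 / (b ^ 2 * z)]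
              [q ^ 2 / b ^ 2, p ^ 3 / b, -(p ^ 3 / b), -(q / b)] q q +
          qThetaL [h * (a * p / b), h * (p / (b * z))] q *
            qPochInfL [p, a, q * a / b ^ 2, b ^ 2 * z / q] q /
            qPochInfL [-1, -p, z, q * a / b, q * a / b, b / p, p / b] q *
            qHyp [p, a * p / b, b * p / a, b * z / p, p ^ 3 / (b * z)]
              [-q, -p, b * p, p ^ 3 / b] q q +
          qThetaL [-(h * (a * p / b)), -(h * (p / (b * z)))] q *
            qPochInfL [-p, a, q * a / b ^ 2, b ^ 2 * z / q] q /
            qPochInfL [-1, p, z, q * a / b, q * a / b, -(b / p), -(p / b)] q *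
            qHyp [-p, -(a * p / b), -(b * p / a), -(b * z / p), -(p ^ 3 / (b * z))]
              [-q, p, -(b * p), -(p ^ 3 / b)] q q +
          qThetaL [-(h * (q * a / b)), -(h / (b * z))] q *
            qPochInfL [-1, a, -(a / b), q * a / b ^ 2, -(b * z / q), b ^ 2 * z / q] q /
            qPochInfL [z, -(b * z), 1 / p, -(1 / p), q * a / b, q * a / b, -(q * a / b),
              -(1 / b), -(b / q)] q *
            qHyp [-q, -(b * z), -(q * a / b), -(q * b / a), -(q ^ 2 / (b * z))]
              [-(q * b), p ^ 3, -(p ^ 3), -(q ^ 2 / b)] q q)) ∧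
    -- the two-term nonterminating summation formula
    (∀ a b p : ℂ, a ≠ 0 → b ≠ 0 → p ^ 2 = q →
      -(q / b) ∉ OmegaSet q → q * a / b ∉ OmegaSet q → q * a ^ 2 / b ^ 2 ∉ OmegaSet q →
      -(a / b) ∉ UpsilonSet q →
      qPochInfL [-q, -q] q *
          qPochInfL [q * a, q * a, q ^ 2 * a / b ^ 2, q ^ 2 * a / b ^ 2] (q ^ 2) /
          qPochInfL [-(q / b), -(q / b), q * a / b, q * a / b] q =
        qPochInfL [-b, -(q * a / b)] q / qPochInfL [-(q / b), -(b / a)] q *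
            qHyp [a * p / b, -(a * p / b), q * a / b ^ 2, a]
              [q * a / b, -(q * a / b), q * a ^ 2 / b ^ 2] q q +
          qPochInfL [-q, -q, a, -(q * a / b), q * a / b ^ 2] q /
            qPochInfL [q * a / b, q * a / b, -(q / b), -(q / b), -(a / b)] q *
            qHyp [p, -p, -b, -(q / b)] [-q, -(q * a / b), -(q * b / a)] q q) ∧
    -- the four-term nonterminating summation formula
    (∀ a b h p : ℂ, a ≠ 0 → b ≠ 0 → h ≠ 0 → p ^ 2 = q →
      h ∉ UpsilonSet q → -(h * (a / b)) ∉ UpsilonSet q →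
      b ^ 2 ∉ UpsilonSet q → q * a / b ∉ OmegaSet q →
      qPochInfL [-q, -q] q *
          qPochInfL [q * a, q * a, q ^ 2 * a / b ^ 2, q ^ 2 * a / b ^ 2] (q ^ 2) /
          qPochInfL [-(q / b), -(q / b), q * a / b, q * a / b] q =
        1 / qThetaL [h, -(h * (a / b))] q *
        (qThetaL [h * a, -(h / b)] q *
            qPochInfL [q / b, q / b, q * a / b ^ 2, q * a / b ^ 2] q /
            qPochInfL [q * a / b, q * a / b, q / b ^ 2, q / b ^ 2] q *
            qHyp [a, b, -b, b ^ 2 / a] [b ^ 2, b * p, -(b * p)] q q +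
          qThetaL [h * (q * a / b ^ 2), -(h * (b / q))] q *
            qPochInfL [a, a, b, -b, b, -b] q /
            qPochInfL [-(q / b), -(q / b), b ^ 2 / q, b ^ 2 / q, q * a / b, q * a / b] q *
            qHyp [q * a / b ^ 2, q / b, -(q / b), q / a]
              [q ^ 2 / b ^ 2, p ^ 3 / b, -(p ^ 3 / b)] q q +
          qThetaL [h * (a * p / b), -(h / p)] q *
            qPochInfL [p, a, -b, q * a / b ^ 2] q /
            qPochInfL [-1, -p, -(q / b), q * a / b, q * a / b, b / p, p / b] q *
            qHyp [a * p / b, b * p / a, p, -p] [-q, b * p, p ^ 3 / b] q q +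
          qThetaL [-(h * (a * p / b)), h / p] q *
            qPochInfL [-p, a, -b, q * a / b ^ 2] q /
            qPochInfL [-1, p, -(q / b), q * a / b, q * a / b, -(b / p), -(p / b)] q *
            qHyp [-(a * p / b), -(b * p / a), p, -p] [-q, -(b * p), -(p ^ 3 / b)] q q)) := by
  refine ⟨fun z a b h s t σ hz hz1 ha hb hh hσ hs2 ht2 h1 h2 h3 h4 h5 h6 => ?_,
    fun z a b h p hz hz1 ha hb hh hpq hθ hθ' hb2 hc hc' hbz => ?_,
    fun a b p ha hb hpq hqb hc hd hab => ?_, fun a b h p ha hb hh hpq hθ hθ' hb2 hc => ?_⟩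
  · exact integral_mbIntegrand hq0 hq1 hz ha hb hh hσ hs2 ht2 h1 h2 h3 h4 h5
  · have hp : p ≠ 0 := by rintro rfl; exact hq0 (by rw [← hpq]; simp)
    rw [one_div, eq_inv_mul_iff_mul_eq₀ (qThetaL_pair_ne_zero hq0 hq1 hθ hθ')]
    exact square_eq hpq hp hq1 ha hb hz hh hz1 hb2 hc hc' hbz
  · have hp : p ≠ 0 := by rintro rfl; exact hq0 (by rw [← hpq]; simp)
    exact two_term_sum hpq hp hq1 ha hb hqb hc hd hab
  · have hp : p ≠ 0 := by rintro rfl; exact hq0 (by rw [← hpq]; simp)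
    rw [one_div, eq_inv_mul_iff_mul_eq₀ (qThetaL_pair_ne_zero hq0 hq1 hθ hθ')]
    exact four_term_sum hpq hp hq1 ha hb hh hb2 hc
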